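/- Let $d\ge 1$, $0<\alpha<1$, let $\omega_d$ be the surface measure of the unit sphere of $\mathbb R^d$ and let $(e_j)$ be the canonical basis. For $R>0$ put $k^R(x)=|x|^{-d/2}1_{|x|\le R}$, $\rho=k^1*k^1$, and let $\phi$ be the continuous function with $\rho(x)=\omega_d\ln^+\frac1{|x|}+\phi(x)$ for $x\ne 0$. For $\gamma_0>0$, an integer $q\ge 2$, an index $1\le j\le d$ and a unit vector $e$, let $$C_q^j(e)=R^{qd/2}e^{\frac{q(q-1)}2\gamma_0^2\phi(0)}\int_{(\mathbb R^d)^q}\prod_{1\le i<k\le q}\frac1{|u_i-u_k|^{\gamma_0^2\omega_d}}\prod_{i=1}^q\Big(\frac{u_i^j}{|u_i|^{d-\alpha+1}}-\frac{u_i^j-e^j}{|u_i-e|^{d-\alpha+1}}\Big)du_1\cdots du_q .$$ For an integer $l\ge1$ call $\gamma_0>0$ $l$-admissible if $\gamma_0^2\omega_d<\alpha$ (when $l=1$), respectively $(2l-\frac32)\gamma_0^2\omega_d<\min(\alpha,\frac d2)$ (when $l>1$). The field $\mathcal X_0$. Let $R>0$, let $\varphi:\mathbb R^d\to[0,1]$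 be smooth and radial with $\varphi=1$ for $|x|\le1$ and $\varphi=0$ for $|x|>2$, and put $\varphi_R(x)=R^{d/2-\alpha}\varphi(x/R)$. Let $\theta\ge0$ be smooth, radial, supported in $|x|\le1$, with $\int\theta=1$, and put $\theta^\epsilon=\epsilon^{-d}\theta(\cdot/\epsilon)$, $k^R_\epsilon=\theta^\epsilon*k^R$, $|\cdot|_\epsilon=\theta^\epsilon*|\cdot|$, $\rho_\epsilon=\theta^\epsilon*\theta^\epsilon*\rho$. Let $dW_0$ be a Gaussian white noise on $\mathbb R^d$, regarded as a random distribution. Put $X^\epsilon(y)=\gamma_0\int k^R_\epsilon(y-\sigma)\,dW_0(\sigma)$, let $C_\epsilon$ be defined by $\gamma_0k_\epsilon^R(0)e^{-C_\epsilon+\frac12\gamma_0^2\rho_{\epsilon/R}(0)}=1$, and $$\mathcal X_{0,\epsilon}(x)=\int_{\mathbb R^d}\varphi_R(x-y)\frac{x-y}{|x-y|_\epsilon^{d-\alpha+1}}e^{X^\epsilon(y)-C_\epsilon}\,dW_0(y)$$ (realization by realization, the distribution $dW_0$ is applied to a smooth function of $y$ with compact support). $\mathcal X_0$ denotes the random vector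 field for which $\mathcal X_{0,\epsilon}(x)\to\mathcal X_0(x)$ in $L^4$ as $\epsilon\to0$, for every $x$. Then the following holds. 1. (Even order.) Let $q=2l$ with $l\ge 1$, $1\le j\le d$ and $|e|=1$. There are a countable set $N\subset\mathbb R$ and $\delta>0$ with $N\cap(0,\delta)=\emptyset$, both independent of $R$, such that $C_q^j(e)\neq0$ for every $l$-admissible $\gamma_0\notin N$ and every $R>0$, and $C_q^j(e)>0$ for all $\gamma_0\in(0,\delta)$ and $R>0$. 2. (Order three.) There are a countable set $N\subset\mathbb R$ and $\delta>0$ with $N\cap(0,\delta)=\emptyset$ such that $C_3^j(e_j)\ne0$ for every $2$-admissible $\gamma_0\notin N$, every $j$ and every $R>0$, and $C_3^j(e_j)>0$ for all $\gamma_0\in(0,\delta)$, all $j$ and all $R>0$. Moreover, for every $2$-admissible $\gamma_0\notin N$ and all $R,\varphi,\theta,W_0$ as above, the field $\mathcal X_0$ exists, and for every $x$ and every unit vector $e$, for all sufficiently small $\lambda>0$, the longitudinal increment $Z_\lambda=(\mathcal X_0(x+\lambda e)-\mathcal X_0(x))\cdot e$ satisfies $E(Z_\lambda^3)\ne0$,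 and its law is not symmetric, that is, $Z_\lambda$ and $-Z_\lambda$ have different laws. -/

import Mathlib

open MeasureTheory ProbabilityTheory Filter Topology Set
open scoped Distributions Convolution

noncomputable section

namespace MultifractalField

/-- Euclidean space of dimension `d`. -/
abbrev E (d : ℕ) : Type := EuclideanSpace ℝ (Fin d)

/-- Surface measure of the unit sphere of `ℝ^d`. -/
def sphereArea (d : ℕ) : ℝ := (volume : Measure (E d)).toSphere.real univ

/-- The function equal to `|x|^(-d/2)` for `|x| ≤ R` and to `0` otherwise. -/
def kernelK (d : ℕ) (R : ℝ) (x : E d) : ℝ :=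
  if ‖x‖ ≤ R then 1 / ‖x‖ ^ ((d : ℝ) / 2) else 0

/-- `ρ = k¹ * k¹`. -/
def rho (d : ℕ) : E d → ℝ :=
  kernelK d 1 ⋆[ContinuousLinearMap.mul ℝ ℝ, volume] kernelK d 1

/-- The continuous function `x ↦ ρ x - ω_d ln⁺ (1 / |x|)`; its value at the origin
is the limit of this expression there. -/
def rhoRegular (d : ℕ) : E d → ℝ :=
  extendFrom {0}ᶜ fun x => rho d x - sphereArea d * Real.posLog (1 / ‖x‖)

/-! ### The constants -/

/-- The integrand `u ↦ u^j / |u|^(d-α+1) - (u^j - e^j) / |u-e|^(d-α+1)`. -/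
def incrementKernel (d : ℕ) (α : ℝ) (j : Fin d) (e u : E d) : ℝ :=
  u j / ‖u‖ ^ ((d : ℝ) - α + 1) - (u j - e j) / ‖u - e‖ ^ ((d : ℝ) - α + 1)

/-- The constant `C_q^j(e)`. -/
def constC (d : ℕ) (α R γ₀ : ℝ) (q : ℕ) (j : Fin d) (e : E d) : ℝ :=
  R ^ ((q : ℝ) * d / 2) * Real.exp ((q : ℝ) * (q - 1) / 2 * γ₀ ^ 2 * rhoRegular d 0) *
    ∫ u : Fin q → E d,
      (∏ i, ∏ k ∈ Finset.Ioi i, 1 / ‖u i - u k‖ ^ (γ₀ ^ 2 * sphereArea d)) *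
        ∏ i, incrementKernel d α j e (u i)

/-- The range of `γ₀` in which the field has moments of order `2l`. -/
def Admissible (d : ℕ) (α : ℝ) (l : ℕ) (γ₀ : ℝ) : Prop :=
  (l = 1 → γ₀ ^ 2 * sphereArea d < α) ∧
  (1 < l → (2 * (l : ℝ) - 3 / 2) * (γ₀ ^ 2 * sphereArea d) < min α ((d : ℝ) / 2))

/-! ### The random field -/

/-- Smooth radial cutoff functions with values in `[0,1]`, equal to `1` for `|x| ≤ 1` and to `0`
for `|x| > 2`. -/
structure IsCutoff {d : ℕ} (φ : E d → ℝ) : Prop where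
  smooth : ContDiff ℝ (⊤ : ℕ∞) φ
  mem_Icc : ∀ x, φ x ∈ Icc (0 : ℝ) 1
  radial : ∀ x y, ‖x‖ = ‖y‖ → φ x = φ y
  eq_one : ∀ x, ‖x‖ ≤ 1 → φ x = 1
  eq_zero : ∀ x, 2 < ‖x‖ → φ x = 0

/-- Smooth nonnegative radial functions supported in `|x| ≤ 1`, of integral `1`. -/
structure IsMollifier {d : ℕ} (θ : E d → ℝ) : Prop where
  smooth : ContDiff ℝ (⊤ : ℕ∞) θ
  nonneg : ∀ x, 0 ≤ θ x
  radial : ∀ x y, ‖x‖ = ‖y‖ → θ x = θ y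
  eq_zero : ∀ x, 1 < ‖x‖ → θ x = 0
  integral_eq_one : ∫ x, θ x = 1

/-- Gaussian white noise on `ℝ^d`, seen as a random distribution: the pairings with test functions
form a centred Gaussian process with the covariance of `L²`. -/
structure IsWhiteNoise {d : ℕ} {Ω : Type*} [MeasurableSpace Ω]
    (W : Ω → 𝓓'((⊤ : TopologicalSpace.Opens (E d)), ℝ)) (μ : Measure Ω) : Prop where
  gaussian : IsGaussianProcess
    (fun (f : 𝓓((⊤ : TopologicalSpace.Opens (E d)), ℝ)) (ω : Ω) => W ω f) μ
  centred : ∀ f : 𝓓((⊤ : TopologicalSpace.Opens (E d)), ℝ), ∫ ω, W ω f ∂μ = 0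
  covariance : ∀ f g : 𝓓((⊤ : TopologicalSpace.Opens (E d)), ℝ),
    ∫ ω, W ω f * W ω g ∂μ = ∫ x, f x * g x

open Classical in
/-- The pairing `∫ f(y) dT(y)` of a distribution `T` with a function `f` which is smooth and has
compact support (as do all functions to which it is applied below). -/
def pairing {d : ℕ} (T : 𝓓'((⊤ : TopologicalSpace.Opens (E d)), ℝ)) (f : E d → ℝ) : ℝ :=
  if h : ContDiff ℝ (⊤ : ℕ∞) f ∧ HasCompactSupport f then
    T ⟨f, h.1, h.2, fun _ _ => trivial⟩
  else 0

/-- `φ_R(x) = R^(d/2-α) φ(x/R)`. -/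
def cutoffR {d : ℕ} (α R : ℝ) (φ : E d → ℝ) (x : E d) : ℝ :=
  R ^ ((d : ℝ) / 2 - α) * φ (R⁻¹ • x)

/-- `θ^ε(x) = ε^(-d) θ(x/ε)`. -/
def mollify {d : ℕ} (θ : E d → ℝ) (ε : ℝ) (x : E d) : ℝ :=
  1 / ε ^ d * θ (ε⁻¹ • x)

/-- `k_ε^R = θ^ε * k^R`. -/
def kernelEps {d : ℕ} (R : ℝ) (θ : E d → ℝ) (ε : ℝ) : E d → ℝ :=
  mollify θ ε ⋆[ContinuousLinearMap.mul ℝ ℝ, volume] kernelK d R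

/-- `|·|_ε = θ^ε * |·|`. -/
def normEps {d : ℕ} (θ : E d → ℝ) (ε : ℝ) : E d → ℝ :=
  mollify θ ε ⋆[ContinuousLinearMap.mul ℝ ℝ, volume] fun x => ‖x‖

/-- `ρ_ε = θ^ε * θ^ε * ρ`. -/
def rhoEps {d : ℕ} (θ : E d → ℝ) (ε : ℝ) : E d → ℝ :=
  mollify θ ε ⋆[ContinuousLinearMap.mul ℝ ℝ, volume]
    (mollify θ ε ⋆[ContinuousLinearMap.mul ℝ ℝ, volume] rho d)

/-- The solution `C_ε` of `γ₀ k_ε^R(0) exp (-C_ε + γ₀² ρ_{ε/R}(0) / 2) = 1`. -/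
def normalization {d : ℕ} (R γ₀ : ℝ) (θ : E d → ℝ) (ε : ℝ) : ℝ :=
  γ₀ ^ 2 * rhoEps θ (ε / R) 0 / 2 + Real.log (γ₀ * kernelEps R θ ε 0)

/-- `X^ε(y) = γ₀ ∫ k_ε^R(y - σ) dT(σ)`, where `T` is a realization of the white noise. -/
def logField {d : ℕ} (R γ₀ : ℝ) (θ : E d → ℝ) (ε : ℝ)
    (T : 𝓓'((⊤ : TopologicalSpace.Opens (E d)), ℝ)) (y : E d) : ℝ :=
  γ₀ * pairing T fun σ => kernelEps R θ ε (y - σ)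

/-- `𝒳_{0,ε}(x) = ∫ φ_R(x-y) (x-y) |x-y|_ε^(-(d-α+1)) exp (X^ε(y) - C_ε) dT(y)`, where `T` is a
realization of the white noise. -/
def fieldEps {d : ℕ} (α R γ₀ : ℝ) (φ θ : E d → ℝ) (ε : ℝ)
    (T : 𝓓'((⊤ : TopologicalSpace.Opens (E d)), ℝ)) (x : E d) : E d :=
  WithLp.toLp 2 fun i => pairing T fun y =>
    cutoffR α R φ (x - y) * ((x - y) i / normEps θ ε (x - y) ^ ((d : ℝ) - α + 1)) *
      Real.exp (logField R γ₀ θ ε T y - normalization R γ₀ θ ε)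

/-- `X₀` is the field `𝒳₀`: for every `x`, `𝒳_{0,ε}(x)` converges to `X₀ x` in `L^p`
as `ε → 0`. -/
def IsLimitField {d : ℕ} (α R γ₀ : ℝ) (φ θ : E d → ℝ) {Ω : Type*} [MeasurableSpace Ω]
    (μ : Measure Ω) (W : Ω → 𝓓'((⊤ : TopologicalSpace.Opens (E d)), ℝ)) (p : ENNReal)
    (X₀ : E d → Ω → E d) : Prop :=
  ∀ x, MemLp (X₀ x) p μ ∧
    Tendsto (fun ε : ℝ => eLpNorm (fun ω => fieldEps α R γ₀ φ θ ε (W ω) x - X₀ x ω) p μ)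
      (𝓝[>] 0) (𝓝 0)

end MultifractalField

end

namespace MultifractalField

variable {d : ℕ}

/-! ### Potentials of negative powers of the distance -/

lemma integrableOn_norm_rpow_neg [NeZero d] {p : ℝ} (hp : p < d) (A : ℝ) :
    IntegrableOn (fun x : E d => ‖x‖ ^ (-p)) (Metric.ball 0 A) := by
  rcases le_or_gt A 0 with hA | hA
  · simp [Metric.ball_eq_empty.2 hA]
  rw [integrableOn_fun_norm_addHaar volume (f := fun y : ℝ => y ^ (-p))]
  have hd : 1 ≤ d := Nat.one_le_iff_ne_zero.2 (NeZero.ne d)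
  have h : IntegrableOn (fun y : ℝ => y ^ ((d : ℝ) - 1 - p)) (Ioo 0 A) := by
    rw [intervalIntegral.integrableOn_Ioo_rpow_iff hA]; linarith
  refine h.congr_fun (fun y hy => ?_) measurableSet_Ioo
  simp only [finrank_euclideanSpace, Fintype.card_fin, smul_eq_mul]
  rw [← Real.rpow_natCast, ← Real.rpow_add hy.1]
  congr 1
  push_cast [hd]
  ring

lemma lintegral_ball_norm_sub_rpow_neg [NeZero d] {p : ℝ} (hp : p < d) (A : ℝ) :
    ∃ M : ENNReal, M ≠ ⊤ ∧ ∀ a : E d,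
      ∫⁻ u in Metric.ball a A, ENNReal.ofReal (‖u - a‖ ^ (-p)) = M := by
  refine ⟨_, (integrableOn_norm_rpow_neg hp A).lintegral_lt_top.ne, fun a => ?_⟩
  rw [← lintegral_indicator Metric.isOpen_ball.measurableSet,
    ← lintegral_indicator Metric.isOpen_ball.measurableSet,
    ← lintegral_sub_right_eq_self ((Metric.ball (0 : E d) A).indicator
      fun x => ENNReal.ofReal (‖x‖ ^ (-p))) a]
  refine lintegral_congr fun u => ?_
  simp [indicator, dist_eq_norm]

/-- The potentials `∫ w(u) |u - a|^(-t) du` with `0 ≤ t ≤ p` are bounded uniformly. -/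
structure BoundedPotential (w : E d → ENNReal) (p : ℝ) : Prop where
  measurable : Measurable w
  bound : ∃ M : ENNReal, M ≠ ⊤ ∧ ∀ t, 0 ≤ t → t ≤ p → ∀ a : E d,
    ∫⁻ u, w u * ENNReal.ofReal (‖u - a‖ ^ (-t)) ≤ M

lemma BoundedPotential.add {w w' : E d → ENNReal} {p : ℝ} (h : BoundedPotential w p)
    (h' : BoundedPotential w' p) : BoundedPotential (fun u => w u + w' u) p := by
  obtain ⟨M, hM, hb⟩ := h.bound
  obtain ⟨M', hM', hb'⟩ := h'.bound
  refine ⟨h.measurable.add h'.measurable, M + M', ENNReal.add_ne_top.2 ⟨hM, hM'⟩,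
    fun t h0 h1 a => ?_⟩
  simp only [add_mul]
  rw [lintegral_add_left]
  · exact add_le_add (hb t h0 h1 a) (hb' t h0 h1 a)
  · exact h.measurable.mul (by fun_prop)

lemma BoundedPotential.const_mul {w : E d → ENNReal} {p : ℝ} (h : BoundedPotential w p)
    {c : ENNReal} (hc : c ≠ ⊤) : BoundedPotential (fun u => c * w u) p := by
  obtain ⟨M, hM, hb⟩ := h.bound
  refine ⟨h.measurable.const_mul c, c * M, ENNReal.mul_ne_top hc hM, fun t h0 h1 a => ?_⟩
  simp only [mul_assoc]
  rw [lintegral_const_mul']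
  · exact mul_le_mul_right (hb t h0 h1 a) c
  · exact hc

lemma BoundedPotential.mono {w w' : E d → ENNReal} {p : ℝ} (h : BoundedPotential w p)
    (hw' : Measurable w') (hle : ∀ u, w' u ≤ w u) : BoundedPotential w' p := by
  obtain ⟨M, hM, hb⟩ := h.bound
  exact ⟨hw', M, hM, fun t h0 h1 a => (lintegral_mono fun u => mul_le_mul_left (hle u) _).trans
    (hb t h0 h1 a)⟩

lemma BoundedPotential.mono_exp {w : E d → ENNReal} {p p' : ℝ} (h : BoundedPotential w p)
    (hp : p' ≤ p) : BoundedPotential w p' := by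
  obtain ⟨M, hM, hb⟩ := h.bound
  exact ⟨h.measurable, M, hM, fun t h0 h1 a => hb t h0 (h1.trans hp) a⟩

lemma rpow_neg_mul_rpow_neg_le {x y β t : ℝ} (hx : 0 ≤ x) (hy : 0 ≤ y) (hβ : 0 < β) (ht : 0 < t) :
    x ^ (-β) * y ^ (-t) ≤ x ^ (-(β + t)) + y ^ (-(β + t)) := by
  have hx' : 0 ≤ x ^ (-(β + t)) := Real.rpow_nonneg hx _
  have hy' : 0 ≤ y ^ (-(β + t)) := Real.rpow_nonneg hy _
  rcases hx.eq_or_lt with rfl | hx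
  · rw [Real.zero_rpow (by linarith), zero_mul]; positivity
  rcases hy.eq_or_lt with rfl | hy
  · rw [Real.zero_rpow (by linarith : -t ≠ 0), mul_zero]; positivity
  rcases le_total x y with h | h
  · have : y ^ (-t) ≤ x ^ (-t) := Real.rpow_le_rpow_of_nonpos hx h (by linarith)
    calc x ^ (-β) * y ^ (-t) ≤ x ^ (-β) * x ^ (-t) := by gcongr
      _ = x ^ (-(β + t)) := by rw [← Real.rpow_add hx]; congr 1; ring
      _ ≤ _ := by linarith
  · have : x ^ (-β) ≤ y ^ (-β) := Real.rpow_le_rpow_of_nonpos hy h (by linarith)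
    calc x ^ (-β) * y ^ (-t) ≤ y ^ (-β) * y ^ (-t) := by gcongr
      _ = y ^ (-(β + t)) := by rw [← Real.rpow_add hy]; congr 1; ring
      _ ≤ _ := by linarith

lemma rpow_neg_le_one_add {x t p : ℝ} (hx : 0 ≤ x) (ht : 0 ≤ t) (htp : t ≤ p) :
    x ^ (-t) ≤ 1 + x ^ (-p) := by
  rcases hx.eq_or_lt with rfl | hx
  · rcases ht.eq_or_lt with rfl | ht
    · have : (0:ℝ) ≤ 0 ^ (-p) := Real.rpow_nonneg le_rfl _
      simp; linarith
    · rw [Real.zero_rpow (by linarith)]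
      have : (0:ℝ) ≤ 0 ^ (-p) := Real.rpow_nonneg le_rfl _
      linarith
  rcases le_total 1 x with h | h
  · have := Real.rpow_le_one_of_one_le_of_nonpos h (by linarith : -t ≤ 0)
    have := Real.rpow_nonneg hx.le (-p)
    linarith
  · have := Real.rpow_le_rpow_of_exponent_ge hx h (by linarith : -p ≤ -t)
    linarith

/-- To bound the potentials of `w` it is enough to bound those with exponents `0` and `p`. -/
lemma BoundedPotential.of_endpoints {w : E d → ENNReal} {p : ℝ} (hw : Measurable w)
    {M : ENNReal} (hM : M ≠ ⊤) (h0 : ∫⁻ u, w u ≤ M)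
    (h1 : ∀ a : E d, ∫⁻ u, w u * ENNReal.ofReal (‖u - a‖ ^ (-p)) ≤ M) :
    BoundedPotential w p := by
  refine ⟨hw, M + M, ENNReal.add_ne_top.2 ⟨hM, hM⟩, fun t ht htp a => ?_⟩
  calc ∫⁻ u, w u * ENNReal.ofReal (‖u - a‖ ^ (-t))
      ≤ ∫⁻ u, (w u + w u * ENNReal.ofReal (‖u - a‖ ^ (-p))) := by
        refine lintegral_mono fun u => ?_
        have := ENNReal.ofReal_le_ofReal (rpow_neg_le_one_add (norm_nonneg (u - a)) ht htp)
        rw [ENNReal.ofReal_add zero_le_one (by positivity), ENNReal.ofReal_one] at this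
        calc _ ≤ w u * (1 + ENNReal.ofReal (‖u - a‖ ^ (-p))) := mul_le_mul_right this _
          _ = _ := by rw [mul_add, mul_one]
    _ = _ := lintegral_add_left hw _
    _ ≤ _ := add_le_add h0 (h1 a)

lemma lintegral_ball_norm_sub_rpow_neg_le [NeZero d] {p : ℝ} (hp0 : 0 ≤ p) (hp : p < d) (A : ℝ) :
    ∃ M : ENNReal, M ≠ ⊤ ∧ ∀ a b : E d,
      ∫⁻ u in Metric.ball b A, ENNReal.ofReal (‖u - a‖ ^ (-p)) ≤ M := by
  obtain ⟨M, hM, h⟩ := lintegral_ball_norm_sub_rpow_neg hp 1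
  refine ⟨M + volume (Metric.ball (0 : E d) A), ENNReal.add_ne_top.2
    ⟨hM, Metric.isBounded_ball.measure_lt_top.ne⟩, fun a b => ?_⟩
  have key : ∀ u : E d, (Metric.ball b A).indicator (fun u => ENNReal.ofReal (‖u - a‖ ^ (-p))) u ≤
      (Metric.ball a 1).indicator (fun u => ENNReal.ofReal (‖u - a‖ ^ (-p))) u +
        (Metric.ball b A).indicator 1 u := by
    intro u
    by_cases hb : u ∈ Metric.ball b A
    · by_cases ha : u ∈ Metric.ball a 1
      · rw [indicator_of_mem hb, indicator_of_mem ha]; exact le_self_add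
      · rw [indicator_of_mem hb, indicator_of_notMem ha, indicator_of_mem hb, zero_add]
        simp only [Metric.mem_ball, dist_eq_norm, not_lt] at ha
        rw [Pi.one_apply, ENNReal.ofReal_le_one]
        exact Real.rpow_le_one_of_one_le_of_nonpos ha (by linarith)
    · rw [indicator_of_notMem hb]; exact zero_le
  rw [← lintegral_indicator Metric.isOpen_ball.measurableSet]
  refine (lintegral_mono key).trans ?_
  rw [lintegral_add_right _ (measurable_one.indicator Metric.isOpen_ball.measurableSet),
    lintegral_indicator Metric.isOpen_ball.measurableSet, h,
    lintegral_indicator_one Metric.isOpen_ball.measurableSet]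
  exact add_le_add le_rfl (Measure.addHaar_ball_center _ b A).le

lemma boundedPotential_rpow_ball [NeZero d] {β p : ℝ} (hβ : 0 < β) (hp : 0 < p) (hβp : β + p < d)
    (A : ℝ) (b : E d) :
    BoundedPotential ((Metric.ball b A).indicator fun u => ENNReal.ofReal (‖u - b‖ ^ (-β))) p := by
  obtain ⟨M, hM, h⟩ := lintegral_ball_norm_sub_rpow_neg_le (d := d) (by linarith) hβp A
  obtain ⟨M', hM', h'⟩ := lintegral_ball_norm_sub_rpow_neg_le (d := d) hβ.le (by linarith) A
  have hmeas : Measurable ((Metric.ball b A).indicator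
      fun u : E d => ENNReal.ofReal (‖u - b‖ ^ (-β))) :=
    Measurable.indicator (by fun_prop) Metric.isOpen_ball.measurableSet
  refine .of_endpoints hmeas (M := M' + (M + M)) (by simp [hM, hM']) ?_ fun a => ?_
  · rw [lintegral_indicator Metric.isOpen_ball.measurableSet]
    exact (h' b b).trans le_self_add
  · have e : ∀ u : E d, (Metric.ball b A).indicator (fun u => ENNReal.ofReal (‖u - b‖ ^ (-β))) u *
        ENNReal.ofReal (‖u - a‖ ^ (-p)) = (Metric.ball b A).indicator (fun u =>
        ENNReal.ofReal (‖u - b‖ ^ (-β)) * ENNReal.ofReal (‖u - a‖ ^ (-p))) u :=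
      fun u => by simp only [indicator]; split_ifs <;> simp
    rw [lintegral_congr e, lintegral_indicator Metric.isOpen_ball.measurableSet]
    calc ∫⁻ u in Metric.ball b A, ENNReal.ofReal (‖u - b‖ ^ (-β)) * ENNReal.ofReal (‖u - a‖ ^ (-p))
        ≤ ∫⁻ u in Metric.ball b A, (ENNReal.ofReal (‖u - b‖ ^ (-(β + p))) +
            ENNReal.ofReal (‖u - a‖ ^ (-(β + p)))) := by
          refine lintegral_mono fun u => ?_
          rw [← ENNReal.ofReal_mul (by positivity), ← ENNReal.ofReal_add (by positivity)
            (by positivity)]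
          exact ENNReal.ofReal_le_ofReal
            (rpow_neg_mul_rpow_neg_le (norm_nonneg _) (norm_nonneg _) hβ hp)
      _ ≤ M + M := by
          rw [lintegral_add_left (by fun_prop)]
          exact add_le_add (h b b) (h a b)
      _ ≤ _ := le_add_self

lemma boundedPotential_one_add_norm [NeZero d] {r p : ℝ} (hr : (d : ℝ) < r) (hp0 : 0 ≤ p)
    (hp : p < d) :
    BoundedPotential (fun u : E d => ENNReal.ofReal ((1 + ‖u‖) ^ (-r))) p := by
  obtain ⟨M, hM, h⟩ := lintegral_ball_norm_sub_rpow_neg hp 1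
  have hfin : (∫⁻ x : E d, ENNReal.ofReal ((1 + ‖x‖) ^ (-r))) < ⊤ :=
    finite_integral_one_add_norm (by simpa using hr)
  set I := ∫⁻ x : E d, ENNReal.ofReal ((1 + ‖x‖) ^ (-r))
  refine .of_endpoints (by fun_prop) (M := M + I) (by simp [hM, hfin.ne]) le_add_self fun a => ?_
  calc ∫⁻ u : E d, ENNReal.ofReal ((1 + ‖u‖) ^ (-r)) * ENNReal.ofReal (‖u - a‖ ^ (-p))
      ≤ ∫⁻ u : E d, ((Metric.ball a 1).indicator
          (fun u => ENNReal.ofReal (‖u - a‖ ^ (-p))) u + ENNReal.ofReal ((1 + ‖u‖) ^ (-r))) := by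
        refine lintegral_mono fun u => ?_
        by_cases ha : u ∈ Metric.ball a 1
        · rw [indicator_of_mem ha]
          have h1 : ENNReal.ofReal ((1 + ‖u‖) ^ (-r)) ≤ 1 := by
            rw [ENNReal.ofReal_le_one]
            refine Real.rpow_le_one_of_one_le_of_nonpos (by linarith [norm_nonneg u]) ?_
            have : (0 : ℝ) ≤ d := by positivity
            linarith
          calc _ ≤ 1 * ENNReal.ofReal (‖u - a‖ ^ (-p)) := mul_le_mul_left h1 _
            _ ≤ _ := by rw [one_mul]; exact le_self_add
        · rw [indicator_of_notMem ha, zero_add]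
          simp only [Metric.mem_ball, dist_eq_norm, not_lt] at ha
          have h1 : ENNReal.ofReal (‖u - a‖ ^ (-p)) ≤ 1 := by
            rw [ENNReal.ofReal_le_one]
            exact Real.rpow_le_one_of_one_le_of_nonpos ha (by linarith)
          calc _ ≤ ENNReal.ofReal ((1 + ‖u‖) ^ (-r)) * 1 := mul_le_mul_right h1 _
            _ = _ := mul_one _
    _ = M + I := by
        rw [lintegral_add_right _ (by fun_prop),
          lintegral_indicator Metric.isOpen_ball.measurableSet, h]

/-! ### Multiple integrals with singularities on the diagonals -/

/-- The product of `|u_i - u_k|^(-s)` over all pairs `i < k`. -/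
noncomputable def pairProd {q : ℕ} (s : ℝ) (u : Fin q → E d) : ℝ :=
  ∏ i, ∏ k ∈ Finset.Ioi i, ‖u i - u k‖ ^ (-s)

lemma pairProd_nonneg {q : ℕ} (s : ℝ) (u : Fin q → E d) : 0 ≤ pairProd s u :=
  Finset.prod_nonneg fun _ _ => Finset.prod_nonneg fun _ _ => Real.rpow_nonneg (norm_nonneg _) _

@[fun_prop]
lemma measurable_pairProd {q : ℕ} (s : ℝ) :
    Measurable (pairProd s : (Fin q → E d) → ℝ) := by
  unfold pairProd; fun_prop

lemma pairProd_succ {q : ℕ} (s : ℝ) (u : Fin (q + 1) → E d) :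
    pairProd s u = (∏ k : Fin q, ‖u 0 - u k.succ‖ ^ (-s)) * pairProd s fun i => u i.succ := by
  unfold pairProd
  rw [Fin.prod_univ_succ, Fin.prod_Ioi_zero (f := fun k => ‖u 0 - u k‖ ^ (-s))]
  congr 1
  refine Finset.prod_congr rfl fun i _ => ?_
  rw [Fin.prod_Ioi_succ (f := fun k => ‖u i.succ - u k‖ ^ (-s))]

lemma prod_rpow_neg_le_sum {n : ℕ} [NeZero n] {c : Fin n → ℝ} (hc : ∀ k, 0 ≤ c k) (s : ℝ) : ∏ k, c k ^ (-s) ≤ ∑ k, c k ^ (-(n * s)) := by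
  obtain ⟨m, -, hm⟩ := Finset.exists_max_image (Finset.univ : Finset (Fin n))
    (fun k => c k ^ (-s)) ⟨0, Finset.mem_univ _⟩
  calc ∏ k, c k ^ (-s) ≤ ∏ _k : Fin n, c m ^ (-s) :=
        Finset.prod_le_prod (fun k _ => Real.rpow_nonneg (hc k) _) fun k _ => hm k (Finset.mem_univ k)
    _ = c m ^ (-(n * s)) := by
        rw [Finset.prod_const, Finset.card_univ, Fintype.card_fin, ← Real.rpow_natCast,
          ← Real.rpow_mul (hc m)]
        congr 1; ring
    _ ≤ _ := Finset.single_le_sum (f := fun k => c k ^ (-(n * s)))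
        (fun k _ => Real.rpow_nonneg (hc k) _) (Finset.mem_univ m)

lemma rpow_neg_three_le_of_le {x y z a b c p : ℝ} (hx : 0 < x) (hxy : x ≤ y) (hyz : y ≤ z)
    (ha : a ≤ p) (hc : 0 ≤ c) (h : a + b + c = 2 * p) :
    x ^ (-a) * y ^ (-b) * z ^ (-c) ≤ x ^ (-p) * y ^ (-p) := by
  have hy := hx.trans_le hxy
  have h1 : z ^ (-c) ≤ y ^ (-c) := Real.rpow_le_rpow_of_nonpos hy hyz (by linarith)
  have h2 : x ^ (p - a) ≤ y ^ (p - a) := Real.rpow_le_rpow hx.le hxy (by linarith)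
  calc x ^ (-a) * y ^ (-b) * z ^ (-c) ≤ x ^ (-a) * y ^ (-b) * y ^ (-c) := by gcongr
    _ = x ^ (-p) * (x ^ (p - a)) * (y ^ (-b) * y ^ (-c)) := by
        rw [← Real.rpow_add hx, mul_assoc]; ring_nf
    _ ≤ x ^ (-p) * (y ^ (p - a)) * (y ^ (-b) * y ^ (-c)) := by gcongr
    _ = x ^ (-p) * y ^ (-p) := by
        rw [mul_assoc, ← Real.rpow_add hy, ← Real.rpow_add hy]
        congr 2; linarith

lemma rpow_neg_three_le {x y z t s p : ℝ} (hx : 0 ≤ x) (hy : 0 ≤ y) (hz : 0 ≤ z)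
    (ht : 0 < t) (hs : 0 < s) (htp : t ≤ p) (hsp : s ≤ p) (h : 2 * t + s = 2 * p) :
    x ^ (-t) * y ^ (-t) * z ^ (-s) ≤
      x ^ (-p) * y ^ (-p) + x ^ (-p) * z ^ (-p) + y ^ (-p) * z ^ (-p) := by
  have h1 : 0 ≤ x ^ (-p) := Real.rpow_nonneg hx _
  have h2 : 0 ≤ y ^ (-p) := Real.rpow_nonneg hy _
  have h3 : 0 ≤ z ^ (-p) := Real.rpow_nonneg hz _
  have h12 := mul_nonneg h1 h2
  have h13 := mul_nonneg h1 h3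
  have h23 := mul_nonneg h2 h3
  have hz' : ∀ r : ℝ, 0 < r → (0 : ℝ) ^ (-r) = 0 := fun r hr => Real.zero_rpow (by linarith)
  rcases hx.eq_or_lt with rfl | hx
  · rw [hz' t ht]; simp only [zero_mul]; positivity
  rcases hy.eq_or_lt with rfl | hy
  · rw [hz' t ht]; simp only [mul_zero, zero_mul]; positivity
  rcases hz.eq_or_lt with rfl | hz
  · rw [hz' s hs]; simp only [mul_zero]; positivity
  rcases le_total x y with hxy | hxy <;> rcases le_total y z with hyz | hyz <;>
    rcases le_total x z with hxz | hxz
  · linarith [rpow_neg_three_le_of_le hx hxy hyz htp hs.le (by linarith : t + t + s = 2 * p)]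
  · linarith [rpow_neg_three_le_of_le hx hxy hyz htp hs.le (by linarith : t + t + s = 2 * p)]
  · linarith [rpow_neg_three_le_of_le hx hxz hyz htp ht.le (by linarith : t + s + t = 2 * p)]
  · linarith [rpow_neg_three_le_of_le hz hxz hxy hsp ht.le (by linarith : s + t + t = 2 * p)]
  · linarith [rpow_neg_three_le_of_le hy hxy hxz htp hs.le (by linarith : t + t + s = 2 * p)]
  · linarith [rpow_neg_three_le_of_le hy hyz hxz htp ht.le (by linarith : t + s + t = 2 * p)]
  · linarith [rpow_neg_three_le_of_le hz hyz hxy hsp ht.le (by linarith : s + t + t = 2 * p)]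
  · linarith [rpow_neg_three_le_of_le hz hyz hxy hsp ht.le (by linarith : s + t + t = 2 * p)]

/-- The integral of the product of the weights with the powers of the mutual distances. -/
noncomputable def pairIntegral (q : ℕ) (w : E d → ENNReal) (s : ℝ) : ENNReal :=
  ∫⁻ u : Fin q → E d, (∏ i, w (u i)) * ENNReal.ofReal (pairProd s u)

lemma lintegral_fin_succ {q : ℕ} {f : (Fin (q + 1) → E d) → ENNReal} (hf : Measurable f) :
    ∫⁻ u, f u = ∫⁻ v : Fin q → E d, ∫⁻ x : E d, f (Fin.cons x v) := by
  have h := (volume_preserving_piFinSuccAbove (fun _ : Fin (q + 1) => E d) 0).symm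
  rw [← h.lintegral_comp hf]
  have hm : Measurable fun z : E d × (Fin q → E d) =>
      f ((MeasurableEquiv.piFinSuccAbove (fun _ : Fin (q + 1) => E d) 0).symm z) :=
    hf.comp (MeasurableEquiv.measurable _)
  rw [Measure.volume_eq_prod, lintegral_prod_symm _ hm.aemeasurable]
  refine lintegral_congr fun v => lintegral_congr fun x => ?_
  simp [MeasurableEquiv.piFinSuccAbove, Fin.insertNthEquiv]

lemma measurable_pairIntegrand {q : ℕ} {w : E d → ENNReal} (hw : Measurable w) (s : ℝ) :
    Measurable fun u : Fin q → E d => (∏ i, w (u i)) * ENNReal.ofReal (pairProd s u) :=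
  (Finset.measurable_prod _ fun i _ => hw.comp (measurable_pi_apply i)).mul
    (measurable_pairProd s).ennreal_ofReal

lemma pairIntegral_succ {q : ℕ} {w : E d → ENNReal} (hw : Measurable w) (s : ℝ) :
    pairIntegral (q + 1) w s = ∫⁻ v : Fin q → E d, ((∏ i, w (v i)) * ENNReal.ofReal (pairProd s v))
      * ∫⁻ x : E d, w x * ENNReal.ofReal (∏ k, ‖x - v k‖ ^ (-s)) := by
  rw [pairIntegral, lintegral_fin_succ (measurable_pairIntegrand hw s)]
  refine lintegral_congr fun v => ?_
  rw [← lintegral_const_mul _ (by fun_prop)]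
  refine lintegral_congr fun x => ?_
  rw [pairProd_succ, Fin.prod_univ_succ, ENNReal.ofReal_mul
    (Finset.prod_nonneg fun _ _ => Real.rpow_nonneg (norm_nonneg _) _)]
  simp only [Fin.cons_zero, Fin.cons_succ]
  ring

lemma pairIntegral_lt_top {w : E d → ENNReal} {p s : ℝ} (hw : BoundedPotential w p) (hs : 0 ≤ s)
    (hp : 0 ≤ p) (q : ℕ) (h : ((q : ℝ) - 1) * s ≤ p) : pairIntegral q w s < ⊤ := by
  obtain ⟨M, hM, hb⟩ := hw.bound
  induction q with
  | zero => simp [pairIntegral, pairProd, volume_pi]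
  | succ n ih =>
    push_cast at h
    have ih := ih (by nlinarith)
    rw [pairIntegral_succ hw.measurable]
    have key : ∀ v : Fin n → E d,
        ∫⁻ x : E d, w x * ENNReal.ofReal (∏ k, ‖x - v k‖ ^ (-s)) ≤ (n + 1) * M := by
      intro v
      rcases Nat.eq_zero_or_pos n with rfl | hn
      · simpa using hb 0 le_rfl hp 0
      have : NeZero n := ⟨hn.ne'⟩
      calc ∫⁻ x : E d, w x * ENNReal.ofReal (∏ k, ‖x - v k‖ ^ (-s))
          ≤ ∫⁻ x : E d, ∑ k, w x * ENNReal.ofReal (‖x - v k‖ ^ (-(n * s))) := by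
            refine lintegral_mono fun x => ?_
            rw [← Finset.mul_sum, ← ENNReal.ofReal_sum_of_nonneg
              fun _ _ => Real.rpow_nonneg (norm_nonneg _) _]
            exact mul_le_mul_right (ENNReal.ofReal_le_ofReal
              (prod_rpow_neg_le_sum (fun _ => norm_nonneg _) s)) _
        _ = ∑ k, ∫⁻ x : E d, w x * ENNReal.ofReal (‖x - v k‖ ^ (-(n * s))) :=
            lintegral_finsetSum _ fun k _ => hw.measurable.mul (by fun_prop)
        _ ≤ ∑ _k : Fin n, M := Finset.sum_le_sum fun k _ =>
            hb _ (by positivity) (by linarith) _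
        _ ≤ _ := by
            rw [Finset.sum_const, Finset.card_univ, Fintype.card_fin, nsmul_eq_mul]
            gcongr; exact le_self_add
    refine (lintegral_mono fun v => mul_le_mul_right (key v) _).trans_lt ?_
    rw [lintegral_mul_const _ (measurable_pairIntegrand hw.measurable s)]
    exact ENNReal.mul_lt_top ih (ENNReal.mul_lt_top (by finiteness) hM.lt_top)

lemma pairIntegral_add_two_lt_top {w : E d → ENNReal} {p s : ℝ} (hw : BoundedPotential w p)
    (hs : 0 < s) {n : ℕ} (hn : 1 ≤ n) (h : ((n : ℝ) + 1 / 2) * s ≤ p) :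
    pairIntegral (n + 2) w s < ⊤ := by
  have hp' : ((n : ℝ) + 1 / 2) * s ≤ p := h
  wlog hpe : ((n : ℝ) + 1 / 2) * s = p generalizing p
  · exact this (hw.mono_exp h) le_rfl le_rfl rfl
  obtain ⟨M, hM, hb⟩ := hw.bound
  have hn1 : (1 : ℝ) ≤ n := by exact_mod_cast hn
  have : NeZero n := ⟨by omega⟩
  have hp0 : 0 ≤ p := by rw [← hpe]; positivity
  have hwm := hw.measurable
  have hI : pairIntegral n w s < ⊤ := pairIntegral_lt_top hw hs.le hp0 n (by nlinarith)
  have hmeas1 : Measurable fun z : (Fin (n+1) → E d) × E d =>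
      w z.2 * ENNReal.ofReal (∏ k, ‖z.2 - z.1 k‖ ^ (-s)) := by
    refine (hwm.comp measurable_snd).mul ?_
    fun_prop
  have hmeas2 : Measurable fun v : Fin (n+1) → E d => ((∏ i, w (v i)) *
      ENNReal.ofReal (pairProd s v)) * ∫⁻ x : E d, w x * ENNReal.ofReal (∏ k, ‖x - v k‖ ^ (-s)) :=
    (measurable_pairIntegrand hwm s).mul hmeas1.lintegral_prod_right'
  rw [pairIntegral_succ hwm, lintegral_fin_succ hmeas2]
  have e1 : ∀ (v : Fin n → E d) (y : E d), (∏ i, w ((Fin.cons y v : Fin (n+1) → E d) i)) *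
      ENNReal.ofReal (pairProd s (Fin.cons y v : Fin (n+1) → E d)) *
      ∫⁻ x : E d, w x * ENNReal.ofReal (∏ k, ‖x - (Fin.cons y v : Fin (n+1) → E d) k‖ ^ (-s)) =
      ((∏ i, w (v i)) * ENNReal.ofReal (pairProd s v)) * ∫⁻ x : E d, w y * w x *
        ENNReal.ofReal ((∏ k, (‖y - v k‖ * ‖x - v k‖) ^ (-s)) * ‖y - x‖ ^ (-s)) := by
    intro v y
    rw [← lintegral_const_mul _ (by fun_prop), ← lintegral_const_mul _ (by fun_prop)]
    refine lintegral_congr fun x => ?_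
    have hA : 0 ≤ ∏ k, ‖y - v k‖ ^ (-s) :=
      Finset.prod_nonneg fun _ _ => Real.rpow_nonneg (norm_nonneg _) _
    have hB : 0 ≤ ∏ k, ‖x - v k‖ ^ (-s) :=
      Finset.prod_nonneg fun _ _ => Real.rpow_nonneg (norm_nonneg _) _
    rw [pairProd_succ, Fin.prod_univ_succ, Fin.prod_univ_succ]
    simp only [Fin.cons_zero, Fin.cons_succ]
    simp_rw [Real.mul_rpow (norm_nonneg _) (norm_nonneg _)]
    rw [Finset.prod_mul_distrib, ENNReal.ofReal_mul hA, ENNReal.ofReal_mul (by positivity),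
      ENNReal.ofReal_mul (by positivity), ENNReal.ofReal_mul hA, norm_sub_rev x y]
    ring
  simp_rw [e1]
  have key : ∀ v : Fin n → E d, ∫⁻ y : E d, ∫⁻ x : E d, w y * w x *
        ENNReal.ofReal ((∏ k, (‖y - v k‖ * ‖x - v k‖) ^ (-s)) * ‖y - x‖ ^ (-s)) ≤
        n * (M * M + M * M + M * M) := by
    intro v
    have hle : ∀ x y : E d, (∏ k, (‖y - v k‖ * ‖x - v k‖) ^ (-s)) * ‖y - x‖ ^ (-s) ≤
        ∑ k, (‖y - v k‖ ^ (-p) * ‖x - v k‖ ^ (-p) + ‖y - v k‖ ^ (-p) * ‖x - y‖ ^ (-p)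
          + ‖x - v k‖ ^ (-p) * ‖y - x‖ ^ (-p)) := by
      intro x y
      refine (mul_le_mul_of_nonneg_right (prod_rpow_neg_le_sum
        (fun k => by positivity) s) (by positivity)).trans ?_
      rw [Finset.sum_mul]
      refine Finset.sum_le_sum fun k _ => ?_
      rw [Real.mul_rpow (norm_nonneg _) (norm_nonneg _), norm_sub_rev x y]
      refine rpow_neg_three_le (norm_nonneg _) (norm_nonneg _) (norm_nonneg _) (by positivity) hs
        ?_ ?_ ?_
      · rw [← hpe]; nlinarith
      · rw [← hpe]; nlinarith
      · rw [← hpe]; ring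
    obtain ⟨f, hf⟩ : ∃ f : E d → E d → ENNReal, ∀ a x, f a x = w x * ENNReal.ofReal (‖x - a‖ ^ (-p)) :=
      ⟨_, fun _ _ => rfl⟩
    have hfm : ∀ {g h : E d × E d → E d}, Measurable g → Measurable h →
        Measurable fun z => f (g z) (h z) := fun hg hh => by
      simp only [hf]
      fun_prop
    have hfx : ∀ a, Measurable (f a) := fun a => by
      rw [funext (hf a)]
      fun_prop
    have hbp : ∀ a, ∫⁻ x, f a x ≤ M := fun a => by
      simp only [hf]
      exact hb p hp0 le_rfl a
    have hm1 : ∀ k, Measurable fun z : E d × E d => f (v k) z.1 * f (v k) z.2 := fun k =>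
      (hfm measurable_const measurable_fst).mul (hfm measurable_const measurable_snd)
    have hm2 : ∀ k, Measurable fun z : E d × E d => f (v k) z.1 * f z.1 z.2 := fun k =>
      (hfm measurable_const measurable_fst).mul (hfm measurable_fst measurable_snd)
    have hm3 : ∀ k, Measurable fun z : E d × E d => f (v k) z.2 * f z.2 z.1 := fun k =>
      (hfm measurable_const measurable_snd).mul (hfm measurable_snd measurable_fst)
    have hm : ∀ k, Measurable fun z : E d × E d =>
        f (v k) z.1 * f (v k) z.2 + f (v k) z.1 * f z.1 z.2 + f (v k) z.2 * f z.2 z.1 :=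
      fun k => ((hm1 k).add (hm2 k)).add (hm3 k)
    calc _ ≤ ∫⁻ y : E d, ∫⁻ x : E d, ∑ k,
            (f (v k) y * f (v k) x + f (v k) y * f y x + f (v k) x * f x y) := by
          refine lintegral_mono fun y => lintegral_mono fun x => ?_
          refine (mul_le_mul_right (ENNReal.ofReal_le_ofReal (hle x y)) _).trans ?_
          rw [ENNReal.ofReal_sum_of_nonneg fun k _ => by positivity, Finset.mul_sum]
          refine Finset.sum_le_sum fun k _ => ?_
          rw [ENNReal.ofReal_add (by positivity) (by positivity),
            ENNReal.ofReal_add (by positivity) (by positivity), ENNReal.ofReal_mul (by positivity),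
            ENNReal.ofReal_mul (by positivity), ENNReal.ofReal_mul (by positivity)]
          simp only [hf]
          apply le_of_eq; ring
      _ = ∑ k, ((∫⁻ y : E d, ∫⁻ x : E d, f (v k) y * f (v k) x) +
            (∫⁻ y : E d, ∫⁻ x : E d, f (v k) y * f y x) +
            ∫⁻ y : E d, ∫⁻ x : E d, f (v k) x * f x y) := by
          simp_rw [← lintegral_prod _ (hm1 _).aemeasurable, ← lintegral_prod _ (hm2 _).aemeasurable,
            ← lintegral_prod _ (hm3 _).aemeasurable]
          rw [← lintegral_prod (fun z : E d × E d => ∑ k, (f (v k) z.1 * f (v k) z.2 +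
              f (v k) z.1 * f z.1 z.2 + f (v k) z.2 * f z.2 z.1))
              (Finset.measurable_fun_sum _ fun k _ => hm k).aemeasurable,
            lintegral_finsetSum _ fun k _ => hm k]
          refine Finset.sum_congr rfl fun k _ => ?_
          rw [lintegral_add_right _ (hm3 k), lintegral_add_left (hm1 k)]
      _ ≤ ∑ _k : Fin n, (M * M + M * M + M * M) := by
          have hdouble : ∀ k, ∫⁻ y : E d, ∫⁻ x : E d, f (v k) y * f y x ≤ M * M := fun k => by
            simp_rw [lintegral_const_mul _ (hfx _)]
            refine (lintegral_mono fun y => mul_le_mul_right (hbp y) _).trans ?_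
            rw [lintegral_mul_const _ (hfx _)]
            exact mul_le_mul_left (hbp _) _
          refine Finset.sum_le_sum fun k _ => add_le_add (add_le_add ?_ (hdouble k)) ?_
          · simp_rw [lintegral_const_mul _ (hfx _)]
            rw [lintegral_mul_const _ (hfx _)]
            exact mul_le_mul' (hbp _) (hbp _)
          · rw [lintegral_lintegral_swap (hm3 k).aemeasurable]
            exact hdouble k
      _ = _ := by rw [Finset.sum_const, Finset.card_univ, Fintype.card_fin, nsmul_eq_mul]
  have e2 : ∀ v : Fin n → E d, ∫⁻ y : E d, ((∏ i, w (v i)) * ENNReal.ofReal (pairProd s v)) *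
      (∫⁻ x : E d, w y * w x *
        ENNReal.ofReal ((∏ k, (‖y - v k‖ * ‖x - v k‖) ^ (-s)) * ‖y - x‖ ^ (-s))) ≤
      ((∏ i, w (v i)) * ENNReal.ofReal (pairProd s v)) * (n * (M * M + M * M + M * M)) := by
    intro v
    have hm : Measurable fun z : E d × E d => w z.1 * w z.2 *
        ENNReal.ofReal ((∏ k, (‖z.1 - v k‖ * ‖z.2 - v k‖) ^ (-s)) * ‖z.1 - z.2‖ ^ (-s)) := by
      fun_prop
    rw [lintegral_const_mul _ hm.lintegral_prod_right']
    exact mul_le_mul_right (key v) _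
  refine (lintegral_mono e2).trans_lt ?_
  rw [lintegral_mul_const _ (measurable_pairIntegrand hwm s)]
  refine ENNReal.mul_lt_top hI (ENNReal.mul_lt_top (by finiteness) ?_)
  finiteness

/-! ### Weights -/

lemma boundedPotential_rpow_mul_one_add [NeZero d] {β κ p : ℝ} (hβ : 0 < β) (hp : 0 < p)
    (hβp : β + p < d) (hκ : (d : ℝ) < β + κ) :
    BoundedPotential (fun u : E d => ENNReal.ofReal (‖u‖ ^ (-β) * (1 + ‖u‖) ^ (-κ))) p := by
  have hκ0 : 0 < κ := by linarith
  have h1 := boundedPotential_rpow_ball hβ hp hβp 1 (0 : E d)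
  have h2 := (boundedPotential_one_add_norm (d := d) hκ hp.le (by linarith)).const_mul
    (c := ENNReal.ofReal (2 ^ β)) ENNReal.ofReal_ne_top
  refine (h1.add h2).mono (by fun_prop) fun u => ?_
  by_cases hu : u ∈ Metric.ball (0 : E d) 1
  · rw [indicator_of_mem hu, sub_zero]
    refine le_trans (ENNReal.ofReal_le_ofReal ?_) le_self_add
    refine mul_le_of_le_one_right (by positivity) ?_
    exact Real.rpow_le_one_of_one_le_of_nonpos (by linarith [norm_nonneg u]) (by linarith)
  · rw [indicator_of_notMem hu, zero_add, ← ENNReal.ofReal_mul (by positivity)]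
    refine ENNReal.ofReal_le_ofReal ?_
    simp only [Metric.mem_ball, dist_zero_right, not_lt] at hu
    have hpos : 0 < 1 + ‖u‖ := by linarith
    have h3 : ‖u‖ ^ (-β) ≤ ((1 + ‖u‖) / 2) ^ (-β) :=
      Real.rpow_le_rpow_of_nonpos (by positivity) (by linarith) (by linarith)
    calc ‖u‖ ^ (-β) * (1 + ‖u‖) ^ (-κ) ≤ ((1 + ‖u‖) / 2) ^ (-β) * (1 + ‖u‖) ^ (-κ) := by gcongr
      _ = 2 ^ β * (1 + ‖u‖) ^ (-(β + κ)) := by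
        rw [Real.div_rpow hpos.le zero_le_two, Real.rpow_neg zero_le_two, div_inv_eq_mul,
          mul_comm _ ((2 : ℝ) ^ β), mul_assoc, ← Real.rpow_add hpos]
        congr 2; ring

lemma BoundedPotential.integrable_of_abs_le {w : E d → ENNReal} {p t : ℝ}
    (hw : BoundedPotential w p) (ht : 0 ≤ t) (htp : t ≤ p) (a : E d) {F : E d → ℝ}
    (hF : AEStronglyMeasurable F)
    (hle : ∀ u, ENNReal.ofReal |F u| ≤ w u * ENNReal.ofReal (‖u - a‖ ^ (-t))) : Integrable F := by
  obtain ⟨M, hM, hb⟩ := hw.bound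
  refine ⟨hF, lt_of_le_of_lt ?_ (hM.lt_top)⟩
  refine le_trans (lintegral_mono fun u => ?_) (hb t ht htp a)
  rw [← ofReal_norm, Real.norm_eq_abs]
  exact hle u

lemma BoundedPotential.integrable {w : E d → ENNReal} {p : ℝ}
    (hw : BoundedPotential w p) (hp : 0 ≤ p) {F : E d → ℝ}
    (hF : AEStronglyMeasurable F) (hle : ∀ u, ENNReal.ofReal |F u| ≤ w u) : Integrable F :=
  hw.integrable_of_abs_le le_rfl hp 0 hF fun u => by simpa using hle u

/-! ### Cutoffs and translations -/

/-- A piecewise linear cutoff at scale `M`. -/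
noncomputable def coneCutoff (M : ℝ) (u : E d) : ℝ := max (1 - ‖u‖ / M) 0

lemma coneCutoff_nonneg (M : ℝ) (u : E d) : 0 ≤ coneCutoff M u := le_max_right _ _

lemma coneCutoff_le_one {M : ℝ} (hM : 0 ≤ M) (u : E d) : coneCutoff M u ≤ 1 :=
  max_le (by have : 0 ≤ ‖u‖ / M := by positivity
             linarith) zero_le_one

lemma coneCutoff_eq_zero {M : ℝ} (hM : 0 < M) {u : E d} (hu : M ≤ ‖u‖) : coneCutoff M u = 0 :=
  max_eq_right (by rw [sub_nonpos, one_le_div hM]; exact hu)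

@[simp] lemma coneCutoff_neg (M : ℝ) (u : E d) : coneCutoff M (-u) = coneCutoff M u := by
  simp [coneCutoff]

@[fun_prop]
lemma continuous_coneCutoff (M : ℝ) : Continuous (coneCutoff M : E d → ℝ) := by
  unfold coneCutoff; fun_prop

lemma abs_coneCutoff_sub_le {M : ℝ} (hM : 0 < M) (u v : E d) :
    |coneCutoff M u - coneCutoff M v| ≤ ‖u - v‖ / M := by
  refine (abs_max_sub_max_le_abs _ _ _).trans ?_
  rw [show 1 - ‖u‖ / M - (1 - ‖v‖ / M) = (‖v‖ - ‖u‖) / M by ring, abs_div, abs_of_pos hM]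
  gcongr
  rw [norm_sub_rev]
  exact abs_norm_sub_norm_le v u

lemma tendsto_coneCutoff (u : E d) : Tendsto (fun M : ℝ => coneCutoff M u) atTop (𝓝 1) := by
  have h : Tendsto (fun M : ℝ => max (1 - ‖u‖ / M) 0) atTop (𝓝 (max (1 - 0) 0)) :=
    (tendsto_const_nhds.sub (tendsto_const_nhds.div_atTop tendsto_id)).max tendsto_const_nhds
  simpa [coneCutoff] using h

lemma tendsto_integral_coneCutoff_mul {F : E d → ℝ} (hF : Integrable F) :
    Tendsto (fun M : ℝ => ∫ u, coneCutoff M u * F u) atTop (𝓝 (∫ u, F u)) := by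
  refine tendsto_integral_filter_of_dominated_convergence (fun u => ‖F u‖) ?_ ?_ hF.norm ?_
  · exact Eventually.of_forall fun M => (continuous_coneCutoff M).aestronglyMeasurable.mul hF.1
  · filter_upwards [eventually_ge_atTop 0] with M hM
    refine ae_of_all _ fun u => ?_
    rw [norm_mul, Real.norm_of_nonneg (coneCutoff_nonneg M u)]
    exact mul_le_of_le_one_left (norm_nonneg _) (coneCutoff_le_one hM u)
  · refine ae_of_all _ fun u => ?_
    simpa using (tendsto_coneCutoff u).mul_const (F u)

lemma one_le_rpow_mul_rpow_neg {x y κ : ℝ} (hx : 0 < x) (hxy : x ≤ y) (hκ : 0 ≤ κ) :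
    1 ≤ y ^ κ * x ^ (-κ) := by
  rw [Real.rpow_neg hx.le, ← div_eq_mul_inv, one_le_div (by positivity)]
  exact Real.rpow_le_rpow hx.le hxy hκ

lemma integrable_coneCutoff_mul {F : E d → ℝ} {κ : ℝ} (hκ : 0 ≤ κ)
    (hF : Integrable fun u => F u * (1 + ‖u‖) ^ (-κ)) (hFm : AEStronglyMeasurable F) {M : ℝ}
    (hM : 0 < M) : Integrable fun u => coneCutoff M u * F u := by
  refine (hF.norm.const_mul ((1 + M) ^ κ)).mono'
    ((continuous_coneCutoff M).aestronglyMeasurable.mul hFm) (ae_of_all _ fun u => ?_)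
  rw [norm_mul, norm_mul, Real.norm_of_nonneg (coneCutoff_nonneg M u)]
  rcases le_or_gt M ‖u‖ with h | h
  · rw [coneCutoff_eq_zero hM h, zero_mul]; positivity
  have h1 : 1 ≤ (1 + M) ^ κ * (1 + ‖u‖) ^ (-κ) :=
    one_le_rpow_mul_rpow_neg (by positivity) (by linarith) hκ
  rw [Real.norm_of_nonneg (Real.rpow_nonneg (by positivity : 0 ≤ 1 + ‖u‖) (-κ))]
  calc coneCutoff M u * ‖F u‖ ≤ 1 * ‖F u‖ := by gcongr; exact coneCutoff_le_one hM.le u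
    _ ≤ ((1 + M) ^ κ * (1 + ‖u‖) ^ (-κ)) * ‖F u‖ := by gcongr
    _ = _ := by ring

lemma tendsto_integral_coneCutoff_shift {F : E d → ℝ} {κ : ℝ} (hκ : 0 ≤ κ) (hκ1 : κ < 1)
    (hF : Integrable fun u => F u * (1 + ‖u‖) ^ (-κ)) {e : E d} (he : ‖e‖ = 1) :
    Tendsto (fun M : ℝ => ∫ u, (coneCutoff M u - coneCutoff M (u + e)) * F u) atTop (𝓝 0) := by
  have hlim : Tendsto (fun M : ℝ => 3 ^ κ * M ^ (-(1 - κ)) * ∫ u, ‖F u * (1 + ‖u‖) ^ (-κ)‖) atTop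
      (𝓝 0) := by
    simpa using ((tendsto_rpow_neg_atTop (by linarith : 0 < 1 - κ)).const_mul
      ((3 : ℝ) ^ κ)).mul_const (∫ u, ‖F u * (1 + ‖u‖) ^ (-κ)‖)
  refine squeeze_zero_norm' ?_ hlim
  filter_upwards [eventually_ge_atTop 1] with M hM
  have hM0 : 0 < M := by linarith
  rw [← integral_const_mul]
  refine norm_integral_le_of_norm_le (hF.norm.const_mul _) (ae_of_all _ fun u => ?_)
  rw [norm_mul, norm_mul]
  rcases le_or_gt (M + 1) ‖u‖ with h | h
  · have h2 : M ≤ ‖u + e‖ := by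
      have := norm_sub_le (u + e) e
      rw [add_sub_cancel_right, he] at this
      linarith
    rw [coneCutoff_eq_zero hM0 h2, coneCutoff_eq_zero hM0 (by linarith)]
    simp only [sub_self, norm_zero, zero_mul]
    positivity
  have h1 : 1 ≤ (3 * M) ^ κ * (1 + ‖u‖) ^ (-κ) :=
    one_le_rpow_mul_rpow_neg (by positivity) (by linarith) hκ
  have h2 : ‖coneCutoff M u - coneCutoff M (u + e)‖ ≤ 1 / M := by
    have := abs_coneCutoff_sub_le hM0 u (u + e)
    rwa [sub_add_cancel_left, norm_neg, he] at this
  rw [Real.norm_of_nonneg (Real.rpow_nonneg (by positivity : 0 ≤ 1 + ‖u‖) (-κ))]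
  calc ‖coneCutoff M u - coneCutoff M (u + e)‖ * ‖F u‖
      ≤ (1 / M) * (((3 * M) ^ κ * (1 + ‖u‖) ^ (-κ)) * ‖F u‖) := by
        refine mul_le_mul h2 ?_ (norm_nonneg _) (by positivity)
        exact le_mul_of_one_le_left (norm_nonneg _) h1
    _ = 3 ^ κ * M ^ (-(1 - κ)) * (‖F u‖ * (1 + ‖u‖) ^ (-κ)) := by
        rw [Real.mul_rpow (by norm_num) hM0.le, show -(1 - κ) = κ - 1 by ring,
          Real.rpow_sub_one hM0.ne']
        ring

/-! ### The increment kernel -/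

/-- The function `u ↦ ⟨a, u⟩ |u|^(-p)`. -/
noncomputable def dipole (p : ℝ) (a u : E d) : ℝ := inner ℝ a u * ‖u‖ ^ (-p)

@[fun_prop]
lemma measurable_dipole (p : ℝ) (a : E d) : Measurable (dipole p a) := by
  unfold dipole; fun_prop

lemma dipole_neg (p : ℝ) (a u : E d) : dipole p a (-u) = -dipole p a u := by
  simp [dipole]

lemma abs_inner_le_norm_of_unit {a : E d} (ha : ‖a‖ = 1) (u : E d) : |inner ℝ a u| ≤ ‖u‖ := by
  simpa [ha] using abs_real_inner_le_norm a u

lemma abs_dipole_le {p : ℝ} (hp : p ≠ 1) {a : E d} (ha : ‖a‖ = 1) (u : E d) :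
    |dipole p a u| ≤ ‖u‖ ^ (-(p - 1)) := by
  rw [dipole, abs_mul, abs_of_nonneg (Real.rpow_nonneg (norm_nonneg u) _)]
  refine (mul_le_mul_of_nonneg_right (abs_inner_le_norm_of_unit ha u) (by positivity)).trans ?_
  rcases (norm_nonneg u).eq_or_lt with h | h
  · rw [← h, zero_mul, Real.zero_rpow (by intro h; apply hp; linarith)]
  · rw [← Real.rpow_one_add' h.le (by intro h; apply hp; linarith)]
    exact le_of_eq (by congr 1; ring)

lemma continuousAt_dipole (p : ℝ) (a : E d) {u : E d} (hu : u ≠ 0) :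
    ContinuousAt (dipole p a) u := by
  unfold dipole
  refine ContinuousAt.mul (by fun_prop) ?_
  exact (Real.continuousAt_rpow_const _ _ (Or.inl (norm_ne_zero_iff.2 hu))).comp
    continuous_norm.continuousAt

lemma abs_rpow_neg_sub_rpow_neg_le {p m x y : ℝ} (hp : 0 ≤ p) (hm : 0 < m) (hx : m ≤ x)
    (hy : m ≤ y) : |x ^ (-p) - y ^ (-p)| ≤ p * m ^ (-p - 1) * |x - y| := by
  have h := (convex_Ici m).norm_image_sub_le_of_norm_hasDerivWithin_le
    (f := fun t : ℝ => t ^ (-p)) (f' := fun t => -p * t ^ (-p - 1)) (C := p * m ^ (-p - 1))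
    (x := y) (y := x) ?_ ?_ hy hx
  · simpa using h
  · intro t ht
    exact (Real.hasDerivAt_rpow_const (Or.inl (hm.trans_le ht).ne')).hasDerivWithinAt
  · intro t ht
    rw [norm_mul, norm_neg, Real.norm_of_nonneg hp,
      Real.norm_of_nonneg (Real.rpow_nonneg (hm.trans_le ht).le _)]
    exact mul_le_mul_of_nonneg_left (Real.rpow_le_rpow_of_nonpos hm ht (by linarith)) hp

/-- Increments of dipoles with slowly varying coefficients decay one power faster. -/
lemma abs_dipole_increment_le {p D c c' : ℝ} (hp : 0 ≤ p) {a e u : E d} (ha : ‖a‖ = 1)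
    (he : ‖e‖ = 1) (hu : 2 ≤ ‖u‖) (hc' : |c'| ≤ 1)
    (hcc : |c - c'| ≤ D / ‖u‖) :
    |c * dipole p a u - c' * dipole p a (u - e)| ≤ (D + 1 + p * 2 ^ (p + 2)) * ‖u‖ ^ (-p) := by
  have hu0 : 0 < ‖u‖ := by linarith
  have hv1 : ‖u‖ / 2 ≤ ‖u - e‖ := by have := norm_sub_norm_le u e; rw [he] at this; linarith
  have hv2 : ‖u - e‖ ≤ 2 * ‖u‖ := by have := norm_sub_le u e; rw [he] at this; linarith
  have hD : 0 ≤ D := by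
    by_contra hD
    have : D / ‖u‖ < 0 := div_neg_of_neg_of_pos (by linarith) hu0
    linarith [abs_nonneg (c - c')]
  have e1 : c * dipole p a u - c' * dipole p a (u - e) =
      (c - c') * inner ℝ a u * ‖u‖ ^ (-p) + c' * inner ℝ a e * ‖u‖ ^ (-p) +
        c' * inner ℝ a (u - e) * (‖u‖ ^ (-p) - ‖u - e‖ ^ (-p)) := by
    simp only [dipole, inner_sub_right]; ring
  have hP : 0 ≤ ‖u‖ ^ (-p) := by positivity
  have b1 : |(c - c') * inner ℝ a u * ‖u‖ ^ (-p)| ≤ D * ‖u‖ ^ (-p) := by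
    rw [abs_mul, abs_mul, abs_of_nonneg hP]
    refine mul_le_mul_of_nonneg_right ?_ hP
    calc |c - c'| * |inner ℝ a u| ≤ (D / ‖u‖) * ‖u‖ :=
          mul_le_mul hcc (abs_inner_le_norm_of_unit ha u) (abs_nonneg _) (by positivity)
      _ = D := by field_simp
  have b2 : |c' * inner ℝ a e * ‖u‖ ^ (-p)| ≤ 1 * ‖u‖ ^ (-p) := by
    rw [abs_mul, abs_mul, abs_of_nonneg hP]
    refine mul_le_mul_of_nonneg_right ?_ hP
    have := abs_inner_le_norm_of_unit ha e
    rw [he] at this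
    exact mul_le_one₀ hc' (abs_nonneg _) this
  have b3 : |c' * inner ℝ a (u - e) * (‖u‖ ^ (-p) - ‖u - e‖ ^ (-p))| ≤
      p * 2 ^ (p + 2) * ‖u‖ ^ (-p) := by
    rw [abs_mul, abs_mul]
    have h1 := abs_rpow_neg_sub_rpow_neg_le hp (half_pos hu0) (by linarith : ‖u‖ / 2 ≤ ‖u‖) hv1
    have h2 : |‖u‖ - ‖u - e‖| ≤ 1 := by
      have := abs_norm_sub_norm_le u (u - e)
      rwa [sub_sub_cancel, he] at this
    have h3 : |c'| * |inner ℝ a (u - e)| ≤ 1 * (2 * ‖u‖) :=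
      mul_le_mul hc' ((abs_inner_le_norm_of_unit ha _).trans hv2) (abs_nonneg _) zero_le_one
    calc |c'| * |inner ℝ a (u - e)| * |‖u‖ ^ (-p) - ‖u - e‖ ^ (-p)|
        ≤ (1 * (2 * ‖u‖)) * (p * (‖u‖ / 2) ^ (-p - 1) * 1) := by
          refine mul_le_mul h3 (h1.trans ?_) (abs_nonneg _) (by positivity)
          exact mul_le_mul_of_nonneg_left h2 (by positivity)
      _ = p * 2 ^ (p + 2) * ‖u‖ ^ (-p) := by
          rw [Real.div_rpow hu0.le zero_le_two, Real.rpow_sub_one hu0.ne',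
            show -p - 1 = -(p + 1) by ring, Real.rpow_neg zero_le_two,
            show p + 2 = (p + 1) + 1 by ring, Real.rpow_add_one two_ne_zero (p + 1),
            Real.rpow_add_one two_ne_zero p]
          field_simp
  rw [e1]
  refine (abs_add_le _ _).trans ?_
  have := abs_add_le ((c - c') * inner ℝ a u * ‖u‖ ^ (-p)) (c' * inner ℝ a e * ‖u‖ ^ (-p))
  nlinarith

/-- The weight dominating the increments of dipoles. -/
noncomputable def incrWeight (β r : ℝ) (e u : E d) : ENNReal :=
  (Metric.ball 0 3).indicator (fun u : E d => ENNReal.ofReal (‖u - 0‖ ^ (-β))) u +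
    (Metric.ball e 3).indicator (fun u => ENNReal.ofReal (‖u - e‖ ^ (-β))) u +
    ENNReal.ofReal ((1 + ‖u‖) ^ (-r))

lemma boundedPotential_incrWeight [NeZero d] {β r p : ℝ} (hβ : 0 < β) (hp : 0 < p)
    (hβp : β + p < d) (hr : (d : ℝ) < r) (e : E d) : BoundedPotential (incrWeight β r e) p :=
  ((boundedPotential_rpow_ball hβ hp hβp 3 0).add (boundedPotential_rpow_ball hβ hp hβp 3 e)).add
    (boundedPotential_one_add_norm hr hp.le (by linarith))

lemma incrWeight_mul_le {β r σ : ℝ} (hσ : 0 ≤ σ) {e : E d} (he : ‖e‖ = 1) (u : E d) :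
    incrWeight β r e u * ENNReal.ofReal ((1 + ‖u‖) ^ σ) ≤
      ENNReal.ofReal (5 ^ σ) * incrWeight β (r - σ) e u := by
  have h5 : 1 ≤ ENNReal.ofReal (5 ^ σ) := by
    rw [ENNReal.one_le_ofReal]; exact Real.one_le_rpow (by norm_num) hσ
  have hb : ∀ b : E d, ‖b‖ ≤ 1 →
      (Metric.ball b 3).indicator (fun u => ENNReal.ofReal (‖u - b‖ ^ (-β))) u *
        ENNReal.ofReal ((1 + ‖u‖) ^ σ) ≤ ENNReal.ofReal (5 ^ σ) *
        (Metric.ball b 3).indicator (fun u => ENNReal.ofReal (‖u - b‖ ^ (-β))) u := by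
    intro b hb
    by_cases hu : u ∈ Metric.ball b 3
    · rw [mul_comm]
      refine mul_le_mul_left (ENNReal.ofReal_le_ofReal (Real.rpow_le_rpow (by positivity) ?_ hσ)) _
      rw [Metric.mem_ball, dist_eq_norm] at hu
      have := norm_sub_norm_le u b
      linarith
    · rw [indicator_of_notMem hu]; simp
  unfold incrWeight
  rw [add_mul, add_mul, mul_add, mul_add]
  refine add_le_add (add_le_add (hb 0 (by simp)) (hb e he.le)) ?_
  rw [← ENNReal.ofReal_mul (by positivity), ← Real.rpow_add (by positivity),
    show -r + σ = -(r - σ) by ring]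
  exact le_mul_of_one_le_left zero_le h5

lemma ofReal_abs_dipole_increment_le {p D c c' : ℝ} (hp : 1 < p) (hD : 0 ≤ D) {a e : E d}
    (u : E d) (ha : ‖a‖ = 1) (he : ‖e‖ = 1) (hc : |c| ≤ 1) (hc' : |c'| ≤ 1)
    (hcc : 2 ≤ ‖u‖ → |c - c'| ≤ D / ‖u‖) :
    ENNReal.ofReal |c * dipole p a u - c' * dipole p a (u - e)| ≤
      ENNReal.ofReal ((D + 1 + p * 2 ^ (p + 2)) * 2 ^ p) * incrWeight (p - 1) p e u := by
  have h2p : (1 : ℝ) ≤ 2 ^ p := Real.one_le_rpow one_le_two (by linarith)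
  have hC : 1 ≤ (D + 1 + p * 2 ^ (p + 2)) * 2 ^ p := by
    have : 0 ≤ p * (2 : ℝ) ^ (p + 2) := by positivity
    nlinarith
  rcases le_or_gt 2 ‖u‖ with hu | hu
  · refine le_trans ?_ (mul_le_mul_right le_add_self _)
    rw [← ENNReal.ofReal_mul (by positivity)]
    refine ENNReal.ofReal_le_ofReal ((abs_dipole_increment_le (by linarith) ha he hu hc'
      (hcc hu)).trans ?_)
    rw [mul_assoc]
    refine mul_le_mul_of_nonneg_left ?_ (by positivity)
    have h1 : ‖u‖ ^ (-p) ≤ ((1 + ‖u‖) / 2) ^ (-p) :=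
      Real.rpow_le_rpow_of_nonpos (by positivity) (by linarith) (by linarith)
    refine h1.trans (le_of_eq ?_)
    rw [Real.div_rpow (by positivity) zero_le_two, Real.rpow_neg zero_le_two, div_inv_eq_mul,
      mul_comm]
  · refine le_trans ?_ (le_mul_of_one_le_left zero_le (ENNReal.one_le_ofReal.2 hC))
    refine le_trans ?_ le_self_add
    rw [indicator_of_mem (by simp; linarith), indicator_of_mem, ← ENNReal.ofReal_add
      (by positivity) (by positivity), sub_zero]
    · refine ENNReal.ofReal_le_ofReal ((abs_sub _ _).trans (add_le_add ?_ ?_))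
      · rw [abs_mul]
        exact (mul_le_of_le_one_left (abs_nonneg _) hc).trans (abs_dipole_le (by linarith) ha u)
      · rw [abs_mul]
        exact (mul_le_of_le_one_left (abs_nonneg _) hc').trans
          (abs_dipole_le (by linarith) ha _)
    · rw [Metric.mem_ball, dist_eq_norm]
      have := norm_sub_le u e
      linarith

/-- The increment of the dipole in the direction `a` along `e`. -/
noncomputable def dipoleIncr (p : ℝ) (a e u : E d) : ℝ := dipole p a u - dipole p a (u - e)

@[fun_prop]
lemma measurable_dipoleIncr (p : ℝ) (a e : E d) : Measurable (dipoleIncr p a e) := by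
  unfold dipoleIncr; fun_prop

lemma incrementKernel_eq_dipoleIncr (α : ℝ) (j : Fin d) (e : E d) :
    incrementKernel d α j e = dipoleIncr ((d : ℝ) - α + 1) (EuclideanSpace.single j 1) e := by
  funext u
  simp only [incrementKernel, dipoleIncr, dipole, Real.rpow_neg (norm_nonneg _), div_eq_mul_inv,
    EuclideanSpace.inner_single_left]
  simp

lemma ofReal_abs_dipoleIncr_le {p : ℝ} (hp : 1 < p) {a e : E d} (ha : ‖a‖ = 1) (he : ‖e‖ = 1)
    (u : E d) : ENNReal.ofReal |dipoleIncr p a e u| ≤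
      ENNReal.ofReal ((0 + 1 + p * 2 ^ (p + 2)) * 2 ^ p) * incrWeight (p - 1) p e u := by
  have := ofReal_abs_dipole_increment_le hp le_rfl u ha he (c := 1) (c' := 1) (by simp) (by simp)
    (by simp)
  simpa [dipoleIncr] using this

lemma integrable_dipoleIncr [NeZero d] {p : ℝ} (hp1 : 1 < p) (hp : (d : ℝ) < p) (hp' : p < d + 1)
    {a e : E d} (ha : ‖a‖ = 1) (he : ‖e‖ = 1) : Integrable (dipoleIncr p a e) := by
  obtain ⟨t, ht⟩ : ∃ t, t = (d + 1 - p) / 2 := ⟨_, rfl⟩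
  exact ((boundedPotential_incrWeight (d := d) (β := p - 1) (p := t) (by linarith) (by linarith)
    (by linarith) hp e).const_mul ENNReal.ofReal_ne_top).integrable (by linarith)
    (measurable_dipoleIncr p a e).aestronglyMeasurable fun u => ofReal_abs_dipoleIncr_le hp1 ha he u

lemma integrable_dipole_mul_one_add [NeZero d] {p κ : ℝ} (hp1 : 1 < p) (hp' : p < d + 1)
    (hκ : d + 1 - p < κ) {a : E d} (ha : ‖a‖ = 1) :
    Integrable fun u : E d => dipole p a u * (1 + ‖u‖) ^ (-κ) := by
  obtain ⟨t, ht⟩ : ∃ t, t = (d + 1 - p) / 2 := ⟨_, rfl⟩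
  refine (boundedPotential_rpow_mul_one_add (d := d) (β := p - 1) (p := t) (κ := κ) (by linarith)
    (by linarith) (by linarith) (by linarith)).integrable (by linarith)
    (by fun_prop) fun u => ENNReal.ofReal_le_ofReal ?_
  rw [abs_mul, abs_of_nonneg (Real.rpow_nonneg (by positivity : 0 ≤ 1 + ‖u‖) _)]
  exact mul_le_mul_of_nonneg_right (abs_dipole_le (by linarith) ha u) (by positivity)

lemma integral_dipoleIncr [NeZero d] {p : ℝ} (hp1 : 1 < p) (hp : (d : ℝ) < p) (hp' : p < d + 1)
    {a e : E d} (ha : ‖a‖ = 1) (he : ‖e‖ = 1) : ∫ u, dipoleIncr p a e u = 0 := by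
  obtain ⟨κ, hκ1, hκ2⟩ : ∃ κ, d + 1 - p < κ ∧ κ < 1 := exists_between (by linarith)
  have hF := integrable_dipole_mul_one_add hp1 hp' hκ1 ha
  have h0 : 0 ≤ κ := by linarith
  have h1 := tendsto_integral_coneCutoff_shift h0 hκ2 hF he
  have h2 := tendsto_integral_coneCutoff_mul (integrable_dipoleIncr hp1 hp hp' ha he)
  refine tendsto_nhds_unique h2 (h1.congr' ?_)
  filter_upwards [eventually_gt_atTop 0] with M hM
  have i1 := integrable_coneCutoff_mul h0 hF (measurable_dipole p a).aestronglyMeasurable hM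
  have i2 : Integrable fun u => coneCutoff M u * dipole p a (u - e) := by
    have := i1.sub ((integrable_dipoleIncr hp1 hp hp' ha he).bdd_mul
      (continuous_coneCutoff M).aestronglyMeasurable (ae_of_all _ fun u => ?_) (c := 1))
    · refine this.congr (ae_of_all _ fun u => ?_)
      simp only [Pi.sub_apply, dipoleIncr]; ring
    · rw [Real.norm_of_nonneg (coneCutoff_nonneg M u)]
      exact coneCutoff_le_one hM.le u
  have i3 : Integrable fun u => coneCutoff M (u + e) * dipole p a u := by
    have := i2.comp_add_right e
    simpa using this
  simp only [sub_mul, dipoleIncr, mul_sub]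
  rw [integral_sub i1 i3, integral_sub i1 i2]
  congr 1
  rw [← integral_add_right_eq_self (fun u => coneCutoff M u * dipole p a (u - e)) e]
  simp

/-! ### Logarithmic potentials of dipoles -/

lemma abs_log_le_rpow {x δ : ℝ} (hx : 0 ≤ x) (hδ : 0 < δ) :
    |Real.log x| ≤ (x ^ δ + x ^ (-δ)) / δ := by
  have h1 : 0 ≤ x ^ δ := Real.rpow_nonneg hx _
  have h2 : 0 ≤ x ^ (-δ) := Real.rpow_nonneg hx _
  rw [abs_le]
  constructor
  · have := Real.log_le_rpow_div (inv_nonneg.2 hx) hδ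
    rw [Real.log_inv, Real.inv_rpow hx, ← Real.rpow_neg hx] at this
    have h3 : x ^ (-δ) / δ ≤ (x ^ δ + x ^ (-δ)) / δ := by gcongr; linarith
    linarith
  · refine (Real.log_le_rpow_div hx hδ).trans ?_
    gcongr; linarith

lemma integrable_log_mul {w : E d → ENNReal} {p δ : ℝ} (hw : BoundedPotential w p) (hδ : 0 < δ)
    (hδp : δ ≤ p) {F : E d → ℝ} (hF : Measurable F)
    (hle : ∀ u, ENNReal.ofReal (|F u| * (1 + ‖u‖) ^ δ) ≤ w u) (a : E d) :
    Integrable fun u => Real.log ‖a - u‖ * F u := by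
  have i1 : Integrable fun u => F u * (1 + ‖u‖) ^ δ := by
    refine hw.integrable (by linarith) (by fun_prop) fun u => ?_
    rw [abs_mul, abs_of_nonneg (Real.rpow_nonneg (by positivity : 0 ≤ 1 + ‖u‖) δ)]
    exact hle u
  have i2 : Integrable fun u => F u * (1 + ‖u‖) ^ δ * ‖u - a‖ ^ (-δ) := by
    refine hw.integrable_of_abs_le hδ.le hδp a (by fun_prop) fun u => ?_
    rw [abs_mul, abs_mul, abs_of_nonneg (Real.rpow_nonneg (by positivity : 0 ≤ 1 + ‖u‖) δ),
      abs_of_nonneg (Real.rpow_nonneg (norm_nonneg (u - a)) _), ENNReal.ofReal_mul (by positivity)]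
    exact mul_le_mul_left (hle u) _
  refine (((i1.norm.const_mul ((1 + ‖a‖) ^ δ)).add i2.norm).const_mul (1 / δ)).mono' (by fun_prop)
    (ae_of_all _ fun u => ?_)
  have h0 : 0 ≤ (1 + ‖u‖) ^ δ := by positivity
  have h1 : 0 ≤ ‖u - a‖ ^ (-δ) := by positivity
  simp only [Pi.add_apply, norm_mul, Real.norm_eq_abs, abs_of_nonneg h0, abs_of_nonneg h1]
  have hlog := abs_log_le_rpow (norm_nonneg (a - u)) hδ
  rw [norm_sub_rev a u] at hlog ⊢
  have h2 : ‖u - a‖ ^ δ ≤ (1 + ‖a‖) ^ δ * (1 + ‖u‖) ^ δ := by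
    rw [← Real.mul_rpow (by positivity) (by positivity)]
    refine Real.rpow_le_rpow (norm_nonneg _) ?_ hδ.le
    nlinarith [norm_sub_le u a, norm_nonneg u, norm_nonneg a]
  have h3 : 1 ≤ (1 + ‖u‖) ^ δ := Real.one_le_rpow (by linarith [norm_nonneg u]) hδ.le
  calc |Real.log ‖u - a‖| * |F u|
      ≤ ((1 + ‖a‖) ^ δ * (1 + ‖u‖) ^ δ + (1 + ‖u‖) ^ δ * ‖u - a‖ ^ (-δ)) / δ * |F u| := by
        refine mul_le_mul_of_nonneg_right (hlog.trans ?_) (abs_nonneg _)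
        gcongr
        exact le_mul_of_one_le_left h1 h3
    _ = _ := by ring

/-- The integral `∫ ln (|u - v| / |u + v|) ⟨a, v⟩ |v|^(-p) dv`. -/
noncomputable def logIntegral (p : ℝ) (a u : E d) : ℝ :=
  ∫ v, Real.log (‖u - v‖ / ‖u + v‖) * dipole p a v

lemma logIntegral_smul (p : ℝ) (a u : E d) {t : ℝ} (ht : 0 < t) :
    logIntegral p a (t • u) = t ^ ((d : ℝ) + 1 - p) * logIntegral p a u := by
  have h := Measure.integral_comp_smul (volume : Measure (E d))
    (fun v => Real.log (‖t • u - v‖ / ‖t • u + v‖) * dipole p a v) t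
  rw [finrank_euclideanSpace, Fintype.card_fin, abs_of_pos (by positivity), smul_eq_mul,
    eq_inv_mul_iff_mul_eq₀ (by positivity)] at h
  rw [logIntegral, ← h, logIntegral, ← integral_const_mul, ← integral_const_mul]
  congr 1
  funext v
  rw [← smul_sub, ← smul_add, norm_smul, norm_smul, dipole, norm_smul, Real.norm_of_nonneg ht.le,
    mul_div_mul_left _ _ ht.ne', inner_smul_right, Real.mul_rpow ht.le (norm_nonneg v), dipole,
    show (d : ℝ) + 1 - p = d + (1 + -p) by ring, Real.rpow_add ht, Real.rpow_add ht,
    Real.rpow_natCast, Real.rpow_one]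
  ring

lemma logIntegral_map (p : ℝ) (a u : E d) (Q : E d ≃ₗᵢ[ℝ] E d) :
    logIntegral p (Q a) (Q u) = logIntegral p a u := by
  rw [logIntegral, ← (Q.measurePreserving).integral_comp Q.toHomeomorph.measurableEmbedding]
  refine integral_congr_ae (ae_of_all _ fun v => ?_)
  simp only [dipole, ← map_sub, ← map_add, LinearIsometryEquiv.norm_map,
    LinearIsometryEquiv.inner_map_map]

lemma abs_log_div_le {x y m D : ℝ} (hm : 0 < m) (hx : m ≤ x) (hy : m ≤ y) (hxy : |x - y| ≤ D) :
    |Real.log (x / y)| ≤ D / m := by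
  have hx0 := hm.trans_le hx
  have hy0 := hm.trans_le hy
  have key : ∀ {x y : ℝ}, m ≤ x → m ≤ y → |x - y| ≤ D → Real.log (x / y) ≤ D / m := by
    intro x y hx hy hxy
    have hx0 := hm.trans_le hx
    have hy0 := hm.trans_le hy
    calc Real.log (x / y) ≤ x / y - 1 := Real.log_le_sub_one_of_pos (by positivity)
      _ = (x - y) / y := by field_simp
      _ ≤ D / y := by gcongr; exact (le_abs_self _).trans hxy
      _ ≤ D / m := div_le_div_of_nonneg_left ((abs_nonneg _).trans hxy) hm hy
  rw [abs_le]
  refine ⟨?_, key hx hy hxy⟩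
  have := key hy hx (by rwa [abs_sub_comm])
  rw [← inv_div, Real.log_inv] at this
  linarith

lemma integrable_logIntegral [NeZero d] {p : ℝ} (hp1 : 1 < p) (hp : (d : ℝ) < p) (hp' : p < d + 1)
    (a u : E d) (hu : u ≠ 0) :
    Integrable fun v => Real.log (‖u - v‖ / ‖u + v‖) * dipole p a v := by
  wlog ha : ‖a‖ = 1 generalizing a
  · rcases eq_or_ne a 0 with rfl | ha0
    · simp [dipole]
    · have := (this (‖a‖⁻¹ • a) (by rw [norm_smul, norm_inv, norm_norm,
        inv_mul_cancel₀ (norm_ne_zero_iff.2 ha0)])).const_mul ‖a‖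
      refine this.congr (ae_of_all _ fun v => ?_)
      have h0 := norm_ne_zero_iff.2 ha0
      simp only [dipole, real_inner_smul_left]
      field_simp
  have hu0 : 0 < ‖u‖ := norm_pos_iff.2 hu
  obtain ⟨δ, hδ⟩ : ∃ t, t = (d + 1 - p) / 2 := ⟨_, rfl⟩
  have hδ0 : 0 < δ := by linarith
  have hw := boundedPotential_rpow_mul_one_add (d := d) (β := p - 1) (p := δ) (κ := 1)
    (by linarith) hδ0 (by linarith) (by linarith)
  have hj : ∀ v : E d, |dipole p a v * (1 + ‖v‖) ^ (-1 : ℝ)| ≤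
      ‖v‖ ^ (-(p - 1)) * (1 + ‖v‖) ^ (-1 : ℝ) := fun v => by
    rw [abs_mul, abs_of_nonneg (Real.rpow_nonneg (by positivity : 0 ≤ 1 + ‖v‖) _)]
    exact mul_le_mul_of_nonneg_right (abs_dipole_le (by linarith) ha v) (by positivity)
  have i0 : Integrable fun v : E d => dipole p a v * (1 + ‖v‖) ^ (-1 : ℝ) :=
    hw.integrable hδ0.le (by fun_prop) fun v => ENNReal.ofReal_le_ofReal (hj v)
  have i1 : ∀ b : E d, Integrable fun v : E d =>
      dipole p a v * (1 + ‖v‖) ^ (-1 : ℝ) * ‖v - b‖ ^ (-δ) := fun b => by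
    refine hw.integrable_of_abs_le hδ0.le le_rfl b (by fun_prop) fun v => ?_
    rw [abs_mul, abs_of_nonneg (Real.rpow_nonneg (norm_nonneg (v - b)) _),
      ENNReal.ofReal_mul (abs_nonneg _)]
    exact mul_le_mul_left (ENNReal.ofReal_le_ofReal (hj v)) _
  set A : ℝ := (4 * ‖u‖ + 2) + (1 + 2 * ‖u‖) * (2 * (3 * ‖u‖) ^ δ) / δ
  set B : ℝ := (1 + 2 * ‖u‖) / δ
  refine (((i0.norm.const_mul A).add ((i1 u).norm.const_mul B)).add
    ((i1 (-u)).norm.const_mul B)).mono' (by fun_prop) (ae_of_all _ fun v => ?_)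
  have hv0 := norm_nonneg v
  have hB : 0 ≤ B := by positivity
  have h1v : (1 + ‖v‖) ^ (-1 : ℝ) = (1 + ‖v‖)⁻¹ := Real.rpow_neg_one _
  have hinv : 0 ≤ (1 + ‖v‖)⁻¹ := by positivity
  have hx1 : 0 ≤ ‖v - u‖ ^ (-δ) := by positivity
  have hx2 : 0 ≤ ‖v - -u‖ ^ (-δ) := by positivity
  simp only [Pi.add_apply, norm_mul, Real.norm_eq_abs, h1v, abs_of_nonneg hinv, abs_of_nonneg hx1,
    abs_of_nonneg hx2]
  suffices h : |Real.log (‖u - v‖ / ‖u + v‖)| ≤ (A + B * ‖v - u‖ ^ (-δ) + B * ‖v - -u‖ ^ (-δ)) *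
      (1 + ‖v‖)⁻¹ by
    calc _ ≤ (A + B * ‖v - u‖ ^ (-δ) + B * ‖v - -u‖ ^ (-δ)) * (1 + ‖v‖)⁻¹ * |dipole p a v| :=
          mul_le_mul_of_nonneg_right h (abs_nonneg _)
      _ = _ := by ring
  have hC : 0 ≤ (1 + 2 * ‖u‖) * (2 * (3 * ‖u‖) ^ δ) / δ := by positivity
  rcases le_or_gt (2 * ‖u‖) ‖v‖ with h | h
  · have h1 : |Real.log (‖u - v‖ / ‖u + v‖)| ≤ 2 * ‖u‖ / (‖v‖ / 2) := by
      refine abs_log_div_le (by linarith) ?_ ?_ ?_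
      · have := norm_sub_norm_le v u; rw [norm_sub_rev] at this; linarith
      · have := norm_sub_le (u + v) u; rw [add_sub_cancel_left] at this; linarith
      · have := abs_norm_sub_norm_le (v - u) (v + u)
        rw [show v - u - (v + u) = -((2 : ℝ) • u) by rw [two_smul]; abel, norm_neg, norm_smul,
          Real.norm_ofNat] at this
        rwa [norm_sub_rev u v, add_comm u v]
    refine h1.trans ?_
    rw [← div_eq_mul_inv, div_le_div_iff₀ (by linarith) (by positivity)]
    have : (4 * ‖u‖ + 2) ≤ A + B * ‖v - u‖ ^ (-δ) + B * ‖v - -u‖ ^ (-δ) := by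
      have := mul_nonneg hB hx1
      have := mul_nonneg hB hx2
      simp only [A]; linarith
    nlinarith
  · have hsplit : |Real.log (‖u - v‖ / ‖u + v‖)| ≤ |Real.log ‖u - v‖| + |Real.log ‖u + v‖| := by
      rcases (norm_nonneg (u - v)).eq_or_lt with h1 | h1
      · rw [← h1]; simp
      rcases (norm_nonneg (u + v)).eq_or_lt with h2 | h2
      · rw [← h2]; simp
      rw [Real.log_div h1.ne' h2.ne']
      exact abs_sub _ _
    have e1 : ‖v - -u‖ = ‖u + v‖ := by rw [sub_neg_eq_add, add_comm]
    rw [e1, norm_sub_rev v u]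
    have b1 := abs_log_le_rpow (norm_nonneg (u - v)) hδ0
    have b2 := abs_log_le_rpow (norm_nonneg (u + v)) hδ0
    have c1 : ‖u - v‖ ^ δ ≤ (3 * ‖u‖) ^ δ :=
      Real.rpow_le_rpow (norm_nonneg _) (by linarith [norm_sub_le u v]) hδ0.le
    have c2 : ‖u + v‖ ^ δ ≤ (3 * ‖u‖) ^ δ :=
      Real.rpow_le_rpow (norm_nonneg _) (by linarith [norm_add_le u v]) hδ0.le
    have k1 : 1 ≤ (1 + 2 * ‖u‖) * (1 + ‖v‖)⁻¹ := by
      rw [← div_eq_mul_inv, one_le_div (by positivity)]; linarith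
    have hX : 0 ≤ ‖u - v‖ ^ (-δ) := by positivity
    have hY : 0 ≤ ‖u + v‖ ^ (-δ) := by positivity
    calc |Real.log (‖u - v‖ / ‖u + v‖)|
        ≤ (2 * (3 * ‖u‖) ^ δ + ‖u - v‖ ^ (-δ) + ‖u + v‖ ^ (-δ)) / δ := by
          refine hsplit.trans ((add_le_add b1 b2).trans ?_)
          rw [← add_div]
          exact div_le_div_of_nonneg_right (by linarith) hδ0.le
      _ ≤ (2 * (3 * ‖u‖) ^ δ + ‖u - v‖ ^ (-δ) + ‖u + v‖ ^ (-δ)) / δ *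
            ((1 + 2 * ‖u‖) * (1 + ‖v‖)⁻¹) := le_mul_of_one_le_right (by positivity) k1
      _ ≤ ((4 * ‖u‖ + 2) + (2 * (3 * ‖u‖) ^ δ + ‖u - v‖ ^ (-δ) + ‖u + v‖ ^ (-δ)) / δ *
            (1 + 2 * ‖u‖)) * (1 + ‖v‖)⁻¹ := by
          rw [← mul_assoc]
          gcongr
          linarith
      _ = _ := by simp only [A, B]; ring

lemma exists_linearIsometryEquiv_map_eq {v w : E d} (h : ‖v‖ = ‖w‖) :
    ∃ Q : E d ≃ₗᵢ[ℝ] E d, Q v = w :=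
  ⟨Submodule.reflection (Submodule.span ℝ {v - w})ᗮ, Submodule.reflection_sub h⟩

lemma logIntegral_add [NeZero d] {p : ℝ} (hp1 : 1 < p) (hp : (d : ℝ) < p) (hp' : p < d + 1)
    (a b u : E d) (hu : u ≠ 0) : logIntegral p (a + b) u = logIntegral p a u + logIntegral p b u := by
  rw [logIntegral, logIntegral, logIntegral, ← integral_add
    (integrable_logIntegral hp1 hp hp' a u hu) (integrable_logIntegral hp1 hp hp' b u hu)]
  congr 1; funext v
  simp only [dipole, inner_add_left]; ring

lemma logIntegral_smul_left (p : ℝ) (a u : E d) (t : ℝ) :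
    logIntegral p (t • a) u = t * logIntegral p a u := by
  rw [logIntegral, logIntegral, ← integral_const_mul]
  congr 1; funext v
  simp only [dipole, real_inner_smul_left]; ring

lemma logIntegral_self_neg [NeZero d] {p : ℝ} (hp1 : 1 < p) (hp : (d : ℝ) < p) (hp' : p < d + 1)
    {e : E d} (he : ‖e‖ = 1) : logIntegral p e e < 0 := by
  have he0 : e ≠ 0 := by rintro rfl; simp at he
  have hsq : ∀ v : E d, ‖e + v‖ ^ 2 - ‖e - v‖ ^ 2 = 4 * inner ℝ e v := fun v => by
    rw [norm_add_sq_real, norm_sub_sq_real]; ring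
  have hint := integrable_logIntegral hp1 hp hp' e e he0
  have hlog : ∀ v : E d, 0 < inner ℝ e v → Real.log (‖e - v‖ / ‖e + v‖) ≤ 0 := fun v hv => by
    refine Real.log_nonpos (by positivity) (div_le_one_of_le₀ ?_ (norm_nonneg _))
    refine le_of_sq_le_sq ?_ (norm_nonneg _)
    linarith [hsq v]
  have hlog' : ∀ v : E d, inner ℝ e v < 0 → 0 ≤ Real.log (‖e - v‖ / ‖e + v‖) := fun v hv => by
    have := hlog (-v) (by rw [inner_neg_right]; linarith)
    rw [sub_neg_eq_add, ← sub_eq_add_neg, ← inv_div, Real.log_inv] at this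
    linarith
  have hnn : ∀ v : E d, 0 ≤ -(Real.log (‖e - v‖ / ‖e + v‖) * dipole p e v) := fun v => by
    rw [neg_nonneg, dipole, ← mul_assoc]
    refine mul_nonpos_of_nonpos_of_nonneg ?_ (by positivity)
    rcases lt_trichotomy (inner ℝ e v) 0 with h | h | h
    · exact mul_nonpos_of_nonneg_of_nonpos (hlog' v h) h.le
    · rw [h, mul_zero]
    · exact mul_nonpos_of_nonpos_of_nonneg (hlog v h) h.le
  suffices h : 0 < ∫ v, -(Real.log (‖e - v‖ / ‖e + v‖) * dipole p e v) by
    rw [integral_neg] at h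
    rw [logIntegral]; linarith
  rw [integral_pos_iff_support_of_nonneg hnn hint.neg]
  have hU : IsOpen ({v : E d | 0 < inner ℝ e v} ∩ {e}ᶜ) :=
    (isOpen_lt continuous_const (by fun_prop)).inter isOpen_compl_singleton
  refine (hU.measure_pos volume ⟨(1 / 2 : ℝ) • e, ?_, ?_⟩).trans_le (measure_mono ?_)
  · simp [inner_smul_right, he]
  · intro h
    have : (1 / 2 : ℝ) • e = (1 : ℝ) • e := by rw [one_smul]; exact h
    have := smul_left_injective ℝ he0 this
    norm_num at this
  · rintro v ⟨hv, hve⟩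
    have hv' : 0 < inner ℝ e v := hv
    have hve' : 0 < ‖e - v‖ := norm_pos_iff.2 (sub_ne_zero.2 (Ne.symm hve))
    have hv0 : v ≠ 0 := by rintro rfl; simp at hv'
    have h2 : ‖e - v‖ < ‖e + v‖ := lt_of_pow_lt_pow_left₀ 2 (norm_nonneg _) (by linarith [hsq v])
    rw [Function.mem_support, neg_ne_zero]
    refine mul_ne_zero (Real.log_neg (div_pos hve' (hve'.trans h2)) ?_).ne (mul_pos hv' ?_).ne'
    · rwa [div_lt_one (hve'.trans h2)]
    · have := norm_pos_iff.2 hv0; positivity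

/-- Up to a negative constant, the logarithmic integral of a dipole is again a dipole. -/
lemma exists_logIntegral_eq [NeZero d] {p : ℝ} (hp1 : 1 < p) (hp : (d : ℝ) < p)
    (hp' : p < d + 1) :
    ∃ c : ℝ, 0 < c ∧ ∀ a u : E d, u ≠ 0 → logIntegral p a u = -c * dipole (p - d) a u := by
  set e₀ : E d := EuclideanSpace.single 0 1
  have he₀ : ‖e₀‖ = 1 := by simp [e₀]
  refine ⟨-logIntegral p e₀ e₀, by linarith [logIntegral_self_neg hp1 hp hp' he₀],
    fun a u hu => ?_⟩
  have hu0 : 0 < ‖u‖ := norm_pos_iff.2 hu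
  set v : E d := ‖u‖⁻¹ • u
  have hv : ‖v‖ = 1 := by simp [v, norm_smul, hu0.ne']
  have huv : u = ‖u‖ • v := by simp [v, smul_smul, hu0.ne']
  have hvv : logIntegral p v u = ‖u‖ ^ ((d : ℝ) + 1 - p) * logIntegral p e₀ e₀ := by
    obtain ⟨Q, hQ⟩ := exists_linearIsometryEquiv_map_eq (he₀.trans hv.symm)
    conv_lhs => rw [huv]
    rw [logIntegral_smul _ _ _ hu0, ← hQ, logIntegral_map]
  set b : E d := a - (inner ℝ v a : ℝ) • v
  have hb : inner ℝ u b = 0 := by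
    rw [huv, real_inner_smul_left, inner_sub_right, inner_smul_right, real_inner_self_eq_norm_sq,
      hv]
    ring
  have hbu : logIntegral p b u = 0 := by
    set Q := Submodule.reflection (Submodule.span ℝ {u})
    have h1 : Q u = u := Submodule.reflection_mem_subspace_eq_self (Submodule.mem_span_singleton_self u)
    have h2 : Q b = -b := Submodule.reflection_mem_subspace_orthogonalComplement_eq_neg
      (Submodule.mem_orthogonal_singleton_iff_inner_right.2 hb)
    have h3 := logIntegral_map p b u Q
    rw [h1, h2, ← neg_one_smul ℝ b, logIntegral_smul_left] at h3
    linarith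
  have hab : a = (inner ℝ v a : ℝ) • v + b := by simp [b]
  conv_lhs => rw [hab]
  rw [logIntegral_add hp1 hp hp' _ _ _ hu, hbu, logIntegral_smul_left, hvv, dipole,
    show (inner ℝ v a : ℝ) = ‖u‖⁻¹ * inner ℝ a u by
      rw [real_inner_smul_left, real_inner_comm],
    show (d : ℝ) + 1 - p = 1 + -(p - d) by ring, Real.rpow_add hu0, Real.rpow_one]
  field_simp
  ring

/-- The logarithmic potential of the increment of a dipole. -/
noncomputable def logPot (p : ℝ) (a e u : E d) : ℝ := ∫ v, Real.log ‖u - v‖ * dipoleIncr p a e v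

lemma integrable_log_mul_dipoleIncr [NeZero d] {p : ℝ} (hp1 : 1 < p) (hp : (d : ℝ) < p)
    (hp' : p < d + 1) {a e : E d} (ha : ‖a‖ = 1) (he : ‖e‖ = 1) (u : E d) :
    Integrable fun v => Real.log ‖u - v‖ * dipoleIncr p a e v := by
  obtain ⟨δ, hδ0, hδ1⟩ : ∃ δ : ℝ, 0 < δ ∧ δ < min (d + 1 - p) (p - d) :=
    exists_between (lt_min (by linarith) (by linarith))
  rw [lt_min_iff] at hδ1
  have hw := ((boundedPotential_incrWeight (d := d) (β := p - 1) (p := δ) (r := p - δ)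
    (by linarith) hδ0 (by linarith) (by linarith) e).const_mul
    (c := ENNReal.ofReal (5 ^ δ)) ENNReal.ofReal_ne_top).const_mul
    (c := ENNReal.ofReal ((0 + 1 + p * 2 ^ (p + 2)) * 2 ^ p)) ENNReal.ofReal_ne_top
  refine integrable_log_mul hw hδ0 le_rfl (by fun_prop) (fun v => ?_) u
  rw [ENNReal.ofReal_mul (abs_nonneg _)]
  refine (mul_le_mul_left (ofReal_abs_dipoleIncr_le hp1 ha he v) _).trans ?_
  rw [mul_assoc]
  exact mul_le_mul_right (incrWeight_mul_le hδ0.le he v) _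

lemma logPot_eq [NeZero d] {p : ℝ} (hp1 : 1 < p) (hp : (d : ℝ) < p) (hp' : p < d + 1)
    {a e : E d} (ha : ‖a‖ = 1) (he : ‖e‖ = 1) {u : E d} (hu : u ≠ 0) (hue : u ≠ e) :
    logPot p a e u = (logIntegral p a u - logIntegral p a (u - e)) / 2 := by
  obtain ⟨κ, hκ0, hκ1⟩ : ∃ κ, d + 1 - p < κ ∧ κ < 1 := exists_between (by linarith)
  obtain ⟨δ, hδ0, hδ1⟩ : ∃ δ : ℝ, 0 < δ ∧ δ < min (κ - (d + 1 - p)) (d + 1 - p) :=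
    exists_between (lt_min (by linarith) (by linarith))
  rw [lt_min_iff] at hδ1
  have hκ : 0 ≤ κ := by linarith
  have iF : ∀ b : E d, Integrable fun v : E d =>
      (Real.log ‖b - v‖ * dipole p a v) * (1 + ‖v‖) ^ (-κ) := by
    intro b
    have hw := boundedPotential_rpow_mul_one_add (d := d) (β := p - 1) (p := δ) (κ := κ - δ)
      (by linarith) hδ0 (by linarith) (by linarith)
    have := integrable_log_mul hw hδ0 le_rfl (F := fun v => dipole p a v * (1 + ‖v‖) ^ (-κ))
      (by fun_prop) (fun v => ENNReal.ofReal_le_ofReal ?_) b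
    · simpa only [mul_assoc] using this
    · have h1 : (0 : ℝ) < 1 + ‖v‖ := by positivity
      rw [abs_mul, abs_of_nonneg (Real.rpow_nonneg h1.le _), mul_assoc, ← Real.rpow_add h1,
        show -κ + δ = -(κ - δ) by ring]
      exact mul_le_mul_of_nonneg_right (abs_dipole_le (by linarith) ha v) (by positivity)
  have iC : ∀ (b : E d) {M : ℝ}, 0 < M → Integrable fun v : E d =>
      coneCutoff M v * (Real.log ‖b - v‖ * dipole p a v) := fun b M hM =>
    integrable_coneCutoff_mul hκ (iF b) (by fun_prop) hM
  have l1 : ∀ b : E d, b ≠ 0 → Tendsto (fun M : ℝ => ∫ v : E d,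
      coneCutoff M v * (Real.log ‖b - v‖ * dipole p a v)) atTop (𝓝 (logIntegral p a b / 2)) := by
    intro b hb
    have h1 := (tendsto_integral_coneCutoff_mul
      (integrable_logIntegral hp1 hp hp' a b hb)).div_const 2
    refine h1.congr' ?_
    filter_upwards [eventually_gt_atTop 0] with M hM
    have e1 : ∫ v : E d, coneCutoff M v * (Real.log ‖b - v‖ * dipole p a v) =
        ∫ v : E d, -(coneCutoff M v * (Real.log ‖b + v‖ * dipole p a v)) := by
      rw [← integral_neg_eq_self]
      congr 1; funext v
      rw [coneCutoff_neg, dipole_neg, sub_neg_eq_add]; ring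
    have i2 : Integrable fun v : E d => -(coneCutoff M v * (Real.log ‖b + v‖ * dipole p a v)) := by
      refine ((iC b hM).comp_neg).congr (ae_of_all _ fun v => ?_)
      simp only [coneCutoff_neg, dipole_neg, sub_neg_eq_add]; ring
    have e2 : ∫ v : E d, coneCutoff M v * (Real.log (‖b - v‖ / ‖b + v‖) * dipole p a v) =
        (∫ v : E d, coneCutoff M v * (Real.log ‖b - v‖ * dipole p a v)) +
        ∫ v : E d, -(coneCutoff M v * (Real.log ‖b + v‖ * dipole p a v)) := by
      rw [← integral_add (iC b hM) i2]
      refine integral_congr_ae ?_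
      have hne : ∀ c : E d, ∀ᵐ v : E d, v ≠ c := fun c => by
        simp [ae_iff]
      filter_upwards [hne b, hne (-b)] with v h1 h2
      have h3 : ‖b - v‖ ≠ 0 := norm_ne_zero_iff.2 (sub_ne_zero.2 (Ne.symm h1))
      have h4 : ‖b + v‖ ≠ 0 := norm_ne_zero_iff.2 fun h => h2 (eq_neg_of_add_eq_zero_right h)
      rw [Real.log_div h3 h4]; ring
    rw [e2, ← e1]; ring
  have l2 := tendsto_integral_coneCutoff_shift hκ hκ1 (iF (u - e)) he
  have l3 := tendsto_integral_coneCutoff_mul (integrable_log_mul_dipoleIncr hp1 hp hp' ha he u)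
  have hlim := ((l1 u hu).sub (l1 (u - e) (sub_ne_zero.2 hue))).add l2
  rw [add_zero, ← sub_div] at hlim
  refine tendsto_nhds_unique l3 (hlim.congr' ?_)
  filter_upwards [eventually_gt_atTop 0] with M hM
  have j1 : Integrable fun v : E d =>
      coneCutoff M v * (Real.log ‖u - v‖ * dipole p a (v - e)) := by
    refine ((iC u hM).sub ((integrable_log_mul_dipoleIncr hp1 hp hp' ha he u).bdd_mul
      (continuous_coneCutoff M).aestronglyMeasurable (ae_of_all _ fun v => ?_) (c := 1))).congr
      (ae_of_all _ fun v => ?_)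
    · rw [Real.norm_of_nonneg (coneCutoff_nonneg M v)]
      exact coneCutoff_le_one hM.le v
    · simp only [Pi.sub_apply, dipoleIncr]; ring
  have j2 : Integrable fun v : E d =>
      coneCutoff M (v + e) * (Real.log ‖u - e - v‖ * dipole p a v) := by
    refine (j1.comp_add_right e).congr (ae_of_all _ fun v => ?_)
    simp only [add_sub_cancel_right]
    rw [show u - (v + e) = u - e - v by abel]
  have e3 : ∫ v : E d, coneCutoff M v * (Real.log ‖u - v‖ * dipole p a (v - e)) =
      ∫ v : E d, coneCutoff M (v + e) * (Real.log ‖u - e - v‖ * dipole p a v) := by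
    rw [← integral_add_right_eq_self _ e]
    congr 1; funext v
    rw [add_sub_cancel_right, show u - (v + e) = u - e - v by abel]
  have e4 : ∫ v : E d, (coneCutoff M v - coneCutoff M (v + e)) *
      (Real.log ‖u - e - v‖ * dipole p a v) =
      (∫ v : E d, coneCutoff M v * (Real.log ‖u - e - v‖ * dipole p a v)) -
      ∫ v : E d, coneCutoff M (v + e) * (Real.log ‖u - e - v‖ * dipole p a v) := by
    rw [← integral_sub (iC (u - e) hM) j2]
    congr 1; funext v; ring
  have e5 : ∫ v : E d, coneCutoff M v * (Real.log ‖u - v‖ * dipoleIncr p a e v) =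
      (∫ v : E d, coneCutoff M v * (Real.log ‖u - v‖ * dipole p a v)) -
      ∫ v : E d, coneCutoff M v * (Real.log ‖u - v‖ * dipole p a (v - e)) := by
    rw [← integral_sub (iC u hM) j1]
    congr 1; funext v; simp only [dipoleIncr]; ring
  rw [e4, e5, e3]; ring

/-! ### Concavity of the profile of a dipole -/

/-- The profile `t ↦ t (t² + r²)^(-b)` of a dipole along a line. -/
noncomputable def profile (r b t : ℝ) : ℝ := t * (t ^ 2 + r ^ 2) ^ (-b)

lemma profile_neg (r b t : ℝ) : profile r b (-t) = -profile r b t := by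
  simp [profile]

lemma profile_mono {r b s t : ℝ} (hb0 : 0 ≤ b) (hb : b ≤ 1 / 2) (hs : 0 < s) (hst : s ≤ t) :
    profile r b s ≤ profile r b t := by
  have e : ∀ x : ℝ, 0 < x → profile r b x = x ^ (1 - 2 * b) * (x ^ 2 / (x ^ 2 + r ^ 2)) ^ b := by
    intro x hx
    have hS : 0 < x ^ 2 + r ^ 2 := by positivity
    have h2 : (x ^ 2) ^ b = x ^ (2 * b) := by
      rw [← Real.rpow_natCast, ← Real.rpow_mul hx.le]; norm_num
    rw [Real.div_rpow (by positivity) hS.le, h2, profile, Real.rpow_neg hS.le, Real.rpow_sub hx,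
      Real.rpow_one]
    have h3 : x ^ (2 * b) ≠ 0 := (Real.rpow_pos_of_pos hx _).ne'
    have h4 : (x ^ 2 + r ^ 2) ^ b ≠ 0 := (Real.rpow_pos_of_pos hS _).ne'
    field_simp
  rw [e s hs, e t (hs.trans_le hst)]
  have h1 : s ^ 2 / (s ^ 2 + r ^ 2) ≤ t ^ 2 / (t ^ 2 + r ^ 2) := by
    have ht := hs.trans_le hst
    have : s ^ 2 ≤ t ^ 2 := by gcongr
    rw [div_le_div_iff₀ (by positivity) (by positivity)]
    nlinarith [sq_nonneg r]
  refine mul_le_mul (Real.rpow_le_rpow hs.le hst (by linarith))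
    (Real.rpow_le_rpow (by positivity) h1 hb0) (Real.rpow_nonneg (by positivity) _)
    (Real.rpow_nonneg (hs.trans_le hst).le _)

lemma strictConcaveOn_profile {r b : ℝ} (hb0 : 0 < b) (hb : b < 1 / 2) :
    StrictConcaveOn ℝ (Ici 0) (profile r b) := by
  rcases eq_or_ne r 0 with rfl | hr
  · refine (Real.strictConcaveOn_rpow (p := 1 - 2 * b) (by linarith) (by linarith)).congr ?_
    intro x (hx : 0 ≤ x)
    rcases hx.eq_or_lt with rfl | hx
    · simp [profile, Real.zero_rpow (by linarith : 1 - 2 * b ≠ 0)]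
    · simp only [profile]
      rw [zero_pow two_ne_zero, add_zero, ← Real.rpow_natCast, ← Real.rpow_mul hx.le,
        ← Real.rpow_one_add' hx.le]
      · congr 1; push_cast; ring
      · push_cast; linarith
  · have hS : ∀ x : ℝ, 0 < x ^ 2 + r ^ 2 := fun x => by positivity
    have hd : ∀ x : ℝ, HasDerivAt (profile r b) ((1 - 2 * b) * (x ^ 2 + r ^ 2) ^ (-b) +
        2 * b * r ^ 2 * (x ^ 2 + r ^ 2) ^ (-b - 1)) x := by
      intro x
      have h1 : HasDerivAt (fun x : ℝ => x ^ 2 + r ^ 2) (2 * x) x := by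
        simpa using (hasDerivAt_pow 2 x).add_const (r ^ 2)
      have h2 := (hasDerivAt_id x).mul (h1.rpow_const (p := -b) (Or.inl (hS x).ne'))
      refine h2.congr_deriv ?_
      rw [show (x ^ 2 + r ^ 2) ^ (-b) = (x ^ 2 + r ^ 2) ^ (-b - 1) * (x ^ 2 + r ^ 2) by
        rw [← Real.rpow_add_one (hS x).ne']; congr 1; ring]
      simp only [id]
      ring
    refine StrictAntiOn.strictConcaveOn_of_deriv (convex_Ici 0)
      (fun x _ => (hd x).continuousAt.continuousWithinAt) ?_
    rw [interior_Ici]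
    intro x hx y hy hxy
    rw [(hd x).deriv, (hd y).deriv]
    have hx' : (0 : ℝ) < x := hx
    have hlt : x ^ 2 + r ^ 2 < y ^ 2 + r ^ 2 := by gcongr
    have h1 := Real.rpow_lt_rpow_of_neg (hS x) hlt (by linarith : -b < 0)
    have h2 := Real.rpow_lt_rpow_of_neg (hS x) hlt (by linarith : -b - 1 < 0)
    have h3 : 0 < 1 - 2 * b := by linarith
    have h4 : 0 < 2 * b * r ^ 2 := by positivity
    exact add_lt_add (mul_lt_mul_of_pos_left h1 h3) (mul_lt_mul_of_pos_left h2 h4)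

lemma profile_second_difference {r b t : ℝ} (hb0 : 0 < b) (hb : b < 1 / 2) (ht : 0 < t) :
    profile r b (t + 1) + profile r b (t - 1) < 2 * profile r b t := by
  obtain ⟨-, hc⟩ := strictConcaveOn_profile (r := r) hb0 hb
  rcases le_or_gt 1 t with h1 | h1
  · have := hc (show t + 1 ∈ Ici 0 from (by linarith : 0 ≤ t + 1))
      (show t - 1 ∈ Ici 0 from (by linarith : 0 ≤ t - 1)) (by intro h; linarith)
      (show (0 : ℝ) < 1 / 2 by norm_num) (show (0 : ℝ) < 1 / 2 by norm_num) (by norm_num)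
    simp only [smul_eq_mul] at this
    rw [show 1 / 2 * (t + 1) + 1 / 2 * (t - 1) = t by ring] at this
    linarith
  · have hz : profile r b 0 = 0 := by simp [profile]
    have hs : ∀ x : ℝ, 0 < x → x < t + 1 → x / (t + 1) * profile r b (t + 1) < profile r b x := by
      intro x hx hxt
      have := hc (show t + 1 ∈ Ici 0 from (by linarith : 0 ≤ t + 1))
        self_mem_Ici (by linarith)
        (show 0 < x / (t + 1) by positivity)
        (show 0 < 1 - x / (t + 1) by rw [sub_pos, div_lt_one (by linarith)]; exact hxt) (by ring)
      simp only [smul_eq_mul, hz, mul_zero, add_zero] at this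
      rwa [div_mul_cancel₀ _ (by linarith : t + 1 ≠ 0)] at this
    have k1 := hs t ht (by linarith)
    have k2 := hs (1 - t) (by linarith) (by linarith)
    have k3 : profile r b (t - 1) = -profile r b (1 - t) := by rw [← profile_neg]; congr 1; ring
    have k4 : t / (t + 1) * profile r b (t + 1) + t / (t + 1) * profile r b (t + 1) +
        (1 - t) / (t + 1) * profile r b (t + 1) = profile r b (t + 1) := by
      have : t + 1 ≠ 0 := by linarith
      field_simp
      ring
    linarith

lemma profile_sq_lt {r b t : ℝ} (hb0 : 0 < b) (hb : b < 1 / 2) (ht : 0 < t) :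
    (profile r b (t + 1) - profile r b t) ^ 2 < (profile r b t - profile r b (t - 1)) ^ 2 := by
  have h1 := profile_second_difference (r := r) hb0 hb ht
  have h2 := profile_mono (r := r) hb0.le hb.le ht (by linarith : t ≤ t + 1)
  rw [sq_lt_sq₀ (by linarith) (by linarith)]
  linarith

lemma dipole_line {q : ℝ} {e u : E d} (he : ‖e‖ = 1) (s : ℝ) :
    dipole q e (u + s • e) =
      profile (√(‖u‖ ^ 2 - inner ℝ e u ^ 2)) (q / 2) (inner ℝ e u + s) := by
  have h0 : 0 ≤ ‖u‖ ^ 2 - inner ℝ e u ^ 2 := by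
    have := abs_inner_le_norm_of_unit he u
    rw [sub_nonneg, ← sq_abs (inner ℝ e u)]
    gcongr
  rw [profile, Real.sq_sqrt h0, dipole, inner_add_right, inner_smul_right,
    real_inner_self_eq_norm_sq, he]
  have h1 : (inner ℝ e u + s) ^ 2 + (‖u‖ ^ 2 - inner ℝ e u ^ 2) = ‖u + s • e‖ ^ 2 := by
    rw [norm_add_sq_real, inner_smul_right, norm_smul, he, real_inner_comm, Real.norm_eq_abs,
      mul_one, sq_abs]
    ring
  have h2 : (‖u + s • e‖ ^ 2) ^ (-(q / 2)) = ‖u + s • e‖ ^ (-q) := by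
    rw [← Real.rpow_natCast, ← Real.rpow_mul (norm_nonneg _)]
    congr 1; push_cast; ring
  rw [h1, h2, one_pow, mul_one]

lemma dipole_mul_sq_sub_pos {p q : ℝ} (hq0 : 0 < q) (hq1 : q < 1) {e u : E d} (he : ‖e‖ = 1)
    (hu : inner ℝ e u ≠ 0) :
    0 < dipole p e u * (dipoleIncr q e e u ^ 2 - dipoleIncr q e e (u + e) ^ 2) := by
  wlog hpos : 0 < inner ℝ e u generalizing u
  · have := this (u := -u) (by simpa using hu)
      (by rw [inner_neg_right]; exact neg_pos.2 (lt_of_le_of_ne (not_lt.1 hpos) hu))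
    have e1 : dipoleIncr q e e (-u) = dipoleIncr q e e (u + e) := by
      rw [dipoleIncr, dipoleIncr, add_sub_cancel_right, ← neg_add', dipole_neg, dipole_neg]; ring
    have e2 : dipoleIncr q e e (-u + e) = dipoleIncr q e e u := by
      have h : dipole q e (e - u) = -dipole q e (u - e) := by rw [← dipole_neg, neg_sub]
      rw [dipoleIncr, dipoleIncr, add_sub_cancel_right, neg_add_eq_sub, h, dipole_neg]
      ring
    rw [e1, e2, dipole_neg] at this
    linarith
  have hu0 : u ≠ 0 := by rintro rfl; simp at hu
  have h0 := dipole_line (q := q) (u := u) he 0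
  have h1 := dipole_line (q := q) (u := u) he 1
  have h2 := dipole_line (q := q) (u := u) he (-1)
  rw [zero_smul, add_zero, add_zero] at h0
  rw [one_smul] at h1
  rw [neg_one_smul, ← sub_eq_add_neg, ← sub_eq_add_neg] at h2
  rw [dipoleIncr, dipoleIncr, add_sub_cancel_right, h0, h1, h2]
  refine mul_pos (mul_pos hpos (Real.rpow_pos_of_pos (norm_pos_iff.2 hu0) _)) (sub_pos.2 ?_)
  exact profile_sq_lt (by linarith) (by linarith) hpos

lemma exists_abs_dipoleIncr_le {q : ℝ} (hq0 : 0 < q) (hq1 : q < 1) {a e : E d} (ha : ‖a‖ = 1)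
    (he : ‖e‖ = 1) : ∃ C, ∀ u, |dipoleIncr q a e u| ≤ C := by
  refine ⟨max 6 (0 + 1 + q * 2 ^ (q + 2)), fun u => ?_⟩
  rcases le_or_gt 2 ‖u‖ with hu | hu
  · have := abs_dipole_increment_le (p := q) (D := 0) (c := 1) (c' := 1) hq0.le ha he hu (by simp)
      (by simp)
    rw [one_mul, one_mul] at this
    refine this.trans (le_trans ?_ (le_max_right _ _))
    refine mul_le_of_le_one_right (by positivity) ?_
    exact Real.rpow_le_one_of_one_le_of_nonpos (by linarith) (by linarith)
  · refine le_trans ?_ (le_max_left _ _)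
    have key : ∀ v : E d, ‖v‖ ≤ 3 → |dipole q a v| ≤ 3 := fun v hv => by
      refine (abs_dipole_le hq1.ne ha v).trans ?_
      calc ‖v‖ ^ (-(q - 1)) ≤ 3 ^ (-(q - 1)) :=
            Real.rpow_le_rpow (norm_nonneg _) hv (by linarith)
        _ ≤ 3 ^ (1 : ℝ) := Real.rpow_le_rpow_of_exponent_le (by norm_num) (by linarith)
        _ = 3 := Real.rpow_one _
    refine (abs_sub _ _).trans ?_
    have h1 := key u (by linarith)
    have h2 := key (u - e) (by have := norm_sub_le u e; linarith)
    linarith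

/-- The constant governing moments of order three is positive. -/
lemma integral_dipoleIncr_mul_sq_pos [NeZero d] {p q : ℝ} (hp1 : 1 < p) (hp : (d : ℝ) < p)
    (hp' : p < d + 1) (hq0 : 0 < q) (hq1 : q < 1) {e : E d} (he : ‖e‖ = 1) :
    0 < ∫ u, dipoleIncr p e e u * dipoleIncr q e e u ^ 2 := by
  obtain ⟨κ, hκ0, hκ1⟩ : ∃ κ, d + 1 - p < κ ∧ κ < 1 := exists_between (by linarith)
  have hκ : 0 ≤ κ := by linarith
  obtain ⟨C, hC⟩ := exists_abs_dipoleIncr_le hq0 hq1 he he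
  have hC2 : ∀ u : E d, ‖dipoleIncr q e e u ^ 2‖ ≤ C ^ 2 := fun u => by
    rw [norm_pow, Real.norm_eq_abs]; gcongr; exact hC u
  have hms : AEStronglyMeasurable (fun u : E d => dipoleIncr q e e u ^ 2) :=
    ((measurable_dipoleIncr q e e).pow_const 2).aestronglyMeasurable
  have hms' : AEStronglyMeasurable (fun u : E d => dipoleIncr q e e (u + e) ^ 2) :=
    (((measurable_dipoleIncr q e e).comp (measurable_id.add_const e)).pow_const
      2).aestronglyMeasurable
  have hdip := integrable_dipole_mul_one_add (d := d) hp1 hp' hκ0 he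
  have iF : Integrable fun u : E d =>
      (dipole p e u * dipoleIncr q e e (u + e) ^ 2) * (1 + ‖u‖) ^ (-κ) := by
    refine (hdip.bdd_mul (g := fun u => dipole p e u * (1 + ‖u‖) ^ (-κ))
      (f := fun u => dipoleIncr q e e (u + e) ^ 2) hms'
      (ae_of_all _ fun u => hC2 (u + e))).congr (ae_of_all _ fun u => ?_)
    ring
  have iG : Integrable fun u : E d => (dipole p e u *
      (dipoleIncr q e e u ^ 2 - dipoleIncr q e e (u + e) ^ 2)) * (1 + ‖u‖) ^ (-κ) := by
    refine ((hdip.bdd_mul (g := fun u => dipole p e u * (1 + ‖u‖) ^ (-κ))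
      (f := fun u => dipoleIncr q e e u ^ 2) hms (ae_of_all _ fun u => hC2 u)).sub
      iF).congr (ae_of_all _ fun u => ?_)
    simp only [Pi.sub_apply]; ring
  have iK : Integrable fun u : E d => dipoleIncr p e e u * dipoleIncr q e e u ^ 2 := by
    refine ((integrable_dipoleIncr hp1 hp hp' he he).bdd_mul
      (f := fun u => dipoleIncr q e e u ^ 2) hms
      (ae_of_all _ fun u => hC2 u)).congr (ae_of_all _ fun u => ?_)
    ring
  have l1 := tendsto_integral_coneCutoff_shift hκ hκ1 iF he
  have l2 := tendsto_integral_coneCutoff_mul iK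
  have l3 := l2.sub l1
  rw [sub_zero] at l3
  have hnn : ∀ u : E d, 0 ≤ dipole p e u *
      (dipoleIncr q e e u ^ 2 - dipoleIncr q e e (u + e) ^ 2) := fun u => by
    rcases eq_or_ne (inner ℝ e u) 0 with h | h
    · simp [dipole, h]
    · exact (dipole_mul_sq_sub_pos hq0 hq1 he h).le
  have iGM : ∀ {M : ℝ}, 0 < M → Integrable fun u : E d => coneCutoff M u * (dipole p e u *
      (dipoleIncr q e e u ^ 2 - dipoleIncr q e e (u + e) ^ 2)) := fun hM =>
    integrable_coneCutoff_mul hκ iG (by fun_prop) hM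
  set c := ∫ u : E d, coneCutoff 1 u * (dipole p e u *
      (dipoleIncr q e e u ^ 2 - dipoleIncr q e e (u + e) ^ 2))
  have hc : 0 < c := by
    rw [integral_pos_iff_support_of_nonneg
      (fun u => mul_nonneg (coneCutoff_nonneg 1 u) (hnn u)) (iGM one_pos)]
    have hU : IsOpen ({u : E d | 0 < inner ℝ e u} ∩ Metric.ball 0 1) :=
      (isOpen_lt continuous_const (by fun_prop)).inter Metric.isOpen_ball
    refine (hU.measure_pos volume ⟨(1 / 2 : ℝ) • e, ?_, ?_⟩).trans_le (measure_mono ?_)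
    · simp [inner_smul_right, he]
    · simp only [Metric.mem_ball, dist_zero_right, norm_smul, he]; norm_num
    · rintro u ⟨hu, hu1⟩
      have hu' : 0 < inner ℝ e u := hu
      rw [Metric.mem_ball, dist_zero_right] at hu1
      refine (mul_pos ?_ (dipole_mul_sq_sub_pos hq0 hq1 he hu'.ne')).ne'
      exact lt_max_of_lt_left (by rw [div_one]; linarith)
  refine hc.trans_le (ge_of_tendsto l3 ?_)
  filter_upwards [eventually_ge_atTop 1] with M hM
  have hM0 : 0 < M := by linarith
  have j1 := integrable_coneCutoff_mul hκ iF (by fun_prop) hM0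
  have j0 : Integrable fun u : E d =>
      coneCutoff M u * (dipoleIncr p e e u * dipoleIncr q e e u ^ 2) :=
    iK.bdd_mul (continuous_coneCutoff M).aestronglyMeasurable (c := 1) (ae_of_all _ fun u => by
      rw [Real.norm_of_nonneg (coneCutoff_nonneg M u)]; exact coneCutoff_le_one hM0.le u)
  have j2 : Integrable fun u : E d =>
      coneCutoff M u * (dipole p e (u - e) * dipoleIncr q e e u ^ 2) := by
    refine (((iGM hM0).add j1).sub j0).congr (ae_of_all _ fun u => ?_)
    simp only [Pi.sub_apply, Pi.add_apply, dipoleIncr]; ring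
  have j3 : Integrable fun u : E d =>
      coneCutoff M (u + e) * (dipole p e u * dipoleIncr q e e (u + e) ^ 2) := by
    simpa using j2.comp_add_right e
  have e1 : ∫ u : E d, coneCutoff M u * (dipole p e (u - e) * dipoleIncr q e e u ^ 2) =
      ∫ u : E d, coneCutoff M (u + e) * (dipole p e u * dipoleIncr q e e (u + e) ^ 2) := by
    rw [← integral_add_right_eq_self _ e]; simp
  have e2 : (∫ u : E d, coneCutoff M u * (dipoleIncr p e e u * dipoleIncr q e e u ^ 2)) -
      ∫ u : E d, (coneCutoff M u - coneCutoff M (u + e)) *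
        (dipole p e u * dipoleIncr q e e (u + e) ^ 2) = ∫ u : E d, coneCutoff M u * (dipole p e u *
      (dipoleIncr q e e u ^ 2 - dipoleIncr q e e (u + e) ^ 2)) := by
    simp only [sub_mul (coneCutoff M _)]
    have j12 : Integrable fun u : E d =>
        coneCutoff M u * (dipole p e u * dipoleIncr q e e (u + e) ^ 2) -
          coneCutoff M u * (dipole p e (u - e) * dipoleIncr q e e u ^ 2) := j1.sub j2
    rw [integral_sub j1 j3, ← e1, ← integral_sub j1 j2, ← integral_sub j0 j12]
    congr 1; funext u
    simp only [dipoleIncr]; ring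
  rw [e2]
  refine integral_mono (iGM one_pos) (iGM hM0) fun u => ?_
  refine mul_le_mul_of_nonneg_right ?_ (hnn u)
  refine max_le_max ?_ le_rfl
  have : ‖u‖ / M ≤ ‖u‖ / 1 := div_le_div_of_nonneg_left (norm_nonneg _) one_pos hM
  linarith

lemma integral_dipoleIncr_mul_logPot_sq_pos [NeZero d] {p : ℝ} (hp1 : 1 < p) (hp : (d : ℝ) < p)
    (hp' : p < d + 1) {e : E d} (he : ‖e‖ = 1) :
    0 < ∫ u, dipoleIncr p e e u * logPot p e e u ^ 2 := by
  obtain ⟨c, hc, h⟩ := exists_logIntegral_eq (d := d) hp1 hp hp'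
  have key : ∫ u, dipoleIncr p e e u * logPot p e e u ^ 2 =
      ∫ u, (c / 2) ^ 2 * (dipoleIncr p e e u * dipoleIncr (p - d) e e u ^ 2) := by
    refine integral_congr_ae ?_
    have hne : ∀ c : E d, ∀ᵐ v : E d, v ≠ c := fun c => by simp [ae_iff]
    filter_upwards [hne 0, hne e] with u h0 h1
    rw [logPot_eq hp1 hp hp' he he h0 h1, h e u h0, h e (u - e) (sub_ne_zero.2 h1)]
    simp only [dipoleIncr]; ring
  rw [key, integral_const_mul]
  exact mul_pos (by positivity)
    (integral_dipoleIncr_mul_sq_pos hp1 hp hp' (by linarith) (by linarith) he)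

/-! ### Positivity of the logarithmic energy -/

lemma integrableOn_frullani_exp {a : ℝ} (ha : 0 < a) :
    IntegrableOn (fun t : ℝ => t⁻¹ * (Real.exp (-(a * t)) - Real.exp (-t))) (Ioi 0) := by
  set m := min a 1
  have hm : 0 < m := lt_min ha one_pos
  refine Integrable.mono' ((exp_neg_integrableOn_Ioi 0 hm).const_mul |a - 1|)
    (by fun_prop) ((ae_restrict_iff' measurableSet_Ioi).2 (ae_of_all _ fun t ht => ?_))
  have ht : 0 < t := ht
  have key : ∀ x y : ℝ, x ≤ y →
      |Real.exp (-x) - Real.exp (-y)| ≤ (y - x) * Real.exp (-x) := fun x y hxy => by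
    rw [abs_of_nonneg (sub_nonneg.2 (Real.exp_le_exp.2 (by linarith)))]
    have h1 := Real.add_one_le_exp (-(y - x))
    have h2 : Real.exp (-y) = Real.exp (-(y - x)) * Real.exp (-x) := by
      rw [← Real.exp_add]; congr 1; ring
    rw [h2]
    nlinarith [Real.exp_pos (-x)]
  have : |Real.exp (-(a * t)) - Real.exp (-t)| ≤ t * (|a - 1| * Real.exp (-m * t)) := by
    rcases le_total a 1 with h | h
    · refine (key _ _ (by nlinarith)).trans_eq ?_
      rw [abs_of_nonpos (by linarith), show m = a from min_eq_left h, neg_mul]; ring_nf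
    · rw [abs_sub_comm]
      refine (key _ _ (by nlinarith)).trans_eq ?_
      rw [abs_of_nonneg (by linarith), show m = 1 from min_eq_right h, neg_one_mul]; ring
  rw [Real.norm_eq_abs, abs_mul, abs_of_pos (inv_pos.2 ht), inv_mul_le_iff₀ ht]
  exact this

lemma integral_frullani_exp {a : ℝ} (ha : 0 < a) :
    ∫ t in Ioi (0 : ℝ), t⁻¹ * (Real.exp (-(a * t)) - Real.exp (-t)) = -Real.log a := by
  have hc : Continuous fun t : ℝ => Real.exp (-t) := by fun_prop
  have := Frullani.integral_Ioi_eq (f := fun t : ℝ => Real.exp (-t)) (L := 1) (R := 0)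
    (hc.locallyIntegrable.locallyIntegrableOn _) ha one_pos
    (by simpa using (hc.tendsto 0).mono_left nhdsWithin_le_nhds)
    (Real.tendsto_exp_atBot.comp tendsto_neg_atTop_atBot)
    (by simpa using integrableOn_frullani_exp ha)
  simpa using this

lemma integral_abs_frullani_exp {a : ℝ} (ha : 0 < a) :
    ∫ t in Ioi (0 : ℝ), |t⁻¹ * (Real.exp (-(a * t)) - Real.exp (-t))| = |Real.log a| := by
  rcases le_total a 1 with h | h
  · rw [abs_of_nonpos (Real.log_nonpos ha.le h), ← integral_frullani_exp ha]
    refine setIntegral_congr_fun measurableSet_Ioi fun t ht => abs_of_nonneg ?_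
    have ht : 0 < t := ht
    exact mul_nonneg (inv_pos.2 ht).le (sub_nonneg.2 (Real.exp_le_exp.2 (by nlinarith)))
  · rw [abs_of_nonneg (Real.log_nonneg h), ← neg_neg (Real.log a), ← integral_frullani_exp ha,
      ← integral_neg]
    refine setIntegral_congr_fun measurableSet_Ioi fun t ht => abs_of_nonpos ?_
    have ht : 0 < t := ht
    exact mul_nonpos_of_nonneg_of_nonpos (inv_pos.2 ht).le
      (sub_nonpos.2 (Real.exp_le_exp.2 (by nlinarith)))

/-- The Gaussian average of `K` around `w`. -/
noncomputable def gaussAvg (K : E d → ℝ) (t : ℝ) (w : E d) : ℝ :=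
  ∫ u, Real.exp (-(2 * t) * ‖w - u‖ ^ 2) * K u

lemma continuous_gaussAvg {K : E d → ℝ} (hK : Integrable K) {t : ℝ} (ht : 0 < t) :
    Continuous (gaussAvg K t) := by
  refine continuous_of_dominated (bound := fun u => ‖K u‖) (fun w => ?_) (fun w => ?_) hK.norm
    (ae_of_all _ fun u => by fun_prop)
  · exact (by fun_prop : Continuous fun u : E d =>
      Real.exp (-(2 * t) * ‖w - u‖ ^ 2)).aestronglyMeasurable.mul hK.1
  · refine ae_of_all _ fun u => ?_
    rw [norm_mul, Real.norm_eq_abs, Real.abs_exp]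
    exact mul_le_of_le_one_left (norm_nonneg _) (Real.exp_le_one_iff.2 (by
      have : 0 ≤ ‖w - u‖ ^ 2 := by positivity
      nlinarith))

lemma exp_mul_exp_gauss (t : ℝ) (u v w : E d) :
    Real.exp (-(2 * t) * ‖w - u‖ ^ 2) * Real.exp (-(2 * t) * ‖w - v‖ ^ 2) =
      Real.exp (-(t * ‖u - v‖ ^ 2)) * Real.exp (-(4 * t) * ‖w - (1 / 2 : ℝ) • (u + v)‖ ^ 2) := by
  rw [← Real.exp_add, ← Real.exp_add]
  congr 1
  have h := parallelogram_law_with_norm ℝ (w - u) (w - v)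
  have h1 : w - u + (w - v) = (2 : ℝ) • (w - (1 / 2 : ℝ) • (u + v)) := by
    rw [smul_sub, smul_smul]; norm_num; rw [two_smul]; abel
  have h2 : w - u - (w - v) = -(u - v) := by abel
  rw [h1, h2, norm_neg, norm_smul, Real.norm_ofNat] at h
  linear_combination t * h

/-- The Gaussian energy of `K`. -/
noncomputable def gaussEnergy (K : E d → ℝ) (t : ℝ) : ℝ :=
  ∫ z : E d × E d, Real.exp (-(t * ‖z.1 - z.2‖ ^ 2)) * (K z.1 * K z.2)

lemma integrable_gaussEnergy {K : E d → ℝ} (hK : Integrable K) {t : ℝ} (ht : 0 ≤ t) :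
    Integrable fun z : E d × E d => Real.exp (-(t * ‖z.1 - z.2‖ ^ 2)) * (K z.1 * K z.2) :=
  (hK.mul_prod hK).bdd_mul (c := 1) (by fun_prop) (ae_of_all _ fun z => by
    rw [Real.norm_eq_abs, Real.abs_exp]
    exact Real.exp_le_one_iff.2 (neg_nonpos.2 (by positivity)))

lemma gaussEnergy_eq {K : E d → ℝ} (hK : Integrable K) {t : ℝ} (ht : 0 < t) :
    Integrable (fun w => gaussAvg K t w ^ 2) ∧
    (∫ w : E d, Real.exp (-(4 * t) * ‖w‖ ^ 2)) * gaussEnergy K t = ∫ w, gaussAvg K t w ^ 2 := by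
  have hG : Integrable fun w : E d => Real.exp (-(4 * t) * ‖w‖ ^ 2) := by
    refine not_imp_comm.1 integral_undef ?_
    rw [GaussianFourier.integral_rexp_neg_mul_sq_norm (by positivity)]
    positivity
  have hGs : ∀ m : E d, Integrable fun w : E d => Real.exp (-(4 * t) * ‖w - m‖ ^ 2) :=
    fun m => hG.comp_sub_right m
  have hGi : ∀ m : E d, ∫ w : E d, Real.exp (-(4 * t) * ‖w - m‖ ^ 2) =
      ∫ w : E d, Real.exp (-(4 * t) * ‖w‖ ^ 2) := fun m =>
    integral_sub_right_eq_self (fun w : E d => Real.exp (-(4 * t) * ‖w‖ ^ 2)) m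
  set Φ : (E d × E d) × E d → ℝ := fun y =>
    (Real.exp (-(t * ‖y.1.1 - y.1.2‖ ^ 2)) * (K y.1.1 * K y.1.2)) *
      Real.exp (-(4 * t) * ‖y.2 - (1 / 2 : ℝ) • (y.1.1 + y.1.2)‖ ^ 2) with hΦ
  have hm : AEStronglyMeasurable Φ ((volume.prod volume).prod volume) :=
    ((integrable_gaussEnergy hK ht.le).1.comp_fst).mul (by fun_prop)
  have hint : Integrable Φ ((volume.prod volume).prod volume) := by
    refine (integrable_prod_iff hm).2 ⟨ae_of_all _ fun z => (hGs ((1 / 2 : ℝ) • (z.1 + z.2))).const_mul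
      (Real.exp (-(t * ‖z.1 - z.2‖ ^ 2)) * (K z.1 * K z.2)), ?_⟩
    refine ((integrable_gaussEnergy hK ht.le).norm.mul_const
      (∫ w : E d, Real.exp (-(4 * t) * ‖w‖ ^ 2))).congr (ae_of_all _ fun z => ?_)
    simp only [hΦ, norm_mul, Real.norm_eq_abs, Real.abs_exp]
    rw [integral_const_mul, hGi]
  have hsq : ∀ w, ∫ z : E d × E d, Φ (z, w) = gaussAvg K t w ^ 2 := fun w => by
    rw [sq, gaussAvg, ← integral_prod_mul]
    congr 1; funext z
    have := exp_mul_exp_gauss t z.1 z.2 w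
    simp only [hΦ]
    linear_combination (-(K z.1 * K z.2)) * this
  constructor
  · exact hint.integral_prod_right.congr (ae_of_all _ hsq)
  · have h1 : ∫ y, Φ y ∂((volume.prod volume).prod volume) =
        (∫ w : E d, Real.exp (-(4 * t) * ‖w‖ ^ 2)) * gaussEnergy K t := by
      rw [integral_prod _ hint, gaussEnergy, ← integral_const_mul]
      congr 1; funext z
      simp only [hΦ]
      rw [integral_const_mul, hGi, mul_comm]
    rw [← h1, integral_prod_symm _ hint]
    congr 1; funext w
    exact hsq w

lemma gaussEnergy_nonneg {K : E d → ℝ} (hK : Integrable K) {t : ℝ} (ht : 0 < t) :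
    0 ≤ gaussEnergy K t := by
  have h := (gaussEnergy_eq hK ht).2
  have h1 : 0 < ∫ w : E d, Real.exp (-(4 * t) * ‖w‖ ^ 2) := by
    rw [GaussianFourier.integral_rexp_neg_mul_sq_norm (by positivity)]; positivity
  have h2 : 0 ≤ ∫ w, gaussAvg K t w ^ 2 := integral_nonneg fun w => sq_nonneg _
  rw [← h] at h2
  exact nonneg_of_mul_nonneg_right h2 h1

lemma eventually_gaussEnergy_pos [NeZero d] {K : E d → ℝ} (hK : Integrable K) {x : E d}
    (hx : ContinuousAt K x) (hKx : K x ≠ 0) : ∀ᶠ t : ℝ in atTop, 0 < gaussEnergy K t := by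
  have hpk := tendsto_integral_comp_smul_smul_of_integrable' (μ := (volume : Measure (E d)))
    (φ := fun x : E d => Real.exp (-Real.pi * ‖x‖ ^ 2)) (fun x => (Real.exp_pos _).le)
    (by rw [GaussianFourier.integral_rexp_neg_mul_sq_norm Real.pi_pos, div_self Real.pi_ne_zero,
      Real.one_rpow])
    (by
      have h := (rpow_mul_exp_neg_mul_sq_isLittleO_exp_neg Real.pi_pos (d : ℝ)).tendsto_zero_of_tendsto
        (Real.tendsto_exp_atBot.comp
          (tendsto_id.const_mul_atTop_of_neg (by norm_num : -(1 / 2 : ℝ) < 0)))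
      refine (h.comp (tendsto_norm_cobounded_atTop (E := E d))).congr fun y => ?_
      simp) hK hx
  have hc : Tendsto (fun t : ℝ => √(2 * t / Real.pi)) atTop atTop :=
    Real.tendsto_sqrt_atTop.comp
      ((tendsto_id.const_mul_atTop two_pos).atTop_div_const Real.pi_pos)
  filter_upwards [(hpk.comp hc).eventually_ne hKx, eventually_gt_atTop 0] with t ht ht0
  have hav : gaussAvg K t x ≠ 0 := fun h0 => ht (by
    simp only [Function.comp, smul_eq_mul, mul_assoc]
    rw [integral_const_mul]
    refine mul_eq_zero_of_right _ (Eq.trans ?_ h0)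
    rw [gaussAvg]
    congr 1; funext u
    congr 2
    rw [norm_smul, mul_pow, Real.norm_of_nonneg (Real.sqrt_nonneg _),
      Real.sq_sqrt (by positivity)]
    field_simp)
  obtain ⟨hi, he⟩ := gaussEnergy_eq hK ht0
  have h1 : 0 < ∫ w : E d, Real.exp (-(4 * t) * ‖w‖ ^ 2) := by
    rw [GaussianFourier.integral_rexp_neg_mul_sq_norm (by positivity)]; positivity
  have h2 : 0 < ∫ w, gaussAvg K t w ^ 2 := by
    rw [integral_pos_iff_support_of_nonneg (fun w => sq_nonneg _) hi]
    exact ((continuous_gaussAvg hK ht0).pow 2).isOpen_support.measure_pos volume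
      ⟨x, by simpa using hav⟩
  rw [← he] at h2
  exact pos_of_mul_pos_right h2 h1.le

/-- The logarithmic energy of a function of vanishing integral is positive. -/
lemma integral_neg_log_mul_pos [NeZero d] {K : E d → ℝ} (hK : Integrable K) (hK0 : ∫ u, K u = 0)
    (hL : Integrable fun z : E d × E d => Real.log ‖z.1 - z.2‖ * (K z.1 * K z.2)) {x : E d}
    (hx : ContinuousAt K x) (hKx : K x ≠ 0) :
    0 < ∫ z : E d × E d, -Real.log ‖z.1 - z.2‖ * (K z.1 * K z.2) := by
  set ν : Measure ℝ := volume.restrict (Ioi 0)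
  have hne : ∀ᵐ z : E d × E d, z.1 - z.2 ≠ 0 := by
    refine (Measure.ae_prod_iff_ae_ae ?_).2 (ae_of_all _ fun u => ?_)
    · exact (measurableSet_eq_fun (by fun_prop) measurable_const).compl
    · filter_upwards [(by simp [ae_iff] : ∀ᵐ v : E d, v ≠ u)] with v hv
      exact sub_ne_zero.2 hv.symm
  set Φ : (E d × E d) × ℝ → ℝ := fun y =>
    (y.2⁻¹ * (Real.exp (-(‖y.1.1 - y.1.2‖ ^ 2 * y.2)) - Real.exp (-y.2))) * (K y.1.1 * K y.1.2)
    with hΦ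
  have hm : AEStronglyMeasurable Φ ((volume.prod volume).prod ν) :=
    (Measurable.aestronglyMeasurable (by fun_prop)).mul ((hK.mul_prod hK).1.comp_fst)
  have hint : Integrable Φ ((volume.prod volume).prod ν) := by
    refine (integrable_prod_iff hm).2 ⟨?_, ?_⟩
    · filter_upwards [hne] with z hz
      exact (integrableOn_frullani_exp (a := ‖z.1 - z.2‖ ^ 2)
        (by positivity)).mul_const (K z.1 * K z.2)
    · refine (hL.norm.const_mul 2).congr ?_
      filter_upwards [hne] with z hz
      have h := integral_abs_frullani_exp (a := ‖z.1 - z.2‖ ^ 2) (by positivity)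
      simp only [hΦ, norm_mul (_ * _) (K z.1 * K z.2)]
      rw [integral_mul_const]
      simp only [Real.norm_eq_abs]
      rw [h, Real.log_pow, abs_mul, abs_mul, abs_mul]
      norm_num [mul_assoc]
  have e1 : ∫ y, Φ y ∂((volume.prod volume).prod ν) =
      2 * ∫ z : E d × E d, -Real.log ‖z.1 - z.2‖ * (K z.1 * K z.2) := by
    rw [integral_prod _ hint, ← integral_const_mul]
    refine integral_congr_ae ?_
    filter_upwards [hne] with z hz
    simp only [hΦ]
    rw [integral_mul_const, integral_frullani_exp (by positivity), Real.log_pow]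
    push_cast; ring
  have e2 : ∀ t ∈ Ioi (0 : ℝ), ∫ z, Φ (z, t) = t⁻¹ * gaussEnergy K t := fun t ht => by
    have h0 : ∫ z : E d × E d, K z.1 * K z.2 = 0 := by
      have := integral_prod_mul (μ := (volume : Measure (E d))) (ν := (volume : Measure (E d))) K K
      rw [hK0, zero_mul] at this
      exact this
    have : ∀ z : E d × E d, Φ (z, t) = t⁻¹ * (Real.exp (-(t * ‖z.1 - z.2‖ ^ 2)) * (K z.1 * K z.2))
        - (t⁻¹ * Real.exp (-t)) * (K z.1 * K z.2) := fun z => by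
      simp only [hΦ]; rw [mul_comm t]; ring
    simp only [this]
    rw [integral_sub ((integrable_gaussEnergy hK (le_of_lt ht)).const_mul _)
      ((hK.mul_prod hK).const_mul _), integral_const_mul, integral_const_mul, h0, mul_zero, sub_zero]
    rfl
  have hint2 : IntegrableOn (fun t => t⁻¹ * gaussEnergy K t) (Ioi 0) :=
    (hint.integral_prod_right).congr
      ((ae_restrict_iff' measurableSet_Ioi).2 (ae_of_all _ fun t ht => e2 t ht))
  have e3 : ∫ y, Φ y ∂((volume.prod volume).prod ν) = ∫ t in Ioi 0, t⁻¹ * gaussEnergy K t := by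
    rw [integral_prod_symm _ hint]
    exact setIntegral_congr_fun measurableSet_Ioi e2
  have hpos : 0 < ∫ t in Ioi 0, t⁻¹ * gaussEnergy K t := by
    rw [setIntegral_pos_iff_support_of_nonneg_ae
      ((ae_restrict_iff' measurableSet_Ioi).2 (ae_of_all _ fun t ht => mul_nonneg
        (inv_nonneg.2 (le_of_lt ht)) (gaussEnergy_nonneg hK ht))) hint2]
    obtain ⟨T, hT⟩ := eventually_atTop.1 (eventually_gaussEnergy_pos hK hx hKx)
    refine lt_of_lt_of_le ?_ (measure_mono (s := Ioi (max T 0)) fun t (ht : max T 0 < t) => ?_)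
    · simp
    · have h0 : 0 < t := (le_max_right _ _).trans_lt ht
      exact ⟨(mul_pos (inv_pos.2 h0) (hT t ((le_max_left _ _).trans ht.le))).ne', h0⟩
  linarith

/-! ### Laplace transforms of signed densities -/

section SignedLaplace

variable {X : Type*} [MeasurableSpace X] {μ : Measure X}

lemma integrable_withDensity_ofReal {F g : X → ℝ} (hF : Measurable F) (hg : Measurable g)
    (h : Integrable (fun x => g x * F x) μ) :
    Integrable g (μ.withDensity fun x => ENNReal.ofReal (F x)) := by
  rw [integrable_withDensity_iff_integrable_smul' hF.ennreal_ofReal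
    (ae_of_all _ fun x => ENNReal.ofReal_lt_top)]
  refine h.norm.mono' (by fun_prop) (ae_of_all _ fun x => ?_)
  rw [norm_smul, norm_mul, mul_comm]
  gcongr
  rw [ENNReal.toReal_ofReal', Real.norm_eq_abs, Real.norm_eq_abs]
  rcases le_total 0 (F x) with h | h <;> simp [h]

lemma integral_withDensity_sub {F g : X → ℝ} (hF : Measurable F) (hg : Measurable g)
    (h : Integrable (fun x => g x * F x) μ) :
    (∫ x, g x ∂(μ.withDensity fun x => ENNReal.ofReal (F x))) -
      ∫ x, g x ∂(μ.withDensity fun x => ENNReal.ofReal (-F x)) = ∫ x, g x * F x ∂μ := by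
  have h1 := integrable_withDensity_ofReal hF hg h
  have h2 := integrable_withDensity_ofReal (F := fun x => -F x) (μ := μ) hF.neg hg
    (by simpa using h.neg)
  rw [integrable_withDensity_iff_integrable_smul' (by fun_prop)
    (ae_of_all _ fun x => ENNReal.ofReal_lt_top)] at h1 h2
  rw [integral_withDensity_eq_integral_toReal_smul (by fun_prop)
    (ae_of_all _ fun x => ENNReal.ofReal_lt_top), integral_withDensity_eq_integral_toReal_smul
    (by fun_prop) (ae_of_all _ fun x => ENNReal.ofReal_lt_top), ← integral_sub h1 h2]
  congr 1; funext x
  rw [ENNReal.toReal_ofReal', ENNReal.toReal_ofReal', smul_eq_mul, smul_eq_mul, ← sub_mul, mul_comm]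
  rcases le_total 0 (F x) with h | h <;> simp [h]

variable {L F : X → ℝ} {a b : ℝ}

lemma subset_interior_integrableExpSet (hL : Measurable L) (hF : Measurable F)
    (h : ∀ t ∈ Ioo a b, Integrable (fun x => Real.exp (t * L x) * F x) μ) :
    Ioo a b ⊆ interior (integrableExpSet L (μ.withDensity fun x => ENNReal.ofReal (F x))) :=
  interior_maximal (fun t ht => integrable_withDensity_ofReal hF (by fun_prop) (h t ht)) isOpen_Ioo

lemma integral_exp_mul_eq_mgf_sub (hL : Measurable L) (hF : Measurable F)
    (h : ∀ t ∈ Ioo a b, Integrable (fun x => Real.exp (t * L x) * F x) μ) {t : ℝ}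
    (ht : t ∈ Ioo a b) : ∫ x, Real.exp (t * L x) * F x ∂μ =
      (mgf L (μ.withDensity fun x => ENNReal.ofReal (F x)) -
        mgf L (μ.withDensity fun x => ENNReal.ofReal (-F x))) t :=
  (integral_withDensity_sub hF (by fun_prop) (h t ht)).symm

lemma analyticOnNhd_mgf_sub (hL : Measurable L) (hF : Measurable F)
    (h : ∀ t ∈ Ioo a b, Integrable (fun x => Real.exp (t * L x) * F x) μ) :
    AnalyticOnNhd ℝ (mgf L (μ.withDensity fun x => ENNReal.ofReal (F x)) -
        mgf L (μ.withDensity fun x => ENNReal.ofReal (-F x))) (Ioo a b) := by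
  have h' : ∀ t ∈ Ioo a b, Integrable (fun x => Real.exp (t * L x) * -F x) μ := fun t ht => by
    simpa using (h t ht).neg
  exact (analyticOnNhd_mgf.mono (subset_interior_integrableExpSet hL hF h)).sub
    (analyticOnNhd_mgf.mono (subset_interior_integrableExpSet hL hF.neg h'))

lemma analyticOnNhd_integral_exp (hL : Measurable L) (hF : Measurable F)
    (h : ∀ t ∈ Ioo a b, Integrable (fun x => Real.exp (t * L x) * F x) μ) :
    AnalyticOnNhd ℝ (fun t => ∫ x, Real.exp (t * L x) * F x ∂μ) (Ioo a b) :=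
  (analyticOnNhd_mgf_sub hL hF h).congr isOpen_Ioo fun _ ht =>
    (integral_exp_mul_eq_mgf_sub hL hF h ht).symm

lemma iteratedDeriv_integral_exp_zero (hL : Measurable L) (hF : Measurable F)
    (h : ∀ t ∈ Ioo a b, Integrable (fun x => Real.exp (t * L x) * F x) μ) (h0 : (0 : ℝ) ∈ Ioo a b)
    {n : ℕ} (hn : Integrable (fun x => L x ^ n * F x) μ) :
    iteratedDeriv n (fun t => ∫ x, Real.exp (t * L x) * F x ∂μ) 0 = ∫ x, L x ^ n * F x ∂μ := by
  have h' : ∀ t ∈ Ioo a b, Integrable (fun x => Real.exp (t * L x) * -F x) μ := fun t ht => by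
    simpa using (h t ht).neg
  have i1 := subset_interior_integrableExpSet hL hF h h0
  have i2 := subset_interior_integrableExpSet (F := fun x => -F x) hL hF.neg h' h0
  have e : (fun t => ∫ x, Real.exp (t * L x) * F x ∂μ) =ᶠ[𝓝 0]
      (mgf L (μ.withDensity fun x => ENNReal.ofReal (F x)) -
        mgf L (μ.withDensity fun x => ENNReal.ofReal (-F x))) := by
    filter_upwards [isOpen_Ioo.mem_nhds h0] with t ht
    exact integral_exp_mul_eq_mgf_sub hL hF h ht
  rw [e.iteratedDeriv_eq, iteratedDeriv_sub (analyticAt_mgf i1).contDiffAt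
    (analyticAt_mgf i2).contDiffAt, iteratedDeriv_mgf_zero i1, iteratedDeriv_mgf_zero i2,
    ← integral_withDensity_sub hF (by fun_prop) hn]
  rfl

end SignedLaplace

/-- An analytic function whose first nonvanishing derivative at the origin is positive is positive
on the right of the origin. -/
lemma exists_pos_of_iteratedDeriv_pos {J : ℝ → ℝ} (hJ : AnalyticAt ℝ J 0) {m : ℕ}
    (h0 : ∀ i < m, iteratedDeriv i J 0 = 0) (hm : 0 < iteratedDeriv m J 0) :
    ∃ δ, 0 < δ ∧ ∀ t ∈ Ioo 0 δ, 0 < J t := by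
  induction m generalizing J with
  | zero =>
    rw [iteratedDeriv_zero] at hm
    obtain ⟨δ, hδ, h⟩ := Metric.eventually_nhds_iff.1 (hJ.continuousAt.eventually_const_lt hm)
    exact ⟨δ, hδ, fun t ht => h (by rw [Real.dist_eq, sub_zero, abs_of_pos ht.1]; exact ht.2)⟩
  | succ m ih =>
    obtain ⟨δ, hδ, h⟩ := ih hJ.deriv (fun i hi => by
      rw [← iteratedDeriv_succ']; exact h0 _ (by omega)) (by rwa [← iteratedDeriv_succ'])
    obtain ⟨η, hη, hd⟩ := Metric.eventually_nhds_iff.1 hJ.eventually_analyticAt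
    refine ⟨min δ η, lt_min hδ hη, fun t ht => ?_⟩
    have ha : ∀ x ∈ Icc 0 t, AnalyticAt ℝ J x := fun x hx => hd (by
      rw [Real.dist_eq, sub_zero, abs_of_nonneg hx.1]
      exact hx.2.trans_lt (ht.2.trans_le (min_le_right _ _)))
    have hmono : StrictMonoOn J (Icc 0 t) := by
      refine strictMonoOn_of_deriv_pos (convex_Icc 0 t)
        (fun x hx => (ha x hx).continuousAt.continuousWithinAt) fun x hx => ?_
      rw [interior_Icc] at hx
      exact h x ⟨hx.1, hx.2.trans (ht.2.trans_le (min_le_left _ _))⟩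
    have := hmono (left_mem_Icc.2 ht.1.le) (right_mem_Icc.2 ht.1.le) ht.1
    have hz := h0 0 (by omega)
    rw [iteratedDeriv_zero] at hz
    linarith

lemma countable_zeros_of_analyticOnNhd {J : ℝ → ℝ} {a b : ℝ} (hJ : AnalyticOnNhd ℝ J (Ioo a b))
    {x : ℝ} (hx : x ∈ Ioo a b) (hJx : J x ≠ 0) : {t ∈ Ioo a b | J t = 0}.Countable := by
  have h : ∀ t ∈ {t ∈ Ioo a b | J t = 0}, {t} ∈ 𝓝[{t ∈ Ioo a b | J t = 0}] t := by
    rintro t ⟨ht, -⟩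
    rcases (hJ t ht).eventually_eq_zero_or_eventually_ne_zero with h | h
    · exact absurd (hJ.eqOn_zero_of_preconnected_of_eventuallyEq_zero isPreconnected_Ioo ht h hx)
        hJx
    · rw [eventually_nhdsWithin_iff] at h
      rw [mem_nhdsWithin_iff_eventually]
      filter_upwards [h] with y hy hy'
      by_contra hne
      exact hy hne hy'.2
  obtain ⟨T, -, hT, hsub⟩ := TopologicalSpace.countable_cover_nhdsWithin h
  exact hT.mono fun y hy => by simpa using hsub hy

/-! ### Weighted products -/

/-- The weight `∏ (1 + |u_i|)`. -/
noncomputable def prodWeight {q : ℕ} (u : Fin q → E d) : ℝ := ∏ i, (1 + ‖u i‖)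

lemma one_le_prodWeight {q : ℕ} (u : Fin q → E d) : 1 ≤ prodWeight u :=
  Finset.one_le_prod fun i _ => by have := norm_nonneg (u i); linarith

lemma norm_sub_le_prodWeight {q : ℕ} (u : Fin q → E d) {i k : Fin q} (h : i ≠ k) :
    ‖u i - u k‖ ≤ prodWeight u := by
  have h1 : (1 + ‖u i‖) * (1 + ‖u k‖) ≤ prodWeight u := by
    rw [prodWeight, ← Finset.prod_pair (f := fun i => 1 + ‖u i‖) h]
    exact Finset.prod_le_prod_of_subset_of_one_le (Finset.subset_univ _)
      (fun i _ => by positivity) (fun i _ _ => by have := norm_nonneg (u i); linarith)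
  have := norm_sub_le (u i) (u k)
  nlinarith [norm_nonneg (u i), norm_nonneg (u k)]

lemma ae_forall_ne [NeZero d] {q : ℕ} : ∀ᵐ u : Fin q → E d, ∀ i k, i ≠ k → u i ≠ u k := by
  refine ae_all_iff.2 fun i => ae_all_iff.2 fun k => ?_
  by_cases hik : i = k
  · exact ae_of_all _ fun u h => absurd hik h
  let S : Submodule ℝ (Fin q → E d) := LinearMap.ker
    (LinearMap.proj (R := ℝ) (φ := fun _ : Fin q => E d) i - LinearMap.proj k)
  have hS : S ≠ ⊤ := fun h => by
    obtain ⟨x, hx⟩ := exists_ne (0 : E d)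
    have : Pi.single i x ∈ S := h ▸ Submodule.mem_top
    simp only [S, LinearMap.mem_ker, LinearMap.sub_apply, LinearMap.proj_apply, Pi.single_eq_same,
      Pi.single_eq_of_ne (Ne.symm hik), sub_zero] at this
    exact hx this
  have h0 := Measure.addHaar_submodule (volume : Measure (Fin q → E d)) S hS
  filter_upwards [measure_eq_zero_iff_ae_notMem.1 h0] with u hu _ h
  exact hu (by simp [S, h])

/-- Pairs of distinct indices. -/
abbrev IndexPair (q : ℕ) : Type := {x : Fin q × Fin q // x.1 < x.2}

@[to_additive]
lemma prod_prod_Ioi {q : ℕ} {M : Type*} [CommMonoid M] (f : Fin q → Fin q → M) :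
    ∏ i, ∏ k ∈ Finset.Ioi i, f i k = ∏ x : IndexPair q, f x.1.1 x.1.2 := by
  have h : ∀ i : Fin q, Finset.Ioi i = Finset.univ.filter (i < ·) := fun i => by ext; simp
  simp only [h, Finset.prod_filter]
  rw [← Finset.prod_product', Finset.univ_product_univ,
    ← Finset.prod_filter (fun x : Fin q × Fin q => x.1 < x.2) fun x => f x.1 x.2,
    Finset.prod_subtype (p := fun x : Fin q × Fin q => x.1 < x.2) _ (by simp)]

/-- Distance of the points of index pair `x`. -/
noncomputable def pairDist {q : ℕ} (u : Fin q → E d) (x : IndexPair q) : ℝ := ‖u x.1.1 - u x.1.2‖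

@[fun_prop]
lemma measurable_pairDist {q : ℕ} (x : IndexPair q) :
    Measurable fun u : Fin q → E d => pairDist u x := by
  unfold pairDist; fun_prop

lemma ae_pairDist_pos [NeZero d] {q : ℕ} : ∀ᵐ u : Fin q → E d, ∀ x, 0 < pairDist u x := by
  filter_upwards [ae_forall_ne (d := d) (q := q)] with u hu x
  exact norm_pos_iff.2 (sub_ne_zero.2 (hu _ _ x.2.ne))

lemma pairProd_eq {q : ℕ} (s : ℝ) (u : Fin q → E d) :
    pairProd s u = ∏ x, pairDist u x ^ (-s) := prod_prod_Ioi _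

/-- The sum of the logarithmic interactions. -/
noncomputable def logInteraction {q : ℕ} (u : Fin q → E d) : ℝ :=
  ∑ x : IndexPair q, -Real.log (pairDist u x)

@[fun_prop]
lemma measurable_logInteraction {q : ℕ} :
    Measurable (logInteraction : (Fin q → E d) → ℝ) := by
  unfold logInteraction; fun_prop

lemma exp_mul_logInteraction {q : ℕ} {u : Fin q → E d} (hu : ∀ x, 0 < pairDist u x) (s : ℝ) :
    Real.exp (s * logInteraction u) = pairProd s u := by
  rw [logInteraction, Finset.mul_sum, Real.exp_sum, pairProd_eq]
  refine Finset.prod_congr rfl fun x _ => ?_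
  rw [Real.rpow_def_of_pos (hu x)]
  congr 1; ring

lemma pairDist_rpow_le {q : ℕ} (u : Fin q → E d) (x : IndexPair q) {δ : ℝ} (hδ : 0 ≤ δ) :
    pairDist u x ^ δ ≤ prodWeight u ^ δ :=
  Real.rpow_le_rpow (norm_nonneg _) (norm_sub_le_prodWeight u x.2.ne) hδ

lemma prod_pairDist_rpow_le {q : ℕ} (u : Fin q → E d) (S : Finset (IndexPair q)) {δ : ℝ}
    (hδ : 0 ≤ δ) :
    ∏ x ∈ S, pairDist u x ^ δ ≤ prodWeight u ^ (Fintype.card (IndexPair q) * δ) := by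
  have h1 := one_le_prodWeight u
  calc ∏ x ∈ S, pairDist u x ^ δ ≤ ∏ _x ∈ S, prodWeight u ^ δ :=
        Finset.prod_le_prod (fun x _ => Real.rpow_nonneg (norm_nonneg _) _)
          fun x _ => pairDist_rpow_le u x hδ
    _ = prodWeight u ^ (S.card * δ) := by
        rw [Finset.prod_const, ← Real.rpow_natCast, ← Real.rpow_mul (by linarith), mul_comm]
    _ ≤ _ := by
        refine Real.rpow_le_rpow_of_exponent_le h1 ?_
        gcongr
        exact Finset.card_le_univ S

lemma pairDist_rpow_neg_le {q : ℕ} {u : Fin q → E d} (hu : ∀ x, 0 < pairDist u x)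
    (x : IndexPair q) {δ : ℝ} (hδ : 0 ≤ δ) : pairDist u x ^ (-δ) ≤
      prodWeight u ^ (Fintype.card (IndexPair q) * δ) * pairProd δ u := by
  have h := prod_pairDist_rpow_le u (Finset.univ.erase x) hδ
  refine le_trans (le_of_eq ?_) (mul_le_mul_of_nonneg_right h (pairProd_nonneg _ _))
  rw [pairProd_eq, ← Finset.mul_prod_erase _ _ (Finset.mem_univ x), mul_left_comm,
    ← Finset.prod_mul_distrib, Finset.prod_congr rfl fun y _ => ?_, Finset.prod_const_one, mul_one]
  rw [← Real.rpow_add (hu y), add_neg_cancel, Real.rpow_zero]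

lemma abs_log_pow_le {x δ : ℝ} (hx : 0 < x) (hδ : 0 < δ) (m : ℕ) :
    |Real.log x| ^ m ≤ m.factorial / δ ^ m * (x ^ δ + x ^ (-δ)) := by
  have h1 := Real.pow_div_factorial_le_exp (δ * |Real.log x|) (by positivity) m
  have h2 : Real.exp (δ * |Real.log x|) ≤ x ^ δ + x ^ (-δ) := by
    rw [Real.rpow_def_of_pos hx, Real.rpow_def_of_pos hx]
    rcases abs_cases (Real.log x) with ⟨h, -⟩ | ⟨h, -⟩
    · rw [h, mul_comm]; linarith [Real.exp_pos (Real.log x * -δ)]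
    · rw [h, mul_neg, mul_neg, mul_comm]; linarith [Real.exp_pos (Real.log x * δ)]
  rw [mul_pow, div_le_iff₀ (by positivity)] at h1
  rw [div_mul_eq_mul_div, le_div_iff₀ (by positivity)]
  nlinarith [(Nat.cast_pos (α := ℝ)).2 m.factorial_pos]

lemma abs_prod_le_sum_pow {ι : Type*} [Fintype ι] [Nonempty ι] (a : ι → ℝ) :
    |∏ j, a j| ≤ ∑ j, |a j| ^ Fintype.card ι := by
  obtain ⟨k, hk⟩ := Finite.exists_max fun j => |a j|
  rw [Finset.abs_prod]
  calc ∏ j, |a j| ≤ ∏ _j : ι, |a k| :=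
        Finset.prod_le_prod (fun j _ => abs_nonneg _) fun j _ => hk j
    _ = |a k| ^ Fintype.card ι := by rw [Finset.prod_const, Finset.card_univ]
    _ ≤ _ := Finset.single_le_sum (f := fun j => |a j| ^ Fintype.card ι)
        (fun j _ => by positivity) (Finset.mem_univ k)

lemma abs_prod_log_le {q : ℕ} {u : Fin q → E d} (hu : ∀ x, 0 < pairDist u x) {δ : ℝ} (hδ : 0 < δ)
    {n : ℕ} (σ : Fin n → IndexPair q) : |∏ j, -Real.log (pairDist u (σ j))| ≤
      (1 + n * (n.factorial / δ ^ n)) * (prodWeight u ^ (Fintype.card (IndexPair q) * δ) *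
        (pairProd 0 u + pairProd δ u)) := by
  have h1 := one_le_prodWeight u
  have hp0 : pairProd 0 u = 1 := by simp [pairProd]
  have hpos : 0 ≤ pairProd δ u := pairProd_nonneg _ _
  set B := prodWeight u ^ (Fintype.card (IndexPair q) * δ)
  have hB : 1 ≤ B := Real.one_le_rpow h1 (by positivity)
  rcases Nat.eq_zero_or_pos n with rfl | hn
  · simp only [Finset.univ_eq_empty, Finset.prod_empty, abs_one, hp0]
    push_cast
    nlinarith
  · have : Nonempty (Fin n) := ⟨⟨0, hn⟩⟩
    refine (abs_prod_le_sum_pow _).trans ?_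
    have h : ∀ j ∈ Finset.univ, |-Real.log (pairDist u (σ j))| ^ Fintype.card (Fin n) ≤
        n.factorial / δ ^ n * (B * (pairProd 0 u + pairProd δ u)) := fun j _ => by
      rw [abs_neg, Fintype.card_fin]
      refine (abs_log_pow_le (hu _) hδ n).trans ?_
      gcongr
      rw [mul_add, hp0, mul_one]
      have h2 := prod_pairDist_rpow_le u {σ j} hδ.le
      rw [Finset.prod_singleton] at h2
      exact add_le_add h2 (pairDist_rpow_neg_le hu _ hδ.le)
    refine (Finset.sum_le_sum h).trans ?_
    rw [Finset.sum_const, Finset.card_univ, Fintype.card_fin, nsmul_eq_mul, ← mul_assoc]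
    refine mul_le_mul_of_nonneg_right (by linarith) ?_
    exact mul_nonneg (by linarith) (by rw [hp0]; linarith)

/-- Integrability against a product of kernels with some room in the decay at infinity. -/
lemma integrable_mul_prod_of_abs_le {q : ℕ} {K : E d → ℝ} {w : E d → ENNReal} {η s C : ℝ}
    (hK : Measurable K) (hw : Measurable w)
    (hle : ∀ u, ENNReal.ofReal (|K u| * (1 + ‖u‖) ^ η) ≤ w u)
    (hfin : pairIntegral q w s < ⊤) {G : (Fin q → E d) → ℝ} (hG : Measurable G)
    (hGle : ∀ᵐ u, |G u| ≤ C * (prodWeight u ^ η * pairProd s u)) :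
    Integrable fun u => G u * ∏ i, K (u i) := by
  refine ⟨(by fun_prop : Measurable _).aestronglyMeasurable, ?_⟩
  have hC : ENNReal.ofReal C * pairIntegral q w s < ⊤ := ENNReal.mul_lt_top ENNReal.ofReal_lt_top hfin
  refine lt_of_le_of_lt ?_ hC
  rw [pairIntegral, ← lintegral_const_mul _ (measurable_pairIntegrand hw s)]
  refine lintegral_mono_ae ?_
  filter_upwards [hGle] with u hu
  have h0 : 0 ≤ C * (prodWeight u ^ η * pairProd s u) := (abs_nonneg _).trans hu
  rw [enorm_mul, Real.enorm_eq_ofReal_abs, Real.enorm_eq_ofReal_abs]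
  calc ENNReal.ofReal |G u| * ENNReal.ofReal |∏ i, K (u i)|
      ≤ ENNReal.ofReal (C * (prodWeight u ^ η * pairProd s u)) * ENNReal.ofReal |∏ i, K (u i)| := by
        gcongr
    _ = ENNReal.ofReal C * ((∏ i, ENNReal.ofReal (|K (u i)| * (1 + ‖u i‖) ^ η)) *
          ENNReal.ofReal (pairProd s u)) := by
        have h1 := one_le_prodWeight u
        rw [← ENNReal.ofReal_prod_of_nonneg (fun i _ => by positivity), Finset.prod_mul_distrib,
          ← Finset.abs_prod, Real.finsetProd_rpow _ _ (fun i _ => by positivity), ← ENNReal.ofReal_mul h0,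
          ← ENNReal.ofReal_mul (by positivity)]
        rcases le_or_gt 0 C with hC0 | hC0
        · rw [← ENNReal.ofReal_mul hC0]
          congr 1
          rw [prodWeight]; ring
        · have h2 : prodWeight u ^ η * pairProd s u = 0 := by
            have := mul_nonneg (Real.rpow_nonneg (by linarith : 0 ≤ prodWeight u) η)
              (pairProd_nonneg s u)
            nlinarith
          rw [prodWeight] at h2
          rw [ENNReal.ofReal_of_nonpos hC0.le, zero_mul, prodWeight, h2]; simp
    _ ≤ _ := by
        gcongr with i
        exact hle _

/-- Kernels with potentials bounded up to the exponent `p`, with some room in the decay at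
infinity. -/
structure RegularKernel (K : E d → ℝ) (w : E d → ENNReal) (p η : ℝ) : Prop where
  measurable : Measurable K
  potential : BoundedPotential w p
  exponent_pos : 0 < p
  room_pos : 0 < η
  bound : ∀ u, ENNReal.ofReal (|K u| * (1 + ‖u‖) ^ η) ≤ w u

variable {K : E d → ℝ} {w : E d → ENNReal} {p η : ℝ}

lemma RegularKernel.integrable (hK : RegularKernel K w p η) : Integrable K := by
  refine hK.potential.integrable hK.exponent_pos.le hK.measurable.aestronglyMeasurable fun u => ?_
  refine le_trans (ENNReal.ofReal_le_ofReal ?_) (hK.bound u)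
  exact le_mul_of_one_le_right (abs_nonneg _) (Real.one_le_rpow
    (by have := norm_nonneg u; linarith) hK.room_pos.le)

lemma RegularKernel.integrable_prod_log [NeZero d] (hK : RegularKernel K w p η) {q n : ℕ}
    (σ : Fin n → IndexPair q) :
    Integrable fun u : Fin q → E d => (∏ j, -Real.log (pairDist u (σ j))) * ∏ i, K (u i) := by
  set P := Fintype.card (IndexPair q)
  have hp := hK.exponent_pos
  have hη := hK.room_pos
  set δ := min (η / (2 * P + 1)) (p / (q + 1)) with hδ
  have hδ0 : 0 < δ := lt_min (by positivity) (by positivity)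
  have h1 : 2 * (P * δ) ≤ η := by
    have := (le_div_iff₀ (by positivity)).1 (min_le_left _ _ : δ ≤ η / (2 * P + 1))
    nlinarith
  have h2 : ((q : ℝ) - 1) * δ ≤ p := by
    have := (le_div_iff₀ (by positivity)).1 (min_le_right _ _ : δ ≤ p / (q + 1))
    nlinarith
  refine integrable_mul_prod_of_abs_le (C := 2 * (1 + n * (n.factorial / δ ^ n))) hK.measurable
    hK.potential.measurable hK.bound (pairIntegral_lt_top hK.potential hδ0.le hp.le q h2)
    (by fun_prop) ?_
  filter_upwards [ae_pairDist_pos (d := d) (q := q)] with u hu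
  refine (abs_prod_log_le hu hδ0 σ).trans ?_
  have hB := one_le_prodWeight u
  have hB' : 1 ≤ prodWeight u ^ (P * δ) := Real.one_le_rpow hB (by positivity)
  have hp0 : pairProd 0 u = 1 := by simp [pairProd]
  have h3 : 1 ≤ prodWeight u ^ (P * δ) * pairProd δ u := by
    refine le_trans (le_of_eq ?_) (mul_le_mul_of_nonneg_right
      (prod_pairDist_rpow_le u Finset.univ hδ0.le) (pairProd_nonneg _ _))
    rw [pairProd_eq, ← Finset.prod_mul_distrib, Finset.prod_congr rfl fun y _ => ?_,
      Finset.prod_const_one]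
    rw [← Real.rpow_add (hu y), add_neg_cancel, Real.rpow_zero]
  have h4 : prodWeight u ^ (P * δ) * prodWeight u ^ (P * δ) ≤ prodWeight u ^ η := by
    rw [← Real.rpow_add (by linarith)]
    exact Real.rpow_le_rpow_of_exponent_le hB (by linarith)
  have h5 : 0 ≤ pairProd δ u := pairProd_nonneg _ _
  rw [mul_comm (2 : ℝ), mul_assoc]
  refine mul_le_mul_of_nonneg_left ?_ (by positivity)
  rw [hp0]
  nlinarith [mul_le_mul_of_nonneg_right h4 h5, mul_nonneg (by linarith : 0 ≤ prodWeight u ^ (P * δ) - 1) h5]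

/-- The interaction integral of a kernel. -/
noncomputable def interactionIntegral (q : ℕ) (K : E d → ℝ) (s : ℝ) : ℝ :=
  ∫ u : Fin q → E d, pairProd s u * ∏ i, K (u i)

/-- Moments of the logarithmic interactions. -/
noncomputable def logMoment {q n : ℕ} (K : E d → ℝ) (σ : Fin n → IndexPair q) : ℝ :=
  ∫ u : Fin q → E d, (∏ j, -Real.log (pairDist u (σ j))) * ∏ i, K (u i)

lemma interactionIntegral_eq [NeZero d] (q : ℕ) (K : E d → ℝ) (s : ℝ) :
    interactionIntegral q K s =
      ∫ u : Fin q → E d, Real.exp (s * logInteraction u) * ∏ i, K (u i) := by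
  refine integral_congr_ae ?_
  filter_upwards [ae_pairDist_pos (d := d) (q := q)] with u hu
  rw [exp_mul_logInteraction hu]

lemma RegularKernel.integrable_exp [NeZero d] (hK : RegularKernel K w p η) {q : ℕ} {s : ℝ}
    (hfin : pairIntegral q w s < ⊤) :
    Integrable fun u : Fin q → E d => Real.exp (s * logInteraction u) * ∏ i, K (u i) := by
  refine integrable_mul_prod_of_abs_le (C := 1) hK.measurable hK.potential.measurable hK.bound
    hfin (by fun_prop) ?_
  filter_upwards [ae_pairDist_pos (d := d) (q := q)] with u hu
  rw [Real.abs_exp, exp_mul_logInteraction hu, one_mul]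
  exact le_mul_of_one_le_left (pairProd_nonneg _ _)
    (Real.one_le_rpow (one_le_prodWeight u) hK.room_pos.le)

lemma RegularKernel.integrable_exp_neg [NeZero d] (hK : RegularKernel K w p η) {q : ℕ} {s : ℝ}
    (hs : 0 ≤ s) (hsη : Fintype.card (IndexPair q) * s ≤ η) :
    Integrable fun u : Fin q → E d => Real.exp (-s * logInteraction u) * ∏ i, K (u i) := by
  refine integrable_mul_prod_of_abs_le (C := 1) (s := 0) hK.measurable hK.potential.measurable
    hK.bound (pairIntegral_lt_top hK.potential le_rfl hK.exponent_pos.le q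
      (by rw [mul_zero]; exact hK.exponent_pos.le)) (by fun_prop) ?_
  filter_upwards [ae_pairDist_pos (d := d) (q := q)] with u hu
  have hp0 : pairProd 0 u = 1 := by simp [pairProd]
  rw [Real.abs_exp, exp_mul_logInteraction hu, one_mul, hp0, mul_one, pairProd_eq]
  simp only [neg_neg]
  exact (prod_pairDist_rpow_le u Finset.univ hs).trans
    (Real.rpow_le_rpow_of_exponent_le (one_le_prodWeight u) hsη)

lemma RegularKernel.integral_logInteraction_pow [NeZero d] (hK : RegularKernel K w p η)
    (q n : ℕ) :
    Integrable (fun u : Fin q → E d => logInteraction u ^ n * ∏ i, K (u i)) ∧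
    ∫ u : Fin q → E d, logInteraction u ^ n * ∏ i, K (u i) =
      ∑ σ : Fin n → IndexPair q, logMoment K σ := by
  have h : ∀ u : Fin q → E d, logInteraction u ^ n * ∏ i, K (u i) =
      ∑ σ : Fin n → IndexPair q, (∏ j, -Real.log (pairDist u (σ j))) * ∏ i, K (u i) := fun u => by
    rw [logInteraction, Fintype.sum_pow, Finset.sum_mul]
  simp only [h]
  exact ⟨integrable_finsetSum _ fun σ _ => hK.integrable_prod_log σ,
    integral_finsetSum _ fun σ _ => hK.integrable_prod_log σ⟩

/-- If the first nonvanishing logarithmic moments are positive, the interaction integral is positive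
for weak interactions and vanishes only on a countable set. -/
lemma RegularKernel.interactionIntegral_pos [NeZero d] (hK : RegularKernel K w p η) {q m : ℕ}
    {b : ℝ} (hb : 0 < b) (hfin : ∀ s ∈ Ioo 0 b, pairIntegral q w s < ⊤)
    (h0 : ∀ n < m, ∀ σ : Fin n → IndexPair q, logMoment K σ = 0)
    (h1 : ∀ σ : Fin m → IndexPair q, 0 ≤ logMoment K σ)
    (h2 : ∃ σ : Fin m → IndexPair q, 0 < logMoment K σ) :
    {s ∈ Ioo 0 b | interactionIntegral q K s = 0}.Countable ∧
    ∃ δ, 0 < δ ∧ ∀ s ∈ Ioo 0 δ, 0 < interactionIntegral q K s := by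
  have hη := hK.room_pos
  set a := η / (Fintype.card (IndexPair q) + 1) with ha
  have ha0 : 0 < a := by positivity
  have hmF : Measurable fun u : Fin q → E d => ∏ i, K (u i) := by
    have := hK.measurable
    fun_prop
  have hint : ∀ t ∈ Ioo (-a) b, Integrable fun u : Fin q → E d =>
      Real.exp (t * logInteraction u) * ∏ i, K (u i) := by
    intro t ht
    rcases lt_or_ge 0 t with h | h
    · exact hK.integrable_exp (hfin t ⟨h, ht.2⟩)
    · have := hK.integrable_exp_neg (q := q) (s := -t) (by linarith) (by
        have h3 : -t ≤ a := by linarith [ht.1]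
        rw [ha, le_div_iff₀ (by positivity)] at h3
        nlinarith)
      simpa using this
  have e : interactionIntegral q K = fun s => ∫ u : Fin q → E d,
      Real.exp (s * logInteraction u) * ∏ i, K (u i) := funext (interactionIntegral_eq q K)
  have han : AnalyticOnNhd ℝ (interactionIntegral q K) (Ioo (-a) b) := by
    rw [e]; exact analyticOnNhd_integral_exp measurable_logInteraction hmF hint
  have hz : (0 : ℝ) ∈ Ioo (-a) b := ⟨by linarith, hb⟩
  have hder : ∀ n, iteratedDeriv n (interactionIntegral q K) 0 =
      ∑ σ : Fin n → IndexPair q, logMoment K σ := fun n => by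
    obtain ⟨i1, i2⟩ := hK.integral_logInteraction_pow q n
    rw [e, iteratedDeriv_integral_exp_zero measurable_logInteraction hmF hint hz i1, i2]
  obtain ⟨δ, hδ, hpos⟩ := exists_pos_of_iteratedDeriv_pos (han 0 hz) (m := m)
    (fun i hi => by rw [hder]; exact Finset.sum_eq_zero fun σ _ => h0 i hi σ)
    (by
      rw [hder]
      obtain ⟨σ, hσ⟩ := h2
      exact Finset.sum_pos' (fun σ _ => h1 σ) ⟨σ, Finset.mem_univ _, hσ⟩)
  refine ⟨?_, δ, hδ, hpos⟩
  have hx : min δ b / 2 ∈ Ioo 0 δ := by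
    have := lt_min hδ hb
    have := min_le_left δ b
    constructor <;> linarith
  have hx' : min δ b / 2 ∈ Ioo (-a) b := by
    have := lt_min hδ hb
    have := min_le_right δ b
    constructor <;> linarith
  refine (countable_zeros_of_analyticOnNhd han hx' (hpos _ hx).ne').mono ?_
  rintro s ⟨hs, h⟩
  exact ⟨⟨by linarith [hs.1], hs.2⟩, h⟩

/-! ### The logarithmic moments -/

lemma logMoment_eq_zero (hK0 : ∫ u, K u = 0) {q n : ℕ} (σ : Fin n → IndexPair (q + 1))
    {i : Fin (q + 1)} (hi : ∀ j, (σ j).1.1 ≠ i ∧ (σ j).1.2 ≠ i) : logMoment K σ = 0 := by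
  set H : (Fin q → E d) → ℝ := fun v =>
    (∏ j, -Real.log (pairDist (i.insertNth 0 v : Fin (q + 1) → E d) (σ j))) * ∏ k, K (v k) with hH
  have h := (volume_preserving_piFinSuccAbove (fun _ : Fin (q + 1) => E d) i).integral_comp'
    (fun z : E d × (Fin q → E d) => K z.1 * H z.2)
  have h' : ∫ z : E d × (Fin q → E d), K z.1 * H z.2 = 0 := by
    have := integral_prod_mul (μ := (volume : Measure (E d)))
      (ν := (volume : Measure (Fin q → E d))) K H
    rw [hK0, zero_mul] at this
    exact this
  rw [h'] at h
  rw [← h, logMoment]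
  congr 1; funext u
  change _ = K (u i) * H (i.removeNth u)
  have hne : ∀ k, k ≠ i → (i.insertNth 0 (i.removeNth u) : Fin (q + 1) → E d) k = u k := by
    intro k hk
    obtain ⟨k, rfl⟩ := Fin.exists_succAbove_eq hk
    rw [Fin.insertNth_apply_succAbove]; rfl
  have e : ∏ j, -Real.log (pairDist (i.insertNth 0 (i.removeNth u) : Fin (q + 1) → E d) (σ j)) =
      ∏ j, -Real.log (pairDist u (σ j)) := Finset.prod_congr rfl fun j _ => by
    rw [pairDist, pairDist, hne _ (hi j).1, hne _ (hi j).2]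
  simp only [hH]
  rw [e, Fin.prod_univ_succAbove _ i]
  simp only [Fin.removeNth]
  ring

/-- The logarithmic energy of a kernel. -/
noncomputable def logEnergy (K : E d → ℝ) : ℝ :=
  ∫ z : E d × E d, -Real.log ‖z.1 - z.2‖ * (K z.1 * K z.2)

lemma logMoment_matching (K : E d → ℝ) {l : ℕ} (σ : Fin l → IndexPair (2 * l))
    (hσ : ∀ i, ∃ j, (σ j).1.1 = i ∨ (σ j).1.2 = i) : logMoment K σ = logEnergy K ^ l := by
  let τ : Fin l ⊕ Fin l → Fin (2 * l) := Sum.elim (fun j => (σ j).1.1) fun j => (σ j).1.2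
  have hτ : Function.Bijective τ := by
    refine (Fintype.bijective_iff_surjective_and_card τ).2 ⟨fun i => ?_, by simp [two_mul]⟩
    obtain ⟨j, h | h⟩ := hσ i
    · exact ⟨.inl j, h⟩
    · exact ⟨.inr j, h⟩
  let e := Equiv.ofBijective τ hτ
  let h : E d × E d → ℝ := fun z => -Real.log ‖z.1 - z.2‖ * (K z.1 * K z.2)
  have i1 := (volume_measurePreserving_piCongrLeft (fun _ : Fin (2 * l) => E d) e).integral_comp'
    (fun u => (∏ j, -Real.log (pairDist u (σ j))) * ∏ i, K (u i))
  have i2 := (volume_measurePreserving_sumPiEquivProdPi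
    (fun _ : Fin l ⊕ Fin l => E d)).integral_comp'
    (fun z : (Fin l → E d) × (Fin l → E d) => ∏ j, h (z.1 j, z.2 j))
  have i3 := (volume_measurePreserving_arrowProdEquivProdArrow (E d) (E d) (Fin l)).integral_comp'
    (fun z : (Fin l → E d) × (Fin l → E d) => ∏ j, h (z.1 j, z.2 j))
  have i4 := integral_fintype_prod_volume_eq_pow (ι := Fin l) h
  rw [Fintype.card_fin] at i4
  rw [logMoment, ← i1, logEnergy, ← i4]
  refine Eq.trans ?_ (i2.trans i3.symm)
  congr 1; funext g
  have hg : ∀ x, (MeasurableEquiv.piCongrLeft (fun _ : Fin (2 * l) => E d) e) g (τ x) = g x :=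
    fun x => Equiv.piCongrLeft_apply_apply (fun _ : Fin (2 * l) => E d) e g x
  have e1 : ∏ i, K ((MeasurableEquiv.piCongrLeft (fun _ : Fin (2 * l) => E d) e) g i) =
      ∏ x, K (g x) := by
    rw [← Equiv.prod_comp e]
    exact Finset.prod_congr rfl fun x _ => by rw [← hg x]; rfl
  have e2 : ∀ j, pairDist ((MeasurableEquiv.piCongrLeft (fun _ : Fin (2 * l) => E d) e) g) (σ j) =
      ‖g (.inl j) - g (.inr j)‖ := fun j => by
    rw [pairDist, ← hg (.inl j), ← hg (.inr j)]; rfl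
  simp only [e2]
  rw [e1, Fintype.prod_sum_type, ← Finset.prod_mul_distrib, ← Finset.prod_mul_distrib]
  rfl

lemma exists_untouched {q n : ℕ} (h : 2 * n < q) (σ : Fin n → IndexPair q) :
    ∃ i, ∀ j, (σ j).1.1 ≠ i ∧ (σ j).1.2 ≠ i := by
  by_contra hcon
  push Not at hcon
  let τ : Fin n ⊕ Fin n → Fin q := Sum.elim (fun j => (σ j).1.1) fun j => (σ j).1.2
  have hτ : Function.Surjective τ := fun i => by
    obtain ⟨j, hj⟩ := hcon i
    by_cases h1 : (σ j).1.1 = i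
    · exact ⟨.inl j, h1⟩
    · exact ⟨.inr j, hj h1⟩
  have := Fintype.card_le_of_surjective τ hτ
  simp at this
  omega

lemma RegularKernel.integrable_logEnergy [NeZero d] (hK : RegularKernel K w p η) :
    Integrable fun z : E d × E d => Real.log ‖z.1 - z.2‖ * (K z.1 * K z.2) := by
  have h := (hK.integrable_prod_log (q := 2) (n := 1) fun _ => ⟨(0, 1), by decide⟩).neg
  have hm := (volume_preserving_finTwoArrow (E d)).symm
  refine ((hm.integrable_comp_emb (MeasurableEquiv.measurableEmbedding _)).2 h).congr
    (ae_of_all _ fun z => ?_)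
  simp [pairDist, Fin.prod_univ_two]

/-- Even order. -/
lemma RegularKernel.interactionIntegral_even_pos [NeZero d] (hK : RegularKernel K w p η)
    (hK0 : ∫ u, K u = 0) {x : E d} (hx : ContinuousAt K x) (hKx : K x ≠ 0) {l : ℕ} (hl : 1 ≤ l)
    {b : ℝ} (hb : 0 < b) (hfin : ∀ s ∈ Ioo 0 b, pairIntegral (2 * l) w s < ⊤) :
    {s ∈ Ioo 0 b | interactionIntegral (2 * l) K s = 0}.Countable ∧
    ∃ δ, 0 < δ ∧ ∀ s ∈ Ioo 0 δ, 0 < interactionIntegral (2 * l) K s := by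
  have hE : 0 < logEnergy K :=
    integral_neg_log_mul_pos hK.integrable hK0 hK.integrable_logEnergy hx hKx
  have hz : ∀ {n} (σ : Fin n → IndexPair (2 * l)),
      (∃ i, ∀ j, (σ j).1.1 ≠ i ∧ (σ j).1.2 ≠ i) → logMoment K σ = 0 := by
    rintro n σ ⟨i, hi⟩
    obtain ⟨k, hk⟩ : ∃ k, 2 * l = k + 1 := ⟨2 * l - 1, by omega⟩
    revert σ i
    rw [hk]
    intro σ i hi
    exact logMoment_eq_zero hK0 σ hi
  refine hK.interactionIntegral_pos (m := l) hb hfin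
    (fun n hn σ => hz σ (exists_untouched (by omega) σ)) (fun σ => ?_) ?_
  · by_cases h : ∃ i, ∀ j, (σ j).1.1 ≠ i ∧ (σ j).1.2 ≠ i
    · exact (hz σ h).ge
    · push Not at h
      rw [logMoment_matching K σ fun i => ?_]
      · positivity
      · obtain ⟨j, hj⟩ := h i
        exact ⟨j, or_iff_not_imp_left.2 hj⟩
  · refine ⟨fun j => ⟨(⟨2 * j, by omega⟩, ⟨2 * j + 1, by omega⟩), by simp [Fin.lt_def]⟩, ?_⟩
    rw [logMoment_matching]
    · positivity
    · intro i
      refine ⟨⟨i / 2, by omega⟩, ?_⟩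
      simp only [Fin.ext_iff]
      omega

lemma RegularKernel.logMoment_three [NeZero d] (hK : RegularKernel K w p η)
    (σ : Fin 2 → IndexPair 3) {c : Fin 3} (k : Equiv.Perm (Fin 2))
    (hσ : ∀ j, ((σ j).1 = (c, c.succAbove (k j))) ∨ ((σ j).1 = (c.succAbove (k j), c))) :
    logMoment K σ = ∫ u, K u * (∫ v, Real.log ‖u - v‖ * K v) ^ 2 := by
  have hdist : ∀ (u : Fin 3 → E d) j, pairDist u (σ j) = ‖u c - u (c.succAbove (k j))‖ := by
    intro u j
    rcases hσ j with h | h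
    · rw [pairDist, h]
    · rw [pairDist, h, norm_sub_rev]
  set Φ : E d × (Fin 2 → E d) → ℝ := fun z =>
    K z.1 * ∏ i, (Real.log ‖z.1 - z.2 i‖ * K (z.2 i)) with hΦ
  have hmp := volume_preserving_piFinSuccAbove (fun _ : Fin 3 => E d) c
  have e : ∀ u : Fin 3 → E d, (∏ j, -Real.log (pairDist u (σ j))) * ∏ i, K (u i) =
      Φ (MeasurableEquiv.piFinSuccAbove (fun _ : Fin 3 => E d) c u) := fun u => by
    change _ = K (u c) * ∏ i, (Real.log ‖u c - u (c.succAbove i)‖ * K (u (c.succAbove i)))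
    simp only [hdist]
    rw [Equiv.prod_comp k fun i => -Real.log ‖u c - u (c.succAbove i)‖, Fin.prod_univ_succAbove _ c,
      Finset.prod_mul_distrib, Fin.prod_univ_two, Fin.prod_univ_two, Fin.prod_univ_two]
    ring
  have hint : Integrable Φ := by
    have h := hK.integrable_prod_log σ
    simp only [e] at h
    exact (hmp.integrable_comp_emb (MeasurableEquiv.measurableEmbedding _)).1 h
  rw [logMoment]
  simp only [e]
  rw [hmp.integral_comp' Φ, Measure.volume_eq_prod, integral_prod _ hint]
  congr 1; funext u
  simp only [hΦ]
  rw [integral_const_mul, integral_fintype_prod_volume_eq_pow (ι := Fin 2)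
    fun v => Real.log ‖u - v‖ * K v, Fintype.card_fin]

lemma three_pairs (x y : IndexPair 3) (h : x ≠ y) : ∃ (c : Fin 3) (k : Equiv.Perm (Fin 2)),
    (x.1 = (c, c.succAbove (k 0)) ∨ x.1 = (c.succAbove (k 0), c)) ∧
      (y.1 = (c, c.succAbove (k 1)) ∨ y.1 = (c.succAbove (k 1), c)) := by
  revert x y
  decide

/-- Order three. -/
lemma RegularKernel.interactionIntegral_three_pos [NeZero d] (hK : RegularKernel K w p η)
    (hK0 : ∫ u, K u = 0) (hpos : 0 < ∫ u, K u * (∫ v, Real.log ‖u - v‖ * K v) ^ 2)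
    {b : ℝ} (hb : 0 < b) (hfin : ∀ s ∈ Ioo 0 b, pairIntegral 3 w s < ⊤) :
    {s ∈ Ioo 0 b | interactionIntegral 3 K s = 0}.Countable ∧
    ∃ δ, 0 < δ ∧ ∀ s ∈ Ioo 0 δ, 0 < interactionIntegral 3 K s := by
  have hz : ∀ {n} (σ : Fin n → IndexPair 3),
      (∃ i, ∀ j, (σ j).1.1 ≠ i ∧ (σ j).1.2 ≠ i) → logMoment K σ = 0 := by
    rintro n σ ⟨i, hi⟩
    exact logMoment_eq_zero hK0 σ hi
  have key : ∀ σ : Fin 2 → IndexPair 3, σ 0 ≠ σ 1 → 0 < logMoment K σ := fun σ h => by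
    obtain ⟨c, k, h0, h1⟩ := three_pairs _ _ h
    rw [hK.logMoment_three σ k (Fin.forall_fin_two.2 ⟨h0, h1⟩)]
    exact hpos
  refine hK.interactionIntegral_pos (m := 2) hb hfin
    (fun n hn σ => hz σ (exists_untouched (by omega) σ)) (fun σ => ?_) ?_
  · by_cases h : σ 0 = σ 1
    · refine (hz σ ?_).ge
      obtain ⟨i, hi⟩ := exists_untouched (by omega : 2 * 1 < 3) fun _ => σ 0
      exact ⟨i, Fin.forall_fin_two.2 ⟨hi 0, h ▸ hi 0⟩⟩
    · exact (key σ h).le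
  · exact ⟨![⟨(0, 1), by decide⟩, ⟨(0, 2), by decide⟩], key _ (by simp)⟩

end MultifractalField

namespace MultifractalField

variable {d : ℕ}

/-! ### The constants -/

lemma sphereArea_pos [NeZero d] : 0 < sphereArea d := by
  have : Nontrivial (E d) := inferInstance
  rw [sphereArea, Measure.real, Measure.toSphere_apply_univ]
  refine ENNReal.toReal_pos ?_ ?_
  · refine mul_ne_zero ?_ (Metric.measure_ball_pos _ _ one_pos).ne'
    simp [NeZero.ne d]
  · exact ENNReal.mul_ne_top (by simp) measure_ball_lt_top.ne

/-- A majorant of the increment of a dipole. -/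
noncomputable def incrMajorant (p D η : ℝ) (e u : E d) : ENNReal :=
  ENNReal.ofReal ((D + 1 + p * 2 ^ (p + 2)) * 2 ^ p) *
    (ENNReal.ofReal (5 ^ η) * incrWeight (p - 1) (p - η) e u)

lemma boundedPotential_incrMajorant [NeZero d] {p D η p' : ℝ} (hp1 : 1 < p) (hp' : 0 < p')
    (hpp : p' < d + 1 - p) (hη : η < p - d) (e : E d) :
    BoundedPotential (incrMajorant p D η e) p' :=
  ((boundedPotential_incrWeight (by linarith) hp' (by linarith) (by linarith) e).const_mul
    ENNReal.ofReal_ne_top).const_mul ENNReal.ofReal_ne_top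

lemma ofReal_abs_mul_rpow_le {p D η c c' : ℝ} (hp : 1 < p) (hD : 0 ≤ D) (hη : 0 ≤ η) {a e : E d}
    (u : E d) (ha : ‖a‖ = 1) (he : ‖e‖ = 1) (hc : |c| ≤ 1) (hc' : |c'| ≤ 1)
    (hcc : 2 ≤ ‖u‖ → |c - c'| ≤ D / ‖u‖) :
    ENNReal.ofReal (|c * dipole p a u - c' * dipole p a (u - e)| * (1 + ‖u‖) ^ η) ≤
      incrMajorant p D η e u := by
  rw [ENNReal.ofReal_mul (abs_nonneg _)]
  refine (mul_le_mul_left (ofReal_abs_dipole_increment_le hp hD u ha he hc hc' hcc) _).trans ?_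
  rw [mul_assoc, incrMajorant]
  exact mul_le_mul_right (incrWeight_mul_le hη he u) _

lemma regularKernel_dipoleIncr [NeZero d] {p η p' : ℝ} (hp1 : 1 < p) (hp' : 0 < p')
    (hpp : p' < d + 1 - p) (hη0 : 0 < η) (hη : η < p - d) {a e : E d} (ha : ‖a‖ = 1)
    (he : ‖e‖ = 1) : RegularKernel (dipoleIncr p a e) (incrMajorant p 0 η e) p' η where
  measurable := measurable_dipoleIncr p a e
  potential := boundedPotential_incrMajorant hp1 hp' hpp hη e
  exponent_pos := hp'
  room_pos := hη0
  bound u := by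
    have := ofReal_abs_mul_rpow_le (c := 1) (c' := 1) hp1 le_rfl hη0.le u ha he (by simp) (by simp)
      (by simp)
    simpa [dipoleIncr] using this

lemma pairIntegral_incrMajorant_lt_top [NeZero d] {p D η s : ℝ} (hp1 : 1 < p) (hη : η < p - d)
    (e : E d) (hs : 0 < s) {l : ℕ} (hl : 1 ≤ l)
    (h1 : l = 1 → s < d + 1 - p) (h2 : 1 < l → (2 * (l : ℝ) - 3 / 2) * s < d + 1 - p) :
    pairIntegral (2 * l) (incrMajorant p D η e) s < ⊤ := by
  rcases hl.eq_or_lt with rfl | hl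
  · obtain ⟨p', h, h'⟩ := exists_between (h1 rfl)
    refine pairIntegral_lt_top (boundedPotential_incrMajorant hp1 (hs.trans h) h' hη e) hs.le
      (hs.trans h).le _ ?_
    norm_num; exact h.le
  · obtain ⟨p', h, h'⟩ := exists_between (h2 hl)
    have hl2 : (2 : ℝ) ≤ l := by exact_mod_cast hl
    have hp0 : 0 < p' := lt_of_le_of_lt (mul_nonneg (by linarith) hs.le) h
    obtain ⟨n, hn, hn1⟩ : ∃ n, 2 * l = n + 2 ∧ 1 ≤ n := ⟨2 * l - 2, by omega, by omega⟩
    rw [hn]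
    refine pairIntegral_add_two_lt_top (boundedPotential_incrMajorant hp1 hp0 h' hη e) hs hn1 ?_
    have : (n : ℝ) + 2 = 2 * l := by exact_mod_cast hn.symm
    rw [show (n : ℝ) + 1 / 2 = 2 * l - 3 / 2 by linarith]
    exact h.le

lemma constC_eq (α R γ₀ : ℝ) (q : ℕ) (j : Fin d) (e : E d) :
    constC d α R γ₀ q j e =
      R ^ ((q : ℝ) * d / 2) * Real.exp ((q : ℝ) * (q - 1) / 2 * γ₀ ^ 2 * rhoRegular d 0) *
      interactionIntegral q (dipoleIncr (d - α + 1) (EuclideanSpace.single j 1) e)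
        (γ₀ ^ 2 * sphereArea d) := by
  rw [constC, interactionIntegral]
  congr 2; funext u
  rw [incrementKernel_eq_dipoleIncr, pairProd]
  congr 1
  refine Finset.prod_congr rfl fun i _ => Finset.prod_congr rfl fun k _ => ?_
  rw [Real.rpow_neg (norm_nonneg _), one_div]

lemma exists_dipoleIncr_ne_zero [NeZero d] {p : ℝ} (hp1 : 1 < p) {a e : E d} (ha : ‖a‖ = 1)
    (he : ‖e‖ = 1) : ∃ x, ContinuousAt (dipoleIncr p a e) x ∧ dipoleIncr p a e x ≠ 0 := by
  set x := (1 / 4 : ℝ) • a with hx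
  have hnx : ‖x‖ = 1 / 4 := by rw [hx, norm_smul, ha]; norm_num
  have hne : 3 / 4 ≤ ‖x - e‖ := by
    have := norm_sub_norm_le e x
    rw [norm_sub_rev] at this
    linarith
  refine ⟨x, ?_, ?_⟩
  · refine (continuousAt_dipole p a (norm_pos_iff.1 (by rw [hnx]; norm_num))).sub ?_
    exact ContinuousAt.comp (g := dipole p a) (continuousAt_dipole p a
      (norm_pos_iff.1 (by linarith))) (by fun_prop)
  · have h1 : dipole p a x = (1 / 4) ^ (-(p - 1)) := by
      rw [dipole, hnx, hx, inner_smul_right, real_inner_self_eq_norm_sq, ha, one_pow, mul_one,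
        show -(p - 1) = 1 + -p by ring, Real.rpow_add (by norm_num), Real.rpow_one]
    have h2 : dipole p a (x - e) ≤ (3 / 4) ^ (-(p - 1)) :=
      ((le_abs_self _).trans (abs_dipole_le hp1.ne' ha _)).trans
        (Real.rpow_le_rpow_of_nonpos (by norm_num) hne (by linarith))
    have h3 : (3 / 4 : ℝ) ^ (-(p - 1)) < (1 / 4) ^ (-(p - 1)) :=
      Real.rpow_lt_rpow_of_neg (by norm_num) (by norm_num) (by linarith)
    rw [dipoleIncr, h1]
    linarith

lemma interactionIntegral_rotate (Q : E d ≃ₗᵢ[ℝ] E d) (q : ℕ) (p s : ℝ) (a e : E d) :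
    interactionIntegral q (dipoleIncr p (Q a) (Q e)) s =
      interactionIntegral q (dipoleIncr p a e) s := by
  have hmp : MeasurePreserving (fun (u : Fin q → E d) i => Q (u i)) :=
    volume_preserving_pi fun _ => Q.measurePreserving
  have hemb : MeasurableEmbedding (fun (u : Fin q → E d) i => Q (u i)) :=
    (MeasurableEquiv.piCongrRight fun _ : Fin q =>
      Q.toHomeomorph.toMeasurableEquiv).measurableEmbedding
  rw [interactionIntegral, ← hmp.integral_comp hemb, interactionIntegral]
  congr 1; funext u
  simp only [pairProd, dipoleIncr, dipole, ← map_sub, Q.norm_map, Q.inner_map_map]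

/-- Countable sets of parameters. -/
lemma countable_coupling {Z : Set ℝ} (hZ : Z.Countable) {ω : ℝ} (hω : 0 < ω) :
    {γ : ℝ | 0 < γ ∧ γ ^ 2 * ω ∈ Z}.Countable := by
  refine MapsTo.countable_of_injOn (t := Z) (f := fun γ => γ ^ 2 * ω) (fun γ h => h.2) ?_ hZ
  intro x hx y hy h
  have h1 : x ^ 2 = y ^ 2 := mul_right_cancel₀ hω.ne' h
  exact (pow_left_inj₀ hx.1.le hy.1.le two_ne_zero).1 h1

lemma exists_coupling {δ ω : ℝ} (hδ : 0 < δ) (hω : 0 < ω) :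
    ∃ η, 0 < η ∧ ∀ γ ∈ Ioo 0 η, γ ^ 2 * ω ∈ Ioo 0 δ := by
  refine ⟨√(δ / ω), by positivity, fun γ h => ⟨by have := h.1; positivity, ?_⟩⟩
  have h2 := (Real.lt_sqrt h.1.le).1 h.2
  rwa [lt_div_iff₀ hω] at h2

lemma exists_exceptional_set {b ω : ℝ} (hω : 0 < ω) {I : ℝ → ℝ}
    (hZ : {s ∈ Ioo 0 b | I s = 0}.Countable) (hpos : ∃ δ, 0 < δ ∧ ∀ s ∈ Ioo 0 δ, 0 < I s) :
    ∃ N : Set ℝ, N.Countable ∧ (∀ γ, 0 < γ → γ ^ 2 * ω < b → γ ∉ N → I (γ ^ 2 * ω) ≠ 0) ∧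
      ∃ δ, 0 < δ ∧ Disjoint N (Ioo 0 δ) ∧ ∀ γ ∈ Ioo 0 δ, 0 < I (γ ^ 2 * ω) := by
  obtain ⟨δ, hδ, hpos⟩ := hpos
  obtain ⟨δ', hδ', h⟩ := exists_coupling hδ hω
  refine ⟨_, countable_coupling hZ hω, fun γ h0 h1 h2 h3 => h2 ⟨h0, ⟨by positivity, h1⟩, h3⟩,
    δ', hδ', ?_, fun γ hγ => hpos _ (h γ hγ)⟩
  exact disjoint_left.2 fun γ h1 h2 => (hpos _ (h γ h2)).ne' h1.2.2

lemma exceptional_set_even [NeZero d] {α : ℝ} (hα₀ : 0 < α) (hα₁ : α < 1) {l : ℕ} (hl : 1 ≤ l)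
    (j : Fin d) {e : E d} (he : ‖e‖ = 1) :
    ∃ N : Set ℝ, N.Countable ∧
      (∀ γ₀ : ℝ, 0 < γ₀ → Admissible d α l γ₀ → γ₀ ∉ N →
        ∀ R : ℝ, 0 < R → constC d α R γ₀ (2 * l) j e ≠ 0) ∧
      ∃ δ : ℝ, 0 < δ ∧ Disjoint N (Set.Ioo 0 δ) ∧
        ∀ γ₀ ∈ Set.Ioo 0 δ, ∀ R : ℝ, 0 < R → 0 < constC d α R γ₀ (2 * l) j e := by
  have hd : (1 : ℝ) ≤ d := by exact_mod_cast NeZero.one_le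
  set p := (d : ℝ) - α + 1 with hp
  have hp1 : 1 < p := by linarith
  set a : E d := EuclideanSpace.single j 1 with ha
  have ha1 : ‖a‖ = 1 := by simp [ha]
  set η := (p - d) / 2
  have hK := regularKernel_dipoleIncr (η := η) (p' := α / 2) hp1 (by linarith) (by linarith)
    (by simp only [η]; linarith) (by simp only [η]; linarith) ha1 he
  obtain ⟨x, hx, hKx⟩ := exists_dipoleIncr_ne_zero hp1 ha1 he
  have hl' : (1 : ℝ) ≤ l := by exact_mod_cast hl
  set b : ℝ := if l = 1 then α else α / (2 * l - 3 / 2) with hb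
  have hb0 : 0 < b := by
    rw [hb]; split_ifs
    · exact hα₀
    · exact div_pos hα₀ (by linarith)
  obtain ⟨h1, h2⟩ := hK.interactionIntegral_even_pos
    (integral_dipoleIncr hp1 (by linarith) (by linarith) ha1 he) hx hKx hl hb0 fun s hs => by
      refine pairIntegral_incrMajorant_lt_top hp1 (by simp only [η]; linarith) e hs.1 hl
        (fun h => ?_) fun h => ?_
      · have := hs.2; rw [hb, if_pos h] at this; linarith
      · have := hs.2
        rw [hb, if_neg (by omega), lt_div_iff₀ (by linarith)] at this
        linarith
  obtain ⟨N, hN, hN1, δ, hδ, hN2, hN3⟩ := exists_exceptional_set (sphereArea_pos (d := d)) h1 h2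
  refine ⟨N, hN, fun γ hγ had hγN R hR => ?_, δ, hδ, hN2, fun γ hγ R hR => ?_⟩
  · rw [constC_eq]
    refine mul_ne_zero (by positivity) (hN1 γ hγ ?_ hγN)
    rw [hb]
    split_ifs with h
    · exact had.1 h
    · rw [lt_div_iff₀ (by linarith), mul_comm]
      exact (had.2 (by omega)).trans_le (min_le_left _ _)
  · rw [constC_eq]
    have := hN3 γ hγ
    positivity

/-- The exceptional set of order three. -/
lemma exceptional_set_three [NeZero d] {α : ℝ} (hα₀ : 0 < α) (hα₁ : α < 1) :
    ∃ N : Set ℝ, N.Countable ∧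
      (∀ γ₀ : ℝ, 0 < γ₀ → Admissible d α 2 γ₀ → γ₀ ∉ N → ∀ e : E d, ‖e‖ = 1 →
        interactionIntegral 3 (dipoleIncr (d - α + 1) e e) (γ₀ ^ 2 * sphereArea d) ≠ 0) ∧
      ∃ δ : ℝ, 0 < δ ∧ Disjoint N (Set.Ioo 0 δ) ∧
        ∀ γ₀ ∈ Set.Ioo 0 δ, ∀ e : E d, ‖e‖ = 1 →
          0 < interactionIntegral 3 (dipoleIncr (d - α + 1) e e) (γ₀ ^ 2 * sphereArea d) := by
  have hd : (1 : ℝ) ≤ d := by exact_mod_cast NeZero.one_le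
  set p := (d : ℝ) - α + 1 with hp
  have hp1 : 1 < p := by linarith
  set a : E d := EuclideanSpace.single 0 1 with ha
  have ha1 : ‖a‖ = 1 := by simp [ha]
  set η := (p - d) / 2
  have hK := regularKernel_dipoleIncr (η := η) (p' := α / 2) hp1 (by linarith) (by linarith)
    (by simp only [η]; linarith) (by simp only [η]; linarith) ha1 ha1
  obtain ⟨h1, h2⟩ := hK.interactionIntegral_three_pos
    (integral_dipoleIncr hp1 (by linarith) (by linarith) ha1 ha1)
    (integral_dipoleIncr_mul_logPot_sq_pos hp1 (by linarith) (by linarith) ha1)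
    (b := α / (5 / 2)) (by linarith) fun s hs => by
      obtain ⟨p', h, h'⟩ := exists_between hs.2
      refine pairIntegral_lt_top (p := 5 / 2 * p') (boundedPotential_incrMajorant hp1
        (by linarith [hs.1]) (by linarith) (by simp only [η]; linarith) a) hs.1.le
        (by linarith [hs.1]) _ ?_
      push_cast; linarith [hs.1]
  obtain ⟨N, hN, hN1, δ, hδ, hN2, hN3⟩ := exists_exceptional_set (sphereArea_pos (d := d)) h1 h2
  have hrot : ∀ (e : E d), ‖e‖ = 1 → ∀ s, interactionIntegral 3 (dipoleIncr p e e) s =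
      interactionIntegral 3 (dipoleIncr p a a) s := fun e he s => by
    obtain ⟨Q, rfl⟩ := exists_linearIsometryEquiv_map_eq (ha1.trans he.symm)
    exact interactionIntegral_rotate Q 3 p s a a
  refine ⟨N, hN, fun γ hγ had hγN e he => ?_, δ, hδ, hN2, fun γ hγ e he => ?_⟩
  · rw [hrot e he]
    refine hN1 γ hγ ?_ hγN
    have := (had.2 (by norm_num)).trans_le (min_le_left _ _)
    push_cast at this
    linarith
  · rw [hrot e he]
    exact hN3 γ hγ

/-! ### Distributions as functionals of jets -/

/-- The space of distributions on `ℝ^d`. -/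
abbrev Dist (d : ℕ) : Type := 𝓓'((⊤ : TopologicalSpace.Opens (E d)), ℝ)

lemma exists_extension_of_abs_le {X V : Type*} [AddCommGroup X] [Module ℝ X]
    [NormedAddCommGroup V] [NormedSpace ℝ V] (J : X →ₗ[ℝ] V) (hJ : Function.Injective J)
    (ℓ : X →ₗ[ℝ] ℝ) {C : ℝ} (hb : ∀ f, |ℓ f| ≤ C * ‖J f‖) :
    ∃ Λ : V →L[ℝ] ℝ, ∀ f, ℓ f = Λ (J f) := by
  let e := LinearEquiv.ofInjective J hJ
  let g : LinearMap.range J →L[ℝ] ℝ := (ℓ.comp e.symm.toLinearMap).mkContinuous C fun x => by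
    obtain ⟨f, rfl⟩ := e.surjective x
    change |ℓ (e.symm (e f))| ≤ _
    rw [e.symm_apply_apply]
    exact hb f
  obtain ⟨Λ, hΛ, -⟩ := exists_extension_norm_eq (LinearMap.range J) g
  refine ⟨Λ, fun f => Eq.trans ?_ (hΛ (e f)).symm⟩
  change ℓ f = ℓ (e.symm (e f))
  rw [e.symm_apply_apply]

set_option synthInstance.maxHeartbeats 200000 in
set_option maxHeartbeats 800000 in
lemma exists_jet_functional (T : Dist d) (K : TopologicalSpace.Compacts (E d)) :
    ∃ (s : Finset ℕ) (Λ : (∀ i : s, BoundedContinuousFunction (E d) (E d [×(i : ℕ)]→L[ℝ] ℝ)) →L[ℝ] ℝ),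
      ∀ f : 𝓓_{K}(E d, ℝ), T (TestFunction.ofSupportedIn (subset_univ _) f) =
        Λ fun i => ContDiffMapSupportedIn.structureMapLM ℝ ⊤ (i : ℕ) f := by
  let ℓ : 𝓓_{K}(E d, ℝ) →ₗ[ℝ] ℝ :=
    { toFun := fun f => T (TestFunction.ofSupportedInCLM ℝ
        (subset_univ _ : (K : Set (E d)) ⊆ (⊤ : TopologicalSpace.Opens (E d))) f)
      map_add' := fun f g => by rw [map_add, map_add]
      map_smul' := fun c f => by rw [map_smul, map_smul]; rfl }
  have hℓ : Continuous ℓ := T.continuous.comp (ContinuousLinearMap.continuous _)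
  obtain ⟨s, C, -, hC⟩ := Seminorm.bound_of_continuous
    (ContDiffMapSupportedIn.withSeminorms ℝ (E d) ℝ ⊤ K)
    ((normSeminorm ℝ ℝ).comp ℓ) (by exact continuous_norm.comp hℓ)
  let J : 𝓓_{K}(E d, ℝ) →ₗ[ℝ]
      (∀ i : (insert 0 s : Finset ℕ), BoundedContinuousFunction (E d) (E d [×(i : ℕ)]→L[ℝ] ℝ)) :=
    LinearMap.pi fun i => ContDiffMapSupportedIn.structureMapLM ℝ ⊤ (i : ℕ)
  have hJ : Function.Injective J := fun f g h =>
    ContDiffMapSupportedIn.structureMapLM_zero_injective ℝ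
      (congrFun h ⟨0, Finset.mem_insert_self _ _⟩)
  have hb : ∀ f, |ℓ f| ≤ C * ‖J f‖ := fun f => by
    refine (hC f).trans ?_
    rw [smul_apply, NNReal.smul_def, smul_eq_mul]
    refine mul_le_mul_of_nonneg_left ?_ C.2
    refine Seminorm.finset_sup_apply_le (norm_nonneg _) fun i hi => ?_
    exact norm_le_pi_norm (J f) ⟨i, Finset.mem_insert_of_mem hi⟩
  obtain ⟨Λ, hΛ⟩ := exists_extension_of_abs_le (V := ∀ i : (insert 0 s : Finset ℕ),
    BoundedContinuousFunction (E d) (E d [×(i : ℕ)]→L[ℝ] ℝ)) J hJ ℓ (C := C) hb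
  exact ⟨insert 0 s, Λ, hΛ⟩

section Translate

/-- The reflected translate `x ↦ g (y - x)` of a continuous function with compact support. -/
noncomputable def reflTranslate {F : Type} [NormedAddCommGroup F] (g : E d → F)
    (hg : Continuous g) (hc : HasCompactSupport g) (y : E d) :
    BoundedContinuousFunction (E d) F :=
  BoundedContinuousFunction.ofNormedAddCommGroup (fun x => g (y - x)) (by fun_prop)
    (hg.bounded_above_of_compact_support hc).choose
    fun x => (hg.bounded_above_of_compact_support hc).choose_spec (y - x)

lemma exists_dist_lt_of_hasCompactSupport {F : Type*} [NormedAddCommGroup F] {g : E d → F}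
    (hg : Continuous g) (hc : HasCompactSupport g) {ε : ℝ} (hε : 0 < ε) :
    ∃ δ > 0, ∀ x y, dist x y < δ → dist (g x) (g y) < ε := by
  obtain ⟨δ, hδ, h⟩ := Metric.uniformContinuous_iff.1
    (hg.uniformContinuous_of_tendsto_cocompact hc.is_zero_at_infty) ε hε
  exact ⟨δ, hδ, fun x y hxy => h hxy⟩

variable {F : Type} [NormedAddCommGroup F] [NormedSpace ℝ F]

/-- Evaluation of a bounded continuous family of linear maps, as a linear map. -/
noncomputable def evalBCF : BoundedContinuousFunction (E d) (E d →L[ℝ] F) →L[ℝ]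
    E d →L[ℝ] BoundedContinuousFunction (E d) F :=
  LinearMap.mkContinuous₂
    (LinearMap.mk₂ ℝ (fun f h =>
        (ContinuousLinearMap.apply ℝ F h).compLeftContinuousBounded (E d) f)
      (fun f f' h => by ext x; simp) (fun c f h => by ext x; simp) (fun f h h' => by ext x; simp)
      (fun c f h => by ext x; simp)) 1 fun f h => by
    rw [one_mul]
    refine (BoundedContinuousFunction.norm_le (by positivity)).2 fun x => ?_
    exact (ContinuousLinearMap.le_opNorm (f x) h).trans
      (mul_le_mul_of_nonneg_right (BoundedContinuousFunction.norm_coe_le_norm _ x)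
        (norm_nonneg _))

lemma hasFDerivAt_reflTranslate {g : E d → F} (hg : ContDiff ℝ 1 g) (hc : HasCompactSupport g)
    (y : E d) : HasFDerivAt (reflTranslate g hg.continuous hc)
      (evalBCF (reflTranslate (fderiv ℝ g) (hg.continuous_fderiv one_ne_zero) (hc.fderiv ℝ) y))
      y := by
  rw [hasFDerivAt_iff_isLittleO, Asymptotics.isLittleO_iff]
  intro ε hε
  obtain ⟨δ, hδ, hu⟩ := exists_dist_lt_of_hasCompactSupport (hg.continuous_fderiv one_ne_zero)
    (hc.fderiv ℝ) hε
  filter_upwards [Metric.ball_mem_nhds y hδ] with y' hy'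
  refine (BoundedContinuousFunction.norm_le (by positivity)).2 fun x => ?_
  change ‖g (y' - x) - g (y - x) - fderiv ℝ g (y - x) (y' - y)‖ ≤ ε * ‖y' - y‖
  have := (convex_ball (y - x) δ).norm_image_sub_le_of_norm_fderiv_le' (𝕜 := ℝ) (f := g)
    (φ := fderiv ℝ g (y - x)) (C := ε) (x := y - x) (y := y' - x)
    (fun z _ => (hg.differentiable one_ne_zero) z)
    (fun z hz => by rw [← dist_eq_norm]; exact (hu _ _ hz).le) (Metric.mem_ball_self hδ)
    (by simpa [dist_eq_norm] using hy')
  simpa using this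

end Translate

lemma contDiff_reflTranslate (n : ℕ) {F : Type} [NormedAddCommGroup F] [NormedSpace ℝ F]
    {g : E d → F} (hg : ContDiff ℝ (⊤ : ℕ∞) g) (hc : HasCompactSupport g) :
    ContDiff ℝ n (reflTranslate g hg.continuous hc) := by
  induction n generalizing F with
  | zero =>
    refine contDiff_zero.2 (continuous_iff_continuousAt.2 fun y => ?_)
    exact (hasFDerivAt_reflTranslate (hg.of_le (by simp)) hc y).continuousAt
  | succ n ih =>
    have hd := fun y => hasFDerivAt_reflTranslate (hg.of_le (by simp)) hc y
    have hg' : ContDiff ℝ (⊤ : ℕ∞) (fderiv ℝ g) := hg.fderiv_right (by simp)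
    rw [Nat.cast_add, Nat.cast_one, contDiff_succ_iff_fderiv]
    refine ⟨fun y => (hd y).differentiableAt, by simp, ?_⟩
    have e : fderiv ℝ (reflTranslate g hg.continuous hc) = fun y =>
        evalBCF (reflTranslate (fderiv ℝ g) hg'.continuous (hc.fderiv ℝ) y) := by
      funext y
      rw [(hd y).fderiv]
    rw [e]
    exact evalBCF.contDiff.comp (ih hg' (hc.fderiv ℝ))

/-! ### Mollifiers -/

section Mollify

variable {θ : E d → ℝ} {ε : ℝ}

lemma contDiff_mollify (hθ : IsMollifier θ) (ε : ℝ) : ContDiff ℝ (⊤ : ℕ∞) (mollify θ ε) :=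
  contDiff_const.mul (hθ.smooth.comp (contDiff_const_smul _))

lemma mollify_nonneg (hθ : IsMollifier θ) (hε : 0 < ε) (x : E d) : 0 ≤ mollify θ ε x :=
  mul_nonneg (by positivity) (hθ.nonneg _)

lemma mollify_eq_zero (hθ : IsMollifier θ) (hε : 0 < ε) {x : E d} (hx : ε < ‖x‖) :
    mollify θ ε x = 0 := by
  rw [mollify, hθ.eq_zero, mul_zero]
  rw [norm_smul, Real.norm_of_nonneg (by positivity), ← div_eq_inv_mul, lt_div_iff₀ hε]
  linarith

lemma mollify_radial (hθ : IsMollifier θ) {x y : E d} (h : ‖x‖ = ‖y‖) :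
    mollify θ ε x = mollify θ ε y := by
  rw [mollify, mollify, hθ.radial (ε⁻¹ • x) (ε⁻¹ • y) (by rw [norm_smul, norm_smul, h])]

lemma mollify_neg (hθ : IsMollifier θ) (x : E d) : mollify θ ε (-x) = mollify θ ε x :=
  mollify_radial hθ (norm_neg x)

lemma support_mollify_subset (hθ : IsMollifier θ) (hε : 0 < ε) :
    Function.support (mollify θ ε) ⊆ Metric.closedBall 0 ε := fun x hx => by
  rw [mem_closedBall_zero_iff]
  by_contra h
  exact hx (mollify_eq_zero hθ hε (not_le.1 h))

lemma hasCompactSupport_mollify (hθ : IsMollifier θ) (hε : 0 < ε) :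
    HasCompactSupport (mollify θ ε) :=
  HasCompactSupport.of_support_subset_isCompact (isCompact_closedBall 0 ε)
    (support_mollify_subset hθ hε)

lemma integral_mollify (hθ : IsMollifier θ) (hε : 0 < ε) : ∫ x, mollify θ ε x = 1 := by
  simp only [mollify]
  rw [integral_const_mul, Measure.integral_comp_inv_smul, hθ.integral_eq_one, finrank_euclideanSpace_fin,
    abs_of_pos (by positivity), smul_eq_mul, mul_one, one_div, inv_mul_cancel₀ (by positivity)]

lemma integrable_mollify (hθ : IsMollifier θ) (hε : 0 < ε) : Integrable (mollify θ ε) :=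
  (contDiff_mollify hθ ε).continuous.integrable_of_hasCompactSupport
    (hasCompactSupport_mollify hθ hε)

end Mollify

/-! ### Regularization of distributions -/

lemma iteratedFDeriv_convolution_lsmul {f g : E d → ℝ} (hf : LocallyIntegrable f)
    (hg : ContDiff ℝ (⊤ : ℕ∞) g) (hc : HasCompactSupport g) (i : ℕ) :
    iteratedFDeriv ℝ i (f ⋆[ContinuousLinearMap.lsmul ℝ ℝ, volume] g) =
      f ⋆[ContinuousLinearMap.lsmul ℝ ℝ, volume] iteratedFDeriv ℝ i g := by
  induction i with
  | zero =>
    funext x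
    rw [iteratedFDeriv_zero_eq_comp, iteratedFDeriv_zero_eq_comp]
    exact ((continuousMultilinearCurryFin0 ℝ (E d) ℝ).symm.toLinearIsometry.integral_comp_comm
      fun t => f t • g (x - t)).symm
  | succ i ih =>
    funext x
    have hgi : ContDiff ℝ (⊤ : ℕ∞) (iteratedFDeriv ℝ i g) := hg.iteratedFDeriv_right (mod_cast le_top)
    have h := (hc.iteratedFDeriv i).hasFDerivAt_convolution_right
      (ContinuousLinearMap.lsmul ℝ ℝ) (μ := volume) hf (hgi.of_le (by simp)) x
    rw [iteratedFDeriv_succ_eq_comp_left, iteratedFDeriv_succ_eq_comp_left, Function.comp, ih,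
      h.fderiv]
    refine ((continuousMultilinearCurryLeftEquiv ℝ (fun _ : Fin (i + 1) => E d)
      ℝ).symm.toLinearIsometry.integral_comp_comm fun t =>
        ((ContinuousLinearMap.lsmul ℝ ℝ).precompR (E d)) (f t)
          (fderiv ℝ (iteratedFDeriv ℝ i g) (x - t))).symm.trans ?_
    refine integral_congr_ae (.of_forall fun t => ?_)
    ext m
    rfl

variable (T : Dist d)

lemma pairing_of_test {f : E d → ℝ} (hf : ContDiff ℝ (⊤ : ℕ∞) f) (hc : HasCompactSupport f) :
    pairing T f = T ⟨f, hf, hc, fun _ _ => trivial⟩ := dif_pos ⟨hf, hc⟩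

lemma contDiff_refl {f : E d → ℝ} (hf : ContDiff ℝ (⊤ : ℕ∞) f) (y : E d) :
    ContDiff ℝ (⊤ : ℕ∞) fun x => f (y - x) := hf.comp (contDiff_const.sub contDiff_id)

lemma hasCompactSupport_refl {F : Type*} [Zero F] {f : E d → F} (hc : HasCompactSupport f)
    (y : E d) : HasCompactSupport fun x => f (y - x) :=
  hc.comp_homeomorph (Homeomorph.subLeft y)

/-- The jets of the reflection of a function. -/
noncomputable def reflJet (f : E d → ℝ) (i : ℕ) (z : E d) : E d [×i]→L[ℝ] ℝ :=
  iteratedFDeriv ℝ i (fun x => f (-x)) (-z)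

lemma contDiff_reflJet {f : E d → ℝ} (hf : ContDiff ℝ (⊤ : ℕ∞) f) (i : ℕ) :
    ContDiff ℝ (⊤ : ℕ∞) (reflJet f i) :=
  ((hf.comp contDiff_neg).iteratedFDeriv_right (i := i) (mod_cast le_top)).comp contDiff_neg

lemma hasCompactSupport_reflJet {f : E d → ℝ} (hc : HasCompactSupport f) (i : ℕ) :
    HasCompactSupport (reflJet f i) :=
  ((hc.comp_homeomorph (Homeomorph.neg (E d))).iteratedFDeriv (𝕜 := ℝ) i).comp_homeomorph
    (Homeomorph.neg (E d))

lemma iteratedFDeriv_refl (f : E d → ℝ) (i : ℕ) (x y : E d) :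
    iteratedFDeriv ℝ i (fun x => f (y - x)) x = reflJet f i (y - x) := by
  have := iteratedFDeriv_comp_sub (𝕜 := ℝ) (f := fun x => f (-x)) i y x
  simpa [reflJet] using this

lemma exists_pairing_refl_eq (r : ℝ) : ∃ (s : Finset ℕ)
    (Λ : (∀ i : s, BoundedContinuousFunction (E d) (E d [×(i : ℕ)]→L[ℝ] ℝ)) →L[ℝ] ℝ),
    (∀ (f : E d → ℝ) (hf : ContDiff ℝ (⊤ : ℕ∞) f) (hc : HasCompactSupport f) (y : E d),
      Function.support (fun x => f (y - x)) ⊆ Metric.closedBall 0 r →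
      pairing T (fun x => f (y - x)) = Λ fun i => reflTranslate (reflJet f i)
        (contDiff_reflJet hf i).continuous (hasCompactSupport_reflJet hc i) y) ∧
    ∀ (f : E d → ℝ) (hf : ContDiff ℝ (⊤ : ℕ∞) f) (hc : HasCompactSupport f),
      Function.support f ⊆ Metric.closedBall 0 r →
      pairing T f = Λ fun i => BoundedContinuousFunction.ofNormedAddCommGroup
        (iteratedFDeriv ℝ i f) (hf.continuous_iteratedFDeriv (mod_cast le_top))
        ((hf.continuous_iteratedFDeriv (mod_cast le_top)).bounded_above_of_compact_support
          (hc.iteratedFDeriv i)).choose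
        ((hf.continuous_iteratedFDeriv (mod_cast le_top)).bounded_above_of_compact_support
          (hc.iteratedFDeriv i)).choose_spec := by
  obtain ⟨s, Λ, h⟩ := exists_jet_functional T ⟨Metric.closedBall 0 r, isCompact_closedBall 0 r⟩
  refine ⟨s, Λ, fun f hf hc y hs => ?_, fun f hf hc hs => ?_⟩
  · rw [pairing_of_test T (contDiff_refl hf y) (hasCompactSupport_refl hc y)]
    refine (h (.of_support_subset (contDiff_refl hf y) hs)).trans ?_
    congr 1; funext i; ext1 x
    rw [ContDiffMapSupportedIn.structureMapLM_top_apply]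
    exact iteratedFDeriv_refl f i x y
  · rw [pairing_of_test T hf hc]
    exact h (.of_support_subset hf hs)

end MultifractalField

namespace MultifractalField

variable {d : ℕ}

lemma exists_support_subset_closedBall {F : Type*} [Zero F] {f : E d → F}
    (hc : HasCompactSupport f) : ∃ r, Function.support f ⊆ Metric.closedBall 0 r := by
  obtain ⟨r, hr⟩ := hc.isBounded.subset_closedBall 0
  exact ⟨r, (subset_tsupport f).trans hr⟩

lemma support_refl_subset {f : E d → ℝ} {r b : ℝ} (hs : Function.support f ⊆ Metric.closedBall 0 r)
    {y : E d} (hy : ‖y‖ ≤ b) :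
    Function.support (fun x => f (y - x)) ⊆ Metric.closedBall 0 (b + r) := fun x hx => by
  have h : ‖y - x‖ ≤ r := mem_closedBall_zero_iff.1 (hs hx)
  rw [mem_closedBall_zero_iff]
  have := norm_sub_le y (y - x)
  rw [sub_sub_cancel] at this
  linarith

/-- Finite families of derivatives of bounded continuous functions. -/
abbrev JetSpace (d : ℕ) (s : Finset ℕ) : Type :=
  ∀ i : s, BoundedContinuousFunction (E d) (E d [×(i : ℕ)]→L[ℝ] ℝ)

set_option synthInstance.maxHeartbeats 400000 in
noncomputable instance (s : Finset ℕ) : NormedAddCommGroup (JetSpace d s) := inferInstance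

set_option synthInstance.maxHeartbeats 400000 in
noncomputable instance (s : Finset ℕ) : NormedSpace ℝ (JetSpace d s) := inferInstance

set_option synthInstance.maxHeartbeats 400000 in
/-- The regularization of a distribution by a test function is smooth. -/
lemma contDiff_pairing_refl (T : Dist d) {f : E d → ℝ} (hf : ContDiff ℝ (⊤ : ℕ∞) f)
    (hc : HasCompactSupport f) : ContDiff ℝ (⊤ : ℕ∞) fun y => pairing T fun σ => f (y - σ) := by
  obtain ⟨r, hr⟩ := exists_support_subset_closedBall hc
  refine contDiff_iff_contDiffAt.2 fun y₀ => ?_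
  obtain ⟨s, Λ, h, -⟩ := exists_pairing_refl_eq T (‖y₀‖ + 1 + r)
  have hΛ : ContDiff ℝ (⊤ : ℕ∞) fun y => Λ fun i : s => reflTranslate (reflJet f i)
      (contDiff_reflJet hf i).continuous (hasCompactSupport_reflJet hc i) y :=
    Λ.contDiff.comp (contDiff_pi.2 fun i => contDiff_infty.2 fun n =>
      contDiff_reflTranslate n (contDiff_reflJet hf i) (hasCompactSupport_reflJet hc i))
  refine hΛ.contDiffAt.congr_of_eventuallyEq ?_
  filter_upwards [Metric.ball_mem_nhds y₀ one_pos] with y hy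
  refine h f hf hc y (support_refl_subset hr ?_)
  rw [Metric.mem_ball, dist_eq_norm] at hy
  linarith [norm_le_norm_add_norm_sub' y y₀]

lemma continuous_pairing_refl (T : Dist d) {f : E d → ℝ} (hf : ContDiff ℝ (⊤ : ℕ∞) f)
    (hc : HasCompactSupport f) : Continuous fun y => pairing T fun σ => f (y - σ) :=
  (contDiff_pairing_refl T hf hc).continuous

lemma reflJet_eq_of_even {f : E d → ℝ} (hf : ∀ x, f (-x) = f x) (i : ℕ) (z : E d) :
    reflJet f i z = iteratedFDeriv ℝ i f (-z) := by
  rw [reflJet, funext hf]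

lemma integral_mul_reflJet {ϑ ψ : E d → ℝ} (hϑ : ContDiff ℝ (⊤ : ℕ∞) ϑ) (hϑc : HasCompactSupport ϑ)
    (he : ∀ x, ϑ (-x) = ϑ x) (hψ : ContDiff ℝ (⊤ : ℕ∞) ψ) (hψc : HasCompactSupport ψ) (i : ℕ)
    (x : E d) : ∫ y, ψ y • reflJet ϑ i (y - x) =
      (ϑ ⋆[ContinuousLinearMap.lsmul ℝ ℝ, volume] iteratedFDeriv ℝ i ψ) x := by
  have h1 := iteratedFDeriv_convolution_lsmul (hψ.continuous.locallyIntegrable) hϑ hϑc i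
  have h2 := iteratedFDeriv_convolution_lsmul (hϑ.continuous.locallyIntegrable) hψ hψc i
  have h3 : (ψ ⋆[ContinuousLinearMap.lsmul ℝ ℝ, volume] ϑ) =
      (ϑ ⋆[ContinuousLinearMap.lsmul ℝ ℝ, volume] ψ) := by
    funext z
    rw [convolution_lsmul_swap, convolution_def]
    exact integral_congr_ae (.of_forall fun t => by simp [mul_comm])
  rw [← h2, ← h3, h1, convolution_def]
  refine integral_congr_ae (.of_forall fun t => ?_)
  simp only [ContinuousLinearMap.lsmul_apply]
  rw [reflJet_eq_of_even he, neg_sub]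

set_option synthInstance.maxHeartbeats 400000 in
set_option maxHeartbeats 1000000 in
/-- The distribution is the limit of its regularizations. -/
lemma tendsto_integral_mul_pairing (T : Dist d) {θ : E d → ℝ} (hθ : IsMollifier θ) {ψ : E d → ℝ}
    (hψ : ContDiff ℝ (⊤ : ℕ∞) ψ) (hψc : HasCompactSupport ψ) :
    Tendsto (fun η : ℝ => ∫ y, ψ y * pairing T fun σ => mollify θ η (y - σ)) (𝓝[>] 0)
      (𝓝 (pairing T ψ)) := by
  obtain ⟨r, hr⟩ := exists_support_subset_closedBall hψc
  obtain ⟨s, Λ, h, h'⟩ := exists_pairing_refl_eq T (r + 1)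
  have hr1 : Function.support ψ ⊆ Metric.closedBall 0 (r + 1) :=
    hr.trans (Metric.closedBall_subset_closedBall (by linarith))
  let J : ℝ → E d → JetSpace d s := fun η y => if hη : 0 < η then fun i => reflTranslate (reflJet (mollify θ η) i)
    (contDiff_reflJet (contDiff_mollify hθ η) i).continuous
    (hasCompactSupport_reflJet (hasCompactSupport_mollify hθ hη) i) y else 0
  have hJc : ∀ η, 0 < η → Continuous (J η) := fun η hη => by
    simp only [J, dif_pos hη]
    exact continuous_pi fun i => (contDiff_reflTranslate 0
      (contDiff_reflJet (contDiff_mollify hθ η) i)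
      (hasCompactSupport_reflJet (hasCompactSupport_mollify hθ hη) i)).continuous
  have hint : ∀ η, 0 < η → Integrable fun y => ψ y • J η y := fun η hη =>
    (hψ.continuous.smul (hJc η hη)).integrable_of_hasCompactSupport hψc.smul_right
  rw [h' ψ hψ hψc hr1]
  have key : ∀ᶠ η in 𝓝[>] (0 : ℝ), Λ (∫ y, ψ y • J η y) =
      ∫ y, ψ y * pairing T fun σ => mollify θ η (y - σ) := by
    filter_upwards [Ioo_mem_nhdsGT one_pos] with η hη
    rw [← ContinuousLinearMap.integral_comp_comm Λ (hint η hη.1)]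
    refine integral_congr_ae (.of_forall fun y => ?_)
    simp only [map_smul, smul_eq_mul]
    by_cases hy : ψ y = 0
    · rw [hy, zero_mul, zero_mul]
    · rw [h _ (contDiff_mollify hθ η) (hasCompactSupport_mollify hθ hη.1) y]
      · simp only [J, dif_pos hη.1]
      · refine (support_refl_subset (support_mollify_subset hθ hη.1)
          (mem_closedBall_zero_iff.1 (hr hy))).trans (Metric.closedBall_subset_closedBall ?_)
        linarith [hη.2]
  refine Tendsto.congr' key ((Λ.continuous.tendsto _).comp (tendsto_pi_nhds.2 fun i => ?_))
  rw [Metric.tendsto_nhds]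
  intro ε hε
  have hci : Continuous (iteratedFDeriv ℝ i ψ) := hψ.continuous_iteratedFDeriv (mod_cast le_top)
  obtain ⟨δ, hδ, hu⟩ := exists_dist_lt_of_hasCompactSupport hci
    (hψc.iteratedFDeriv (𝕜 := ℝ) i) (half_pos hε)
  filter_upwards [Ioo_mem_nhdsGT hδ] with η hη
  refine lt_of_le_of_lt ?_ (half_lt_self hε)
  refine (BoundedContinuousFunction.dist_le (by positivity)).2 fun x => ?_
  have e1 : (∫ y, ψ y • J η y) i x =
      (mollify θ η ⋆[ContinuousLinearMap.lsmul ℝ ℝ, volume] iteratedFDeriv ℝ i ψ) x := by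
    rw [← integral_mul_reflJet (contDiff_mollify hθ η) (hasCompactSupport_mollify hθ hη.1)
      (mollify_neg hθ) hψ hψc]
    have := ContinuousLinearMap.integral_comp_comm
      ((BoundedContinuousFunction.evalCLM ℝ x).comp (ContinuousLinearMap.proj (R := ℝ)
        (φ := fun i : s => BoundedContinuousFunction (E d) (E d [×(i : ℕ)]→L[ℝ] ℝ)) i)) (hint η hη.1)
    refine this.symm.trans (integral_congr_ae (.of_forall fun y => ?_))
    simp only [J, dif_pos hη.1]
    rfl
  rw [e1]
  exact dist_convolution_le (R := δ) (by positivity)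
    ((support_mollify_subset hθ hη.1).trans (Metric.closedBall_subset_ball hη.2))
    (mollify_nonneg hθ hη.1) (integral_mollify hθ hη.1) hci.aestronglyMeasurable
    fun y hy => (hu y x hy).le

/-! ### Gaussian families -/

section Gaussian

variable {V Ω : Type*} [AddCommGroup V] [Module ℝ V] [MeasurableSpace Ω]

/-- A linear family of centred Gaussian variables with covariance `B`. -/
structure IsGaussianFamily (W : V → Ω → ℝ) (B : V →ₗ[ℝ] V →ₗ[ℝ] ℝ) (μ : Measure Ω) : Prop where
  add : ∀ f g ω, W (f + g) ω = W f ω + W g ω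
  smul : ∀ (c : ℝ) f ω, W (c • f) ω = c * W f ω
  symm : ∀ f g, B f g = B g f
  aemeasurable : ∀ f, AEMeasurable (W f) μ
  integrable_exp : ∀ f, Integrable (fun ω => Real.exp (W f ω)) μ
  integral_exp : ∀ f, ∫ ω, Real.exp (W f ω) ∂μ = Real.exp (B f f / 2)

variable {W : V → Ω → ℝ} {B : V →ₗ[ℝ] V →ₗ[ℝ] ℝ} {μ : Measure Ω}

/-- Variables all of whose exponential tilts are integrable. -/
def ExpIntegrable (W : V → Ω → ℝ) (μ : Measure Ω) (Y : Ω → ℝ) : Prop :=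
  ∀ S, Integrable (fun ω => Y ω * Real.exp (W S ω)) μ

lemma abs_mul_exp_le {x t : ℝ} (ht : |t| ≤ 1) :
    |x| * Real.exp (t * x) ≤ Real.exp (2 * x) + Real.exp (-2 * x) := by
  have h1 : |x| ≤ Real.exp |x| := by linarith [Real.add_one_le_exp |x|]
  have h2 : t * x ≤ |x| := (le_abs_self _).trans (by
    rw [abs_mul]; exact mul_le_of_le_one_left (abs_nonneg _) ht)
  calc |x| * Real.exp (t * x) ≤ Real.exp |x| * Real.exp |x| :=
        mul_le_mul h1 (Real.exp_le_exp.2 h2) (Real.exp_pos _).le (Real.exp_pos _).le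
    _ = Real.exp (2 * |x|) := by rw [← Real.exp_add, two_mul]
    _ ≤ _ := by
        rcases abs_cases x with ⟨h, -⟩ | ⟨h, -⟩ <;> rw [h]
        · linarith [Real.exp_pos (-2 * x)]
        · rw [show 2 * -x = -2 * x by ring]; linarith [Real.exp_pos (2 * x)]

namespace IsGaussianFamily

variable (hW : IsGaussianFamily W B μ)
include hW

lemma expIntegrable_one : ExpIntegrable W μ fun _ => 1 := fun S => by
  simpa using hW.integrable_exp S

lemma aemeasurable_tilt {Y : Ω → ℝ} (hY : ExpIntegrable W μ Y) : AEMeasurable Y μ := by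
  have := (hY 0).aestronglyMeasurable.aemeasurable
  refine this.congr (.of_forall fun ω => ?_)
  have h0 := hW.smul 0 0 ω
  simp only [zero_smul, zero_mul] at h0
  simp [h0]

lemma exp_add_smul (S g : V) (t : ℝ) (ω : Ω) : Real.exp (W (S + t • g) ω) =
    Real.exp (W S ω) * Real.exp (t * W g ω) := by
  rw [hW.add, hW.smul, Real.exp_add]

lemma integrable_majorant {Y : Ω → ℝ} (hY : ExpIntegrable W μ Y) (S g : V) :
    Integrable (fun ω => |Y ω * Real.exp (W S ω)| *
      (Real.exp (2 * W g ω) + Real.exp (-2 * W g ω))) μ := by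
  refine ((hY (S + (2 : ℝ) • g)).abs.add (hY (S + (-2 : ℝ) • g)).abs).congr (.of_forall fun ω => ?_)
  simp only [Pi.add_apply, hW.exp_add_smul, abs_mul, Real.abs_exp]
  ring

lemma expIntegrable_mul {Y : Ω → ℝ} (hY : ExpIntegrable W μ Y) (g : V) :
    ExpIntegrable W μ fun ω => W g ω * Y ω := fun S => by
  refine (hW.integrable_majorant hY S g).mono' ?_ (.of_forall fun ω => ?_)
  · exact (((hW.aemeasurable g).mul (hW.aemeasurable_tilt hY)).mul
      (Real.measurable_exp.comp_aemeasurable (hW.aemeasurable S))).aestronglyMeasurable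
  · have := abs_mul_exp_le (x := W g ω) (t := 0) (by simp)
    rw [zero_mul, Real.exp_zero, mul_one] at this
    rw [Real.norm_eq_abs, mul_assoc, abs_mul, mul_comm]
    exact mul_le_mul_of_nonneg_left this (abs_nonneg _)

lemma expIntegrable_sub_mul {Y : Ω → ℝ} (hY : ExpIntegrable W μ Y) (g : V) (m : ℝ) :
    ExpIntegrable W μ fun ω => (W g ω - m) * Y ω := fun S => by
  refine ((hW.expIntegrable_mul hY g S).sub ((hY S).const_mul m)).congr (.of_forall fun ω => ?_)
  simp only [Pi.sub_apply]
  ring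

lemma hasDerivAt_tilt {Y : Ω → ℝ} (hY : ExpIntegrable W μ Y) (S g : V) :
    HasDerivAt (fun t : ℝ => ∫ ω, Y ω * Real.exp (W (S + t • g) ω) ∂μ)
      (∫ ω, W g ω * Y ω * Real.exp (W S ω) ∂μ) 0 := by
  have h := hasDerivAt_integral_of_dominated_loc_of_deriv_le (μ := μ) (x₀ := (0 : ℝ))
    (s := Metric.ball 0 1) (F := fun t ω => Y ω * Real.exp (W (S + t • g) ω))
    (F' := fun t ω => Y ω * (Real.exp (W S ω) * (W g ω * Real.exp (t * W g ω))))
    (bound := fun ω => |Y ω * Real.exp (W S ω)| *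
      (Real.exp (2 * W g ω) + Real.exp (-2 * W g ω)))
    (Metric.ball_mem_nhds _ one_pos) (.of_forall fun t => (hY _).aestronglyMeasurable)
    (hY _) ?_ (.of_forall fun ω t ht => ?_) (hW.integrable_majorant hY S g)
    (.of_forall fun ω t _ => ?_)
  · refine h.2.congr_deriv (integral_congr_ae (.of_forall fun ω => ?_))
    simp only [zero_mul, Real.exp_zero]
    ring
  · refine AEMeasurable.aestronglyMeasurable ?_
    have h1 := hW.aemeasurable_tilt hY
    have h2 := hW.aemeasurable S
    have h3 := hW.aemeasurable g
    fun_prop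
  · have := abs_mul_exp_le (x := W g ω) (t := t) (by
      rw [mem_ball_zero_iff] at ht; exact ht.le)
    rw [Real.norm_eq_abs, ← mul_assoc, abs_mul]
    refine mul_le_mul_of_nonneg_left ?_ (abs_nonneg _)
    rwa [abs_mul, Real.abs_exp]
  · simp only [hW.exp_add_smul]
    have := ((hasDerivAt_id t).mul_const (W g ω)).exp
    simp only [id, one_mul] at this
    convert! ((this.const_mul (Real.exp (W S ω))).const_mul (Y ω)) using 1
    ring

/-- A formula for the tilted expectations of `Y` gives one for those of `(W g - m) Y`. -/
lemma integral_sub_mul {Y : Ω → ℝ} (hY : ExpIntegrable W μ Y) {Q : V → ℝ}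
    (hQ : ∀ S, ∫ ω, Y ω * Real.exp (W S ω) ∂μ = Real.exp (B S S / 2) * Q S) (g S : V) (m : ℝ)
    {Q' : ℝ} (hQ' : HasDerivAt (fun t : ℝ => Q (S + t • g)) Q' 0) :
    ∫ ω, (W g ω - m) * Y ω * Real.exp (W S ω) ∂μ =
      Real.exp (B S S / 2) * ((B g S - m) * Q S + Q') := by
  have h1 := hW.hasDerivAt_tilt hY S g
  have e : ∀ t : ℝ, B (S + t • g) (S + t • g) / 2 = B S S / 2 + t * B g S + t ^ 2 * (B g g / 2) := by
    intro t
    simp only [map_add, map_smul, LinearMap.add_apply, LinearMap.smul_apply, smul_eq_mul]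
    rw [hW.symm S g]
    ring
  have h2 : HasDerivAt (fun t : ℝ => B (S + t • g) (S + t • g) / 2) (B g S) 0 := by
    simp only [e]
    have := (((hasDerivAt_id (0 : ℝ)).mul_const (B g S)).const_add (B S S / 2)).add
      (((hasDerivAt_id (0 : ℝ)).pow 2).mul_const (B g g / 2))
    convert! this using 1
    simp
  have h3 := h2.exp.mul hQ'
  simp only [hQ] at h1
  have h4 := h1.unique h3
  simp only [zero_smul, add_zero] at h4
  have : ∫ ω, (W g ω - m) * Y ω * Real.exp (W S ω) ∂μ =
      ∫ ω, W g ω * Y ω * Real.exp (W S ω) ∂μ - m * ∫ ω, Y ω * Real.exp (W S ω) ∂μ := by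
    rw [← integral_const_mul, ← integral_sub (hW.expIntegrable_mul hY g S) ((hY S).const_mul m)]
    exact integral_congr_ae (.of_forall fun ω => by ring)
  rw [this, h4, hQ]
  ring

omit [MeasurableSpace Ω] hW in
lemma hasDerivAt_shift (f S g : V) (m : ℝ) :
    HasDerivAt (fun t : ℝ => B f (S + t • g) - m) (B f g) 0 := by
  simp only [map_add, map_smul, smul_eq_mul]
  simpa using (((hasDerivAt_id (0 : ℝ)).mul_const (B f g)).const_add (B f S)).sub_const m

/-- The fourth mixed moment of the variables `W (g i) - m i`, with an exponential weight. -/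
lemma integral_four (g : Fin 4 → V) (m : Fin 4 → ℝ) (S : V) :
    Integrable (fun ω => (∏ i, (W (g i) ω - m i)) * Real.exp (W S ω)) μ ∧
    ∫ ω, (∏ i, (W (g i) ω - m i)) * Real.exp (W S ω) ∂μ = Real.exp (B S S / 2) *
      ((B (g 0) S - m 0) * (B (g 1) S - m 1) * (B (g 2) S - m 2) * (B (g 3) S - m 3)
        + B (g 0) (g 1) * (B (g 2) S - m 2) * (B (g 3) S - m 3)
        + B (g 0) (g 2) * (B (g 1) S - m 1) * (B (g 3) S - m 3)
        + B (g 0) (g 3) * (B (g 1) S - m 1) * (B (g 2) S - m 2)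
        + B (g 1) (g 2) * (B (g 0) S - m 0) * (B (g 3) S - m 3)
        + B (g 1) (g 3) * (B (g 0) S - m 0) * (B (g 2) S - m 2)
        + B (g 2) (g 3) * (B (g 0) S - m 0) * (B (g 1) S - m 1)
        + B (g 0) (g 1) * B (g 2) (g 3) + B (g 0) (g 2) * B (g 1) (g 3)
        + B (g 0) (g 3) * B (g 1) (g 2)) := by
  have Y0 := hW.expIntegrable_one
  have Y1 := hW.expIntegrable_sub_mul Y0 (g 3) (m 3)
  have Y2 := hW.expIntegrable_sub_mul Y1 (g 2) (m 2)
  have Y3 := hW.expIntegrable_sub_mul Y2 (g 1) (m 1)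
  have Y4 := hW.expIntegrable_sub_mul Y3 (g 0) (m 0)
  have D := fun i S k => hasDerivAt_shift (B := B) (g i) S (g k) (m i)
  have Q0 : ∀ S, ∫ ω, 1 * Real.exp (W S ω) ∂μ = Real.exp (B S S / 2) * 1 := fun S => by
    simpa using hW.integral_exp S
  have Q1 : ∀ S, ∫ ω, (W (g 3) ω - m 3) * 1 * Real.exp (W S ω) ∂μ =
      Real.exp (B S S / 2) * (B (g 3) S - m 3) := fun S => by
    simpa using hW.integral_sub_mul Y0 Q0 (g 3) S (m 3) (hasDerivAt_const _ _)
  have Q2 : ∀ S, ∫ ω, (W (g 2) ω - m 2) * ((W (g 3) ω - m 3) * 1) * Real.exp (W S ω) ∂μ =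
      Real.exp (B S S / 2) * ((B (g 2) S - m 2) * (B (g 3) S - m 3) + B (g 3) (g 2)) :=
    fun S => hW.integral_sub_mul Y1 Q1 (g 2) S (m 2) (D 3 S 2)
  have Q3 : ∀ S, ∫ ω, (W (g 1) ω - m 1) * ((W (g 2) ω - m 2) * ((W (g 3) ω - m 3) * 1)) *
      Real.exp (W S ω) ∂μ = Real.exp (B S S / 2) *
      ((B (g 1) S - m 1) * ((B (g 2) S - m 2) * (B (g 3) S - m 3) + B (g 3) (g 2)) +
        (B (g 2) (g 1) * (B (g 3) S - m 3) + (B (g 2) S - m 2) * B (g 3) (g 1))) := fun S => by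
    simpa using hW.integral_sub_mul Y2 Q2 (g 1) S (m 1)
      (((D 2 S 1).mul (D 3 S 1)).add_const (B (g 3) (g 2)))
  have Q4 := hW.integral_sub_mul Y3 Q3 (g 0) S (m 0)
    (((D 1 S 0).mul (((D 2 S 0).mul (D 3 S 0)).add_const (B (g 3) (g 2)))).add
      (((D 3 S 0).const_mul (B (g 2) (g 1))).add ((D 2 S 0).mul_const (B (g 3) (g 1)))))
  have e : ∀ ω, ∏ i, (W (g i) ω - m i) =
      (W (g 0) ω - m 0) * ((W (g 1) ω - m 1) * ((W (g 2) ω - m 2) * ((W (g 3) ω - m 3) * 1))) :=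
    fun ω => by rw [Fin.prod_univ_four]; ring
  simp only [e]
  refine ⟨Y4 S, Q4.trans ?_⟩
  simp only [zero_smul, add_zero, Pi.mul_apply]
  rw [hW.symm (g 3) (g 2), hW.symm (g 3) (g 1), hW.symm (g 3) (g 0), hW.symm (g 2) (g 1),
    hW.symm (g 2) (g 0), hW.symm (g 1) (g 0)]
  ring

end IsGaussianFamily

end Gaussian

/-! ### White noise as a Gaussian family -/

section WhiteNoise

/-- Smooth functions with compact support. -/
abbrev Test (d : ℕ) : Type := 𝓓((⊤ : TopologicalSpace.Opens (E d)), ℝ)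

lemma Test.integrable_mul (f g : Test d) : Integrable fun x => f x * g x :=
  (f.contDiff.continuous.mul g.contDiff.continuous).integrable_of_hasCompactSupport
    (f.hasCompactSupport.mul_right)

/-- The covariance of the white noise. -/
noncomputable def l2Form (d : ℕ) : Test d →ₗ[ℝ] Test d →ₗ[ℝ] ℝ :=
  LinearMap.mk₂ ℝ (fun f g => ∫ x, f x * g x)
    (fun f f' g => by
      rw [← integral_add (f.integrable_mul g) (f'.integrable_mul g)]
      exact integral_congr_ae (.of_forall fun x => by simp [add_mul]))
    (fun c f g => by
      rw [smul_eq_mul, ← integral_const_mul]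
      exact integral_congr_ae (.of_forall fun x => by simp [mul_assoc]))
    (fun f g g' => by
      rw [← integral_add (f.integrable_mul g) (f.integrable_mul g')]
      exact integral_congr_ae (.of_forall fun x => by simp [mul_add]))
    (fun c f g => by
      rw [smul_eq_mul, ← integral_const_mul]
      exact integral_congr_ae (.of_forall fun x => by simp [mul_left_comm]))

lemma l2Form_apply (f g : Test d) : l2Form d f g = ∫ x, f x * g x := rfl

lemma IsWhiteNoise.isGaussianFamily {Ω : Type*} [MeasurableSpace Ω] {μ : Measure Ω}
    [IsProbabilityMeasure μ] {W : Ω → Dist d} (hW : IsWhiteNoise W μ) :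
    IsGaussianFamily (fun (f : Test d) ω => W ω f) (l2Form d) μ := by
  have hg : ∀ f : Test d, HasGaussianLaw (fun ω => W ω f) μ := fun f => hW.gaussian.hasGaussianLaw_eval f
  have hlaw : ∀ f : Test d, μ.map (fun ω => W ω f) = gaussianReal 0 (l2Form d f f).toNNReal := fun f => by
    have hm := (hg f).memLp_two
    rw [(hg f).map_eq_gaussianReal, hW.centred, variance_of_integral_eq_zero (hg f).aemeasurable
      (hW.centred f)]
    congr 2
    simp only [pow_two]
    exact hW.covariance f f
  have hpos : ∀ f : Test d, 0 ≤ l2Form d f f := fun f =>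
    integral_nonneg fun x => mul_self_nonneg _
  refine ⟨fun f g ω => map_add _ _ _, fun c f ω => by simp,
    fun f g => integral_congr_ae (.of_forall fun x => mul_comm _ _),
    fun f => (hg f).aemeasurable, fun f => ?_, fun f => ?_⟩
  · have h := integrable_exp_mul_gaussianReal (μ := 0) (v := (l2Form d f f).toNNReal) 1
    rw [← hlaw] at h
    simpa [Function.comp_def] using h.comp_aemeasurable (hg f).aemeasurable
  · have h := mgf_gaussianReal (hlaw f) 1
    simpa [mgf, hpos f] using h

end WhiteNoise

/-! ### Convolutions with mollifiers -/

/-- The convolution of real functions. -/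
noncomputable abbrev conv (f g : E d → ℝ) : E d → ℝ :=
  f ⋆[ContinuousLinearMap.mul ℝ ℝ, volume] g

lemma conv_apply (f g : E d → ℝ) (x : E d) : conv f g x = ∫ t, f t * g (x - t) := rfl

lemma conv_comm (f g : E d → ℝ) : conv f g = conv g f := by
  funext x
  rw [conv, convolution_mul_swap, conv_apply]
  exact integral_congr_ae (.of_forall fun t => mul_comm _ _)

lemma conv_even {f g : E d → ℝ} (hf : ∀ x, f (-x) = f x) (hg : ∀ x, g (-x) = g x) (x : E d) :
    conv f g (-x) = conv f g x := by
  rw [conv_apply, conv_apply, ← integral_neg_eq_self]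
  refine integral_congr_ae (.of_forall fun t => ?_)
  simp only [hf]
  rw [← hg (-x - -t)]
  congr 2
  abel

lemma conv_mono_right {f g g' : E d → ℝ} {x : E d} (hf : ∀ t, 0 ≤ f t) (hg : ∀ t, g t ≤ g' t)
    (hg0 : ∀ t, 0 ≤ g t) (hi : Integrable fun t => f t * g' (x - t)) : conv f g x ≤ conv f g' x :=
  integral_mono_of_nonneg (.of_forall fun t => mul_nonneg (hf t) (hg0 _)) hi
    (.of_forall fun t => mul_le_mul_of_nonneg_left (hg _) (hf t))

section Mollify

variable {θ : E d → ℝ}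

lemma conv_mollify_eq (θ : E d → ℝ) {ε : ℝ} (hε : 0 < ε) (f : E d → ℝ) (x : E d) :
    conv (mollify θ ε) f x = ∫ t, θ t * f (x - ε • t) := by
  have h := Measure.integral_comp_inv_smul_of_nonneg (μ := (volume : Measure (E d)))
    (fun t => θ t * f (x - ε • t)) hε.le
  rw [finrank_euclideanSpace_fin, smul_eq_mul] at h
  have e : ∫ t, θ t * f (x - ε • t) = 1 / ε ^ d * ∫ t, θ (ε⁻¹ • t) * f (x - ε • ε⁻¹ • t) := by
    rw [h]; field_simp
  rw [e, conv_apply, ← integral_const_mul]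
  refine integral_congr_ae (.of_forall fun t => ?_)
  simp only [mollify, smul_inv_smul₀ hε.ne', mul_assoc]

lemma convolutionExists_mollify (hθ : IsMollifier θ) {ε : ℝ} (hε : 0 < ε) {f : E d → ℝ}
    (hf : LocallyIntegrable f) (x : E d) :
    Integrable fun t => mollify θ ε t * f (x - t) :=
  (hasCompactSupport_mollify hθ hε).convolutionExists_left (ContinuousLinearMap.mul ℝ ℝ)
    (contDiff_mollify hθ ε).continuous hf x

lemma contDiff_conv_mollify (hθ : IsMollifier θ) {ε : ℝ} (hε : 0 < ε) {f : E d → ℝ}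
    (hf : LocallyIntegrable f) : ContDiff ℝ (⊤ : ℕ∞) (conv (mollify θ ε) f) :=
  (hasCompactSupport_mollify hθ hε).contDiff_convolution_left _ (contDiff_mollify hθ ε) hf

lemma conv_mollify_nonneg (hθ : IsMollifier θ) {ε : ℝ} (hε : 0 < ε) {f : E d → ℝ}
    (hf : ∀ x, 0 ≤ f x) (x : E d) : 0 ≤ conv (mollify θ ε) f x :=
  integral_nonneg fun t => mul_nonneg (mollify_nonneg hθ hε t) (hf _)

lemma conv_mollify_le_of_le (hθ : IsMollifier θ) {ε : ℝ} (hε : 0 < ε) {f : E d → ℝ} {c : ℝ}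
    {x : E d} (hf0 : ∀ y, 0 ≤ f y) (hf : ∀ y, dist y x ≤ ε → f y ≤ c) : conv (mollify θ ε) f x ≤ c := by
  have h : conv (mollify θ ε) f x ≤ ∫ t, mollify θ ε t * c := by
    refine integral_mono_of_nonneg (.of_forall fun t => mul_nonneg (mollify_nonneg hθ hε t) (hf0 _))
      ((integrable_mollify hθ hε).mul_const c) (.of_forall fun t => ?_)
    change mollify θ ε t * f (x - t) ≤ mollify θ ε t * c
    rcases le_or_gt ‖t‖ ε with ht | ht
    · exact mul_le_mul_of_nonneg_left (hf _ (by simpa [dist_eq_norm] using ht))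
        (mollify_nonneg hθ hε t)
    · rw [mollify_eq_zero hθ hε ht, zero_mul, zero_mul]
  rwa [integral_mul_const, integral_mollify hθ hε, one_mul] at h

lemma le_conv_mollify_of_le (hθ : IsMollifier θ) {ε : ℝ} (hε : 0 < ε) {f : E d → ℝ} {c : ℝ}
    {x : E d} (hfi : LocallyIntegrable f) (hf : ∀ᵐ t, ‖t‖ ≤ ε → c ≤ f (x - t)) :
    c ≤ conv (mollify θ ε) f x := by
  have h : ∫ t, mollify θ ε t * c ≤ conv (mollify θ ε) f x := by
    refine integral_mono_ae ((integrable_mollify hθ hε).mul_const c)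
      (convolutionExists_mollify hθ hε hfi x) ?_
    filter_upwards [hf] with t h
    change mollify θ ε t * c ≤ mollify θ ε t * f (x - t)
    rcases le_or_gt ‖t‖ ε with ht | ht
    · exact mul_le_mul_of_nonneg_left (h ht) (mollify_nonneg hθ hε t)
    · rw [mollify_eq_zero hθ hε ht, zero_mul, zero_mul]
  rwa [integral_mul_const, integral_mollify hθ hε, one_mul] at h

lemma tendsto_conv_mollify (hθ : IsMollifier θ) {f : E d → ℝ} (hf : Measurable f) {x : E d}
    (hx : ContinuousAt f x) :
    Tendsto (fun ε => conv (mollify θ ε) f x) (𝓝[>] 0) (𝓝 (f x)) := by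
  rw [Metric.tendsto_nhds]
  intro c hc
  obtain ⟨δ, hδ, h⟩ := Metric.continuousAt_iff.1 hx (c / 2) (half_pos hc)
  filter_upwards [Ioo_mem_nhdsGT hδ] with ε hε
  refine lt_of_le_of_lt ?_ (half_lt_self hc)
  exact dist_convolution_le (f := mollify θ ε) (g := f) (R := δ) (by positivity)
    ((support_mollify_subset hθ hε.1).trans (Metric.closedBall_subset_ball hε.2))
    (mollify_nonneg hθ hε.1) (integral_mollify hθ hε.1) hf.aestronglyMeasurable
    fun y hy => (h hy).le

lemma conv_mollify_even (hθ : IsMollifier θ) (ε : ℝ) {f : E d → ℝ} (hf : ∀ x, f (-x) = f x)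
    (x : E d) : conv (mollify θ ε) f (-x) = conv (mollify θ ε) f x :=
  conv_even (mollify_neg hθ) hf x

lemma locallyIntegrable_rpow_neg [NeZero d] {β : ℝ} (hβ : β < d) :
    LocallyIntegrable fun x : E d => ‖x‖ ^ (-β) := fun x =>
  ⟨Metric.ball 0 (‖x‖ + 1), Metric.isOpen_ball.mem_nhds (by simp),
    integrableOn_norm_rpow_neg hβ _⟩

lemma exists_conv_mollify_rpow_le [NeZero d] (hθ : IsMollifier θ) {β : ℝ} (hβ0 : 0 ≤ β) (hβ : β < d) :
    ∃ C > 0, ∀ ε > 0, ∀ x : E d,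
      conv (mollify θ ε) (fun y => ‖y‖ ^ (-β)) x ≤ C * max ‖x‖ ε ^ (-β) := by
  obtain ⟨M, hM, hMb⟩ := lintegral_ball_norm_sub_rpow_neg_le (d := d) hβ0 hβ 2
  obtain ⟨B, hB⟩ := hθ.smooth.continuous.bounded_above_of_compact_support
    (HasCompactSupport.of_support_subset_isCompact (isCompact_closedBall (0 : E d) 1) fun x hx => by
      rw [mem_closedBall_zero_iff]; by_contra h; exact hx (hθ.eq_zero x (not_le.1 h)))
  have hB0 : 0 ≤ B := (norm_nonneg _).trans (hB 0)
  refine ⟨2 ^ β * (1 + B * M.toReal), by positivity, fun ε hε x => ?_⟩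
  have hmax : 0 < max ‖x‖ ε := lt_max_of_lt_right hε
  rcases le_or_gt (2 * ε) ‖x‖ with hx | hx
  · have hx0 : 0 < ‖x‖ := by linarith
    have h : conv (mollify θ ε) (fun y => ‖y‖ ^ (-β)) x ≤ (‖x‖ / 2) ^ (-β) := by
      refine conv_mollify_le_of_le hθ hε (fun y => by positivity) fun y hy => ?_
      refine Real.rpow_le_rpow_of_nonpos (by positivity) ?_ (by linarith)
      have := norm_sub_norm_le x y
      rw [dist_comm, dist_eq_norm] at hy
      linarith
    refine h.trans ?_
    rw [max_eq_left (by linarith), Real.div_rpow hx0.le zero_le_two, Real.rpow_neg zero_le_two,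
      div_inv_eq_mul, mul_comm]
    refine mul_le_mul_of_nonneg_right ?_ (by positivity)
    have : 0 ≤ B * M.toReal := by positivity
    exact le_mul_of_one_le_right (by positivity) (by linarith)
  · have hint : ∀ z : E d, ∫ t in Metric.ball (0 : E d) 2, ‖z - t‖ ^ (-β) ≤ M.toReal := fun z => by
      rw [integral_eq_lintegral_of_nonneg_ae (.of_forall fun t => by positivity)
        (Measurable.aestronglyMeasurable (by fun_prop))]
      refine ENNReal.toReal_mono hM ?_
      simpa only [norm_sub_rev] using hMb z 0
    have hon : ∀ z : E d, IntegrableOn (fun t => ‖z - t‖ ^ (-β)) (Metric.ball (0 : E d) 2) := fun z => by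
      refine ⟨Measurable.aestronglyMeasurable (by fun_prop), lt_of_le_of_lt ?_ hM.lt_top⟩
      refine le_trans (lintegral_mono fun t => ?_) (hMb z 0)
      rw [← ofReal_norm, Real.norm_of_nonneg (by positivity), norm_sub_rev]
    rw [conv_mollify_eq θ hε]
    have e : ∀ t, ‖x - ε • t‖ ^ (-β) = ε ^ (-β) * ‖ε⁻¹ • x - t‖ ^ (-β) := fun t => by
      rw [← Real.mul_rpow hε.le (norm_nonneg _)]
      congr 1
      rw [← Real.norm_of_nonneg hε.le, ← norm_smul, Real.norm_of_nonneg hε.le, smul_sub,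
        smul_inv_smul₀ hε.ne']
    have h1 : ∫ t, θ t * ‖x - ε • t‖ ^ (-β) ≤ ε ^ (-β) * (B * M.toReal) := by
      have h2 : ∫ t, θ t * ‖x - ε • t‖ ^ (-β) ≤
          ∫ t, (Metric.ball (0 : E d) 2).indicator (fun t => ε ^ (-β) * (B * ‖ε⁻¹ • x - t‖ ^ (-β))) t := by
        refine integral_mono_of_nonneg (.of_forall fun t => mul_nonneg (hθ.nonneg t) (by positivity))
          ((integrable_indicator_iff Metric.isOpen_ball.measurableSet).2
            (Integrable.const_mul (Integrable.const_mul (hon (ε⁻¹ • x)) B) _))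
          (.of_forall fun t => ?_)
        by_cases ht : t ∈ Metric.ball (0 : E d) 2
        · rw [indicator_of_mem ht]
          simp only [e]
          rw [mul_left_comm]
          refine mul_le_mul_of_nonneg_left (mul_le_mul_of_nonneg_right ?_ (by positivity))
            (by positivity)
          exact (le_abs_self _).trans (hB t)
        · rw [indicator_of_notMem ht]
          rw [mem_ball_zero_iff, not_lt] at ht
          simp [hθ.eq_zero t (by linarith)]
      refine h2.trans ?_
      rw [integral_indicator Metric.isOpen_ball.measurableSet, integral_const_mul, integral_const_mul]
      exact mul_le_mul_of_nonneg_left (mul_le_mul_of_nonneg_left (hint _) hB0) (by positivity)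
    refine h1.trans ?_
    have h3 : ε ^ (-β) ≤ 2 ^ β * max ‖x‖ ε ^ (-β) := by
      have : max ‖x‖ ε ≤ 2 * ε := max_le hx.le (by linarith)
      calc ε ^ (-β) = 2 ^ β * (2 * ε) ^ (-β) := by
            rw [Real.mul_rpow zero_le_two hε.le, ← mul_assoc, ← Real.rpow_add two_pos]; simp
        _ ≤ _ := mul_le_mul_of_nonneg_left
            (Real.rpow_le_rpow_of_nonpos hmax this (by linarith)) (by positivity)
    have : 0 ≤ B * M.toReal := by positivity
    calc ε ^ (-β) * (B * M.toReal) ≤ (2 ^ β * max ‖x‖ ε ^ (-β)) * (1 + B * M.toReal) := by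
          gcongr; linarith
      _ = _ := by ring

end Mollify

/-! ### The kernel of the logarithmic field -/

section Kernel

variable {R : ℝ}

lemma kernelK_eq (R : ℝ) (x : E d) :
    kernelK d R x = (Metric.closedBall 0 R).indicator (fun x => ‖x‖ ^ (-((d : ℝ) / 2))) x := by
  rw [kernelK]
  split_ifs with h
  · rw [indicator_of_mem (by simpa using h), Real.rpow_neg (norm_nonneg _), one_div]
  · rw [indicator_of_notMem (by simpa using h)]

lemma kernelK_nonneg (R : ℝ) (x : E d) : 0 ≤ kernelK d R x := by
  rw [kernelK_eq]; exact indicator_nonneg (fun _ _ => by positivity) _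

lemma kernelK_le (R : ℝ) (x : E d) : kernelK d R x ≤ ‖x‖ ^ (-((d : ℝ) / 2)) := by
  rw [kernelK_eq]
  exact indicator_le_self' (fun _ _ => by positivity) _

lemma kernelK_neg (R : ℝ) (x : E d) : kernelK d R (-x) = kernelK d R x := by
  simp [kernelK]

lemma measurable_kernelK (R : ℝ) : Measurable (kernelK d R) := by
  rw [funext (kernelK_eq R)]
  exact Measurable.indicator (by fun_prop) Metric.isClosed_closedBall.measurableSet

lemma half_dim_lt [NeZero d] : (d : ℝ) / 2 < d := by
  have : (0 : ℝ) < d := by exact_mod_cast NeZero.pos d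
  linarith

lemma integrable_kernelK [NeZero d] (R : ℝ) : Integrable (kernelK d R) := by
  rw [funext (kernelK_eq R), integrable_indicator_iff Metric.isClosed_closedBall.measurableSet]
  exact (integrableOn_norm_rpow_neg half_dim_lt (R + 1)).mono_set
    (Metric.closedBall_subset_ball (by linarith))

lemma continuousAt_kernelK {x : E d} (hx : x ≠ 0) (hxR : ‖x‖ ≠ R) :
    ContinuousAt (kernelK d R) x := by
  have hc : ContinuousAt (fun x : E d => ‖x‖ ^ (-((d : ℝ) / 2))) x :=
    continuousAt_id.norm.rpow_const (.inl (norm_ne_zero_iff.2 hx))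
  rcases hxR.lt_or_gt with h | h
  · refine hc.congr ?_
    filter_upwards [Metric.isOpen_ball.mem_nhds (mem_ball_zero_iff.2 h)] with y hy
    rw [kernelK_eq, indicator_of_mem (Metric.ball_subset_closedBall hy)]
  · refine (continuousAt_const (y := (0 : ℝ))).congr ?_
    filter_upwards [Metric.isClosed_closedBall.isOpen_compl.mem_nhds
      (show x ∈ (Metric.closedBall (0 : E d) R)ᶜ by simpa using h)] with y hy
    rw [kernelK_eq, indicator_of_notMem hy]

lemma kernelK_smul (hR : 0 < R) (x : E d) :
    kernelK d R x = R ^ (-((d : ℝ) / 2)) * kernelK d 1 (R⁻¹ • x) := by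
  rw [kernelK_eq, kernelK_eq]
  have h : R⁻¹ • x ∈ Metric.closedBall (0 : E d) 1 ↔ x ∈ Metric.closedBall (0 : E d) R := by
    rw [mem_closedBall_zero_iff, mem_closedBall_zero_iff, norm_smul, norm_inv,
      Real.norm_of_nonneg hR.le, inv_mul_le_iff₀ hR, mul_one]
  by_cases hx : x ∈ Metric.closedBall (0 : E d) R
  · rw [indicator_of_mem hx, indicator_of_mem (h.2 hx), ← Real.mul_rpow hR.le (norm_nonneg _),
      norm_smul, norm_inv, Real.norm_of_nonneg hR.le, mul_inv_cancel_left₀ hR.ne']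
  · rw [indicator_of_notMem hx, indicator_of_notMem (h.not.2 hx), mul_zero]

variable {θ : E d → ℝ} (hθ : IsMollifier θ)
include hθ

lemma kernelEps_nonneg {ε : ℝ} (hε : 0 < ε) (x : E d) : 0 ≤ kernelEps R θ ε x :=
  conv_mollify_nonneg hθ hε (kernelK_nonneg R) x

lemma kernelEps_neg (ε : ℝ) (x : E d) : kernelEps R θ ε (-x) = kernelEps R θ ε x :=
  conv_mollify_even hθ ε (kernelK_neg R) x

lemma contDiff_kernelEps [NeZero d] {ε : ℝ} (hε : 0 < ε) : ContDiff ℝ (⊤ : ℕ∞) (kernelEps R θ ε) :=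
  contDiff_conv_mollify hθ hε (integrable_kernelK R).locallyIntegrable

lemma kernelEps_eq_zero {ε : ℝ} (hε : 0 < ε) {x : E d} (hx : R + ε < ‖x‖) :
    kernelEps R θ ε x = 0 := by
  refine integral_eq_zero_of_ae (.of_forall fun t => ?_)
  change mollify θ ε t * kernelK d R (x - t) = 0
  rcases le_or_gt ‖t‖ ε with ht | ht
  · rw [kernelK, if_neg, mul_zero]
    have := norm_sub_norm_le x t
    linarith
  · rw [mollify_eq_zero hθ hε ht, zero_mul]

lemma hasCompactSupport_kernelEps {ε : ℝ} (hε : 0 < ε) : HasCompactSupport (kernelEps R θ ε) :=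
  HasCompactSupport.of_support_subset_isCompact (isCompact_closedBall 0 (R + ε)) fun x hx => by
    rw [mem_closedBall_zero_iff]
    by_contra h
    exact hx (kernelEps_eq_zero hθ hε (not_le.1 h))

lemma exists_kernelEps_le [NeZero d] (R : ℝ) : ∃ C > 0, ∀ ε > 0, ∀ x : E d,
    kernelEps R θ ε x ≤ C * max ‖x‖ ε ^ (-((d : ℝ) / 2)) := by
  obtain ⟨C, hC, h⟩ := exists_conv_mollify_rpow_le hθ (β := (d : ℝ) / 2) (by positivity) half_dim_lt
  exact ⟨C, hC, fun ε hε x => (conv_mono_right (mollify_nonneg hθ hε) (kernelK_le R)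
    (kernelK_nonneg R) (convolutionExists_mollify hθ hε
      (locallyIntegrable_rpow_neg half_dim_lt) x)).trans (h ε hε x)⟩

lemma kernelEps_zero_ge [NeZero d] {ε : ℝ} (hε : 0 < ε) (hεR : ε ≤ R) :
    ε ^ (-((d : ℝ) / 2)) ≤ kernelEps R θ ε 0 := by
  refine le_conv_mollify_of_le hθ hε (integrable_kernelK R).locallyIntegrable ?_
  have : ∀ᵐ t : E d, t ≠ 0 := by simp [ae_iff, measure_singleton]
  filter_upwards [this] with t ht h
  rw [zero_sub, kernelK_neg, kernelK_eq, indicator_of_mem (by simpa using h.trans hεR)]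
  exact Real.rpow_le_rpow_of_nonpos (norm_pos_iff.2 ht) h (neg_nonpos.2 (by positivity))

lemma kernelEps_zero_pos [NeZero d] {ε : ℝ} (hε : 0 < ε) (hεR : ε ≤ R) : 0 < kernelEps R θ ε 0 :=
  (Real.rpow_pos_of_pos hε _).trans_le (kernelEps_zero_ge hθ hε hεR)

lemma tendsto_kernelEps [NeZero d] {x : E d} (hx : x ≠ 0) (hxR : ‖x‖ ≠ R) :
    Tendsto (fun ε => kernelEps R θ ε x) (𝓝[>] 0) (𝓝 (kernelK d R x)) :=
  tendsto_conv_mollify hθ (measurable_kernelK R) (continuousAt_kernelK hx hxR)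

end Kernel

/-! ### The regularized norm -/

section NormEps

variable {θ : E d → ℝ} (hθ : IsMollifier θ)
include hθ

lemma contDiff_normEps {ε : ℝ} (hε : 0 < ε) : ContDiff ℝ (⊤ : ℕ∞) (normEps θ ε) :=
  contDiff_conv_mollify hθ hε continuous_norm.locallyIntegrable

lemma normEps_ge_max_integral {ε : ℝ} (hε : 0 < ε) (x : E d) :
    ‖x‖ ≤ normEps θ ε x ∧ ε * ∫ t, θ t * ‖t‖ ≤ normEps θ ε x := by
  have hi := fun x : E d => convolutionExists_mollify hθ hε continuous_norm.locallyIntegrable x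
  have h1 : normEps θ ε x = ∫ t, mollify θ ε t * ‖x + t‖ := by
    change ∫ t, mollify θ ε t * ‖x - t‖ = _
    rw [← integral_neg_eq_self]
    simp only [mollify_neg hθ, sub_neg_eq_add]
  have hi' : Integrable fun t => mollify θ ε t * ‖x + t‖ := by
    have := (hi x).comp_neg
    simpa only [mollify_neg hθ, sub_neg_eq_add] using this
  have h2 : 2 * normEps θ ε x = ∫ t, mollify θ ε t * (‖x - t‖ + ‖x + t‖) := by
    simp only [mul_add]
    rw [integral_add (hi x) hi', ← h1, two_mul]
    rfl
  have hi2 : Integrable fun t => mollify θ ε t * (‖x - t‖ + ‖x + t‖) := by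
    simp only [mul_add]; exact (hi x).add hi'
  constructor
  · have : ∫ t, mollify θ ε t * (2 * ‖x‖) ≤ 2 * normEps θ ε x := by
      rw [h2]
      refine integral_mono ((integrable_mollify hθ hε).mul_const _) hi2 fun t =>
        mul_le_mul_of_nonneg_left ?_ (mollify_nonneg hθ hε t)
      have := norm_add_le (x - t) (x + t)
      rwa [sub_add_add_cancel, ← two_smul ℝ, norm_smul, Real.norm_two] at this
    rw [integral_mul_const, integral_mollify hθ hε] at this
    linarith
  · have h3 : ε * ∫ t, θ t * ‖t‖ = ∫ t, mollify θ ε t * ‖t‖ := by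
      have := conv_mollify_eq θ hε (fun x => ‖x‖) 0
      rw [conv_apply] at this
      simp only [zero_sub, norm_neg, norm_smul, Real.norm_of_nonneg hε.le] at this
      rw [this, ← integral_const_mul]
      exact integral_congr_ae (.of_forall fun t => by ring)
    have hi0 := hi 0
    simp only [zero_sub, norm_neg] at hi0
    have : ∫ t, mollify θ ε t * (2 * ‖t‖) ≤ 2 * normEps θ ε x := by
      rw [h2]
      refine integral_mono ?_ hi2 fun t => mul_le_mul_of_nonneg_left ?_ (mollify_nonneg hθ hε t)
      · refine (hi0.mul_const 2).congr (.of_forall fun t => by ring)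
      · have := norm_sub_le (x + t) (x - t)
        rw [add_sub_sub_cancel, ← two_smul ℝ, norm_smul, Real.norm_two] at this
        linarith
    have h4 : ∫ t, mollify θ ε t * (2 * ‖t‖) = 2 * ∫ t, mollify θ ε t * ‖t‖ := by
      rw [← integral_const_mul]
      exact integral_congr_ae (.of_forall fun t => by ring)
    rw [h3]
    linarith

lemma integral_mul_norm_pos [NeZero d] : 0 < ∫ t, θ t * ‖t‖ := by
  have hc : HasCompactSupport θ :=
    HasCompactSupport.of_support_subset_isCompact (isCompact_closedBall (0 : E d) 1) fun x hx => by
      rw [mem_closedBall_zero_iff]; by_contra h; exact hx (hθ.eq_zero x (not_le.1 h))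
  have hi : Integrable fun t => θ t * ‖t‖ :=
    (hθ.smooth.continuous.mul continuous_norm).integrable_of_hasCompactSupport hc.mul_right
  have h0 : ∀ t, 0 ≤ θ t * ‖t‖ := fun t => mul_nonneg (hθ.nonneg t) (norm_nonneg t)
  refine lt_of_le_of_ne (integral_nonneg h0) fun h => ?_
  have h1 := (integral_eq_zero_iff_of_nonneg h0 hi).1 h.symm
  have h2 : ∀ᵐ t : E d, t ≠ 0 := by simp [ae_iff, measure_singleton]
  have h3 : θ =ᵐ[volume] 0 := by
    filter_upwards [h1, h2] with t h1 h2
    exact (mul_eq_zero.1 h1).resolve_right (norm_ne_zero_iff.2 h2)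
  have h4 := hθ.integral_eq_one
  rw [integral_congr_ae h3] at h4
  simp at h4

lemma exists_normEps_ge [NeZero d] : ∃ c > 0, ∀ ε > 0, ∀ x : E d, c * max ‖x‖ ε ≤ normEps θ ε x := by
  have hm := integral_mul_norm_pos hθ
  refine ⟨min 1 (∫ t, θ t * ‖t‖), by positivity, fun ε hε x => ?_⟩
  obtain ⟨h1, h2⟩ := normEps_ge_max_integral hθ hε x
  rw [mul_max_of_nonneg _ _ (by positivity)]
  refine max_le (le_trans ?_ h1) (le_trans ?_ h2)
  · exact mul_le_of_le_one_left (norm_nonneg _) (min_le_left _ _)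
  · rw [mul_comm]; exact mul_le_mul_of_nonneg_left (min_le_right _ _) hε.le

lemma tendsto_normEps (x : E d) : Tendsto (fun ε => normEps θ ε x) (𝓝[>] 0) (𝓝 ‖x‖) :=
  tendsto_conv_mollify hθ measurable_norm continuous_norm.continuousAt

end NormEps

/-! ### The covariance near the diagonal -/

section Rho

lemma conv_kernelK (R : ℝ) (hR : 0 < R) (x : E d) :
    conv (kernelK d R) (kernelK d R) x = rho d (R⁻¹ • x) := by
  have h := Measure.integral_comp_inv_smul_of_nonneg (μ := (volume : Measure (E d)))
    (fun t => kernelK d 1 t * kernelK d 1 (R⁻¹ • x - t)) hR.le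
  rw [finrank_euclideanSpace_fin, smul_eq_mul] at h
  have e : (R ^ (-((d : ℝ) / 2)) * R ^ (-((d : ℝ) / 2))) * R ^ d = 1 := by
    rw [← Real.rpow_natCast, ← Real.rpow_add hR, ← Real.rpow_add hR]
    rw [show -((d : ℝ) / 2) + -((d : ℝ) / 2) + d = 0 by ring, Real.rpow_zero]
  calc conv (kernelK d R) (kernelK d R) x
      = ∫ t, (R ^ (-((d : ℝ) / 2)) * R ^ (-((d : ℝ) / 2))) *
          (kernelK d 1 (R⁻¹ • t) * kernelK d 1 (R⁻¹ • x - R⁻¹ • t)) := by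
        refine integral_congr_ae (.of_forall fun t => ?_)
        change kernelK d R t * kernelK d R (x - t) = _
        rw [kernelK_smul hR t, kernelK_smul hR (x - t), smul_sub]
        ring
    _ = _ := by
        rw [integral_const_mul, h, ← mul_assoc, e, one_mul]
        rfl

lemma rho_map (Q : E d ≃ₗᵢ[ℝ] E d) (x : E d) : rho d (Q x) = rho d x := by
  change ∫ t, kernelK d 1 t * kernelK d 1 (Q x - t) = ∫ t, kernelK d 1 t * kernelK d 1 (x - t)
  rw [← Q.measurePreserving.integral_comp Q.toHomeomorph.measurableEmbedding]
  refine integral_congr_ae (.of_forall fun t => ?_)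
  simp only [← map_sub, kernelK, Q.norm_map]

lemma rho_eq_of_norm_eq {x y : E d} (h : ‖x‖ = ‖y‖) : rho d x = rho d y := by
  obtain ⟨Q, rfl⟩ := exists_linearIsometryEquiv_map_eq h
  rw [rho_map]

lemma integral_annulus [NeZero d] {A : ℝ} (hA : 1 ≤ A) :
    IntegrableOn (fun u : E d => (Ioc 1 A).indicator (fun y : ℝ => y ^ (-(d : ℝ))) ‖u‖) univ ∧
    ∫ u : E d, (Ioc 1 A).indicator (fun y : ℝ => y ^ (-(d : ℝ))) ‖u‖ = sphereArea d * Real.log A := by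
  have hd : 1 ≤ d := NeZero.one_le
  have e : ∀ y ∈ Ioi (0 : ℝ), y ^ (Module.finrank ℝ (E d) - 1) •
      (Ioc 1 A).indicator (fun y : ℝ => y ^ (-(d : ℝ))) y =
      (Ioc 1 A).indicator (fun y : ℝ => y⁻¹) y := fun y hy => by
    by_cases h : y ∈ Ioc 1 A
    · rw [indicator_of_mem h, indicator_of_mem h, finrank_euclideanSpace_fin, smul_eq_mul,
        ← Real.rpow_natCast, ← Real.rpow_add hy, ← Real.rpow_neg_one]
      congr 1; push_cast [hd]; ring
    · rw [indicator_of_notMem h, indicator_of_notMem h, smul_zero]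
  have hii : IntegrableOn (fun y : ℝ => y⁻¹) (Ioc 1 A) := by
    have := (intervalIntegrable_inv_iff (a := (1 : ℝ)) (b := A)).2 (.inr (by
      rw [uIcc_of_le hA]; simp))
    rwa [intervalIntegrable_iff_integrableOn_Ioc_of_le hA] at this
  have hsub : Ioc (1 : ℝ) A ⊆ Ioi 0 := fun y hy => lt_trans one_pos hy.1
  constructor
  · rw [integrableOn_univ, integrable_fun_norm_addHaar volume]
    refine IntegrableOn.congr_fun ?_ (fun y hy => (e y hy).symm) measurableSet_Ioi
    exact ((integrable_indicator_iff measurableSet_Ioc).2 hii).integrableOn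
  · rw [integral_fun_norm_addHaar, setIntegral_congr_fun measurableSet_Ioi e,
      setIntegral_indicator measurableSet_Ioc, inter_eq_self_of_subset_right hsub,
      ← intervalIntegral.integral_of_le hA, integral_inv_of_pos one_pos (by linarith), div_one,
      sphereArea, Measure.toSphere_real_apply_univ, nsmul_eq_mul, smul_eq_mul]
    ring

lemma integrable_rho_tail [NeZero d] {ξ : E d} (hξ : ‖ξ‖ = 1) :
    Integrable fun u : E d => ‖u‖ ^ (-((d : ℝ) / 2)) * ‖ξ - u‖ ^ (-((d : ℝ) / 2)) -
      (Ioi 1).indicator (fun y : ℝ => y ^ (-(d : ℝ))) ‖u‖ := by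
  have hd : (0 : ℝ) < d := by exact_mod_cast NeZero.pos d
  set b : ℝ := (d : ℝ) / 2
  have hb : 0 < b := by positivity
  have hmeas : Measurable fun u : E d => ‖u‖ ^ (-b) * ‖ξ - u‖ ^ (-b) -
      (Ioi 1).indicator (fun y : ℝ => y ^ (-(d : ℝ))) ‖u‖ := by
    have : Measurable ((Ioi (1 : ℝ)).indicator fun y : ℝ => y ^ (-(d : ℝ))) :=
      Measurable.indicator (by fun_prop) measurableSet_Ioi
    exact Measurable.sub (by fun_prop) (this.comp measurable_norm)
  have hloc1 : IntegrableOn (fun u : E d => ‖u‖ ^ (-b)) (Metric.ball 0 2) :=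
    integrableOn_norm_rpow_neg half_dim_lt 2
  have hloc2 : IntegrableOn (fun u : E d => ‖ξ - u‖ ^ (-b)) (Metric.ball 0 2) := by
    obtain ⟨M, hM, h⟩ := lintegral_ball_norm_sub_rpow_neg_le (d := d) hb.le half_dim_lt 2
    refine ⟨Measurable.aestronglyMeasurable (by fun_prop), lt_of_le_of_lt ?_ hM.lt_top⟩
    refine le_trans (lintegral_mono fun t => ?_) (h ξ 0)
    rw [← ofReal_norm, Real.norm_of_nonneg (by positivity), norm_sub_rev]
  have hone : IntegrableOn (fun _ : E d => (1 : ℝ)) (Metric.ball 0 2) :=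
    integrableOn_const (Metric.isBounded_ball.measure_lt_top.ne)
  have htail : Integrable fun u : E d => (1 + ‖u‖) ^ (-((d : ℝ) + 1)) :=
    integrable_one_add_norm (by simp)
  have hnear := (integrable_indicator_iff (μ := volume) Metric.isOpen_ball.measurableSet).2
    (Integrable.add (Integrable.const_mul (Integrable.add hloc1 hloc2) (2 ^ b)) hone)
  refine (hnear.add (htail.const_mul (b * 2 ^ (b + 1) * 2 ^ ((d : ℝ) + 1)))).mono'
    hmeas.aestronglyMeasurable (.of_forall fun u => ?_)
  rw [Real.norm_eq_abs]
  simp only [Pi.add_apply]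
  by_cases hu : u ∈ Metric.ball (0 : E d) 2
  · rw [indicator_of_mem hu]
    have h1 : ‖u‖ ^ (-b) * ‖ξ - u‖ ^ (-b) ≤ 2 ^ b * (‖u‖ ^ (-b) + ‖ξ - u‖ ^ (-b)) := by
      have h2 : ∀ x : ℝ, 1 / 2 ≤ x → x ^ (-b) ≤ 2 ^ b := fun x hx => by
        calc x ^ (-b) ≤ (1 / 2 : ℝ) ^ (-b) :=
              Real.rpow_le_rpow_of_nonpos (by norm_num) hx (by linarith)
          _ = 2 ^ b := by rw [one_div, Real.inv_rpow zero_le_two, ← Real.rpow_neg zero_le_two, neg_neg]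
      have p1 : 0 ≤ ‖u‖ ^ (-b) := by positivity
      have p2 : 0 ≤ ‖ξ - u‖ ^ (-b) := by positivity
      rcases le_or_gt ‖u‖ (1 / 2) with h | h
      · have h3 : 1 / 2 ≤ ‖ξ - u‖ := by linarith [norm_sub_norm_le ξ u]
        nlinarith [mul_le_mul_of_nonneg_left (h2 _ h3) p1, Real.rpow_pos_of_pos two_pos b]
      · nlinarith [mul_le_mul_of_nonneg_right (h2 _ h.le) p2, Real.rpow_pos_of_pos two_pos b]
    have h3 : |(Ioi 1).indicator (fun y : ℝ => y ^ (-(d : ℝ))) ‖u‖| ≤ 1 := by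
      by_cases h : ‖u‖ ∈ Ioi (1 : ℝ)
      · rw [indicator_of_mem h, abs_of_nonneg (by positivity)]
        exact Real.rpow_le_one_of_one_le_of_nonpos (le_of_lt h) (by linarith)
      · rw [indicator_of_notMem h]; simp
    have h4 : 0 ≤ b * 2 ^ (b + 1) * 2 ^ ((d : ℝ) + 1) * (1 + ‖u‖) ^ (-((d : ℝ) + 1)) := by positivity
    refine (abs_sub _ _).trans ?_
    rw [abs_of_nonneg (by positivity : 0 ≤ ‖u‖ ^ (-b) * ‖ξ - u‖ ^ (-b))]
    simp only [Pi.add_apply]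
    linarith
  · rw [indicator_of_notMem hu, zero_add]
    rw [mem_ball_zero_iff, not_lt] at hu
    have hu0 : 0 < ‖u‖ := by linarith
    have hu1 : ‖u‖ ∈ Ioi (1 : ℝ) := by simp only [mem_Ioi]; linarith
    have hm : ‖u‖ / 2 ≤ ‖ξ - u‖ := by
      have := norm_sub_norm_le u ξ
      rw [norm_sub_rev] at this
      linarith
    have h1 := abs_rpow_neg_sub_rpow_neg_le hb.le (by positivity : 0 < ‖u‖ / 2) hm
      (by linarith : ‖u‖ / 2 ≤ ‖u‖)
    have h2 : |‖ξ - u‖ - ‖u‖| ≤ 1 := by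
      have := abs_norm_sub_norm_le (u - ξ) u
      rw [norm_sub_rev u ξ, sub_sub_cancel_left, norm_neg, hξ] at this
      exact this
    rw [indicator_of_mem hu1, show -(d : ℝ) = -b + -b by simp only [b]; ring, Real.rpow_add hu0,
      ← mul_sub, abs_mul, abs_of_nonneg (by positivity : 0 ≤ ‖u‖ ^ (-b))]
    have h3 : ‖u‖ ^ (-b) * (b * (‖u‖ / 2) ^ (-(b + 1)) * 1) =
        b * 2 ^ (b + 1) * ‖u‖ ^ (-((d : ℝ) + 1)) := by
      rw [Real.div_rpow hu0.le zero_le_two, Real.rpow_neg zero_le_two, div_inv_eq_mul,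
        show -((d : ℝ) + 1) = -b + -(b + 1) by simp only [b]; ring, Real.rpow_add hu0]
      ring
    have h4 : ‖u‖ ^ (-((d : ℝ) + 1)) ≤ 2 ^ ((d : ℝ) + 1) * (1 + ‖u‖) ^ (-((d : ℝ) + 1)) := by
      calc ‖u‖ ^ (-((d : ℝ) + 1)) ≤ ((1 + ‖u‖) / 2) ^ (-((d : ℝ) + 1)) :=
            Real.rpow_le_rpow_of_nonpos (by positivity) (by linarith) (by linarith)
        _ = _ := by
            rw [Real.div_rpow (by positivity) zero_le_two, Real.rpow_neg zero_le_two, div_inv_eq_mul,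
              mul_comm]
    calc ‖u‖ ^ (-b) * |‖ξ - u‖ ^ (-b) - ‖u‖ ^ (-b)|
        ≤ ‖u‖ ^ (-b) * (b * (‖u‖ / 2) ^ (-(b + 1)) * 1) := by
          refine mul_le_mul_of_nonneg_left (h1.trans ?_) (by positivity)
          refine le_trans (le_of_eq ?_) (mul_le_mul_of_nonneg_left h2 (by positivity))
          first | rfl | ring_nf
      _ = b * 2 ^ (b + 1) * ‖u‖ ^ (-((d : ℝ) + 1)) := h3
      _ ≤ b * 2 ^ (b + 1) * (2 ^ ((d : ℝ) + 1) * (1 + ‖u‖) ^ (-((d : ℝ) + 1))) :=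
          mul_le_mul_of_nonneg_left h4 (by positivity)
      _ = _ := by ring

lemma integral_shell_le {A : ℝ} (hA : 1 < A) {h : E d → ℝ} (h0 : ∀ u, 0 ≤ h u)
    (hle : ∀ u, h u ≤ (Metric.closedBall 0 A \ Metric.closedBall 0 (A - 1)).indicator
      (fun _ => (A - 1) ^ (-(d : ℝ))) u) :
    ∫ u, h u ≤ ((A / (A - 1)) ^ d - 1) * volume.real (Metric.ball (0 : E d) 1) := by
  have hA1 : 0 < A - 1 := by linarith
  have hm : MeasurableSet (Metric.closedBall (0 : E d) A \ Metric.closedBall 0 (A - 1)) :=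
    Metric.isClosed_closedBall.measurableSet.diff Metric.isClosed_closedBall.measurableSet
  have hfin : volume (Metric.closedBall (0 : E d) A \ Metric.closedBall 0 (A - 1)) ≠ ⊤ :=
    ((measure_mono sdiff_subset).trans_lt measure_closedBall_lt_top).ne
  refine (integral_mono_of_nonneg (.of_forall h0)
    ((integrable_indicator_iff hm).2 (integrableOn_const hfin)) (.of_forall hle)).trans ?_
  rw [integral_indicator hm, setIntegral_const, measureReal_sdiff (Metric.closedBall_subset_closedBall
    (by linarith)) Metric.isClosed_closedBall.measurableSet (h₁ := measure_closedBall_lt_top.ne),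
    Measure.addHaar_real_closedBall _ _
    (by linarith), Measure.addHaar_real_closedBall _ _ hA1.le, finrank_euclideanSpace_fin, smul_eq_mul,
    Real.rpow_neg hA1.le, Real.rpow_natCast, div_pow]
  refine le_of_eq ?_
  field_simp

/-- The covariance has a logarithmic singularity at the origin. -/
lemma exists_tendsto_rho [NeZero d] :
    ∃ c, Tendsto (fun x => rho d x + sphereArea d * Real.log ‖x‖) (𝓝[≠] 0) (𝓝 c) := by
  have hd : (0 : ℝ) < d := by exact_mod_cast NeZero.pos d
  set b : ℝ := (d : ℝ) / 2
  have hb : 0 < b := by positivity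
  obtain ⟨ξ, hξ⟩ : ∃ ξ : E d, ‖ξ‖ = 1 := ⟨EuclideanSpace.single 0 1, by simp⟩
  set g : E d → ℝ := fun u => ‖u‖ ^ (-b) * ‖ξ - u‖ ^ (-b) -
      (Ioi 1).indicator (fun y : ℝ => y ^ (-(d : ℝ))) ‖u‖
  have hg : Integrable g := integrable_rho_tail hξ
  have key : Tendsto (fun A : ℝ => conv (kernelK d A) (kernelK d A) ξ - sphereArea d * Real.log A)
      atTop (𝓝 (∫ u, g u)) := by
    let h : ℝ → E d → ℝ := fun A u => {u | ‖u‖ ≤ A ∧ A < ‖ξ - u‖}.indicator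
      (fun u => ‖u‖ ^ (-b) * ‖ξ - u‖ ^ (-b)) u
    have h0 : ∀ A u, 0 ≤ h A u := fun A u => indicator_nonneg (fun u _ => by positivity) u
    have hle : ∀ A, 2 ≤ A → ∀ u, h A u ≤
        (Metric.closedBall 0 A \ Metric.closedBall 0 (A - 1)).indicator
          (fun _ => (A - 1) ^ (-(d : ℝ))) u := fun A hA u => by
      have hA1 : 0 < A - 1 := by linarith
      by_cases hu : u ∈ {u | ‖u‖ ≤ A ∧ A < ‖ξ - u‖}
      · have h1 : A - 1 < ‖u‖ := by have := norm_sub_le ξ u; linarith [hu.2]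
        simp only [h]
        rw [indicator_of_mem hu, indicator_of_mem (by simpa using ⟨hu.1, by linarith⟩),
          show -(d : ℝ) = -b + -b by simp only [b]; ring, Real.rpow_add hA1]
        exact mul_le_mul (Real.rpow_le_rpow_of_nonpos hA1 h1.le (by linarith))
          (Real.rpow_le_rpow_of_nonpos hA1 (by linarith [hu.2]) (by linarith))
          (by positivity) (by positivity)
      · simp only [h]
        rw [indicator_of_notMem hu]
        exact indicator_nonneg (fun _ _ => by positivity) u
    have hhm : ∀ A, Measurable (h A) := fun A => by
      have hf : Measurable fun u : E d => ‖u‖ ^ (-b) * ‖ξ - u‖ ^ (-b) := by fun_prop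
      exact hf.indicator ((measurableSet_le measurable_norm measurable_const).inter
        (measurableSet_lt measurable_const (measurable_id.const_sub ξ).norm))
    have hhi : ∀ A, 2 ≤ A → Integrable (h A) := fun A hA => by
      have hm : MeasurableSet (Metric.closedBall (0 : E d) A \ Metric.closedBall 0 (A - 1)) :=
        Metric.isClosed_closedBall.measurableSet.diff Metric.isClosed_closedBall.measurableSet
      refine ((integrable_indicator_iff hm).2 (integrableOn_const
        (C := (A - 1) ^ (-(d : ℝ))) ((measure_mono sdiff_subset).trans_lt measure_closedBall_lt_top).ne)).mono'
        (hhm A).aestronglyMeasurable (.of_forall fun u => ?_)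
      rw [Real.norm_of_nonneg (h0 A u)]
      exact hle A hA u
    have hsplit : ∀ A, 2 ≤ A → conv (kernelK d A) (kernelK d A) ξ - sphereArea d * Real.log A =
        (∫ u, (Metric.closedBall 0 A).indicator g u) - ∫ u, h A u := fun A hA => by
      obtain ⟨hi1, hi2⟩ := integral_annulus (d := d) (show 1 ≤ A by linarith)
      rw [integrableOn_univ] at hi1
      have hgi : Integrable ((Metric.closedBall 0 A).indicator g) :=
        hg.indicator Metric.isClosed_closedBall.measurableSet
      have hgh : Integrable fun u => (Metric.closedBall 0 A).indicator g u - h A u :=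
        hgi.sub (hhi A hA)
      rw [sub_eq_iff_eq_add, ← hi2, ← integral_sub hgi (hhi A hA), ← integral_add hgh hi1]
      refine integral_congr_ae (.of_forall fun u => ?_)
      change kernelK d A u * kernelK d A (ξ - u) = _
      rw [kernelK_eq, kernelK_eq]
      simp only [h, g]
      by_cases h1 : ‖u‖ ≤ A
      · by_cases h2 : A < ‖ξ - u‖
        · by_cases h3 : 1 < ‖u‖ <;> simp [indicator, h1, h2, h3, b]
        · by_cases h3 : 1 < ‖u‖ <;> simp [indicator, h1, h2, h3, b, not_lt.1 h2]
      · simp [indicator, h1]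
    have t1 : Tendsto (fun A : ℝ => ∫ u, (Metric.closedBall 0 A).indicator g u) atTop
        (𝓝 (∫ u, g u)) := by
      refine tendsto_integral_filter_of_dominated_convergence (fun u => |g u|)
        (.of_forall fun A => (hg.indicator
          Metric.isClosed_closedBall.measurableSet).aestronglyMeasurable)
        (.of_forall fun A => .of_forall fun u => ?_) hg.abs (.of_forall fun u => ?_)
      · rw [Real.norm_eq_abs]
        by_cases hu : u ∈ Metric.closedBall (0 : E d) A
        · rw [indicator_of_mem hu]
        · rw [indicator_of_notMem hu, abs_zero]; exact abs_nonneg _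
      · refine tendsto_const_nhds.congr' ?_
        filter_upwards [eventually_ge_atTop ‖u‖] with A hA
        rw [indicator_of_mem (by simpa using hA)]
    have t2 : Tendsto (fun A : ℝ => ∫ u, h A u) atTop (𝓝 0) := by
      have hq : Tendsto (fun A : ℝ => ((A / (A - 1)) ^ d - 1) *
          volume.real (Metric.ball (0 : E d) 1)) atTop (𝓝 0) := by
        have h1 : Tendsto (fun A : ℝ => 1 + 1 / (A - 1)) atTop (𝓝 (1 + 0)) :=
          tendsto_const_nhds.add (tendsto_const_nhds.div_atTop
            (tendsto_atTop_add_const_right _ (-1) tendsto_id))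
        have h2 : Tendsto (fun A : ℝ => A / (A - 1)) atTop (𝓝 1) := by
          rw [add_zero] at h1
          refine h1.congr' ?_
          filter_upwards [eventually_gt_atTop 1] with A hA
          have : A - 1 ≠ 0 := by linarith
          field_simp
          ring
        have h3 := ((h2.pow d).sub_const 1).mul_const (volume.real (Metric.ball (0 : E d) 1))
        simpa using h3
      refine squeeze_zero' (.of_forall fun A => integral_nonneg (h0 A)) ?_ hq
      filter_upwards [eventually_ge_atTop 2] with A hA
      exact integral_shell_le (by linarith) (h0 A) (hle A hA)
    have := t1.sub t2
    rw [sub_zero] at this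
    refine this.congr' ?_
    filter_upwards [eventually_ge_atTop 2] with A hA
    exact (hsplit A hA).symm
  refine ⟨∫ u, g u, ?_⟩
  have hn : Tendsto (fun x : E d => ‖x‖⁻¹) (𝓝[≠] 0) atTop := by
    refine tendsto_inv_nhdsGT_zero.comp (tendsto_nhdsWithin_iff.2 ⟨?_, ?_⟩)
    · exact (tendsto_norm_zero).mono_left nhdsWithin_le_nhds
    · filter_upwards [self_mem_nhdsWithin] with x hx
      exact norm_pos_iff.2 hx
  refine (key.comp hn).congr' ?_
  filter_upwards [self_mem_nhdsWithin] with x hx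
  have hx0 : 0 < ‖x‖ := norm_pos_iff.2 hx
  rw [Function.comp_apply, conv_kernelK _ (by positivity), inv_inv, Real.log_inv,
    rho_eq_of_norm_eq (y := x) (by rw [norm_smul, hξ, mul_one, norm_norm])]
  ring

lemma rho_le [NeZero d] {x : E d} (hx : x ≠ 0) :
    rho d x ≤ 2 * (‖x‖ / 2) ^ (-((d : ℝ) / 2)) * ∫ t, kernelK d 1 t := by
  have hx0 : 0 < ‖x‖ := norm_pos_iff.2 hx
  have hi := integrable_kernelK (d := d) 1
  have hi' : Integrable fun t => kernelK d 1 (x - t) := hi.comp_sub_left x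
  have h : rho d x ≤ ∫ t, (‖x‖ / 2) ^ (-((d : ℝ) / 2)) * (kernelK d 1 t + kernelK d 1 (x - t)) := by
    refine integral_mono_of_nonneg (.of_forall fun t => mul_nonneg (kernelK_nonneg 1 t)
      (kernelK_nonneg 1 _)) ((hi.add hi').const_mul _) (.of_forall fun t => ?_)
    change kernelK d 1 t * kernelK d 1 (x - t) ≤ _
    have h1 : ∀ y : E d, ‖x‖ / 2 ≤ ‖y‖ → kernelK d 1 y ≤ (‖x‖ / 2) ^ (-((d : ℝ) / 2)) := fun y hy =>
      (kernelK_le 1 y).trans (Real.rpow_le_rpow_of_nonpos (by positivity) hy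
        (neg_nonpos.2 (by positivity)))
    have p1 := kernelK_nonneg 1 t
    have p2 := kernelK_nonneg 1 (x - t)
    have p3 : 0 ≤ (‖x‖ / 2) ^ (-((d : ℝ) / 2)) := by positivity
    rcases le_or_gt (‖x‖ / 2) ‖t‖ with ht | ht
    · nlinarith [mul_le_mul_of_nonneg_right (h1 t ht) p2, mul_nonneg p3 p1]
    · have : ‖x‖ / 2 ≤ ‖x - t‖ := by linarith [norm_sub_norm_le x t]
      nlinarith [mul_le_mul_of_nonneg_left (h1 _ this) p1, mul_nonneg p3 p2]
  refine h.trans (le_of_eq ?_)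
  rw [integral_const_mul, integral_add hi hi', integral_sub_left_eq_self (kernelK d 1)]
  ring

/-- An upper bound of the covariance by a logarithm, at all scales. -/
lemma exists_rho_le [NeZero d] : ∃ C, ∀ x : E d, x ≠ 0 →
    rho d x ≤ sphereArea d * max 0 (-Real.log ‖x‖) + C := by
  obtain ⟨c, hc⟩ := exists_tendsto_rho (d := d)
  have h1 : ∀ᶠ x in 𝓝[≠] (0 : E d), rho d x + sphereArea d * Real.log ‖x‖ < c + 1 :=
    hc.eventually_lt_const (by linarith)
  obtain ⟨δ, hδ, h⟩ := Metric.mem_nhdsWithin_iff.1 h1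
  refine ⟨max (c + 1) (2 * (δ / 2) ^ (-((d : ℝ) / 2)) * ∫ t, kernelK d 1 t), fun x hx => ?_⟩
  have hω : 0 < sphereArea d := sphereArea_pos
  rcases lt_or_ge ‖x‖ δ with hxδ | hxδ
  · have h2 : rho d x + sphereArea d * Real.log ‖x‖ < c + 1 := h ⟨by simpa using hxδ, hx⟩
    have h3 := mul_le_mul_of_nonneg_left (le_max_right 0 (-Real.log ‖x‖)) hω.le
    linarith [le_max_left (c + 1) (2 * (δ / 2) ^ (-((d : ℝ) / 2)) * ∫ t, kernelK d 1 t)]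
  · have h2 : (‖x‖ / 2) ^ (-((d : ℝ) / 2)) ≤ (δ / 2) ^ (-((d : ℝ) / 2)) :=
      Real.rpow_le_rpow_of_nonpos (by positivity) (by linarith) (neg_nonpos.2 (by positivity))
    have h3 : 0 ≤ ∫ t : E d, kernelK d 1 t := integral_nonneg (kernelK_nonneg 1)
    have h4 := rho_le hx
    have h5 := mul_nonneg hω.le (le_max_left 0 (-Real.log ‖x‖))
    have h6 : 2 * (‖x‖ / 2) ^ (-((d : ℝ) / 2)) * ∫ t : E d, kernelK d 1 t ≤
        2 * (δ / 2) ^ (-((d : ℝ) / 2)) * ∫ t : E d, kernelK d 1 t := by gcongr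
    linarith [le_max_right (c + 1) (2 * (δ / 2) ^ (-((d : ℝ) / 2)) * ∫ t : E d, kernelK d 1 t)]

end Rho

/-! ### The covariance of the regularized field -/

lemma conv_assoc_of_hasCompactSupport {a g h : E d → ℝ} (ha : Continuous a) (hac : HasCompactSupport a)
    (hg : Integrable g) (hh : Integrable h) : conv (conv a g) h = conv a (conv g h) := by
  funext x
  refine convolution_assoc _ _ _ _ (fun x y z => mul_assoc x y z) ha.aestronglyMeasurable
    hg.aestronglyMeasurable hh.aestronglyMeasurable
    (.of_forall (hac.convolutionExists_left _ ha hg.locallyIntegrable))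
    (hg.norm.ae_convolution_exists _ hh.norm) ?_
  exact hac.norm.convolutionExists_left (ContinuousLinearMap.mul ℝ ℝ) ha.norm
    (hg.norm.integrable_convolution _ hh.norm).locallyIntegrable x

lemma conv_mollify_mono {θ : E d → ℝ} (hθ : IsMollifier θ) {ε : ℝ} (hε : 0 < ε) {g g' : E d → ℝ}
    (hg : LocallyIntegrable g) (hg' : LocallyIntegrable g') (h : ∀ᵐ y, g y ≤ g' y) (x : E d) :
    conv (mollify θ ε) g x ≤ conv (mollify θ ε) g' x := by
  refine integral_mono_ae (convolutionExists_mollify hθ hε hg x)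
    (convolutionExists_mollify hθ hε hg' x) ?_
  have h' : ∀ᵐ t, g (x - t) ≤ g' (x - t) :=
    (quasiMeasurePreserving_sub_left_of_right_invariant volume x).ae h
  filter_upwards [h'] with t ht
  exact mul_le_mul_of_nonneg_left ht (mollify_nonneg hθ hε t)

/-- The covariance of the regularizations at scales `ε` and `ε'` of the field. -/
noncomputable def covEps (R : ℝ) (θ : E d → ℝ) (ε ε' : ℝ) : E d → ℝ :=
  conv (kernelEps R θ ε) (kernelEps R θ ε')

section

variable {θ : E d → ℝ} {R : ℝ}

lemma kernelEps_smul (hR : 0 < R) {ε : ℝ} (hε : 0 < ε) (x : E d) :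
    kernelEps R θ ε x = R ^ (-((d : ℝ) / 2)) * kernelEps 1 θ (ε / R) (R⁻¹ • x) := by
  have h1 := conv_mollify_eq θ hε (kernelK d R) x
  have h2 := conv_mollify_eq θ (div_pos hε hR) (kernelK d 1) (R⁻¹ • x)
  change conv _ _ _ = _ * conv _ _ _
  rw [h1, h2, ← integral_const_mul]
  refine integral_congr_ae (.of_forall fun t => ?_)
  simp only
  rw [kernelK_smul hR (x - ε • t), smul_sub, smul_smul, div_eq_inv_mul]
  ring_nf

lemma covEps_zero_smul (hR : 0 < R) {ε : ℝ} (hε : 0 < ε) :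
    covEps R θ ε ε 0 = covEps 1 θ (ε / R) (ε / R) 0 := by
  have h := Measure.integral_comp_inv_smul_of_nonneg (μ := (volume : Measure (E d)))
    (fun t => kernelEps 1 θ (ε / R) t * kernelEps 1 θ (ε / R) (0 - t)) hR.le
  rw [finrank_euclideanSpace_fin, smul_eq_mul] at h
  have e : (R ^ (-((d : ℝ) / 2)) * R ^ (-((d : ℝ) / 2))) * R ^ d = 1 := by
    rw [← Real.rpow_natCast, ← Real.rpow_add hR, ← Real.rpow_add hR]
    rw [show -((d : ℝ) / 2) + -((d : ℝ) / 2) + d = 0 by ring, Real.rpow_zero]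
  calc covEps R θ ε ε 0
      = ∫ t, (R ^ (-((d : ℝ) / 2)) * R ^ (-((d : ℝ) / 2))) *
          (kernelEps 1 θ (ε / R) (R⁻¹ • t) * kernelEps 1 θ (ε / R) (0 - R⁻¹ • t)) := by
        refine integral_congr_ae (.of_forall fun t => ?_)
        change kernelEps R θ ε t * kernelEps R θ ε (0 - t) = _
        rw [kernelEps_smul hR hε t, kernelEps_smul hR hε (0 - t), smul_sub, smul_zero]
        ring
    _ = _ := by
        rw [integral_const_mul, h, ← mul_assoc, e, one_mul]
        rfl

variable (hθ : IsMollifier θ)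
include hθ

lemma integrable_kernelEps [NeZero d] {ε : ℝ} (hε : 0 < ε) : Integrable (kernelEps R θ ε) :=
  (contDiff_kernelEps hθ hε).continuous.integrable_of_hasCompactSupport
    (hasCompactSupport_kernelEps hθ hε)

lemma covEps_eq [NeZero d] (R : ℝ) {ε ε' : ℝ} (hε : 0 < ε) (hε' : 0 < ε') :
    covEps R θ ε ε' = conv (mollify θ ε) (conv (mollify θ ε') (conv (kernelK d R) (kernelK d R))) := by
  have hk := integrable_kernelK (d := d) R
  rw [covEps, kernelEps, conv_assoc_of_hasCompactSupport (contDiff_mollify hθ ε).continuous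
    (hasCompactSupport_mollify hθ hε) hk (integrable_kernelEps hθ hε'), conv_comm (kernelK d R),
    kernelEps, conv_assoc_of_hasCompactSupport (contDiff_mollify hθ ε').continuous
    (hasCompactSupport_mollify hθ hε') hk hk]

lemma continuous_covEps [NeZero d] {ε ε' : ℝ} (hε : 0 < ε) (hε' : 0 < ε') :
    Continuous (covEps R θ ε ε') :=
  (hasCompactSupport_kernelEps hθ hε).continuous_convolution_left _
    (contDiff_kernelEps hθ hε).continuous (integrable_kernelEps hθ hε').locallyIntegrable

/-- The normalization turns the stochastic exponential into one of mean one. -/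
lemma exp_neg_normalization [NeZero d] (hR : 0 < R) {γ₀ : ℝ} (hγ : 0 < γ₀) {ε : ℝ} (hε : 0 < ε)
    (hεR : ε ≤ R) : γ₀ * kernelEps R θ ε 0 * Real.exp (-normalization R γ₀ θ ε) =
      Real.exp (-(γ₀ ^ 2 * covEps R θ ε ε 0 / 2)) := by
  have hpos : 0 < γ₀ * kernelEps R θ ε 0 := mul_pos hγ (kernelEps_zero_pos hθ hε hεR)
  have h : rhoEps θ (ε / R) 0 = covEps R θ ε ε 0 := by
    rw [covEps_zero_smul hR hε, covEps_eq hθ 1 (div_pos hε hR) (div_pos hε hR)]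
    rfl
  rw [normalization, h, neg_add, Real.exp_add, Real.exp_neg (Real.log _), Real.exp_log hpos,
    mul_comm, mul_assoc, inv_mul_cancel₀ hpos.ne', mul_one]

omit hθ in
lemma exists_conv_kernelK_le [NeZero d] (hR : 0 < R) {δ : ℝ} (hδ : 0 < δ) (M : ℝ) :
    ∃ C, ∀ m, 0 < m → m ≤ M → ∀ z : E d, z ≠ 0 →
      conv (kernelK d R) (kernelK d R) z ≤ sphereArea d * (-Real.log m) + C +
        sphereArea d / δ * m ^ δ * ‖z‖ ^ (-δ) := by
  obtain ⟨C, hC⟩ := exists_rho_le (d := d)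
  have hω : 0 < sphereArea d := sphereArea_pos
  refine ⟨sphereArea d * (|Real.log R| + |Real.log M|) + C, fun m hm hmM z hz => ?_⟩
  have hz0 : 0 < ‖z‖ := norm_pos_iff.2 hz
  have h1 := hC (R⁻¹ • z) (smul_ne_zero (inv_ne_zero hR.ne') hz)
  rw [← conv_kernelK R hR, norm_smul, norm_inv, Real.norm_of_nonneg hR.le,
    Real.log_mul (by positivity) hz0.ne', Real.log_inv] at h1
  have h2 : Real.log (m / ‖z‖) ≤ (m / ‖z‖) ^ δ / δ :=
    Real.log_le_rpow_div (by positivity) hδ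
  rw [Real.log_div hm.ne' hz0.ne', Real.div_rpow hm.le hz0.le, div_eq_mul_inv (m ^ δ),
    ← Real.rpow_neg hz0.le] at h2
  have h3 : Real.log m ≤ |Real.log M| := (Real.log_le_log hm hmM).trans (le_abs_self _)
  have h4 : 0 ≤ m ^ δ * ‖z‖ ^ (-δ) / δ := by positivity
  have h5 : max 0 (-(-Real.log R + Real.log ‖z‖)) ≤
      -Real.log m + (|Real.log R| + |Real.log M|) + m ^ δ * ‖z‖ ^ (-δ) / δ :=
    max_le (by linarith [abs_nonneg (Real.log R)])
      (by linarith [le_abs_self (Real.log R), abs_nonneg (Real.log M)])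
  calc _ ≤ _ := h1
    _ ≤ sphereArea d * (-Real.log m + (|Real.log R| + |Real.log M|) + m ^ δ * ‖z‖ ^ (-δ) / δ) + C := by
        gcongr
    _ = _ := by ring

lemma exists_covEps_le [NeZero d] (hR : 0 < R) (M : ℝ) : ∃ C, ∀ ε ε' : ℝ, 0 < ε → 0 < ε' →
    ∀ y : E d, max ‖y‖ ε ≤ M →
      covEps R θ ε ε' y ≤ sphereArea d * (-Real.log (max ‖y‖ ε)) + C := by
  have hd : (0 : ℝ) < d := by exact_mod_cast NeZero.pos d
  set δ : ℝ := (d : ℝ) / 2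
  have hδ : 0 < δ := by positivity
  have hδd : δ < d := half_dim_lt
  have hω : 0 < sphereArea d := sphereArea_pos
  obtain ⟨C, hC⟩ := exists_conv_kernelK_le (d := d) hR hδ M
  obtain ⟨C₀, hC₀, hs⟩ := exists_conv_mollify_rpow_le hθ hδ.le hδd
  refine ⟨C + sphereArea d / δ * C₀ * C₀, fun ε ε' hε hε' y hy => ?_⟩
  have hm : 0 < max ‖y‖ ε := lt_max_of_lt_right hε
  set m := max ‖y‖ ε
  have hr := locallyIntegrable_rpow_neg (d := d) hδd
  have hne : ∀ᵐ t : E d, t ≠ 0 := by simp [ae_iff, measure_singleton]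
  have hmaj : ∀ (c A : ℝ), LocallyIntegrable fun z : E d => c + A * ‖z‖ ^ (-δ) := fun c A =>
    (locallyIntegrable_const c).add (hr.smul A)
  have hconv : ∀ (c A ε : ℝ), 0 < ε → ∀ x : E d, conv (mollify θ ε) (fun z => c + A * ‖z‖ ^ (-δ)) x =
      c + A * conv (mollify θ ε) (fun z => ‖z‖ ^ (-δ)) x := fun c A ε hε x => by
    have h1 := convolutionExists_mollify hθ hε hr x
    simp only [conv_apply]
    rw [← integral_const_mul]
    have : c = ∫ t, mollify θ ε t * c := by
      rw [integral_mul_const, integral_mollify hθ hε, one_mul]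
    conv_rhs => rw [this]
    rw [← integral_add ((integrable_mollify hθ hε).mul_const c) (h1.const_mul A)]
    exact integral_congr_ae (.of_forall fun t => by ring)
  have hk := integrable_kernelK (d := d) R
  have hkk : LocallyIntegrable (conv (kernelK d R) (kernelK d R)) :=
    (hk.integrable_convolution _ hk).locallyIntegrable
  set c := sphereArea d * (-Real.log m) + C
  set A := sphereArea d / δ * m ^ δ
  have hA : 0 ≤ A := by positivity
  have s1 : ∀ z : E d, z ≠ 0 → conv (mollify θ ε') (conv (kernelK d R) (kernelK d R)) z ≤
      c + (A * C₀) * ‖z‖ ^ (-δ) := fun z hz => by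
    refine (conv_mollify_mono hθ hε' hkk (hmaj c A) ?_ z).trans ?_
    · filter_upwards [hne] with t ht
      exact hC m hm hy t ht
    · rw [hconv c A ε' hε', mul_assoc]
      have h2 : max ‖z‖ ε' ^ (-δ) ≤ ‖z‖ ^ (-δ) :=
        Real.rpow_le_rpow_of_nonpos (norm_pos_iff.2 hz) (le_max_left _ _) (by linarith)
      have h3 := (hs ε' hε' z).trans (mul_le_mul_of_nonneg_left h2 hC₀.le)
      linarith [mul_le_mul_of_nonneg_left h3 hA]
  rw [covEps_eq hθ R hε hε']
  have hcont : LocallyIntegrable (conv (mollify θ ε') (conv (kernelK d R) (kernelK d R))) :=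
    (contDiff_conv_mollify hθ hε' hkk).continuous.locallyIntegrable
  refine (conv_mollify_mono hθ hε hcont (hmaj c (A * C₀))
    (hne.mono fun z hz => s1 z hz) y).trans ?_
  rw [hconv c _ ε hε]
  have h4 := mul_le_mul_of_nonneg_left (hs ε hε y) (mul_nonneg hA hC₀.le)
  have h5 : A * C₀ * (C₀ * m ^ (-δ)) = sphereArea d / δ * C₀ * C₀ := by
    have : m ^ δ * m ^ (-δ) = 1 := by rw [← Real.rpow_add hm]; simp
    calc A * C₀ * (C₀ * m ^ (-δ)) = sphereArea d / δ * C₀ * C₀ * (m ^ δ * m ^ (-δ)) := by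
          simp only [A]; ring
      _ = _ := by rw [this, mul_one]
  rw [h5] at h4
  simp only [c]
  linarith

omit hθ in
lemma integrable_mul_rpow_neg [NeZero d] {y : E d} (hy : y ≠ 0) (r : ℝ) :
    IntegrableOn (fun t => ‖t‖ ^ (-((d : ℝ) / 2)) * ‖y - t‖ ^ (-((d : ℝ) / 2))) (Metric.ball 0 r) := by
  have hy0 : 0 < ‖y‖ := norm_pos_iff.2 hy
  set b : ℝ := (d : ℝ) / 2
  have hb : 0 ≤ b := by positivity
  have hloc1 : IntegrableOn (fun u : E d => ‖u‖ ^ (-b)) (Metric.ball 0 r) :=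
    integrableOn_norm_rpow_neg half_dim_lt r
  have hloc2 : IntegrableOn (fun u : E d => ‖y - u‖ ^ (-b)) (Metric.ball 0 r) := by
    obtain ⟨M, hM, h⟩ := lintegral_ball_norm_sub_rpow_neg_le (d := d) hb half_dim_lt r
    refine ⟨Measurable.aestronglyMeasurable (by fun_prop), lt_of_le_of_lt ?_ hM.lt_top⟩
    refine le_trans (lintegral_mono fun t => ?_) (h y 0)
    rw [← ofReal_norm, Real.norm_of_nonneg (by positivity), norm_sub_rev]
  refine Integrable.mono' (Integrable.const_mul (Integrable.add hloc1 hloc2) ((‖y‖ / 2) ^ (-b)))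
    (Measurable.aestronglyMeasurable (by fun_prop)) (.of_forall fun t => ?_)
  rw [Real.norm_of_nonneg (by positivity), Pi.add_apply]
  have h1 : ∀ x : ℝ, ‖y‖ / 2 ≤ x → x ^ (-b) ≤ (‖y‖ / 2) ^ (-b) := fun x hx =>
    Real.rpow_le_rpow_of_nonpos (by positivity) hx (by linarith)
  have p1 : 0 ≤ ‖t‖ ^ (-b) := by positivity
  have p2 : 0 ≤ ‖y - t‖ ^ (-b) := by positivity
  have p3 : 0 ≤ (‖y‖ / 2) ^ (-b) := by positivity
  rcases le_or_gt (‖y‖ / 2) ‖t‖ with ht | ht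
  · nlinarith [mul_le_mul_of_nonneg_right (h1 _ ht) p2, mul_nonneg p3 p1]
  · have : ‖y‖ / 2 ≤ ‖y - t‖ := by linarith [norm_sub_norm_le y t]
    nlinarith [mul_le_mul_of_nonneg_left (h1 _ this) p1, mul_nonneg p3 p2]

lemma tendsto_covEps [NeZero d] (hR : 0 < R) {ι : Type*} {l : Filter ι} [l.IsCountablyGenerated]
    {a b : ι → ℝ} (ha : Tendsto a l (𝓝[>] 0)) (hb : Tendsto b l (𝓝[>] 0)) {y : E d} (hy : y ≠ 0) :
    Tendsto (fun i => covEps R θ (a i) (b i) y) l (𝓝 (rho d (R⁻¹ • y))) := by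
  rw [← conv_kernelK R hR]
  obtain ⟨C, hC, hle⟩ := exists_kernelEps_le hθ R
  have hI : Integrable ((Metric.ball (0 : E d) (R + 2)).indicator fun t =>
      (C * C) * (‖t‖ ^ (-((d : ℝ) / 2)) * ‖y - t‖ ^ (-((d : ℝ) / 2)))) :=
    (integrable_indicator_iff Metric.isOpen_ball.measurableSet).2
      (Integrable.const_mul (integrable_mul_rpow_neg hy (R + 2)) _)
  have hne : ∀ᵐ t : E d, t ≠ 0 ∧ t ≠ y ∧ ‖t‖ ≠ R ∧ ‖y - t‖ ≠ R := by
    have h1 : ∀ z : E d, ∀ᵐ t : E d, t ≠ z := fun z => by simp [ae_iff, measure_singleton]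
    have h2 : ∀ z : E d, ∀ᵐ t : E d, ‖z - t‖ ≠ R := fun z => by
      have := Measure.addHaar_sphere_of_ne_zero (volume : Measure (E d)) z hR.ne'
      filter_upwards [measure_eq_zero_iff_ae_notMem.1 this] with t ht h
      exact ht (by rw [mem_sphere_iff_norm, norm_sub_rev, h])
    filter_upwards [h1 0, h1 y, h2 0, h2 y] with t a1 a2 a3 a4
    exact ⟨a1, a2, by simpa using a3, a4⟩
  have ha' : ∀ᶠ i in l, a i ∈ Ioo 0 1 := ha (Ioo_mem_nhdsGT one_pos)
  have hb' : ∀ᶠ i in l, b i ∈ Ioo 0 1 := hb (Ioo_mem_nhdsGT one_pos)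
  refine tendsto_integral_filter_of_dominated_convergence _ ?_ ?_ hI ?_
  · filter_upwards [ha', hb'] with i h1 h2
    exact ((contDiff_kernelEps hθ h1.1).continuous.mul ((contDiff_kernelEps hθ h2.1).continuous.comp
      (continuous_const.sub continuous_id))).aestronglyMeasurable
  · filter_upwards [ha', hb'] with i h1 h2
    filter_upwards [hne] with t ht
    change ‖kernelEps R θ (a i) t * kernelEps R θ (b i) (y - t)‖ ≤ _
    rw [Real.norm_of_nonneg (mul_nonneg (kernelEps_nonneg hθ h1.1 _) (kernelEps_nonneg hθ h2.1 _))]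
    by_cases h : t ∈ Metric.ball (0 : E d) (R + 2)
    · rw [indicator_of_mem h]
      have hk : ∀ ε > 0, ∀ x : E d, x ≠ 0 → kernelEps R θ ε x ≤ C * ‖x‖ ^ (-((d : ℝ) / 2)) :=
        fun ε hε x hx => (hle ε hε x).trans (mul_le_mul_of_nonneg_left
          (Real.rpow_le_rpow_of_nonpos (norm_pos_iff.2 hx) (le_max_left _ _)
            (neg_nonpos.2 (by positivity))) hC.le)
      calc _ ≤ (C * ‖t‖ ^ (-((d : ℝ) / 2))) * (C * ‖y - t‖ ^ (-((d : ℝ) / 2))) :=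
            mul_le_mul (hk _ h1.1 t ht.1) (hk _ h2.1 _ (sub_ne_zero.2 ht.2.1.symm))
              (kernelEps_nonneg hθ h2.1 _) (by positivity)
        _ = _ := by ring
    · rw [indicator_of_notMem h]
      rw [mem_ball_zero_iff, not_lt] at h
      rw [kernelEps_eq_zero hθ h1.1 (by linarith [h1.2]), zero_mul]
  · filter_upwards [hne] with t ht
    exact ((tendsto_kernelEps hθ ht.1 ht.2.2.1).comp ha).mul
      ((tendsto_kernelEps hθ (sub_ne_zero.2 ht.2.1.symm) ht.2.2.2).comp hb)

end

/-! ### Reflected translates as test functions -/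

/-- The test function `σ ↦ f (y - σ)`. -/
noncomputable def reflTest {f : E d → ℝ} (hf : ContDiff ℝ (⊤ : ℕ∞) f) (hc : HasCompactSupport f)
    (y : E d) : Test d :=
  ⟨fun σ => f (y - σ), contDiff_refl hf y, hasCompactSupport_refl hc y, fun _ _ => trivial⟩

lemma reflTest_apply {f : E d → ℝ} (hf : ContDiff ℝ (⊤ : ℕ∞) f) (hc : HasCompactSupport f)
    (y σ : E d) : reflTest hf hc y σ = f (y - σ) := rfl

lemma pairing_reflTest (T : Dist d) {f : E d → ℝ} (hf : ContDiff ℝ (⊤ : ℕ∞) f)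
    (hc : HasCompactSupport f) (y : E d) : pairing T (fun σ => f (y - σ)) = T (reflTest hf hc y) :=
  pairing_of_test T (contDiff_refl hf y) (hasCompactSupport_refl hc y)

lemma l2Form_reflTest {f g : E d → ℝ} (hf : ContDiff ℝ (⊤ : ℕ∞) f) (hfc : HasCompactSupport f)
    (hg : ContDiff ℝ (⊤ : ℕ∞) g) (hgc : HasCompactSupport g) (hge : ∀ x, g (-x) = g x) (y y' : E d) :
    l2Form d (reflTest hf hfc y) (reflTest hg hgc y') = conv f g (y - y') := by
  rw [l2Form_apply, conv_apply, ← integral_sub_left_eq_self _ volume y]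
  refine integral_congr_ae (.of_forall fun t => ?_)
  simp only [reflTest_apply, sub_sub_cancel]
  rw [← hge (y' - _)]
  congr 2
  abel

end MultifractalField

namespace MultifractalField

variable {d : ℕ} {Ω : Type*} [MeasurableSpace Ω] {μ : Measure Ω}

/-! ### Moments of integrals of random fields -/

/-- A continuous random field with bounded moments of order `q`. -/
structure IsRandomField (q : ℕ) (μ : Measure Ω) (Y : E d → Ω → ℝ) : Prop where
  continuous : ∀ ω, Continuous fun y => Y y ω
  aemeasurable : ∀ y, AEMeasurable (Y y) μ
  bound : ∃ K : ENNReal, K ≠ ⊤ ∧ ∀ y, ∫⁻ ω, ENNReal.ofReal (|Y y ω| ^ q) ∂μ ≤ K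

lemma exists_measurable_version {Y : E d → Ω → ℝ} (hc : ∀ ω, Continuous fun y => Y y ω)
    (hm : ∀ y, AEMeasurable (Y y) μ) :
    ∃ Y' : E d → Ω → ℝ, Measurable (Function.uncurry Y') ∧ ∀ᵐ ω ∂μ, ∀ y, Y' y ω = Y y ω := by
  classical
  have h1 : ∀ᵐ ω ∂μ, ∀ n, Y (TopologicalSpace.denseSeq (E d) n) ω =
      (hm (TopologicalSpace.denseSeq (E d) n)).mk _ ω :=
    ae_all_iff.2 fun n => (hm _).ae_eq_mk
  obtain ⟨S, hS, hSm, hSn⟩ := exists_measurable_superset_of_null h1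
  have hS' : ∀ ω, ω ∉ S → ∀ n, Y (TopologicalSpace.denseSeq (E d) n) ω =
      (hm (TopologicalSpace.denseSeq (E d) n)).mk _ ω := fun ω hω => by
    by_contra h; exact hω (hS h)
  let Y' : E d → Ω → ℝ := fun y => Sᶜ.indicator (Y y)
  have hc' : ∀ ω, Continuous fun y => Y' y ω := fun ω => by
    by_cases h : ω ∈ Sᶜ
    · simpa only [Y', indicator_of_mem h] using hc ω
    · simpa only [Y', indicator_of_notMem h] using continuous_const
  have hd : ∀ n, Measurable (Y' (TopologicalSpace.denseSeq (E d) n)) := fun n => by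
    have : Y' (TopologicalSpace.denseSeq (E d) n) =
        Sᶜ.indicator ((hm (TopologicalSpace.denseSeq (E d) n)).mk _) := by
      funext ω
      by_cases h : ω ∈ Sᶜ
      · simp only [Y', indicator_of_mem h]; exact hS' ω h n
      · simp only [Y', indicator_of_notMem h]
    rw [this]
    exact (hm _).measurable_mk.indicator hSm.compl
  have hmeas : ∀ y, Measurable (Y' y) := fun y => by
    obtain ⟨u, hu, hlim⟩ := mem_closure_iff_seq_limit.1
      (TopologicalSpace.denseRange_denseSeq (E d) y)
    refine measurable_of_tendsto_metrizable (f := fun n => Y' (u n)) (fun n => ?_)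
      (tendsto_pi_nhds.2 fun ω => ((hc' ω).tendsto y).comp hlim)
    obtain ⟨k, hk⟩ := hu n
    rw [← hk]
    exact hd k
  refine ⟨Y', ?_, ?_⟩
  · exact measurable_uncurry_of_continuous_of_measurable (u := Y') hc' hmeas
  · have : ∀ᵐ ω ∂μ, ω ∉ S := measure_eq_zero_iff_ae_notMem.1 hSn
    filter_upwards [this] with ω hω y
    exact indicator_of_mem (show ω ∈ Sᶜ from hω) _

lemma aemeasurable_integral_mul [SFinite μ] {Y : E d → Ω → ℝ} (hc : ∀ ω, Continuous fun y => Y y ω)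
    (hm : ∀ y, AEMeasurable (Y y) μ) {G : E d → ℝ} (hG : Measurable G) :
    AEMeasurable (fun ω => ∫ y, G y * Y y ω) μ := by
  obtain ⟨Y', hY', h⟩ := exists_measurable_version hc hm
  have h1 : StronglyMeasurable fun p : Ω × E d => G p.2 * Y' p.2 p.1 :=
    ((hG.comp measurable_snd).mul (hY'.comp (measurable_snd.prodMk measurable_fst))).stronglyMeasurable
  refine ⟨fun ω => ∫ y, G y * Y' y ω, h1.integral_prod_right.measurable, ?_⟩
  filter_upwards [h] with ω hω
  simp only [hω]

/-- The mixed moments of integrals of random fields. -/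
lemma IsRandomField.integral_prod [SFinite μ] {q : ℕ} [NeZero q] {Y : Fin q → E d → Ω → ℝ}
    (hY : ∀ i, IsRandomField q μ (Y i)) {G : Fin q → E d → ℝ} (hG : ∀ i, Continuous (G i))
    (hGc : ∀ i, HasCompactSupport (G i)) :
    Integrable (fun ω => ∏ i, ∫ y, G i y * Y i y ω) μ ∧
      ∫ ω, ∏ i, (∫ y, G i y * Y i y ω) ∂μ =
        ∫ u : Fin q → E d, (∏ i, G i (u i)) * ∫ ω, ∏ i, Y i (u i) ω ∂μ := by
  have hne : Nonempty (Fin q) := ⟨0⟩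
  choose Y' hY' hYY' using fun i => exists_measurable_version (hY i).continuous (hY i).aemeasurable
  choose K hK hKb using fun i => (hY i).bound
  have hall : ∀ᵐ ω ∂μ, ∀ i y, Y' i y ω = Y i y ω := ae_all_iff.2 hYY'
  let Φ : Ω × (Fin q → E d) → ℝ := fun p => ∏ i, (G i (p.2 i) * Y' i (p.2 i) p.1)
  have hmΦ : Measurable Φ := Finset.measurable_prod _ fun i _ =>
    ((hG i).measurable.comp ((measurable_pi_apply i).comp measurable_snd)).mul
      ((hY' i).comp (f := fun p : Ω × (Fin q → E d) => (p.2 i, p.1))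
        (((measurable_pi_apply i).comp measurable_snd).prodMk measurable_fst))
  have hGi : ∀ i, Integrable (G i) := fun i => (hG i).integrable_of_hasCompactSupport (hGc i)
  have hprodG : Integrable fun u : Fin q → E d => ∏ i, G i (u i) :=
    Integrable.fintype_prod hGi
  have hYb : ∀ u : Fin q → E d, ∫⁻ ω, ENNReal.ofReal |∏ i, Y' i (u i) ω| ∂μ ≤ ∑ i, K i := fun u => by
    calc ∫⁻ ω, ENNReal.ofReal |∏ i, Y' i (u i) ω| ∂μ
        ≤ ∫⁻ ω, ∑ i, ENNReal.ofReal (|Y' i (u i) ω| ^ q) ∂μ := by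
          refine lintegral_mono fun ω => ?_
          rw [← ENNReal.ofReal_sum_of_nonneg fun i _ => by positivity]
          refine ENNReal.ofReal_le_ofReal ?_
          simpa using abs_prod_le_sum_pow fun i => Y' i (u i) ω
      _ = ∑ i, ∫⁻ ω, ENNReal.ofReal (|Y' i (u i) ω| ^ q) ∂μ := by
          refine lintegral_finsetSum _ fun i _ => ?_
          have : Measurable (Y' i (u i)) := (hY' i).comp (measurable_const.prodMk measurable_id)
          exact (this.abs.pow_const q).ennreal_ofReal
      _ ≤ ∑ i, K i := Finset.sum_le_sum fun i _ => by
          refine le_trans (le_of_eq (lintegral_congr_ae ?_)) (hKb i (u i))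
          filter_upwards [hall] with ω hω
          rw [hω i]
  have hint : Integrable Φ (μ.prod volume) := by
    refine ⟨hmΦ.aestronglyMeasurable, ?_⟩
    change ∫⁻ p, ‖Φ p‖ₑ ∂_ < ⊤
    rw [lintegral_prod_symm' _ hmΦ.enorm]
    calc ∫⁻ u, ∫⁻ ω, ‖Φ (ω, u)‖ₑ ∂μ
        ≤ ∫⁻ u : Fin q → E d, ‖∏ i, G i (u i)‖ₑ * ∑ i, K i := by
          refine lintegral_mono fun u => ?_
          have e : ∀ ω, ‖Φ (ω, u)‖ₑ = ‖∏ i, G i (u i)‖ₑ * ENNReal.ofReal |∏ i, Y' i (u i) ω| :=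
            fun ω => by
              simp only [Φ]
              rw [Finset.prod_mul_distrib, enorm_mul, ← Real.norm_eq_abs, ofReal_norm]
          simp only [e]
          have hm : Measurable fun ω => ∏ i, Y' i (u i) ω := Finset.measurable_prod _ fun i _ =>
            (hY' i).comp (measurable_const.prodMk measurable_id)
          rw [lintegral_const_mul _ hm.abs.ennreal_ofReal]
          exact mul_le_mul_right (hYb u) _
      _ < ⊤ := by
          rw [lintegral_mul_const'' _ hprodG.1.enorm]
          exact ENNReal.mul_lt_top hprodG.2 (ENNReal.sum_lt_top.2 fun i _ => (hK i).lt_top)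
  have hprod : ∀ ω, (∀ i y, Y' i y ω = Y i y ω) →
      ∫ u, Φ (ω, u) = ∏ i, ∫ y, G i y * Y i y ω := fun ω hω => by
    simp only [Φ, hω]
    exact integral_fintype_prod_volume_eq_prod fun i y => G i y * Y i y ω
  constructor
  · refine hint.integral_prod_left.congr ?_
    filter_upwards [hall] with ω hω
    exact hprod ω hω
  · calc ∫ ω, ∏ i, (∫ y, G i y * Y i y ω) ∂μ = ∫ ω, (∫ u, Φ (ω, u)) ∂μ := by
          refine integral_congr_ae ?_
          filter_upwards [hall] with ω hω
          exact (hprod ω hω).symm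
      _ = ∫ u, ∫ ω, Φ (ω, u) ∂μ := integral_integral_swap hint
      _ = _ := by
          refine integral_congr_ae (.of_forall fun u => ?_)
          simp only [Φ, Finset.prod_mul_distrib]
          rw [integral_const_mul]
          congr 1
          refine integral_congr_ae ?_
          filter_upwards [hall] with ω hω
          simp only [hω]

/-! ### The exponential of the field -/

/-- The stochastic exponential of the regularized field. -/
noncomputable def expField (R γ₀ : ℝ) (θ : E d → ℝ) (ε : ℝ) (T : Dist d) (y : E d) : ℝ :=
  Real.exp (logField R γ₀ θ ε T y - γ₀ ^ 2 * covEps R θ ε ε 0 / 2)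

lemma sum_sum_eq_of_symm {q : ℕ} (a : Fin q → Fin q → ℝ) (ha : ∀ i k, a i k = a k i) :
    ∑ i, ∑ k, a i k = ∑ i, a i i + 2 * ∑ i, ∑ k ∈ Finset.Ioi i, a i k := by
  have h := Finset.sum_sum_Ioi_add_eq_sum_sum_off_diag a
  have h1 : ∑ i, ∑ k ∈ Finset.Ioi i, (a k i + a i k) = 2 * ∑ i, ∑ k ∈ Finset.Ioi i, a i k := by
    simp only [Finset.mul_sum]
    refine Finset.sum_congr rfl fun i _ => Finset.sum_congr rfl fun k _ => ?_
    rw [ha k i]; ring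
  rw [← h1, h, ← Finset.sum_add_distrib]
  refine Finset.sum_congr rfl fun i _ => ?_
  rw [Fintype.sum_eq_add_sum_compl i]
  congr 1
  exact Finset.sum_congr rfl fun k _ => ha _ _

section ExpField

variable [NeZero d] [IsProbabilityMeasure μ] {R γ₀ : ℝ} {θ : E d → ℝ} (hθ : IsMollifier θ)
  {W : Ω → Dist d} (hW : IsWhiteNoise W μ)

include hθ in
lemma logField_eq {ε : ℝ} (hε : 0 < ε) (T : Dist d) (y : E d) : logField R γ₀ θ ε T y =
    T (γ₀ • reflTest (contDiff_kernelEps (R := R) hθ hε) (hasCompactSupport_kernelEps hθ hε) y) := by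
  rw [logField, pairing_reflTest T (contDiff_kernelEps hθ hε) (hasCompactSupport_kernelEps hθ hε),
    map_smul, smul_eq_mul]

include hθ in
lemma contDiff_logField {ε : ℝ} (hε : 0 < ε) (T : Dist d) :
    ContDiff ℝ (⊤ : ℕ∞) (logField R γ₀ θ ε T) :=
  contDiff_const.mul (contDiff_pairing_refl T (contDiff_kernelEps hθ hε)
    (hasCompactSupport_kernelEps hθ hε))

include hθ hW

/-- The mixed moments of the stochastic exponentials. -/
lemma integral_prod_expField {q : ℕ} {ε : Fin q → ℝ} (hε : ∀ i, 0 < ε i) (u : Fin q → E d) :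
    Integrable (fun ω => ∏ i, expField R γ₀ θ (ε i) (W ω) (u i)) μ ∧
    ∫ ω, ∏ i, expField R γ₀ θ (ε i) (W ω) (u i) ∂μ =
      Real.exp (γ₀ ^ 2 * ∑ i, ∑ k ∈ Finset.Ioi i, covEps R θ (ε i) (ε k) (u i - u k)) := by
  have hG := hW.isGaussianFamily
  let g : Fin q → Test d := fun i =>
    reflTest (contDiff_kernelEps (R := R) hθ (hε i)) (hasCompactSupport_kernelEps hθ (hε i)) (u i)
  have hg : ∀ i k, l2Form d (g i) (g k) = covEps R θ (ε i) (ε k) (u i - u k) := fun i k =>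
    l2Form_reflTest _ _ _ _ (kernelEps_neg hθ (ε k)) _ _
  let S : Test d := ∑ i, γ₀ • g i
  have e1 : ∀ ω, ∏ i, expField R γ₀ θ (ε i) (W ω) (u i) =
      Real.exp (-(γ₀ ^ 2 / 2 * ∑ i, covEps R θ (ε i) (ε i) 0)) * Real.exp (W ω S) := fun ω => by
    simp only [expField]
    rw [← Real.exp_sum, ← Real.exp_add]
    congr 1
    simp only [S, map_sum, Finset.sum_sub_distrib, logField_eq hθ (hε _), Finset.mul_sum]
    rw [sub_eq_neg_add]
    congr 2
    exact Finset.sum_congr rfl fun i _ => by ring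
  have e2 : l2Form d S S = γ₀ ^ 2 * (∑ i, covEps R θ (ε i) (ε i) 0 +
      2 * ∑ i, ∑ k ∈ Finset.Ioi i, covEps R θ (ε i) (ε k) (u i - u k)) := by
    have := sum_sum_eq_of_symm (fun i k => l2Form d (g i) (g k)) fun i k => hG.symm _ _
    simp only [hg, sub_self] at this
    rw [← this]
    simp only [S, map_sum, map_smul, LinearMap.sum_apply, LinearMap.smul_apply, smul_eq_mul, hg,
      Finset.mul_sum]
    refine (Finset.sum_comm).trans (Finset.sum_congr rfl fun i _ => Finset.sum_congr rfl fun k _ => ?_)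
    ring
  simp only [e1]
  refine ⟨(hG.integrable_exp S).const_mul _, ?_⟩
  rw [integral_const_mul, hG.integral_exp S, ← Real.exp_add, e2]
  congr 1
  ring

lemma isRandomField_expField (q : ℕ) {ε : ℝ} (hε : 0 < ε) :
    IsRandomField q μ fun y ω => expField R γ₀ θ ε (W ω) y := by
  refine ⟨fun ω => ?_, fun y => ?_, ?_⟩
  · exact Real.continuous_exp.comp ((contDiff_logField hθ hε (W ω)).continuous.sub continuous_const)
  · have := (integral_prod_expField (R := R) (γ₀ := γ₀) hθ hW (q := 1) (ε := fun _ => ε) (fun _ => hε)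
      (fun _ => y)).1.aemeasurable
    simpa using this
  · refine ⟨ENNReal.ofReal (Real.exp (γ₀ ^ 2 * ∑ i : Fin q, ∑ k ∈ Finset.Ioi i, covEps R θ ε ε 0)),
      ENNReal.ofReal_ne_top, fun y => le_of_eq ?_⟩
    obtain ⟨h1, h2⟩ := integral_prod_expField (R := R) (γ₀ := γ₀) hθ hW (q := q) (ε := fun _ => ε)
      (fun _ => hε) (fun _ => y)
    simp only [Finset.prod_const, Finset.card_univ, Fintype.card_fin, sub_self] at h1 h2
    have e : ∀ ω, |expField R γ₀ θ ε (W ω) y| = expField R γ₀ θ ε (W ω) y := fun ω =>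
      abs_of_pos (Real.exp_pos _)
    simp only [e]
    rw [← ofReal_integral_eq_lintegral_ofReal h1
      (.of_forall fun ω => pow_nonneg (Real.exp_pos _).le _), h2]

end ExpField

/-! ### Convergence of moments -/

/-- Continuous functions `G ε` supported in a common ball, dominated by `w` and converging
to `H` almost everywhere. -/
structure IsKernelFamily (G : ℝ → E d → ℝ) (H w : E d → ℝ) (r : ℝ) : Prop where
  measurable : Measurable w
  continuous : ∀ᶠ ε in 𝓝[>] 0, Continuous (G ε)
  abs_le : ∀ᶠ ε in 𝓝[>] 0, ∀ y, |G ε y| ≤ w y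
  eq_zero : ∀ᶠ ε in 𝓝[>] 0, ∀ y, r < ‖y‖ → G ε y = 0
  tendsto : ∀ᵐ y, Tendsto (fun ε => G ε y) (𝓝[>] 0) (𝓝 (H y))

/-- The integral of a function against the stochastic exponential. -/
noncomputable def expIntegral (R γ₀ : ℝ) (θ : E d → ℝ) (ε : ℝ) (G : E d → ℝ) (T : Dist d) : ℝ :=
  ∫ y, G y * expField R γ₀ θ ε T y

/-- The moments of the limits of these integrals. -/
noncomputable def limitMoment (R γ₀ : ℝ) (q : ℕ) (H : E d → ℝ) : ℝ :=
  ∫ u : Fin q → E d, (∏ i, H (u i)) *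
    Real.exp (γ₀ ^ 2 * ∑ i, ∑ k ∈ Finset.Ioi i, rho d (R⁻¹ • (u i - u k)))

lemma exp_sum_log_eq_pairProd {q : ℕ} {u : Fin q → E d} (hu : ∀ i k, i ≠ k → u i ≠ u k)
    (g ω C : ℝ) : Real.exp (g * ∑ i, ∑ k ∈ Finset.Ioi i, (ω * (-Real.log ‖u i - u k‖) + C)) =
      Real.exp (g * ∑ i : Fin q, ∑ _k ∈ Finset.Ioi i, C) * pairProd (g * ω) u := by
  simp only [Finset.sum_add_distrib, mul_add, Real.exp_add]
  rw [mul_comm]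
  congr 1
  rw [pairProd]
  simp only [Finset.mul_sum, Real.exp_sum]
  refine Finset.prod_congr rfl fun i _ => Finset.prod_congr rfl fun k hk => ?_
  have : 0 < ‖u i - u k‖ := norm_pos_iff.2 (sub_ne_zero.2 (hu i k (Finset.mem_Ioi.1 hk).ne))
  rw [Real.rpow_def_of_pos this]
  congr 1
  ring

lemma integrable_mul_pairProd {q : ℕ} {w : E d → ℝ} (hw : Measurable w) (hw0 : ∀ y, 0 ≤ w y) {s : ℝ}
    (hfin : pairIntegral q (fun y => ENNReal.ofReal (w y)) s < ⊤) :
    Integrable fun u : Fin q → E d => (∏ i, w (u i)) * pairProd s u := by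
  refine ⟨((Finset.measurable_prod _ fun i _ => hw.comp (measurable_pi_apply i)).mul
    (measurable_pairProd s)).aestronglyMeasurable, lt_of_eq_of_lt (lintegral_congr fun u => ?_) hfin⟩
  have h0 : 0 ≤ ∏ i, w (u i) := Finset.prod_nonneg fun i _ => hw0 _
  rw [← ofReal_norm, Real.norm_of_nonneg (mul_nonneg h0 (pairProd_nonneg s u)),
    ENNReal.ofReal_mul h0, ENNReal.ofReal_prod_of_nonneg fun i _ => hw0 _]

lemma integral_alternating_sum {f₀ f₁ f₂ f₃ f₄ : Ω → ℝ} (h₀ : Integrable f₀ μ)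
    (h₁ : Integrable f₁ μ) (h₂ : Integrable f₂ μ) (h₃ : Integrable f₃ μ) (h₄ : Integrable f₄ μ) :
    ∫ ω, (f₀ ω - 4 * f₁ ω + 6 * f₂ ω - 4 * f₃ ω + f₄ ω) ∂μ =
      ∫ ω, f₀ ω ∂μ - 4 * ∫ ω, f₁ ω ∂μ + 6 * ∫ ω, f₂ ω ∂μ - 4 * ∫ ω, f₃ ω ∂μ + ∫ ω, f₄ ω ∂μ := by
  have i1 : Integrable (fun ω => f₀ ω - 4 * f₁ ω) μ := h₀.sub (h₁.const_mul 4)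
  have i2 : Integrable (fun ω => f₀ ω - 4 * f₁ ω + 6 * f₂ ω) μ := i1.add (h₂.const_mul 6)
  have i3 : Integrable (fun ω => f₀ ω - 4 * f₁ ω + 6 * f₂ ω - 4 * f₃ ω) μ :=
    i2.sub (h₃.const_mul 4)
  rw [integral_add i3 h₄, integral_sub i2 (h₃.const_mul 4), integral_add i1 (h₂.const_mul 6),
    integral_sub h₀ (h₁.const_mul 4), integral_const_mul, integral_const_mul, integral_const_mul]

section

variable [NeZero d] [IsProbabilityMeasure μ] {R γ₀ : ℝ} {θ : E d → ℝ} (hθ : IsMollifier θ)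
  {W : Ω → Dist d} (hW : IsWhiteNoise W μ) {G : ℝ → E d → ℝ} {H w : E d → ℝ} {r : ℝ}

omit [NeZero d] in
lemma IsKernelFamily.nonneg (hG : IsKernelFamily G H w r) (y : E d) : 0 ≤ w y := by
  obtain ⟨ε, h⟩ := hG.abs_le.exists
  exact (abs_nonneg _).trans (h y)

omit [NeZero d] in
lemma IsKernelFamily.eventually (hG : IsKernelFamily G H w r) : ∀ᶠ ε in 𝓝[>] 0, 0 < ε ∧ ε < 1 ∧
    Continuous (G ε) ∧ (∀ y, |G ε y| ≤ w y) ∧ (∀ y, r < ‖y‖ → G ε y = 0) := by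
  filter_upwards [Ioo_mem_nhdsGT one_pos, hG.continuous, hG.abs_le, hG.eq_zero] with ε h1 h2 h3 h4
  exact ⟨h1.1, h1.2, h2, h3, h4⟩

omit [NeZero d] in
lemma hasCompactSupport_of_eq_zero {g : E d → ℝ} (h : ∀ y, r < ‖y‖ → g y = 0) : HasCompactSupport g :=
  HasCompactSupport.of_support_subset_isCompact (isCompact_closedBall 0 r) fun x hx => by
    rw [mem_closedBall_zero_iff]; by_contra hr; exact hx (h x (not_le.1 hr))

include hθ

lemma IsKernelFamily.tendsto_integral (hR : 0 < R) (hG : IsKernelFamily G H w r) {q : ℕ}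
    (hfin : pairIntegral q (fun y => ENNReal.ofReal (w y)) (γ₀ ^ 2 * sphereArea d) < ⊤)
    {ι : Type*} {l : Filter ι} [l.IsCountablyGenerated] {ε : Fin q → ι → ℝ}
    (hε : ∀ i, Tendsto (ε i) l (𝓝[>] 0)) :
    Tendsto (fun a => ∫ u : Fin q → E d, (∏ i, G (ε i a) (u i)) *
      Real.exp (γ₀ ^ 2 * ∑ i, ∑ k ∈ Finset.Ioi i, covEps R θ (ε i a) (ε k a) (u i - u k))) l
      (𝓝 (limitMoment R γ₀ q H)) := by
  obtain ⟨C, hC⟩ := exists_covEps_le hθ hR (2 * |r| + 1)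
  have hw0 := hG.nonneg
  have hI := (integrable_mul_pairProd hG.measurable hw0 hfin).const_mul
    (Real.exp (γ₀ ^ 2 * ∑ i : Fin q, ∑ _k ∈ Finset.Ioi i, C))
  have hev : ∀ᶠ a in l, ∀ i, 0 < ε i a ∧ ε i a < 1 ∧ Continuous (G (ε i a)) ∧
      (∀ y, |G (ε i a) y| ≤ w y) ∧ (∀ y, r < ‖y‖ → G (ε i a) y = 0) :=
    eventually_all.2 fun i => (hε i).eventually hG.eventually
  have hlim : ∀ᵐ u : Fin q → E d, ∀ i, Tendsto (fun ε => G ε (u i)) (𝓝[>] 0) (𝓝 (H (u i))) :=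
    ae_all_iff.2 fun i =>
      (Measure.quasiMeasurePreserving_eval (fun _ : Fin q => (volume : Measure (E d))) i).ae hG.tendsto
  refine tendsto_integral_filter_of_dominated_convergence _ ?_ ?_ hI ?_
  · filter_upwards [hev] with a ha
    refine Continuous.aestronglyMeasurable ?_
    refine Continuous.mul (continuous_finsetProd _ fun i _ => (ha i).2.2.1.comp (continuous_apply i)) ?_
    refine Real.continuous_exp.comp (continuous_const.mul ?_)
    exact continuous_finsetSum _ fun i _ => continuous_finsetSum _ fun k _ =>
      (continuous_covEps hθ (ha i).1 (ha k).1).comp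
        ((continuous_apply i).sub (continuous_apply k))
  · filter_upwards [hev] with a ha
    filter_upwards [ae_forall_ne (d := d) (q := q)] with u hu
    rw [norm_mul, Real.norm_of_nonneg (Real.exp_pos _).le, norm_prod]
    have hprod0 : 0 ≤ ∏ i, w (u i) := Finset.prod_nonneg fun i _ => hw0 _
    by_cases hr : ∀ i, ‖u i‖ ≤ r
    · have h1 : ∏ i, ‖G (ε i a) (u i)‖ ≤ ∏ i, w (u i) :=
        Finset.prod_le_prod (fun i _ => norm_nonneg _) fun i _ => (ha i).2.2.2.1 _
      have h2 : Real.exp (γ₀ ^ 2 * ∑ i, ∑ k ∈ Finset.Ioi i, covEps R θ (ε i a) (ε k a) (u i - u k)) ≤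
          Real.exp (γ₀ ^ 2 * ∑ i, ∑ k ∈ Finset.Ioi i,
            (sphereArea d * (-Real.log ‖u i - u k‖) + C)) := by
        refine Real.exp_le_exp.2 (mul_le_mul_of_nonneg_left ?_ (sq_nonneg _))
        refine Finset.sum_le_sum fun i _ => Finset.sum_le_sum fun k hk => ?_
        have hpos : 0 < ‖u i - u k‖ :=
          norm_pos_iff.2 (sub_ne_zero.2 (hu i k (Finset.mem_Ioi.1 hk).ne))
        have hle : ‖u i - u k‖ ≤ 2 * |r| := by
          linarith [norm_sub_le (u i) (u k), hr i, hr k, le_abs_self r]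
        refine (hC _ _ (ha i).1 (ha k).1 _ (max_le (by linarith)
          (by linarith [(ha i).2.1, abs_nonneg r]))).trans ?_
        have := Real.log_le_log hpos (le_max_left ‖u i - u k‖ (ε i a))
        have hω : 0 < sphereArea d := sphereArea_pos
        nlinarith
      rw [exp_sum_log_eq_pairProd hu] at h2
      calc _ ≤ (∏ i, w (u i)) * (Real.exp (γ₀ ^ 2 * ∑ i : Fin q, ∑ _k ∈ Finset.Ioi i, C) *
            pairProd (γ₀ ^ 2 * sphereArea d) u) :=
            mul_le_mul h1 h2 (Real.exp_pos _).le hprod0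
        _ = _ := by ring
    · push Not at hr
      obtain ⟨i, hi⟩ := hr
      rw [Finset.prod_eq_zero (Finset.mem_univ i) (by rw [(ha i).2.2.2.2 _ hi, norm_zero]), zero_mul]
      exact mul_nonneg (Real.exp_pos _).le (mul_nonneg hprod0 (pairProd_nonneg _ _))
  · filter_upwards [ae_forall_ne (d := d) (q := q), hlim] with u hu hl
    refine (tendsto_finsetProd _ fun i _ => (hl i).comp (hε i)).mul ?_
    refine (Real.continuous_exp.tendsto _).comp (Tendsto.const_mul _ ?_)
    exact tendsto_finsetSum _ fun i _ => tendsto_finsetSum _ fun k hk =>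
      tendsto_covEps hθ hR (hε i) (hε k) (sub_ne_zero.2 (hu i k (Finset.mem_Ioi.1 hk).ne))

include hW

lemma IsKernelFamily.integral_prod (hG : IsKernelFamily G H w r) {q : ℕ} [NeZero q] :
    ∀ᶠ δ in 𝓝[>] (0 : ℝ), ∀ ε : Fin q → ℝ, (∀ i, 0 < ε i ∧ ε i < δ) →
      Integrable (fun ω => ∏ i, expIntegral R γ₀ θ (ε i) (G (ε i)) (W ω)) μ ∧
      ∫ ω, ∏ i, expIntegral R γ₀ θ (ε i) (G (ε i)) (W ω) ∂μ =
        ∫ u : Fin q → E d, (∏ i, G (ε i) (u i)) *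
          Real.exp (γ₀ ^ 2 * ∑ i, ∑ k ∈ Finset.Ioi i, covEps R θ (ε i) (ε k) (u i - u k)) := by
  obtain ⟨δ₀, hδ₀, h⟩ := mem_nhdsGT_iff_exists_Ioo_subset.1 hG.eventually
  filter_upwards [Ioo_mem_nhdsGT hδ₀] with δ hδ ε hε
  have hev := fun i => h ⟨(hε i).1, (hε i).2.trans hδ.2⟩
  obtain ⟨h1, h2⟩ := IsRandomField.integral_prod (μ := μ) (q := q)
    (Y := fun i y ω => expField R γ₀ θ (ε i) (W ω) y) (G := fun i => G (ε i))
    (fun i => isRandomField_expField hθ hW q (hε i).1) (fun i => (hev i).2.2.1)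
    (fun i => hasCompactSupport_of_eq_zero (hev i).2.2.2.2)
  refine ⟨h1, h2.trans (integral_congr_ae (.of_forall fun u => ?_))⟩
  simp only
  rw [(integral_prod_expField hθ hW (fun i => (hε i).1) u).2]

lemma IsKernelFamily.tendsto_moment (hR : 0 < R) (hG : IsKernelFamily G H w r) {q : ℕ} [NeZero q]
    (hfin : pairIntegral q (fun y => ENNReal.ofReal (w y)) (γ₀ ^ 2 * sphereArea d) < ⊤)
    {ι : Type*} {l : Filter ι} [l.IsCountablyGenerated] {ε : Fin q → ι → ℝ}
    (hε : ∀ i, Tendsto (ε i) l (𝓝[>] 0)) :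
    Tendsto (fun a => ∫ ω, ∏ i, expIntegral R γ₀ θ (ε i a) (G (ε i a)) (W ω) ∂μ) l
      (𝓝 (limitMoment R γ₀ q H)) := by
  refine (hG.tendsto_integral hθ hR hfin hε).congr' ?_
  obtain ⟨δ, hδ, hδ0⟩ := ((hG.integral_prod hθ hW (R := R) (γ₀ := γ₀) (q := q)).and
    self_mem_nhdsWithin).exists
  have : ∀ᶠ a in l, ∀ i, ε i a ∈ Ioo 0 δ :=
    eventually_all.2 fun i => (hε i).eventually (Ioo_mem_nhdsGT hδ0)
  filter_upwards [this] with a ha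
  exact (hδ (fun i => ε i a) fun i => ha i).2.symm

lemma IsKernelFamily.aemeasurable_expIntegral (hG : IsKernelFamily G H w r) :
    ∀ᶠ ε in 𝓝[>] (0 : ℝ), AEMeasurable (fun ω => expIntegral R γ₀ θ ε (G ε) (W ω)) μ := by
  filter_upwards [hG.eventually] with ε h
  have hY := isRandomField_expField (R := R) (γ₀ := γ₀) hθ hW 1 h.1
  exact aemeasurable_integral_mul hY.continuous hY.aemeasurable h.2.2.1.measurable

/-- The integrals form a Cauchy family in `L⁴`. -/
lemma IsKernelFamily.tendsto_integral_sub_pow_four (hR : 0 < R) (hG : IsKernelFamily G H w r)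
    (hfin : pairIntegral 4 (fun y => ENNReal.ofReal (w y)) (γ₀ ^ 2 * sphereArea d) < ⊤) :
    Tendsto (fun p : ℝ × ℝ => ∫ ω, (expIntegral R γ₀ θ p.1 (G p.1) (W ω) -
      expIntegral R γ₀ θ p.2 (G p.2) (W ω)) ^ 4 ∂μ) (𝓝[>] 0 ×ˢ 𝓝[>] 0) (𝓝 0) := by
  let c : ℕ → Fin 4 → ℝ × ℝ → ℝ := fun j i => if i < j then Prod.snd else Prod.fst
  have hc : ∀ j i, c j i = Prod.fst ∨ c j i = Prod.snd := fun j i => by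
    simp only [c]
    split_ifs <;> simp
  have T : ∀ j, Tendsto (fun p : ℝ × ℝ => ∫ ω, ∏ i, expIntegral R γ₀ θ (c j i p) (G (c j i p)) (W ω) ∂μ)
      (𝓝[>] 0 ×ˢ 𝓝[>] 0) (𝓝 (limitMoment R γ₀ 4 H)) := fun j =>
    hG.tendsto_moment hθ hW hR hfin fun i => by
      rcases hc j i with h | h <;> rw [h]
      exacts [tendsto_fst, tendsto_snd]
  obtain ⟨δ, hδ, hδ0⟩ := ((hG.integral_prod hθ hW (R := R) (γ₀ := γ₀) (q := 4)).and
    self_mem_nhdsWithin).exists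
  have hI : ∀ p : ℝ × ℝ, p.1 ∈ Ioo 0 δ → p.2 ∈ Ioo 0 δ → ∀ j,
      Integrable (fun ω => ∏ i, expIntegral R γ₀ θ (c j i p) (G (c j i p)) (W ω)) μ := fun p h1 h2 j =>
    (hδ (fun i => c j i p) fun i => by
      rcases hc j i with h | h <;> rw [h]
      exacts [h1, h2]).1
  have h := ((((T 0).sub ((T 1).const_mul 4)).add ((T 2).const_mul 6)).sub
    ((T 3).const_mul 4)).add (T 4)
  rw [show limitMoment R γ₀ 4 H - 4 * limitMoment R γ₀ 4 H + 6 * limitMoment R γ₀ 4 H -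
    4 * limitMoment R γ₀ 4 H + limitMoment R γ₀ 4 H = 0 by ring] at h
  refine h.congr' ?_
  filter_upwards [(tendsto_fst (f := 𝓝[>] (0 : ℝ)) (g := 𝓝[>] (0 : ℝ))).eventually (Ioo_mem_nhdsGT hδ0),
    (tendsto_snd (f := 𝓝[>] (0 : ℝ)) (g := 𝓝[>] (0 : ℝ))).eventually (Ioo_mem_nhdsGT hδ0)] with p h1 h2
  rw [← integral_alternating_sum (hI p h1 h2 0) (hI p h1 h2 1) (hI p h1 h2 2)
    (hI p h1 h2 3) (hI p h1 h2 4)]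
  refine integral_congr_ae (.of_forall fun ω => ?_)
  simp [Fin.prod_univ_four, c]
  ring

end

/-! ### The kernel of the field -/

/-- The kernel `φ_R(z) z_i |z|_ε^(-(d-α+1))`. -/
noncomputable def fieldKernel (α R : ℝ) (φ θ : E d → ℝ) (ε : ℝ) (i : Fin d) (z : E d) : ℝ :=
  cutoffR α R φ z * (z i / normEps θ ε z ^ ((d : ℝ) - α + 1))

/-- The kernel `φ_R(z) z_i |z|^(-(d-α+1))`. -/
noncomputable def limitKernel (α R : ℝ) (φ : E d → ℝ) (i : Fin d) (z : E d) : ℝ :=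
  cutoffR α R φ z * (z i / ‖z‖ ^ ((d : ℝ) - α + 1))

section FieldKernel

variable {α R : ℝ} {φ θ : E d → ℝ}

lemma contDiff_cutoffR (hφ : IsCutoff φ) : ContDiff ℝ (⊤ : ℕ∞) (cutoffR α R φ) :=
  contDiff_const.mul (hφ.smooth.comp (contDiff_const_smul _))

lemma cutoffR_eq_zero (hφ : IsCutoff φ) (hR : 0 < R) {z : E d} (hz : 2 * R < ‖z‖) :
    cutoffR α R φ z = 0 := by
  rw [cutoffR, hφ.eq_zero, mul_zero]
  rw [norm_smul, norm_inv, Real.norm_of_nonneg hR.le, ← div_eq_inv_mul, lt_div_iff₀ hR]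
  exact hz

lemma abs_cutoffR_le (hφ : IsCutoff φ) (hR : 0 < R) (z : E d) :
    |cutoffR α R φ z| ≤ R ^ ((d : ℝ) / 2 - α) := by
  obtain ⟨h0, h1⟩ := hφ.mem_Icc (R⁻¹ • z)
  rw [cutoffR, abs_of_nonneg (mul_nonneg (by positivity) h0)]
  exact mul_le_of_le_one_right (by positivity) h1

lemma fieldKernel_eq_zero (hφ : IsCutoff φ) (hR : 0 < R) {ε : ℝ} {i : Fin d} {z : E d}
    (hz : 2 * R < ‖z‖) : fieldKernel α R φ θ ε i z = 0 := by
  rw [fieldKernel, cutoffR_eq_zero hφ hR hz, zero_mul]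

variable [NeZero d] (hφ : IsCutoff φ) (hθ : IsMollifier θ)
include hφ hθ

lemma contDiff_fieldKernel {ε : ℝ} (hε : 0 < ε) (i : Fin d) :
    ContDiff ℝ (⊤ : ℕ∞) (fieldKernel α R φ θ ε i) := by
  obtain ⟨c, hc, h⟩ := exists_normEps_ge hθ
  have hpos : ∀ z : E d, 0 < normEps θ ε z := fun z =>
    (mul_pos hc (lt_max_of_lt_right hε)).trans_le (h ε hε z)
  have hi : ContDiff ℝ (⊤ : ℕ∞) fun z : E d => z i := by fun_prop
  refine (contDiff_cutoffR hφ).mul (hi.div ?_ fun z => (Real.rpow_pos_of_pos (hpos z) _).ne')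
  exact (contDiff_normEps hθ hε).rpow_const_of_ne fun z => (hpos z).ne'

lemma exists_abs_fieldKernel_le (hR : 0 < R) (hα : α < d + 1) : ∃ C > 0, ∀ ε > 0, ∀ i, ∀ z : E d,
    |fieldKernel α R φ θ ε i z| ≤ C * max ‖z‖ ε ^ (-((d : ℝ) - α)) := by
  obtain ⟨c, hc, h⟩ := exists_normEps_ge hθ
  refine ⟨R ^ ((d : ℝ) / 2 - α) * c ^ (-((d : ℝ) - α + 1)), by positivity, fun ε hε i z => ?_⟩
  have hm : 0 < max ‖z‖ ε := lt_max_of_lt_right hε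
  have hn : 0 < normEps θ ε z := (mul_pos hc hm).trans_le (h ε hε z)
  have h1 : |z i / normEps θ ε z ^ ((d : ℝ) - α + 1)| ≤
      c ^ (-((d : ℝ) - α + 1)) * max ‖z‖ ε ^ (-((d : ℝ) - α)) := by
    rw [abs_div, abs_of_pos (Real.rpow_pos_of_pos hn _), div_eq_mul_inv, ← Real.rpow_neg hn.le]
    have hz : |z i| ≤ max ‖z‖ ε := (PiLp.norm_apply_le z i).trans (le_max_left _ _)
    calc |z i| * normEps θ ε z ^ (-((d : ℝ) - α + 1))
        ≤ max ‖z‖ ε * (c * max ‖z‖ ε) ^ (-((d : ℝ) - α + 1)) := by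
          refine mul_le_mul hz ?_ (by positivity) hm.le
          exact Real.rpow_le_rpow_of_nonpos (by positivity) (h ε hε z) (by linarith)
      _ = _ := by
          rw [Real.mul_rpow hc.le hm.le, mul_left_comm]
          congr 1
          rw [show -((d : ℝ) - α) = 1 + -((d : ℝ) - α + 1) by ring, Real.rpow_add hm, Real.rpow_one]
  rw [fieldKernel, abs_mul, mul_assoc]
  exact mul_le_mul (abs_cutoffR_le hφ hR z) h1 (abs_nonneg _) (by positivity)

omit [NeZero d] hφ in
lemma tendsto_fieldKernel (i : Fin d) {z : E d} (hz : z ≠ 0) :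
    Tendsto (fun ε => fieldKernel α R φ θ ε i z) (𝓝[>] 0) (𝓝 (limitKernel α R φ i z)) := by
  have hz0 : 0 < ‖z‖ := norm_pos_iff.2 hz
  exact tendsto_const_nhds.mul (tendsto_const_nhds.div
    ((tendsto_normEps hθ z).rpow_const (.inl hz0.ne')) (Real.rpow_pos_of_pos hz0 _).ne')

/-- The translates of the kernels of the field. -/
lemma exists_isKernelFamily_fieldKernel (hR : 0 < R) (hα : α < d) :
    ∃ C > 0, ∀ (i : Fin d) (x : E d), IsKernelFamily (fun ε y => fieldKernel α R φ θ ε i (x - y))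
      (fun y => limitKernel α R φ i (x - y)) (fun y => (Metric.ball x (2 * R + 1)).indicator
        (fun y => C * ‖y - x‖ ^ (-((d : ℝ) - α))) y) (‖x‖ + 2 * R) := by
  obtain ⟨C, hC, hle⟩ := exists_abs_fieldKernel_le hφ hθ hR (by linarith : α < d + 1)
  refine ⟨C, hC, fun i x => ⟨?_, ?_, ?_, ?_, ?_⟩⟩
  · exact Measurable.indicator (by fun_prop) Metric.isOpen_ball.measurableSet
  · filter_upwards [self_mem_nhdsWithin] with ε hε
    exact (contDiff_fieldKernel hφ hθ hε i).continuous.comp (continuous_const.sub continuous_id)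
  · filter_upwards [self_mem_nhdsWithin] with ε hε y
    by_cases hy : y ∈ Metric.ball x (2 * R + 1)
    · rw [indicator_of_mem hy]
      rcases eq_or_ne y x with rfl | hyx
      · rw [sub_self, fieldKernel, PiLp.zero_apply, zero_div, mul_zero, abs_zero]; positivity
      · rw [norm_sub_rev y x]
        exact (hle ε hε i (x - y)).trans (mul_le_mul_of_nonneg_left (Real.rpow_le_rpow_of_nonpos
          (norm_pos_iff.2 (sub_ne_zero.2 hyx.symm)) (le_max_left _ _) (by linarith)) hC.le)
    · rw [indicator_of_notMem hy, fieldKernel_eq_zero hφ hR, abs_zero]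
      rw [Metric.mem_ball, dist_comm, dist_eq_norm, not_lt] at hy
      linarith
  · refine .of_forall fun ε y hy => fieldKernel_eq_zero hφ hR ?_
    have := norm_sub_norm_le y x
    rw [norm_sub_rev] at this
    linarith
  · have : ∀ᵐ y : E d, y ≠ x := by simp [ae_iff, measure_singleton]
    filter_upwards [this] with y hy
    exact tendsto_fieldKernel hθ i (sub_ne_zero.2 hy.symm)

omit hφ hθ in
lemma boundedPotential_fieldKernel {C p : ℝ} (hC : 0 < C) (hα : α < d) (hp : 0 < p) (hpα : p < α)
    (r : ℝ) (x : E d) : BoundedPotential (fun y => ENNReal.ofReal ((Metric.ball x r).indicator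
      (fun y => C * ‖y - x‖ ^ (-((d : ℝ) - α))) y)) p := by
  refine ((boundedPotential_rpow_ball (d := d) (β := (d : ℝ) - α) (by linarith) hp (by linarith)
    r x).const_mul (c := ENNReal.ofReal C) ENNReal.ofReal_ne_top).mono ?_ fun y => le_of_eq ?_
  · exact (Measurable.indicator (by fun_prop) Metric.isOpen_ball.measurableSet).ennreal_ofReal
  · by_cases hy : y ∈ Metric.ball x r
    · rw [indicator_of_mem hy, indicator_of_mem hy, ENNReal.ofReal_mul hC.le]
    · rw [indicator_of_notMem hy, indicator_of_notMem hy, ENNReal.ofReal_zero, mul_zero]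

end FieldKernel

/-! ### Convergence in `L⁴` -/

lemma eLpNorm_four (g : Ω → ℝ) :
    eLpNorm g 4 μ = (∫⁻ ω, ENNReal.ofReal (g ω ^ 4) ∂μ) ^ (1 / 4 : ℝ) := by
  rw [eLpNorm_eq_lintegral_rpow_enorm_toReal (by norm_num) (by simp)]
  have h4 : (4 : ENNReal).toReal = 4 := by simp
  rw [h4]
  congr 1
  refine lintegral_congr fun ω => ?_
  rw [show (4 : ℝ) = ((4 : ℕ) : ℝ) by norm_num, ENNReal.rpow_natCast, ← ofReal_norm,
    ← ENNReal.ofReal_pow (norm_nonneg _), Real.norm_eq_abs, Even.pow_abs (by decide)]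

lemma memLp_four_of_integrable {g : Ω → ℝ} (hg : AEMeasurable g μ)
    (hi : Integrable (fun ω => g ω ^ 4) μ) : MemLp g 4 μ := by
  refine ⟨hg.aestronglyMeasurable, ?_⟩
  rw [eLpNorm_four]
  refine ENNReal.rpow_lt_top_of_nonneg (by norm_num) ?_
  rw [← ofReal_integral_eq_lintegral_ofReal hi (.of_forall fun ω => by positivity)]
  exact ENNReal.ofReal_ne_top

lemma integrable_pow_four {g : Ω → ℝ} (hg : MemLp g 4 μ) : Integrable (fun ω => g ω ^ 4) μ := by
  have := hg.integrable_norm_pow (p := 4) (by norm_num)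
  simpa [Even.pow_abs (show Even 4 by decide)] using this

lemma tendsto_eLpNorm_four {ι : Type*} {l : Filter ι} {g : ι → Ω → ℝ}
    (h : Tendsto (fun a => ∫⁻ ω, ENNReal.ofReal (g a ω ^ 4) ∂μ) l (𝓝 0)) :
    Tendsto (fun a => eLpNorm (g a) 4 μ) l (𝓝 0) := by
  simp only [eLpNorm_four]
  have := ((ENNReal.continuous_rpow_const (y := (1 / 4 : ℝ))).tendsto 0).comp h
  simpa [Function.comp_def] using this

lemma tendsto_integral_pow_four {ι : Type*} {l : Filter ι} {g : ι → Ω → ℝ}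
    (hm : ∀ᶠ a in l, MemLp (g a) 4 μ) (h : Tendsto (fun a => eLpNorm (g a) 4 μ) l (𝓝 0)) :
    Tendsto (fun a => ∫ ω, g a ω ^ 4 ∂μ) l (𝓝 0) := by
  have h1 := ((ENNReal.continuous_rpow_const (y := (4 : ℝ))).tendsto 0).comp h
  rw [ENNReal.zero_rpow_of_pos (by norm_num)] at h1
  have h2 := (ENNReal.tendsto_toReal ENNReal.zero_ne_top).comp h1
  rw [ENNReal.toReal_zero] at h2
  refine h2.congr' ?_
  filter_upwards [hm] with a ha
  simp only [Function.comp_apply]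
  rw [eLpNorm_four, ← ENNReal.rpow_mul, show (1 / 4 : ℝ) * 4 = 1 by norm_num, ENNReal.rpow_one,
    integral_eq_lintegral_of_nonneg_ae (.of_forall fun ω => by positivity)
      (integrable_pow_four ha).aestronglyMeasurable]

/-- Completeness of `L⁴`, for families. -/
lemma exists_tendsto_eLpNorm_four {f : ℝ → Ω → ℝ} (hm : ∀ᶠ ε in 𝓝[>] (0 : ℝ), MemLp (f ε) 4 μ)
    (h : Tendsto (fun p : ℝ × ℝ => ∫ ω, (f p.1 ω - f p.2 ω) ^ 4 ∂μ) (𝓝[>] 0 ×ˢ 𝓝[>] 0) (𝓝 0)) :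
    ∃ X : Ω → ℝ, MemLp X 4 μ ∧ Tendsto (fun ε => eLpNorm (fun ω => f ε ω - X ω) 4 μ) (𝓝[>] 0) (𝓝 0) := by
  classical
  have : Fact ((1 : ENNReal) ≤ 4) := ⟨by norm_num⟩
  let F : ℝ → Lp ℝ 4 μ := fun ε => if h : MemLp (f ε) 4 μ then h.toLp else 0
  have h2 : ∀ᶠ p : ℝ × ℝ in 𝓝[>] 0 ×ˢ 𝓝[>] 0, MemLp (f p.1) 4 μ ∧ MemLp (f p.2) 4 μ :=
    (tendsto_fst.eventually hm).and (tendsto_snd.eventually hm)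
  have hF : Tendsto (fun p : ℝ × ℝ => dist (F p.1) (F p.2)) (𝓝[>] 0 ×ˢ 𝓝[>] 0) (𝓝 0) := by
    have h3 : Tendsto (fun p : ℝ × ℝ => eLpNorm (fun ω => f p.1 ω - f p.2 ω) 4 μ)
        (𝓝[>] 0 ×ˢ 𝓝[>] 0) (𝓝 0) := by
      refine tendsto_eLpNorm_four ?_
      have h4 := ENNReal.tendsto_ofReal h
      rw [ENNReal.ofReal_zero] at h4
      refine h4.congr' ?_
      filter_upwards [h2] with p hp
      exact ofReal_integral_eq_lintegral_ofReal (integrable_pow_four (hp.1.sub hp.2))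
        (.of_forall fun ω => by positivity)
    have h4 := (ENNReal.tendsto_toReal ENNReal.zero_ne_top).comp h3
    rw [ENNReal.toReal_zero] at h4
    refine h4.congr' ?_
    filter_upwards [h2] with p hp
    simp only [F, dif_pos hp.1, dif_pos hp.2, Function.comp_apply]
    rw [dist_edist, Lp.edist_toLp_toLp]
    rfl
  have hC : Cauchy (map F (𝓝[>] 0)) :=
    cauchy_map_iff.2 ⟨inferInstance, tendsto_uniformity_iff_dist_tendsto_zero.2 hF⟩
  obtain ⟨X, hX⟩ := CompleteSpace.complete hC
  refine ⟨X, Lp.memLp X, ?_⟩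
  have h5 : Tendsto F (𝓝[>] 0) (𝓝 X) := hX
  rw [tendsto_iff_edist_tendsto_0] at h5
  refine h5.congr' ?_
  filter_upwards [hm] with ε hε
  simp only [F, dif_pos hε]
  conv_lhs => rw [← Lp.toLp_coeFn X (Lp.memLp X)]
  rw [Lp.edist_toLp_toLp]
  rfl

lemma abs_cube_sub_cube_le (z h : ℝ) {δ : ℝ} (hδ : 0 < δ) (hδ1 : δ ≤ 1) :
    |(z + h) ^ 3 - z ^ 3| ≤ 7 * δ * (1 + z ^ 4) + 7 * (δ ^ 3)⁻¹ * h ^ 4 := by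
  obtain ⟨k, rfl⟩ : ∃ k, h = δ * k := ⟨h / δ, by field_simp⟩
  have e : 7 * δ * (1 + z ^ 4) + 7 * (δ ^ 3)⁻¹ * (δ * k) ^ 4 = δ * (7 * (1 + z ^ 4 + k ^ 4)) := by
    field_simp
  have e2 : (z + δ * k) ^ 3 - z ^ 3 = δ * (3 * (z * z * k) + 3 * δ * (z * k * k) + δ ^ 2 * (k * k * k)) := by
    ring
  rw [e, e2, abs_mul, abs_of_pos hδ]
  refine mul_le_mul_of_nonneg_left ?_ hδ.le
  have hm : ∀ a b : ℝ, |a * a * b| ≤ 1 + a ^ 4 + b ^ 4 := fun a b => by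
    rw [abs_le]
    constructor <;> nlinarith [sq_nonneg (a ^ 2 - b), sq_nonneg (a ^ 2 + b), sq_nonneg (b ^ 2 - 1)]
  have m1 := hm z k
  have m2 : |z * k * k| ≤ 1 + z ^ 4 + k ^ 4 := by
    have := hm k z
    rw [show z * k * k = k * k * z by ring]
    linarith
  have m3 : |k * k * k| ≤ 1 + z ^ 4 + k ^ 4 := by
    rw [abs_le]
    constructor <;> nlinarith [sq_nonneg (k ^ 2 - k), sq_nonneg (k ^ 2 + k), sq_nonneg (k ^ 2 - 1),
      sq_nonneg (z ^ 2)]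
  have hs : δ ^ 2 ≤ 1 := pow_le_one₀ hδ.le hδ1
  calc _ ≤ |3 * (z * z * k)| + |3 * δ * (z * k * k)| + |δ ^ 2 * (k * k * k)| :=
        (abs_add_le _ _).trans (add_le_add (abs_add_le _ _) le_rfl)
    _ = 3 * |z * z * k| + 3 * δ * |z * k * k| + δ ^ 2 * |k * k * k| := by
        rw [abs_mul 3, abs_mul (3 * δ), abs_mul (δ ^ 2), abs_of_pos (by positivity : 0 < 3 * δ),
          abs_of_pos (by positivity : 0 < δ ^ 2), abs_of_pos (by norm_num : (0 : ℝ) < 3)]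
    _ ≤ 3 * |z * z * k| + 3 * 1 * |z * k * k| + 1 * |k * k * k| := by gcongr
    _ ≤ _ := by linarith

/-- Third moments are continuous in `L⁴`. -/
lemma tendsto_integral_cube [IsProbabilityMeasure μ] {f : ℝ → Ω → ℝ} {Z : Ω → ℝ} (hZ : MemLp Z 4 μ)
    (hm : ∀ᶠ ε in 𝓝[>] (0 : ℝ), MemLp (f ε) 4 μ)
    (h : Tendsto (fun ε => eLpNorm (fun ω => f ε ω - Z ω) 4 μ) (𝓝[>] 0) (𝓝 0)) :
    Tendsto (fun ε => ∫ ω, f ε ω ^ 3 ∂μ) (𝓝[>] 0) (𝓝 (∫ ω, Z ω ^ 3 ∂μ)) := by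
  have h4 := tendsto_integral_pow_four (hm.mono fun ε hε => hε.sub hZ) h
  simp only [Pi.sub_apply] at h4
  have hcube : ∀ g : Ω → ℝ, MemLp g 4 μ → Integrable (fun ω => g ω ^ 3) μ := fun g hg => by
    have h3 : MemLp g 3 μ := hg.mono_exponent (by norm_num)
    have := h3.integrable_norm_pow (p := 3) (by norm_num)
    refine this.mono' (hg.1.pow 3) (.of_forall fun ω => ?_)
    rw [norm_pow]
  set B := ∫ ω, (1 + Z ω ^ 4) ∂μ
  have hBi : Integrable (fun ω => 1 + Z ω ^ 4) μ := (integrable_const _).add (integrable_pow_four hZ)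
  have hB : 0 ≤ B := integral_nonneg fun ω => by positivity
  rw [Metric.tendsto_nhds]
  intro c hc
  obtain ⟨δ, hδ, hδ1, hδc⟩ : ∃ δ : ℝ, 0 < δ ∧ δ ≤ 1 ∧ 7 * δ * B < c / 2 := by
    refine ⟨min 1 (c / (28 * (B + 1))), by positivity, min_le_left _ _, ?_⟩
    calc 7 * min 1 (c / (28 * (B + 1))) * B ≤ 7 * (c / (28 * (B + 1))) * (B + 1) := by
          gcongr
          · exact min_le_right _ _
          · linarith
      _ = c / 4 := by field_simp; norm_num
      _ < c / 2 := by linarith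
  have h5 := h4.const_mul (7 * (δ ^ 3)⁻¹)
  rw [mul_zero] at h5
  filter_upwards [h5.eventually_lt_const (half_pos hc), hm] with ε h6 hε
  have hsub := hε.sub hZ
  rw [dist_eq_norm, ← integral_sub (hcube _ hε) (hcube _ hZ)]
  have hi1 := hBi.const_mul (7 * δ)
  have hi2 := (integrable_pow_four hsub).const_mul (7 * (δ ^ 3)⁻¹)
  calc ‖∫ ω, (f ε ω ^ 3 - Z ω ^ 3) ∂μ‖ ≤ ∫ ω, ‖f ε ω ^ 3 - Z ω ^ 3‖ ∂μ := norm_integral_le_integral_norm _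
    _ ≤ ∫ ω, (7 * δ * (1 + Z ω ^ 4) + 7 * (δ ^ 3)⁻¹ * (f ε - Z) ω ^ 4) ∂μ := by
        refine integral_mono ((hcube _ hε).sub (hcube _ hZ)).norm (hi1.add hi2) fun ω => ?_
        have := abs_cube_sub_cube_le (Z ω) (f ε ω - Z ω) hδ hδ1
        rwa [add_sub_cancel] at this
    _ = 7 * δ * B + 7 * (δ ^ 3)⁻¹ * ∫ ω, (f ε - Z) ω ^ 4 ∂μ := by
        rw [integral_add hi1 hi2, integral_const_mul, integral_const_mul]
    _ < c := by
        have : 7 * (δ ^ 3)⁻¹ * ∫ ω, (f ε - Z) ω ^ 4 ∂μ < c / 2 := h6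
        linarith

/-! ### Regularized majorants -/

/-- A regularization at scale `ε` of a product of powers of distances. -/
noncomputable def regMajorant {q : ℕ} (β κ s ε : ℝ) (x : E d) (u : Fin q → E d) : ℝ :=
  (∏ i, max ‖u i - x‖ ε ^ (-β) * (1 + ‖u i - x‖) ^ (-κ)) *
    ∏ i, ∏ k ∈ Finset.Ioi i, max ‖u i - u k‖ ε ^ (-s)

lemma regMajorant_nonneg {q : ℕ} (β κ s ε : ℝ) (x : E d) (u : Fin q → E d) :
    0 ≤ regMajorant β κ s ε x u := by
  refine mul_nonneg (Finset.prod_nonneg fun i _ => by positivity)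
    (Finset.prod_nonneg fun i _ => Finset.prod_nonneg fun k _ => ?_)
  exact Real.rpow_nonneg ((norm_nonneg _).trans (le_max_left _ _)) _

@[fun_prop]
lemma measurable_regMajorant {q : ℕ} (β κ s ε : ℝ) (x : E d) :
    Measurable fun u : Fin q → E d => regMajorant β κ s ε x u := by
  unfold regMajorant
  fun_prop

lemma max_norm_rpow_neg_le {ε a : ℝ} (hε : 0 < ε) (ha : 0 ≤ a) {z z' : E d}
    (h : ‖z' - z‖ ≤ 2 * ε) : max ‖z‖ ε ^ (-a) ≤ 3 ^ a * max ‖z'‖ ε ^ (-a) := by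
  have hm : 0 < max ‖z‖ ε := lt_max_of_lt_right hε
  have h1 : max ‖z'‖ ε ≤ 3 * max ‖z‖ ε := by
    refine max_le ?_ (by linarith [le_max_right ‖z‖ ε])
    linarith [norm_sub_norm_le z' z, le_max_left ‖z‖ ε, le_max_right ‖z‖ ε]
  have h2 := Real.rpow_le_rpow_of_nonpos (lt_max_of_lt_right hε) h1 (neg_nonpos.2 ha)
  rw [Real.mul_rpow (by norm_num) hm.le, Real.rpow_neg (by norm_num : (0:ℝ) ≤ 3)] at h2
  calc max ‖z‖ ε ^ (-a) = 3 ^ a * ((3 ^ a)⁻¹ * max ‖z‖ ε ^ (-a)) := by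
        rw [← mul_assoc, mul_inv_cancel₀ (by positivity), one_mul]
    _ ≤ _ := mul_le_mul_of_nonneg_left h2 (by positivity)

lemma one_add_norm_rpow_neg_le {κ : ℝ} (hκ : 0 ≤ κ) {z z' : E d} (h : ‖z' - z‖ ≤ 1) :
    (1 + ‖z‖) ^ (-κ) ≤ 2 ^ κ * (1 + ‖z'‖) ^ (-κ) := by
  have h1 : 1 + ‖z'‖ ≤ 2 * (1 + ‖z‖) := by linarith [norm_sub_norm_le z' z, norm_nonneg z]
  have h2 := Real.rpow_le_rpow_of_nonpos (by positivity) h1 (neg_nonpos.2 hκ)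
  rw [Real.mul_rpow (by norm_num) (by positivity), Real.rpow_neg (by norm_num : (0:ℝ) ≤ 2)] at h2
  calc (1 + ‖z‖) ^ (-κ) = 2 ^ κ * ((2 ^ κ)⁻¹ * (1 + ‖z‖) ^ (-κ)) := by
        rw [← mul_assoc, mul_inv_cancel₀ (by positivity), one_mul]
    _ ≤ _ := mul_le_mul_of_nonneg_left h2 (by positivity)

/-- Majorants at scale `ε` are comparable at points at distance at most `ε`. -/
lemma exists_regMajorant_le (q : ℕ) {β κ s : ℝ} (hβ : 0 ≤ β) (hκ : 0 ≤ κ) (hs : 0 ≤ s) :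
    ∃ C : ℝ, 0 < C ∧ ∀ ε : ℝ, 0 < ε → ε ≤ 1 → ∀ (x : E d) (u u' : Fin q → E d),
      (∀ i, ‖u' i - u i‖ ≤ ε) → regMajorant β κ s ε x u ≤ C * regMajorant β κ s ε x u' := by
  refine ⟨(∏ _i : Fin q, 3 ^ β * 2 ^ κ) * ∏ i : Fin q, ∏ _k ∈ Finset.Ioi i, 3 ^ s, ?_,
    fun ε hε hε1 x u u' h => ?_⟩
  · exact mul_pos (Finset.prod_pos fun i _ => by positivity)
      (Finset.prod_pos fun i _ => Finset.prod_pos fun k _ => by positivity)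
  · rw [regMajorant, regMajorant, mul_mul_mul_comm]
    simp only [← Finset.prod_mul_distrib]
    have hp : ∀ z : E d, ∀ a : ℝ, 0 ≤ max ‖z‖ ε ^ a := fun z a =>
      Real.rpow_nonneg (hε.le.trans (le_max_right _ _)) _
    refine Finset.prod_le_prod (fun i _ => mul_nonneg (mul_nonneg (hp _ _) (by positivity))
      (Finset.prod_nonneg fun k _ => hp _ _)) fun i _ => mul_le_mul ?_
        (Finset.prod_le_prod (fun k _ => hp _ _) fun k _ => ?_)
        (Finset.prod_nonneg fun k _ => hp _ _)
        (mul_nonneg (by positivity) (mul_nonneg (hp _ _) (by positivity)))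
    · have e : u' i - x - (u i - x) = u' i - u i := by abel
      rw [mul_mul_mul_comm]
      exact mul_le_mul (max_norm_rpow_neg_le hε hβ (by rw [e]; linarith [h i]))
        (one_add_norm_rpow_neg_le hκ (by rw [e]; linarith [h i])) (by positivity)
        (mul_nonneg (by positivity) (hp _ _))
    · refine max_norm_rpow_neg_le hε hs ?_
      have e : u' i - u' k - (u i - u k) = (u' i - u i) - (u' k - u k) := by abel
      rw [e]
      linarith [norm_sub_le (u' i - u i) (u' k - u k), h i, h k]

/-- An approximate identity in the difference of two variables is replaced by an indicator. -/
lemma lintegral_smear_le {q : ℕ} {Φ H : (Fin q → E d) → ENNReal} {T : E d → ENNReal}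
    (hΦm : Measurable Φ) (hHm : Measurable H) (hTm : Measurable T) {C : ENNReal} {ε : ℝ}
    {i j : Fin q} (hij : i ≠ j)
    (hΦ : ∀ u v, ‖v‖ ≤ ε → Φ u ≤ C * Φ (u + Pi.single j v))
    (hH : ∀ u v, H (u + Pi.single j v) = H u) (hT : ∫⁻ z, T z ≤ 1) (hT0 : ∀ z, ε < ‖z‖ → T z = 0) :
    volume (Metric.ball (0 : E d) ε) * ∫⁻ u, Φ u * T (u i - u j) * H u ≤
      C * ∫⁻ u, Φ u * {u : Fin q → E d | ‖u i - u j‖ ≤ 2 * ε}.indicator 1 u * H u := by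
  have hS : MeasurableSet {u : Fin q → E d | ‖u i - u j‖ ≤ 2 * ε} :=
    measurableSet_le (by fun_prop) measurable_const
  calc volume (Metric.ball (0 : E d) ε) * ∫⁻ u, Φ u * T (u i - u j) * H u
      = ∫⁻ _v in Metric.ball (0 : E d) ε, ∫⁻ u, Φ u * T (u i - u j) * H u := by
        rw [setLIntegral_const, mul_comm]
    _ ≤ ∫⁻ v in Metric.ball (0 : E d) ε, ∫⁻ u, C * (Φ u * T (u i - u j + v) * H u) := by
        refine setLIntegral_mono' Metric.isOpen_ball.measurableSet fun v hv => ?_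
        rw [← lintegral_add_right_eq_self (fun u => C * (Φ u * T (u i - u j + v) * H u))
          (Pi.single j v)]
        refine lintegral_mono fun u => ?_
        have e : (u + Pi.single j v : Fin q → E d) i - (u + Pi.single j v : Fin q → E d) j + v =
            u i - u j := by
          rw [Pi.add_apply, Pi.add_apply, Pi.single_eq_same, Pi.single_eq_of_ne hij]
          abel
        simp only [e, hH]
        rw [← mul_assoc, ← mul_assoc]
        gcongr
        exact hΦ u v (mem_ball_zero_iff.1 hv).le
    _ = ∫⁻ u, ∫⁻ v in Metric.ball (0 : E d) ε, C * (Φ u * T (u i - u j + v) * H u) := by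
        refine lintegral_lintegral_swap (Measurable.aemeasurable ?_)
        have h1 : Measurable fun p : E d × (Fin q → E d) => T (p.2 i - p.2 j + p.1) :=
          hTm.comp (by fun_prop)
        exact (((hΦm.comp measurable_snd).mul h1).mul (hHm.comp measurable_snd)).const_mul C
    _ ≤ ∫⁻ u, C * (Φ u * {u : Fin q → E d | ‖u i - u j‖ ≤ 2 * ε}.indicator 1 u * H u) := by
        refine lintegral_mono fun u => ?_
        have h1 : ∀ v, C * (Φ u * T (u i - u j + v) * H u) = C * Φ u * H u * T (u i - u j + v) :=
          fun v => by ring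
        simp only [h1]
        have hTm' : Measurable fun v => T (u i - u j + v) := hTm.comp (by fun_prop)
        rw [lintegral_const_mul _ hTm']
        have h2 : ∫⁻ v in Metric.ball (0 : E d) ε, T (u i - u j + v) ≤
            {u : Fin q → E d | ‖u i - u j‖ ≤ 2 * ε}.indicator 1 u := by
          by_cases hu : ‖u i - u j‖ ≤ 2 * ε
          · rw [indicator_of_mem (show u ∈ {u : Fin q → E d | ‖u i - u j‖ ≤ 2 * ε} from hu),
              Pi.one_apply]
            refine (setLIntegral_le_lintegral _ _).trans ?_
            rwa [lintegral_add_left_eq_self]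
          · rw [indicator_of_notMem (show u ∉ {u : Fin q → E d | ‖u i - u j‖ ≤ 2 * ε} from hu)]
            refine le_of_eq (setLIntegral_eq_zero Metric.isOpen_ball.measurableSet fun v hv => ?_)
            refine hT0 _ ?_
            have := norm_sub_norm_le (u i - u j) (-v)
            rw [sub_neg_eq_add, norm_neg] at this
            linarith [mem_ball_zero_iff.1 hv, not_le.1 hu]
        calc _ ≤ C * Φ u * H u * _ := mul_le_mul_right h2 _
          _ = _ := by ring
    _ = _ := lintegral_const_mul _ ((hΦm.mul (measurable_one.indicator hS)).mul hHm)

lemma regMajorant_le {q : ℕ} {β κ s ε : ℝ} (hβ : 0 ≤ β) (hs : 0 ≤ s) {x : E d} {u : Fin q → E d}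
    (hx : ∀ i, u i ≠ x) (hu : ∀ i k, i ≠ k → u i ≠ u k) : regMajorant β κ s ε x u ≤
      (∏ i, ‖u i - x‖ ^ (-β) * (1 + ‖u i - x‖) ^ (-κ)) * pairProd s u := by
  have hp : ∀ z : E d, ∀ a : ℝ, 0 ≤ max ‖z‖ ε ^ a := fun z a =>
    Real.rpow_nonneg ((norm_nonneg _).trans (le_max_left _ _)) _
  refine mul_le_mul (Finset.prod_le_prod (fun i _ => mul_nonneg (hp _ _) (by positivity)) fun i _ => ?_)
    (Finset.prod_le_prod (fun i _ => Finset.prod_nonneg fun k _ => hp _ _) fun i _ =>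
      Finset.prod_le_prod (fun k _ => hp _ _) fun k hk => ?_)
    (Finset.prod_nonneg fun i _ => Finset.prod_nonneg fun k _ => hp _ _)
    (Finset.prod_nonneg fun i _ => by positivity)
  · refine mul_le_mul_of_nonneg_right ?_ (by positivity)
    exact Real.rpow_le_rpow_of_nonpos (norm_pos_iff.2 (sub_ne_zero.2 (hx i))) (le_max_left _ _)
      (by linarith)
  · exact Real.rpow_le_rpow_of_nonpos (norm_pos_iff.2 (sub_ne_zero.2
      (hu i k (Finset.mem_Ioi.1 hk).ne))) (le_max_left _ _) (by linarith)

/-- The function `(ε / max |z| ε) ^ (d / 2)`. -/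
noncomputable def scaleRatio (ε : ℝ) (z : E d) : ℝ := (ε / max ‖z‖ ε) ^ ((d : ℝ) / 2)

@[fun_prop]
lemma measurable_scaleRatio (ε : ℝ) : Measurable fun z : E d => scaleRatio ε z := by
  unfold scaleRatio
  fun_prop

lemma scaleRatio_nonneg {ε : ℝ} (hε : 0 < ε) (z : E d) : 0 ≤ scaleRatio ε z :=
  Real.rpow_nonneg (div_nonneg hε.le (hε.le.trans (le_max_right _ _))) _

lemma scaleRatio_le_one {ε : ℝ} (hε : 0 < ε) (z : E d) : scaleRatio ε z ≤ 1 :=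
  Real.rpow_le_one (div_nonneg hε.le (hε.le.trans (le_max_right _ _)))
    (div_le_one_of_le₀ (le_max_right _ _) (hε.le.trans (le_max_right _ _))) (by positivity)

lemma scaleRatio_eq {ε : ℝ} (hε : 0 < ε) (z : E d) :
    scaleRatio ε z = ε ^ ((d : ℝ) / 2) * max ‖z‖ ε ^ (-((d : ℝ) / 2)) := by
  have := hε.le.trans (le_max_right ‖z‖ ε)
  rw [scaleRatio, Real.div_rpow hε.le this, Real.rpow_neg this, div_eq_mul_inv]

lemma indicator_le_scaleRatio {ε : ℝ} (hε : 0 < ε) (z : E d) (hz : ‖z‖ ≤ 2 * ε) :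
    1 ≤ 2 ^ ((d : ℝ) / 2) * scaleRatio ε z := by
  have hm : 0 < max ‖z‖ ε := lt_max_of_lt_right hε
  rw [scaleRatio, ← Real.mul_rpow (by norm_num) (by positivity)]
  refine Real.one_le_rpow ?_ (by positivity)
  rw [← mul_div_assoc, one_le_div hm]
  exact max_le hz (by linarith)

lemma tendsto_scaleRatio [NeZero d] {z : E d} (hz : z ≠ 0) :
    Tendsto (fun ε => scaleRatio ε z) (𝓝[>] 0) (𝓝 0) := by
  have hd : (0 : ℝ) < d := by exact_mod_cast NeZero.pos d
  have hz0 : 0 < ‖z‖ := norm_pos_iff.2 hz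
  have h1 : Tendsto (fun ε : ℝ => ε) (𝓝[>] 0) (𝓝 0) := tendsto_nhdsWithin_of_tendsto_nhds tendsto_id
  have h2 : Tendsto (fun ε : ℝ => ε / max ‖z‖ ε) (𝓝[>] 0) (𝓝 0) := by
    have := h1.div (tendsto_const_nhds.max h1) (by rw [max_eq_left hz0.le]; exact hz0.ne')
    rwa [zero_div] at this
  have := h2.rpow_const (p := (d : ℝ) / 2) (.inr (by positivity))
  rwa [Real.zero_rpow (by positivity)] at this

lemma BoundedPotential.comp_sub {w : E d → ENNReal} {p : ℝ} (h : BoundedPotential w p) (x : E d) :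
    BoundedPotential (fun u => w (u - x)) p := by
  obtain ⟨M, hM, hb⟩ := h.bound
  refine ⟨h.measurable.comp (by fun_prop), M, hM, fun t h0 h1 a => ?_⟩
  have := lintegral_sub_right_eq_self (fun u => w u * ENNReal.ofReal (‖u - (a - x)‖ ^ (-t))) x
    (μ := (volume : Measure (E d)))
  simp only [sub_sub_sub_cancel_right] at this
  rw [this]
  exact hb t h0 h1 _

lemma tendsto_lintegral_regMajorant [NeZero d] {q : ℕ} {β κ s : ℝ} (hβ : 0 ≤ β) (hs : 0 ≤ s) (x : E d)
    (hfin : pairIntegral q (fun y : E d =>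
      ENNReal.ofReal (‖y - x‖ ^ (-β) * (1 + ‖y - x‖) ^ (-κ))) s < ⊤) {i j : Fin q} (hij : i ≠ j) :
    Tendsto (fun ε => ∫⁻ u : Fin q → E d, ENNReal.ofReal (regMajorant β κ s ε x u) *
      ENNReal.ofReal (scaleRatio ε (u i - u j))) (𝓝[>] 0) (𝓝 0) := by
  have hae : ∀ᵐ u : Fin q → E d, (∀ i, u i ≠ x) ∧ ∀ i k, i ≠ k → u i ≠ u k := by
    have h1 : ∀ᵐ y : E d, y ≠ x := by simp [ae_iff, measure_singleton]
    have h2 : ∀ᵐ u : Fin q → E d, ∀ i, u i ≠ x := ae_all_iff.2 fun i =>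
      (Measure.quasiMeasurePreserving_eval (fun _ : Fin q => (volume : Measure (E d))) i).ae h1
    filter_upwards [h2, ae_forall_ne] with u hu hu' using ⟨hu, hu'⟩
  have h := tendsto_lintegral_filter_of_dominated_convergence (μ := (volume : Measure (Fin q → E d)))
    (l := 𝓝[>] (0 : ℝ)) (f := fun _ => 0)
    (F := fun ε (u : Fin q → E d) => ENNReal.ofReal (regMajorant β κ s ε x u) *
      ENNReal.ofReal (scaleRatio ε (u i - u j)))
    (fun u => (∏ i, ENNReal.ofReal (‖u i - x‖ ^ (-β) * (1 + ‖u i - x‖) ^ (-κ))) *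
      ENNReal.ofReal (pairProd s u)) (.of_forall fun ε => by fun_prop) ?_ hfin.ne ?_
  · simpa using h
  · filter_upwards [self_mem_nhdsWithin] with ε hε
    filter_upwards [hae] with u hu
    rw [← ENNReal.ofReal_prod_of_nonneg fun i _ => by positivity,
      ← ENNReal.ofReal_mul (Finset.prod_nonneg fun i _ => by positivity)]
    refine (mul_le_mul (ENNReal.ofReal_le_ofReal (regMajorant_le hβ hs hu.1 hu.2))
      (ENNReal.ofReal_le_ofReal (scaleRatio_le_one hε _)) zero_le zero_le).trans ?_
    rw [ENNReal.ofReal_one, mul_one]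
  · filter_upwards [hae] with u hu
    have h1 := (tendsto_scaleRatio (sub_ne_zero.2 (hu.2 i j hij))).const_mul
      ((∏ i, ‖u i - x‖ ^ (-β) * (1 + ‖u i - x‖) ^ (-κ)) * pairProd s u)
    rw [mul_zero] at h1
    have h2 := ENNReal.tendsto_ofReal h1
    rw [ENNReal.ofReal_zero] at h2
    refine tendsto_of_tendsto_of_tendsto_of_le_of_le' tendsto_const_nhds h2
      (.of_forall fun _ => zero_le) ?_
    filter_upwards [self_mem_nhdsWithin] with ε hε
    rw [← ENNReal.ofReal_mul (regMajorant_nonneg _ _ _ _ _ _)]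
    exact ENNReal.ofReal_le_ofReal (mul_le_mul_of_nonneg_right (regMajorant_le hβ hs hu.1 hu.2)
      (scaleRatio_nonneg hε _))

/-! ### The noise term -/

/-- The mollified noise, minus its mean under the exponential weight, times this weight. -/
noncomputable def noiseField (R γ₀ : ℝ) (θ : E d → ℝ) (ε η : ℝ) (T : Dist d) (y : E d) : ℝ :=
  (pairing T (fun σ => mollify θ η (y - σ)) - γ₀ * conv (mollify θ η) (kernelEps R θ ε) 0) *
    Real.exp (logField R γ₀ θ ε T y - normalization R γ₀ θ ε)

/-- The polynomial giving the fourth mixed moment. -/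
def quartic (c : Fin 4 → ℝ) (g : Fin 4 → Fin 4 → ℝ) : ℝ :=
  c 0 * c 1 * c 2 * c 3 + g 0 1 * c 2 * c 3 + g 0 2 * c 1 * c 3 + g 0 3 * c 1 * c 2
    + g 1 2 * c 0 * c 3 + g 1 3 * c 0 * c 2 + g 2 3 * c 0 * c 1
    + g 0 1 * g 2 3 + g 0 2 * g 1 3 + g 0 3 * g 1 2

/-- The sum majorizing `quartic`. -/
noncomputable def pairSum (b τ : Fin 4 → Fin 4 → ℝ) : ℝ :=
  ∑ σ : Fin 4 → Fin 4 with Function.Injective σ,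
    (b (σ 0) (σ 1) + τ (σ 0) (σ 1) + τ (σ 0) (σ 1) * τ (σ 2) (σ 3))

lemma abs_quartic_le {c : Fin 4 → ℝ} {g b τ : Fin 4 → Fin 4 → ℝ} {A : ℝ} (hA : 0 ≤ A)
    (hc : ∀ i, |c i| ≤ A * ∑ k ∈ Finset.univ.erase i, b i k) (hb0 : ∀ i k, 0 ≤ b i k)
    (hb1 : ∀ i k, b i k ≤ 1) (hτ : ∀ i k, 0 ≤ τ i k) (hg0 : ∀ i k, 0 ≤ g i k)
    (hg : ∀ i k, g i k ≤ A * τ i k) :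
    |quartic c g| ≤ (81 * A ^ 4 + 54 * A ^ 3 + 3 * A ^ 2) * pairSum b τ := by
  set S := pairSum b τ
  have hS : ∀ σ : Fin 4 → Fin 4, Function.Injective σ →
      b (σ 0) (σ 1) + τ (σ 0) (σ 1) + τ (σ 0) (σ 1) * τ (σ 2) (σ 3) ≤ S := fun σ hσ =>
    Finset.single_le_sum (f := fun σ : Fin 4 → Fin 4 =>
      b (σ 0) (σ 1) + τ (σ 0) (σ 1) + τ (σ 0) (σ 1) * τ (σ 2) (σ 3))
      (fun σ _ => by have := hb0 (σ 0) (σ 1); have := hτ (σ 0) (σ 1); have := hτ (σ 2) (σ 3); positivity)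
      (Finset.mem_filter.2 ⟨Finset.mem_univ _, hσ⟩)
  have h3 : ∀ i j k l : Fin 4, Function.Injective ![i, j, k, l] →
      b i j ≤ S ∧ τ i j ≤ S ∧ τ i j * τ k l ≤ S := fun i j k l h => by
    have := hS _ h
    simp only [Matrix.cons_val] at this
    have h1 := mul_nonneg (hτ i j) (hτ k l)
    refine ⟨?_, ?_, ?_⟩ <;> linarith [hb0 i j, hτ i j]
  have hS0 : 0 ≤ S := (hb0 0 1).trans (h3 0 1 2 3 (by decide)).1
  have hc3 : ∀ i, |c i| ≤ 3 * A := fun i => by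
    refine (hc i).trans ?_
    have : ∑ k ∈ Finset.univ.erase i, b i k ≤ 3 := by
      refine (Finset.sum_le_card_nsmul _ _ 1 fun k _ => hb1 i k).trans ?_
      simp [Finset.card_erase_of_mem]
    nlinarith
  have hc0 : |c 0| ≤ 3 * A * S := by
    refine (hc 0).trans ?_
    have : ∑ k ∈ Finset.univ.erase (0 : Fin 4), b 0 k ≤ 3 * S := by
      have e : (Finset.univ.erase (0 : Fin 4)) = {1, 2, 3} := by decide
      rw [e, Finset.sum_insert (by decide), Finset.sum_pair (by decide)]
      linarith [(h3 0 1 2 3 (by decide)).1, (h3 0 2 1 3 (by decide)).1, (h3 0 3 1 2 (by decide)).1]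
    nlinarith
  have q1 : |c 0 * c 1 * c 2 * c 3| ≤ 81 * A ^ 4 * S := by
    rw [abs_mul, abs_mul, abs_mul]
    calc _ ≤ 3 * A * S * (3 * A) * (3 * A) * (3 * A) := by
          gcongr
          exacts [hc3 1, hc3 2, hc3 3]
      _ = _ := by ring
  have q2 : ∀ i j k l, Function.Injective ![i, j, k, l] → |g i j * c k * c l| ≤ 9 * A ^ 3 * S := by
    intro i j k l h
    rw [abs_mul, abs_mul, abs_of_nonneg (hg0 i j)]
    calc _ ≤ A * S * (3 * A) * (3 * A) := by
          gcongr
          exacts [(hg i j).trans (mul_le_mul_of_nonneg_left (h3 i j k l h).2.1 hA), hc3 k, hc3 l]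
      _ = _ := by ring
  have q3 : ∀ i j k l, Function.Injective ![i, j, k, l] → |g i j * g k l| ≤ A ^ 2 * S := by
    intro i j k l h
    rw [abs_mul, abs_of_nonneg (hg0 i j), abs_of_nonneg (hg0 k l)]
    calc _ ≤ (A * τ i j) * (A * τ k l) := mul_le_mul (hg i j) (hg k l) (hg0 _ _)
          (mul_nonneg hA (hτ _ _))
      _ = A ^ 2 * (τ i j * τ k l) := by ring
      _ ≤ _ := mul_le_mul_of_nonneg_left (h3 i j k l h).2.2 (by positivity)
  have t1 := q2 0 1 2 3 (by decide)
  have t2 := q2 0 2 1 3 (by decide)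
  have t3 := q2 0 3 1 2 (by decide)
  have t4 := q2 1 2 0 3 (by decide)
  have t5 := q2 1 3 0 2 (by decide)
  have t6 := q2 2 3 0 1 (by decide)
  have t7 := q3 0 1 2 3 (by decide)
  have t8 := q3 0 2 1 3 (by decide)
  have t9 := q3 0 3 1 2 (by decide)
  rw [abs_le] at *
  unfold quartic
  constructor <;> linarith

section Noise

variable [NeZero d] {R γ₀ : ℝ} {θ : E d → ℝ} (hθ : IsMollifier θ) (hR : 0 < R) (hγ : 0 < γ₀)
  {W : Ω → Dist d}

include hθ in
lemma noiseField_eq {ε η : ℝ} (hε : 0 < ε) (hη : 0 < η) (T : Dist d) (y : E d) :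
    noiseField R γ₀ θ ε η T y = (T (reflTest (contDiff_mollify hθ η) (hasCompactSupport_mollify hθ hη) y) -
      γ₀ * conv (mollify θ η) (kernelEps R θ ε) 0) * (Real.exp (-normalization R γ₀ θ ε) *
        Real.exp (T (γ₀ • reflTest (contDiff_kernelEps (R := R) hθ hε)
          (hasCompactSupport_kernelEps hθ hε) y))) := by
  rw [noiseField, logField_eq hθ hε, pairing_reflTest T (contDiff_mollify hθ η)
    (hasCompactSupport_mollify hθ hη), ← Real.exp_add, neg_add_eq_sub]

include hθ hR hγ

/-- The fourth mixed moments of the noise term. -/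
lemma integral_prod_noiseField [IsProbabilityMeasure μ] (hW : IsWhiteNoise W μ) {ε η : ℝ}
    (hε : 0 < ε) (hεR : ε ≤ R) (hη : 0 < η) (u : Fin 4 → E d) :
    Integrable (fun ω => ∏ i, noiseField R γ₀ θ ε η (W ω) (u i)) μ ∧
    (γ₀ * kernelEps R θ ε 0) ^ 4 * ∫ ω, ∏ i, noiseField R γ₀ θ ε η (W ω) (u i) ∂μ =
      Real.exp (γ₀ ^ 2 * ∑ i, ∑ k ∈ Finset.Ioi i, covEps R θ ε ε (u i - u k)) *
        quartic (fun i => γ₀ * ∑ k ∈ Finset.univ.erase i,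
            conv (mollify θ η) (kernelEps R θ ε) (u i - u k))
          fun i k => conv (mollify θ η) (mollify θ η) (u i - u k) := by
  have hG := hW.isGaussianFamily
  let f : Fin 4 → Test d := fun i =>
    reflTest (contDiff_mollify hθ η) (hasCompactSupport_mollify hθ hη) (u i)
  let g : Fin 4 → Test d := fun i =>
    reflTest (contDiff_kernelEps (R := R) hθ hε) (hasCompactSupport_kernelEps hθ hε) (u i)
  have hg : ∀ i k, l2Form d (g i) (g k) = covEps R θ ε ε (u i - u k) := fun i k =>
    l2Form_reflTest _ _ _ _ (kernelEps_neg hθ ε) _ _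
  have hfg : ∀ i k, l2Form d (f i) (g k) = conv (mollify θ η) (kernelEps R θ ε) (u i - u k) :=
    fun i k => l2Form_reflTest _ _ _ _ (kernelEps_neg hθ ε) _ _
  have hf : ∀ i k, l2Form d (f i) (f k) = conv (mollify θ η) (mollify θ η) (u i - u k) :=
    fun i k => l2Form_reflTest _ _ _ _ (mollify_neg hθ) _ _
  let S : Test d := ∑ i, γ₀ • g i
  have e1 : ∀ ω, ∏ i, noiseField R γ₀ θ ε η (W ω) (u i) = Real.exp (-normalization R γ₀ θ ε) ^ 4 *
      ((∏ i, (W ω (f i) - γ₀ * conv (mollify θ η) (kernelEps R θ ε) 0)) * Real.exp (W ω S)) := by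
    intro ω
    simp only [noiseField_eq hθ hε hη, Finset.prod_mul_distrib, Finset.prod_const, Finset.card_univ,
      Fintype.card_fin, S, map_sum, Real.exp_sum, f, g]
    ring
  have e2 : l2Form d S S = γ₀ ^ 2 * (4 * covEps R θ ε ε 0 +
      2 * ∑ i, ∑ k ∈ Finset.Ioi i, covEps R θ ε ε (u i - u k)) := by
    have := sum_sum_eq_of_symm (fun i k => l2Form d (g i) (g k)) fun i k => hG.symm _ _
    simp only [hg, sub_self, Finset.sum_const, Finset.card_univ, Fintype.card_fin, nsmul_eq_mul] at this
    rw [show (4 : ℝ) = ((4 : ℕ) : ℝ) by norm_num, ← this]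
    simp only [S, map_sum, map_smul, LinearMap.sum_apply, LinearMap.smul_apply, smul_eq_mul, hg,
      Finset.mul_sum]
    refine (Finset.sum_comm).trans (Finset.sum_congr rfl fun i _ => Finset.sum_congr rfl fun k _ => ?_)
    ring
  have e3 : ∀ i, l2Form d (f i) S - γ₀ * conv (mollify θ η) (kernelEps R θ ε) 0 =
      γ₀ * ∑ k ∈ Finset.univ.erase i, conv (mollify θ η) (kernelEps R θ ε) (u i - u k) := fun i => by
    simp only [S, map_sum, map_smul, smul_eq_mul, hfg]
    rw [← Finset.mul_sum, ← Finset.add_sum_erase _ _ (Finset.mem_univ i), sub_self]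
    ring
  obtain ⟨h1, h2⟩ := hG.integral_four f (fun _ => γ₀ * conv (mollify θ η) (kernelEps R θ ε) 0) S
  simp only [e3, hf] at h2
  simp only [e1]
  refine ⟨h1.const_mul _, ?_⟩
  rw [integral_const_mul, h2, ← mul_assoc, ← mul_pow, exp_neg_normalization hθ hR hγ hε hεR,
    ← mul_assoc, e2]
  congr 1
  rw [← Real.exp_nat_mul, ← Real.exp_add]
  congr 1
  push_cast
  ring

lemma isRandomField_noiseField [IsProbabilityMeasure μ] (hW : IsWhiteNoise W μ) {ε η : ℝ}
    (hε : 0 < ε) (hεR : ε ≤ R) (hη : 0 < η) : IsRandomField 4 μ fun y ω => noiseField R γ₀ θ ε η (W ω) y := by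
  have hG := hW.isGaussianFamily
  have hpos : 0 < (γ₀ * kernelEps R θ ε 0) ^ 4 := by
    have := kernelEps_zero_pos hθ hε hεR
    positivity
  refine ⟨fun ω => ?_, fun y => ?_, ?_⟩
  · refine Continuous.mul ((continuous_pairing_refl _ (contDiff_mollify hθ η)
      (hasCompactSupport_mollify hθ hη)).sub continuous_const) ?_
    exact Real.continuous_exp.comp ((contDiff_logField hθ hε (W ω)).continuous.sub continuous_const)
  · simp only [noiseField_eq hθ hε hη]
    exact ((hG.aemeasurable _).sub aemeasurable_const).mul
      ((Real.measurable_exp.comp_aemeasurable (hG.aemeasurable _)).const_mul _)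
  · have h := fun y => integral_prod_noiseField hθ hR hγ hW hε hεR hη (fun _ : Fin 4 => (y : E d))
    refine ⟨ENNReal.ofReal (∫ ω, noiseField R γ₀ θ ε η (W ω) 0 ^ 4 ∂μ), ENNReal.ofReal_ne_top,
      fun y => le_of_eq ?_⟩
    have e : ∀ y, ∫ ω, noiseField R γ₀ θ ε η (W ω) y ^ 4 ∂μ =
        ∫ ω, noiseField R γ₀ θ ε η (W ω) 0 ^ 4 ∂μ := fun y => by
      have h1 := (h y).2
      have h2 := (h 0).2
      simp only [sub_self, Finset.prod_const, Finset.card_univ, Fintype.card_fin] at h1 h2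
      exact mul_left_cancel₀ hpos.ne' (h1.trans h2.symm)
    have h1 := (h y).1
    simp only [Finset.prod_const, Finset.card_univ, Fintype.card_fin] at h1
    simp only [Even.pow_abs (show Even 4 by decide)]
    rw [← e y, ofReal_integral_eq_lintegral_ofReal h1 (.of_forall fun ω => by positivity)]

end Noise

/-! ### Bounds for the moments of the noise term -/

section Noise

variable [NeZero d] {R γ₀ : ℝ} {θ : E d → ℝ} (hθ : IsMollifier θ) (hR : 0 < R) (hγ : 0 < γ₀)
  {W : Ω → Dist d}

include hθ

omit [NeZero d] in
lemma conv_mollify_self_nonneg {η : ℝ} (hη : 0 < η) (z : E d) :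
    0 ≤ conv (mollify θ η) (mollify θ η) z :=
  conv_mollify_nonneg hθ hη (mollify_nonneg hθ hη) z

omit [NeZero d] in
lemma conv_mollify_self_eq_zero {η : ℝ} (hη : 0 < η) {z : E d} (hz : 2 * η < ‖z‖) :
    conv (mollify θ η) (mollify θ η) z = 0 := by
  refine integral_eq_zero_of_ae (.of_forall fun t => ?_)
  change mollify θ η t * mollify θ η (z - t) = 0
  rcases le_or_gt ‖t‖ η with ht | ht
  · rw [mollify_eq_zero hθ hη (x := z - t), mul_zero]
    linarith [norm_sub_norm_le z t]
  · rw [mollify_eq_zero hθ hη ht, zero_mul]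

omit [NeZero d] in
lemma continuous_conv_mollify_self {η : ℝ} (hη : 0 < η) :
    Continuous (conv (mollify θ η) (mollify θ η)) :=
  (contDiff_conv_mollify hθ hη (integrable_mollify hθ hη).locallyIntegrable).continuous

omit [NeZero d] in
lemma lintegral_conv_mollify_self {η : ℝ} (hη : 0 < η) :
    ∫⁻ z, ENNReal.ofReal (conv (mollify θ η) (mollify θ η) z) = 1 := by
  have hi := integrable_mollify hθ hη
  rw [← ofReal_integral_eq_lintegral_ofReal
    (hi.integrable_convolution (ContinuousLinearMap.mul ℝ ℝ) hi)
    (.of_forall (conv_mollify_self_nonneg hθ hη))]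
  have := integral_convolution (ContinuousLinearMap.mul ℝ ℝ) hi hi
  rw [ContinuousLinearMap.mul_apply', integral_mollify hθ hη] at this
  exact (congrArg ENNReal.ofReal (this.trans (mul_one 1))).trans ENNReal.ofReal_one

lemma exists_conv_mollify_kernelEps_le (R : ℝ) : ∃ C > 0, ∀ ε, 0 < ε → ε ≤ R → ∀ η, 0 < η →
    η ≤ ε → ∀ z : E d, conv (mollify θ η) (kernelEps R θ ε) z ≤
      C * kernelEps R θ ε 0 * scaleRatio ε z := by
  obtain ⟨C, hC, h⟩ := exists_kernelEps_le hθ R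
  refine ⟨C * 3 ^ ((d : ℝ) / 2), by positivity, fun ε hε hεR η hη hηε z => ?_⟩
  have h1 : conv (mollify θ η) (kernelEps R θ ε) z ≤
      C * (3 ^ ((d : ℝ) / 2) * max ‖z‖ ε ^ (-((d : ℝ) / 2))) := by
    refine conv_mollify_le_of_le hθ hη (kernelEps_nonneg hθ hε) fun y hy => (h ε hε y).trans ?_
    refine mul_le_mul_of_nonneg_left (max_norm_rpow_neg_le hε (by positivity) ?_) hC.le
    rw [← dist_eq_norm, dist_comm]
    linarith
  have h2 := kernelEps_zero_ge hθ hε hεR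
  have h3 := scaleRatio_nonneg hε z
  calc _ ≤ _ := h1
    _ = C * 3 ^ ((d : ℝ) / 2) * ε ^ (-((d : ℝ) / 2)) * scaleRatio ε z := by
        rw [scaleRatio_eq hε, Real.rpow_neg hε.le]
        have : ε ^ ((d : ℝ) / 2) ≠ 0 := (Real.rpow_pos_of_pos hε _).ne'
        field_simp
    _ ≤ _ := by gcongr

lemma exists_exp_sum_covEps_le (hR : 0 < R) (γ₀ M : ℝ) (q : ℕ) : ∃ C > 0, ∀ ε > 0, ∀ u : Fin q → E d,
    (∀ i k, max ‖u i - u k‖ ε ≤ M) →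
    Real.exp (γ₀ ^ 2 * ∑ i, ∑ k ∈ Finset.Ioi i, covEps R θ ε ε (u i - u k)) ≤
      C * ∏ i, ∏ k ∈ Finset.Ioi i, max ‖u i - u k‖ ε ^ (-(γ₀ ^ 2 * sphereArea d)) := by
  obtain ⟨C, h⟩ := exists_covEps_le hθ hR M
  refine ⟨∏ i : Fin q, ∏ _k ∈ Finset.Ioi i, Real.exp (γ₀ ^ 2 * C),
    Finset.prod_pos fun i _ => Finset.prod_pos fun k _ => Real.exp_pos _, fun ε hε u hu => ?_⟩
  simp only [Finset.mul_sum, Real.exp_sum, ← Finset.prod_mul_distrib]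
  refine Finset.prod_le_prod (fun i _ => (Finset.prod_pos fun k _ => Real.exp_pos _).le) fun i _ =>
    Finset.prod_le_prod (fun k _ => (Real.exp_pos _).le) fun k _ => ?_
  have hm : 0 < max ‖u i - u k‖ ε := lt_max_of_lt_right hε
  rw [Real.rpow_def_of_pos hm, ← Real.exp_add]
  refine Real.exp_le_exp.2 ?_
  calc _ ≤ γ₀ ^ 2 * (sphereArea d * (-Real.log (max ‖u i - u k‖ ε)) + C) :=
        mul_le_mul_of_nonneg_left (h ε ε hε hε _ (hu i k)) (sq_nonneg _)
    _ = _ := by ring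

/-- The matrices of `quartic` are bounded in the scale of the regularization. -/
lemma exists_abs_integral_prod_noiseField_le [IsProbabilityMeasure μ] (hR : 0 < R) (hγ : 0 < γ₀)
    (hW : IsWhiteNoise W μ) (M : ℝ) :
    ∃ K > 0, ∀ ε, 0 < ε → ε ≤ R → ∀ η, 0 < η → η ≤ ε → ∀ u : Fin 4 → E d,
      (∀ i k, max ‖u i - u k‖ ε ≤ M) →
      |∫ ω, ∏ i, noiseField R γ₀ θ ε η (W ω) (u i) ∂μ| ≤
        K * (∏ i, ∏ k ∈ Finset.Ioi i, max ‖u i - u k‖ ε ^ (-(γ₀ ^ 2 * sphereArea d))) *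
          pairSum (fun i k => scaleRatio ε (u i - u k))
            fun i k => ε ^ d * conv (mollify θ η) (mollify θ η) (u i - u k) := by
  obtain ⟨C₁, hC₁, h₁⟩ := exists_conv_mollify_kernelEps_le hθ R
  obtain ⟨C₂, hC₂, h₂⟩ := exists_exp_sum_covEps_le hθ hR γ₀ M 4
  set A := max C₁ (γ₀ ^ 2)⁻¹
  have hA : 0 ≤ A := hC₁.le.trans (le_max_left _ _)
  set B := 81 * A ^ 4 + 54 * A ^ 3 + 3 * A ^ 2
  have hB : 0 ≤ B := by positivity
  refine ⟨C₂ * (B + 1), by positivity, fun ε hε hεR η hη hηε u hu => ?_⟩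
  have hk := kernelEps_zero_pos hθ hε hεR
  set k₀ := kernelEps R θ ε 0
  set c : Fin 4 → ℝ := fun i => γ₀ * ∑ k ∈ Finset.univ.erase i,
    conv (mollify θ η) (kernelEps R θ ε) (u i - u k)
  set g : Fin 4 → Fin 4 → ℝ := fun i k => conv (mollify θ η) (mollify θ η) (u i - u k)
  set b : Fin 4 → Fin 4 → ℝ := fun i k => scaleRatio ε (u i - u k)
  set τ : Fin 4 → Fin 4 → ℝ := fun i k => ε ^ d * g i k
  have hg0 : ∀ i k, 0 ≤ g i k := fun i k => conv_mollify_self_nonneg hθ hη _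
  have hβ : 0 < γ₀ * k₀ := by positivity
  obtain ⟨-, h3⟩ := integral_prod_noiseField hθ hR hγ hW hε hεR hη u
  have hQ : quartic c g = (γ₀ * k₀) ^ 4 *
      quartic (fun i => c i / (γ₀ * k₀)) (fun i k => g i k / (γ₀ * k₀) ^ 2) := by
    unfold quartic
    field_simp
  have hQle := abs_quartic_le (c := fun i => c i / (γ₀ * k₀)) (g := fun i k => g i k / (γ₀ * k₀) ^ 2)
    (b := b) (τ := τ) hA (fun i => ?_) (fun i k => scaleRatio_nonneg hε _)
    (fun i k => scaleRatio_le_one hε _) (fun i k => mul_nonneg (by positivity) (hg0 i k))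
    (fun i k => div_nonneg (hg0 i k) (by positivity)) (fun i k => ?_)
  · rw [hQ, mul_left_comm] at h3
    have h4 := mul_left_cancel₀ (by positivity) h3
    rw [h4, abs_mul, abs_of_pos (Real.exp_pos _)]
    have hS : 0 ≤ pairSum b τ := Finset.sum_nonneg fun σ _ => by
      have := scaleRatio_nonneg hε (u (σ 0) - u (σ 1))
      have := hg0 (σ 0) (σ 1)
      have := hg0 (σ 2) (σ 3)
      positivity
    calc _ ≤ (C₂ * ∏ i, ∏ k ∈ Finset.Ioi i, max ‖u i - u k‖ ε ^ (-(γ₀ ^ 2 * sphereArea d))) *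
          ((B + 1) * pairSum b τ) := by
          refine mul_le_mul (h₂ ε hε u hu) (hQle.trans ?_) (abs_nonneg _) ?_
          · exact mul_le_mul_of_nonneg_right (by linarith) hS
          · exact (Real.exp_pos _).le.trans (h₂ ε hε u hu)
      _ = _ := by ring
  · rw [abs_div, abs_of_pos hβ, div_le_iff₀ hβ, abs_of_nonneg (mul_nonneg hγ.le
      (Finset.sum_nonneg fun k _ => conv_mollify_nonneg hθ hη (kernelEps_nonneg hθ hε) _))]
    calc _ ≤ γ₀ * ∑ k ∈ Finset.univ.erase i, C₁ * k₀ * b i k := by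
          refine mul_le_mul_of_nonneg_left (Finset.sum_le_sum fun k _ => ?_) hγ.le
          exact h₁ ε hε hεR η hη hηε _
      _ = C₁ * (∑ k ∈ Finset.univ.erase i, b i k) * (γ₀ * k₀) := by
          rw [← Finset.mul_sum]; ring
      _ ≤ _ := by
          gcongr
          · exact Finset.sum_nonneg fun k _ => scaleRatio_nonneg hε _
          · exact le_max_left _ _
  · have h5 : (ε ^ d)⁻¹ ≤ k₀ ^ 2 := by
      have h6 : ε ^ (-((d : ℝ) / 2)) ≤ k₀ := kernelEps_zero_ge hθ hε hεR
      calc (ε ^ d)⁻¹ = (ε ^ (-((d : ℝ) / 2))) ^ 2 := by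
            rw [← Real.rpow_natCast, ← Real.rpow_natCast, ← Real.rpow_mul hε.le, ← Real.rpow_neg hε.le]
            congr 1
            push_cast
            ring
        _ ≤ _ := by gcongr
    have h7 : 1 ≤ k₀ ^ 2 * ε ^ d := by
      rwa [← inv_le_iff_one_le_mul₀ (by positivity)]
    rw [div_le_iff₀ (by positivity)]
    calc g i k ≤ g i k * (k₀ ^ 2 * ε ^ d) := le_mul_of_one_le_right (hg0 i k) h7
      _ = (γ₀ ^ 2)⁻¹ * τ i k * (γ₀ * k₀) ^ 2 := by
          simp only [τ]
          field_simp
      _ ≤ _ := by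
          have : 0 ≤ τ i k := mul_nonneg (by positivity) (hg0 i k)
          gcongr
          exact le_max_right _ _

end Noise

/-! ### The noise term vanishes in the limit -/

/-- The integral majorizing the fourth moment of the noise term. -/
noncomputable def noiseMajorant (β κ s ε : ℝ) (x : E d) : ENNReal :=
  ∑ σ : Fin 4 → Fin 4 with Function.Injective σ, ∫⁻ u : Fin 4 → E d,
    ENNReal.ofReal (regMajorant β κ s ε x u) * ENNReal.ofReal (scaleRatio ε (u (σ 0) - u (σ 1)))

section Noise

variable [NeZero d] {R γ₀ : ℝ} {θ : E d → ℝ} (hθ : IsMollifier θ) (hR : 0 < R) (hγ : 0 < γ₀)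
  {W : Ω → Dist d}

include hθ

lemma exists_lintegral_regMajorant_mul_le (q : ℕ) {β κ s : ℝ} (hβ : 0 ≤ β) (hκ : 0 ≤ κ) (hs : 0 ≤ s)
    (x : E d) : ∃ K : ENNReal, K ≠ ⊤ ∧ ∀ ε, 0 < ε → ε ≤ 1 → ∀ η, 0 < η → 2 * η ≤ ε →
      ∀ i j : Fin q, i ≠ j → ∀ H : (Fin q → E d) → ENNReal, Measurable H →
      (∀ u v, H (u + Pi.single j v) = H u) →
      ∫⁻ u, ENNReal.ofReal (regMajorant β κ s ε x u) *
        ENNReal.ofReal (ε ^ d * conv (mollify θ η) (mollify θ η) (u i - u j)) * H u ≤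
      K * ∫⁻ u, ENNReal.ofReal (regMajorant β κ s ε x u) *
        ENNReal.ofReal (scaleRatio ε (u i - u j)) * H u := by
  obtain ⟨C, hC, h⟩ := exists_regMajorant_le (d := d) q hβ hκ hs
  set V := volume (Metric.ball (0 : E d) 1)
  have hV : V ≠ ⊤ := measure_ball_lt_top.ne
  have hV0 : V ≠ 0 := (Metric.measure_ball_pos _ _ one_pos).ne'
  refine ⟨V⁻¹ * (ENNReal.ofReal C * ENNReal.ofReal (2 ^ ((d : ℝ) / 2))),
    ENNReal.mul_ne_top (ENNReal.inv_ne_top.2 hV0)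
      (ENNReal.mul_ne_top ENNReal.ofReal_ne_top ENNReal.ofReal_ne_top),
    fun ε hε hε1 η hη hηε i j hij H hHm hH => ?_⟩
  have hTm := (continuous_conv_mollify_self hθ hη).measurable.ennreal_ofReal
  have h1 := lintegral_smear_le (Φ := fun u => ENNReal.ofReal (regMajorant β κ s ε x u)) (H := H)
    (T := fun z => ENNReal.ofReal (conv (mollify θ η) (mollify θ η) z)) (by fun_prop) hHm hTm
    (C := ENNReal.ofReal C) (ε := ε) hij (fun u v hv => ?_) hH (lintegral_conv_mollify_self hθ hη).le
    fun z hz => by rw [conv_mollify_self_eq_zero hθ hη (by linarith), ENNReal.ofReal_zero]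
  · rw [Measure.addHaar_ball _ _ hε.le, finrank_euclideanSpace_fin] at h1
    have hTu : Measurable fun u : Fin q → E d =>
        ENNReal.ofReal (conv (mollify θ η) (mollify θ η) (u i - u j)) := hTm.comp (by fun_prop)
    have e : ∀ u : Fin q → E d, ENNReal.ofReal (regMajorant β κ s ε x u) *
        ENNReal.ofReal (ε ^ d * conv (mollify θ η) (mollify θ η) (u i - u j)) * H u =
        ENNReal.ofReal (ε ^ d) * (ENNReal.ofReal (regMajorant β κ s ε x u) *
          ENNReal.ofReal (conv (mollify θ η) (mollify θ η) (u i - u j)) * H u) := fun u => by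
      rw [ENNReal.ofReal_mul (by positivity)]
      ring
    simp only [e]
    rw [lintegral_const_mul _ (by fun_prop), mul_assoc, ← ENNReal.mul_le_iff_le_inv hV0 hV, mul_left_comm,
      ← mul_assoc]
    refine h1.trans ?_
    rw [mul_assoc]
    refine mul_le_mul_right ?_ _
    rw [← lintegral_const_mul _ (by fun_prop)]
    refine lintegral_mono fun u => ?_
    rw [← mul_assoc, mul_left_comm]
    gcongr
    by_cases hu : ‖u i - u j‖ ≤ 2 * ε
    · rw [indicator_of_mem (show u ∈ {u : Fin q → E d | ‖u i - u j‖ ≤ 2 * ε} from hu), Pi.one_apply,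
        ← ENNReal.ofReal_mul (by positivity), ← ENNReal.ofReal_one]
      exact ENNReal.ofReal_le_ofReal (indicator_le_scaleRatio hε _ hu)
    · rw [indicator_of_notMem (show u ∉ {u : Fin q → E d | ‖u i - u j‖ ≤ 2 * ε} from hu)]
      exact zero_le
  · rw [← ENNReal.ofReal_mul hC.le]
    refine ENNReal.ofReal_le_ofReal (h ε hε hε1 x _ _ fun k => ?_)
    rw [Pi.add_apply, add_sub_cancel_left]
    by_cases hk : k = j
    · subst hk; rwa [Pi.single_eq_same]
    · rw [Pi.single_eq_of_ne hk, norm_zero]; exact hε.le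

lemma exists_lintegral_regMajorant_pairSum_le {β κ s : ℝ} (hβ : 0 ≤ β) (hκ : 0 ≤ κ) (hs : 0 ≤ s)
    (x : E d) : ∃ K : ENNReal, K ≠ ⊤ ∧ ∀ ε, 0 < ε → ε ≤ 1 → ∀ η, 0 < η → 2 * η ≤ ε →
      ∫⁻ u : Fin 4 → E d, ENNReal.ofReal (regMajorant β κ s ε x u) *
        ENNReal.ofReal (pairSum (fun i k => scaleRatio ε (u i - u k))
            fun i k => ε ^ d * conv (mollify θ η) (mollify θ η) (u i - u k)) ≤
      K * noiseMajorant β κ s ε x := by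
  obtain ⟨K, hK, h⟩ := exists_lintegral_regMajorant_mul_le hθ 4 hβ hκ hs x
  refine ⟨1 + K + K * K, by simp [hK, ENNReal.mul_eq_top], fun ε hε hε1 η hη hηε => ?_⟩
  have hT0 : ∀ z, 0 ≤ ε ^ d * conv (mollify θ η) (mollify θ η) z := fun z =>
    mul_nonneg (by positivity) (conv_mollify_self_nonneg hθ hη z)
  have hTc := (continuous_conv_mollify_self hθ hη).measurable
  set Φ : (Fin 4 → E d) → ENNReal := fun u => ENNReal.ofReal (regMajorant β κ s ε x u)
  have hΦm : Measurable Φ := by fun_prop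
  let b : Fin 4 → Fin 4 → (Fin 4 → E d) → ENNReal := fun i k u =>
    ENNReal.ofReal (scaleRatio ε (u i - u k))
  let τ : Fin 4 → Fin 4 → (Fin 4 → E d) → ENNReal := fun i k u =>
    ENNReal.ofReal (ε ^ d * conv (mollify θ η) (mollify θ η) (u i - u k))
  have hbm : ∀ i k, Measurable (b i k) := fun i k => by fun_prop
  have hτm : ∀ i k, Measurable (τ i k) := fun i k =>
    ((hTc.comp (by fun_prop : Measurable fun u : Fin 4 → E d => u i - u k)).const_mul _).ennreal_ofReal
  have hinv : ∀ {i k j : Fin 4} (F : E d → ENNReal), i ≠ j → k ≠ j → ∀ (u : Fin 4 → E d) v,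
      F ((u + Pi.single j v : Fin 4 → E d) i - (u + Pi.single j v : Fin 4 → E d) k) =
        F (u i - u k) := fun F hi hk u v => by
    rw [Pi.add_apply, Pi.add_apply, Pi.single_eq_of_ne hi, Pi.single_eq_of_ne hk, add_zero, add_zero]
  have e : ∀ u : Fin 4 → E d, Φ u * ENNReal.ofReal (pairSum (fun i k => scaleRatio ε (u i - u k))
      fun i k => ε ^ d * conv (mollify θ η) (mollify θ η) (u i - u k)) =
      ∑ σ : Fin 4 → Fin 4 with Function.Injective σ, (Φ u * b (σ 0) (σ 1) u +
        Φ u * τ (σ 0) (σ 1) u * 1 + Φ u * τ (σ 0) (σ 1) u * τ (σ 2) (σ 3) u) := fun u => by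
    rw [pairSum, ENNReal.ofReal_sum_of_nonneg, Finset.mul_sum]
    · refine Finset.sum_congr rfl fun σ _ => ?_
      have h0 := scaleRatio_nonneg hε (u (σ 0) - u (σ 1))
      have h1 := hT0 (u (σ 0) - u (σ 1))
      have h2 := hT0 (u (σ 2) - u (σ 3))
      rw [ENNReal.ofReal_add (add_nonneg h0 h1) (mul_nonneg h1 h2), ENNReal.ofReal_add h0 h1,
        ENNReal.ofReal_mul h1]
      simp only [b, τ]
      ring
    · intro σ _
      have h0 := scaleRatio_nonneg hε (u (σ 0) - u (σ 1))
      have h1 := hT0 (u (σ 0) - u (σ 1))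
      have h2 := hT0 (u (σ 2) - u (σ 3))
      exact add_nonneg (add_nonneg h0 h1) (mul_nonneg h1 h2)
  refine (lintegral_congr e).trans_le ?_
  rw [lintegral_finsetSum _ fun σ _ => by fun_prop, noiseMajorant, Finset.mul_sum]
  refine Finset.sum_le_sum fun σ hσ => ?_
  have hinj : Function.Injective σ := (Finset.mem_filter.1 hσ).2
  have hne : ∀ i j : Fin 4, i ≠ j → σ i ≠ σ j := fun i j hij => hinj.ne hij
  rw [lintegral_add_left (by fun_prop), lintegral_add_left (by fun_prop), add_mul, add_mul, one_mul]
  refine add_le_add (add_le_add le_rfl ?_) ?_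
  · refine (h ε hε hε1 η hη hηε _ _ (hne 0 1 (by decide)) (fun _ => 1) measurable_const
      fun _ _ => rfl).trans (le_of_eq ?_)
    simp only [mul_one]
  · calc _ ≤ K * ∫⁻ u, Φ u * b (σ 0) (σ 1) u * τ (σ 2) (σ 3) u :=
          h ε hε hε1 η hη hηε _ _ (hne 0 1 (by decide)) (τ (σ 2) (σ 3)) (hτm _ _)
            (hinv (fun z => ENNReal.ofReal (ε ^ d * conv (mollify θ η) (mollify θ η) z))
              (hne 2 1 (by decide)) (hne 3 1 (by decide)))
      _ = K * ∫⁻ u, Φ u * τ (σ 2) (σ 3) u * b (σ 0) (σ 1) u := by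
          simp only [mul_right_comm]
      _ ≤ K * (K * ∫⁻ u, Φ u * b (σ 2) (σ 3) u * b (σ 0) (σ 1) u) := mul_le_mul_right
          (h ε hε hε1 η hη hηε _ _ (hne 2 3 (by decide)) (b (σ 0) (σ 1)) (hbm _ _)
            (hinv (fun z => ENNReal.ofReal (scaleRatio ε z))
              (hne 0 3 (by decide)) (hne 1 3 (by decide)))) _
      _ ≤ K * (K * ∫⁻ u, Φ u * b (σ 0) (σ 1) u) := by
          refine mul_le_mul_right (mul_le_mul_right (lintegral_mono fun u => ?_) _) _
          refine mul_le_mul_left ?_ _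
          refine mul_le_of_le_one_right zero_le ?_
          rw [← ENNReal.ofReal_one]
          exact ENNReal.ofReal_le_ofReal (scaleRatio_le_one hε _)
      _ = _ := by rw [mul_assoc]

include hR hγ

lemma exists_lintegral_integral_noiseField_le [IsProbabilityMeasure μ] (hW : IsWhiteNoise W μ)
    {β κ C r : ℝ} (hβ : 0 ≤ β) (hκ : 0 ≤ κ) (hr : 0 < r) (hC : 0 < C) (x : E d) : ∃ K : ENNReal, K ≠ ⊤ ∧
      ∀ ε, 0 < ε → ε ≤ 1 → ε ≤ R → ∀ η, 0 < η → 2 * η ≤ ε → ∀ ψ : E d → ℝ, Continuous ψ →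
      (∀ y, |ψ y| ≤ C * max ‖y - x‖ ε ^ (-β)) → (∀ y, r < ‖y - x‖ → ψ y = 0) →
      ∫⁻ ω, ENNReal.ofReal ((∫ y, ψ y * noiseField R γ₀ θ ε η (W ω) y) ^ 4) ∂μ ≤
        K * noiseMajorant β κ (γ₀ ^ 2 * sphereArea d) ε x := by
  have hs : 0 ≤ γ₀ ^ 2 * sphereArea d := mul_nonneg (sq_nonneg _) measureReal_nonneg
  obtain ⟨K₁, hK₁, h₁⟩ := exists_abs_integral_prod_noiseField_le hθ hR hγ hW (2 * r + 1)
  obtain ⟨K₂, hK₂, h₂⟩ := exists_lintegral_regMajorant_pairSum_le hθ hβ hκ hs x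
  set L := (C * (1 + r) ^ κ) ^ 4
  refine ⟨ENNReal.ofReal (L * K₁) * K₂, ENNReal.mul_ne_top ENNReal.ofReal_ne_top hK₂,
    fun ε hε hε1 hεR η hη hηε ψ hψ hle h0 => ?_⟩
  have hψc : HasCompactSupport ψ := hasCompactSupport_of_eq_zero (r := ‖x‖ + r) fun y hy =>
    h0 y (by linarith [norm_sub_norm_le y x])
  have hY := isRandomField_noiseField hθ hR hγ hW hε hεR hη
  obtain ⟨i1, i2⟩ := IsRandomField.integral_prod (fun _ : Fin 4 => hY) (fun _ => hψ) fun _ => hψc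
  simp only [Finset.prod_const, Finset.card_univ, Fintype.card_fin] at i1 i2
  rw [← ofReal_integral_eq_lintegral_ofReal i1 (.of_forall fun ω => by positivity), i2]
  refine (Real.ofReal_le_enorm _).trans ((enorm_integral_le_lintegral_enorm _).trans ?_)
  have hpt : ∀ u : Fin 4 → E d, ‖(∏ i, ψ (u i)) * ∫ ω, ∏ i, noiseField R γ₀ θ ε η (W ω) (u i) ∂μ‖ₑ ≤
      ENNReal.ofReal (L * K₁) * (ENNReal.ofReal (regMajorant β κ (γ₀ ^ 2 * sphereArea d) ε x u) *
        ENNReal.ofReal (pairSum (fun i k => scaleRatio ε (u i - u k))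
            fun i k => ε ^ d * conv (mollify θ η) (mollify θ η) (u i - u k))) := fun u => by
    by_cases hu : ∀ i, ‖u i - x‖ ≤ r
    · have hM : ∀ i k, max ‖u i - u k‖ ε ≤ 2 * r + 1 := fun i k => by
        refine max_le ?_ (by linarith)
        have := norm_sub_le (u i - x) (u k - x)
        rw [sub_sub_sub_cancel_right] at this
        linarith [hu i, hu k]
      have h3 := h₁ ε hε hεR η hη (by linarith) u hM
      have h4 : |∏ i, ψ (u i)| ≤ L * ∏ i, (max ‖u i - x‖ ε ^ (-β) * (1 + ‖u i - x‖) ^ (-κ)) := by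
        have : L = ∏ _i : Fin 4, (C * (1 + r) ^ κ) := by simp [L]
        rw [Finset.abs_prod, this, ← Finset.prod_mul_distrib]
        refine Finset.prod_le_prod (fun i _ => abs_nonneg _) fun i _ => (hle (u i)).trans ?_
        have hn : 0 < 1 + ‖u i - x‖ := by positivity
        have h5 : 1 ≤ (1 + r) ^ κ * (1 + ‖u i - x‖) ^ (-κ) := by
          rw [Real.rpow_neg hn.le, ← div_eq_mul_inv, one_le_div (Real.rpow_pos_of_pos hn _)]
          exact Real.rpow_le_rpow hn.le (by linarith [hu i]) hκ
        have h6 : 0 ≤ C * max ‖u i - x‖ ε ^ (-β) := (abs_nonneg _).trans (hle (u i))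
        calc _ ≤ C * max ‖u i - x‖ ε ^ (-β) * ((1 + r) ^ κ * (1 + ‖u i - x‖) ^ (-κ)) :=
              le_mul_of_one_le_right h6 h5
          _ = _ := by ring
      rw [← ENNReal.ofReal_mul (regMajorant_nonneg _ _ _ _ _ _), ← ENNReal.ofReal_mul (by positivity),
        ← ofReal_norm, norm_mul, Real.norm_eq_abs, Real.norm_eq_abs]
      refine ENNReal.ofReal_le_ofReal ?_
      calc _ ≤ _ := mul_le_mul h4 h3 (abs_nonneg _) ((abs_nonneg _).trans h4)
        _ = _ := by
            rw [regMajorant]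
            ring
    · push Not at hu
      obtain ⟨i, hi⟩ := hu
      rw [Finset.prod_eq_zero (Finset.mem_univ i) (h0 _ hi), zero_mul, enorm_zero]
      exact zero_le
  refine (lintegral_mono hpt).trans ?_
  rw [lintegral_const_mul' _ _ ENNReal.ofReal_ne_top, mul_assoc]
  exact mul_le_mul_right (h₂ ε hε hε1 η hη hηε) _

end Noise

/-! ### Existence of the field -/

/-- The integral against the noise, minus the integral against the stochastic exponential. -/
noncomputable def noiseTerm (R γ₀ : ℝ) (θ : E d → ℝ) (ε : ℝ) (ψ : E d → ℝ) (T : Dist d) : ℝ :=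
  pairing T (fun y => ψ y * Real.exp (logField R γ₀ θ ε T y - normalization R γ₀ θ ε)) -
    expIntegral R γ₀ θ ε ψ T

section Limit

variable [NeZero d] {R γ₀ : ℝ} {θ : E d → ℝ} (hθ : IsMollifier θ) (hR : 0 < R) (hγ : 0 < γ₀)
  {W : Ω → Dist d}

include hθ hR hγ

lemma tendsto_integral_noiseField {ε : ℝ} (hε : 0 < ε) (hεR : ε ≤ R) {ψ : E d → ℝ}
    (hψ : ContDiff ℝ (⊤ : ℕ∞) ψ) (hψc : HasCompactSupport ψ) (T : Dist d) :
    Tendsto (fun η => ∫ y, ψ y * noiseField R γ₀ θ ε η T y) (𝓝[>] 0)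
      (𝓝 (noiseTerm R γ₀ θ ε ψ T)) := by
  set f : E d → ℝ := fun y => ψ y * Real.exp (logField R γ₀ θ ε T y - normalization R γ₀ θ ε)
  have hf : ContDiff ℝ (⊤ : ℕ∞) f :=
    hψ.mul (Real.contDiff_exp.comp ((contDiff_logField hθ hε T).sub contDiff_const))
  have hfc : HasCompactSupport f := hψc.mul_right
  have h1 := tendsto_integral_mul_pairing T hθ hf hfc
  have h2 : Tendsto (fun η => γ₀ * conv (mollify θ η) (kernelEps R θ ε) 0 * ∫ y, f y) (𝓝[>] 0)
      (𝓝 (γ₀ * kernelEps R θ ε 0 * ∫ y, f y)) := by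
    have hk := (contDiff_kernelEps (R := R) hθ hε).continuous
    exact ((tendsto_conv_mollify hθ hk.measurable hk.continuousAt).const_mul γ₀).mul_const _
  have e1 : γ₀ * kernelEps R θ ε 0 * ∫ y, f y = expIntegral R γ₀ θ ε ψ T := by
    rw [expIntegral, ← integral_const_mul]
    refine integral_congr_ae (.of_forall fun y => ?_)
    have h3 := exp_neg_normalization hθ hR hγ hε hεR
    simp only [f, expField, sub_eq_add_neg, Real.exp_add]
    rw [← h3]
    ring
  rw [e1] at h2
  refine (h1.sub h2).congr' ?_
  filter_upwards [self_mem_nhdsWithin] with η hη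
  rw [← integral_const_mul, ← integral_sub]
  · refine integral_congr_ae (.of_forall fun y => ?_)
    simp only [f, noiseField]
    ring
  · exact (hf.continuous.mul (continuous_pairing_refl T (contDiff_mollify hθ η)
      (hasCompactSupport_mollify hθ hη))).integrable_of_hasCompactSupport hfc.mul_right
  · exact (hf.continuous.integrable_of_hasCompactSupport hfc).const_mul _

variable [IsProbabilityMeasure μ] (hW : IsWhiteNoise W μ)
include hW

lemma exists_lintegral_pairing_sub_le {β κ C r : ℝ} (hβ : 0 ≤ β) (hκ : 0 ≤ κ) (hr : 0 < r)
    (hC : 0 < C) (x : E d) : ∃ K : ENNReal, K ≠ ⊤ ∧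
      ∀ ε, 0 < ε → ε ≤ 1 → ε ≤ R → ∀ ψ : E d → ℝ, ContDiff ℝ (⊤ : ℕ∞) ψ →
      (∀ y, |ψ y| ≤ C * max ‖y - x‖ ε ^ (-β)) → (∀ y, r < ‖y - x‖ → ψ y = 0) →
      AEMeasurable (fun ω => noiseTerm R γ₀ θ ε ψ (W ω)) μ ∧
      ∫⁻ ω, ENNReal.ofReal (noiseTerm R γ₀ θ ε ψ (W ω) ^ 4) ∂μ ≤
        K * noiseMajorant β κ (γ₀ ^ 2 * sphereArea d) ε x := by
  obtain ⟨K, hK, h⟩ := exists_lintegral_integral_noiseField_le hθ hR hγ hW hβ hκ hr hC x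
  refine ⟨K, hK, fun ε hε hε1 hεR ψ hψ hle h0 => ?_⟩
  have hψc : HasCompactSupport ψ := hasCompactSupport_of_eq_zero (r := ‖x‖ + r) fun y hy =>
    h0 y (by linarith [norm_sub_norm_le y x])
  obtain ⟨η, -, hη, hlim⟩ := exists_seq_strictAnti_tendsto' (half_pos hε)
  have hη' : Tendsto η atTop (𝓝[>] 0) := tendsto_nhdsWithin_iff.2
    ⟨hlim, .of_forall fun n => (hη n).1⟩
  have hT : ∀ ω, Tendsto (fun n => ∫ y, ψ y * noiseField R γ₀ θ ε (η n) (W ω) y) atTop _ :=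
    fun ω => (tendsto_integral_noiseField hθ hR hγ hε hεR hψ hψc (W ω)).comp hη'
  have hm : ∀ n, AEMeasurable (fun ω => ∫ y, ψ y * noiseField R γ₀ θ ε (η n) (W ω) y) μ := fun n => by
    have hY := isRandomField_noiseField hθ hR hγ hW hε hεR (hη n).1
    exact aemeasurable_integral_mul hY.continuous hY.aemeasurable hψ.continuous.measurable
  refine ⟨aemeasurable_of_tendsto_metrizable_ae atTop hm (.of_forall hT), ?_⟩
  have e : ∀ ω, ENNReal.ofReal (noiseTerm R γ₀ θ ε ψ (W ω) ^ 4) = liminf (fun n => ENNReal.ofReal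
          ((∫ y, ψ y * noiseField R γ₀ θ ε (η n) (W ω) y) ^ 4)) atTop := fun ω =>
    (ENNReal.tendsto_ofReal ((hT ω).pow 4)).liminf_eq.symm
  simp only [e]
  refine (lintegral_liminf_le' fun n => ((hm n).pow_const 4).ennreal_ofReal).trans ?_
  refine liminf_le_of_frequently_le' (.of_forall fun n => ?_)
  exact h ε hε hε1 hεR (η n) (hη n).1 (by linarith [(hη n).2]) ψ hψ.continuous hle h0

variable {α : ℝ} {φ : E d → ℝ} (hαd : α < d)
  (hs : 5 / 2 * (γ₀ ^ 2 * sphereArea d) < α) (hφ : IsCutoff φ)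
include hαd hs hφ

/-- The regularized fields are asymptotic to integrals against the stochastic exponential. -/
lemma tendsto_eLpNorm_fieldEps_sub (x : E d) (i : Fin d) :
    (∀ᶠ ε in 𝓝[>] (0 : ℝ), AEMeasurable (fun ω => fieldEps α R γ₀ φ θ ε (W ω) x i -
      expIntegral R γ₀ θ ε (fun y => fieldKernel α R φ θ ε i (x - y)) (W ω)) μ) ∧
    Tendsto (fun ε => eLpNorm (fun ω => fieldEps α R γ₀ φ θ ε (W ω) x i -
      expIntegral R γ₀ θ ε (fun y => fieldKernel α R φ θ ε i (x - y)) (W ω)) 4 μ) (𝓝[>] 0) (𝓝 0) := by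
  have hs0 : 0 < γ₀ ^ 2 * sphereArea d := mul_pos (by positivity) sphereArea_pos
  obtain ⟨C, hC, hle⟩ := exists_abs_fieldKernel_le hφ hθ hR (by linarith : α < d + 1)
  obtain ⟨K, hK, h⟩ := exists_lintegral_pairing_sub_le hθ hR hγ hW (β := (d : ℝ) - α)
    (κ := (d : ℝ) + 1) (r := 2 * R) (by linarith) (by positivity) (by positivity) hC x
  have hbp : BoundedPotential (fun y : E d => ENNReal.ofReal (‖y - x‖ ^ (-((d : ℝ) - α)) *
      (1 + ‖y - x‖) ^ (-((d : ℝ) + 1)))) (5 / 2 * (γ₀ ^ 2 * sphereArea d)) :=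
    (boundedPotential_rpow_mul_one_add (by linarith) (by linarith) (by linarith)
      (by linarith)).comp_sub x
  have hfin := pairIntegral_add_two_lt_top hbp hs0 (n := 2) (by norm_num) (by norm_num)
  have hev : ∀ᶠ ε in 𝓝[>] (0 : ℝ), ε ∈ Ioo 0 (min 1 R) := Ioo_mem_nhdsGT (lt_min one_pos hR)
  have H : ∀ᶠ ε in 𝓝[>] (0 : ℝ), _ := hev.mono fun ε hε =>
    h ε hε.1 (hε.2.le.trans (min_le_left _ _)) (hε.2.le.trans (min_le_right _ _))
      (fun y => fieldKernel α R φ θ ε i (x - y))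
      ((contDiff_fieldKernel hφ hθ hε.1 i).comp (contDiff_const.sub contDiff_id))
      (fun y => by rw [norm_sub_rev]; exact hle ε hε.1 i _)
      fun y hy => fieldKernel_eq_zero hφ hR (by rwa [norm_sub_rev])
  refine ⟨H.mono fun ε hε => hε.1, tendsto_eLpNorm_four ?_⟩
  have hlim : Tendsto (fun ε => K * noiseMajorant ((d : ℝ) - α) ((d : ℝ) + 1)
      (γ₀ ^ 2 * sphereArea d) ε x) (𝓝[>] 0) (𝓝 0) := by
    have h1 := tendsto_finsetSum (Finset.univ.filter fun σ : Fin 4 → Fin 4 => Function.Injective σ)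
      fun σ hσ => tendsto_lintegral_regMajorant (β := (d : ℝ) - α) (by linarith) hs0.le x hfin
        ((Finset.mem_filter.1 hσ).2.ne (by decide : (0 : Fin 4) ≠ 1))
    have h2 := ENNReal.Tendsto.const_mul h1 (.inr hK)
    simpa [noiseMajorant] using h2
  exact tendsto_of_tendsto_of_tendsto_of_le_of_le' tendsto_const_nhds hlim
    (.of_forall fun _ => zero_le) (H.mono fun ε hε => hε.2)

end Limit

/-! ### Linear combinations of the components of the field -/

lemma tendsto_eLpNorm_sum {ι : Type*} [Fintype ι] {f : ι → ℝ → Ω → ℝ} (c : ι → ℝ)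
    (hm : ∀ k, ∀ᶠ ε in 𝓝[>] (0 : ℝ), AEStronglyMeasurable (f k ε) μ)
    (h : ∀ k, Tendsto (fun ε => eLpNorm (f k ε) 4 μ) (𝓝[>] 0) (𝓝 0)) :
    Tendsto (fun ε => eLpNorm (fun ω => ∑ k, c k * f k ε ω) 4 μ) (𝓝[>] 0) (𝓝 0) := by
  have h1 : Tendsto (fun ε => ∑ k, ‖c k‖ₑ * eLpNorm (f k ε) 4 μ) (𝓝[>] 0) (𝓝 0) := by
    have := tendsto_finsetSum Finset.univ fun k (_ : k ∈ Finset.univ) =>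
      ENNReal.Tendsto.const_mul (h k) (.inr (enorm_ne_top (x := c k)))
    simpa using this
  refine tendsto_of_tendsto_of_tendsto_of_le_of_le' tendsto_const_nhds h1
    (.of_forall fun _ => zero_le) ?_
  filter_upwards [eventually_all.2 hm] with ε hε
  have e : (fun ω => ∑ k, c k * f k ε ω) = ∑ k, c k • f k ε := by
    funext ω
    simp
  rw [e]
  refine (eLpNorm_sum_le (fun k _ => (hε k).const_smul (c k)) (by norm_num)).trans
    (Finset.sum_le_sum fun k _ => ?_)
  rw [eLpNorm_const_smul]

lemma tendsto_eLpNorm_of_add {f g : ℝ → Ω → ℝ}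
    (hf : ∀ᶠ ε in 𝓝[>] (0 : ℝ), AEStronglyMeasurable (f ε) μ)
    (hg : ∀ᶠ ε in 𝓝[>] (0 : ℝ), AEStronglyMeasurable (g ε) μ)
    (h : Tendsto (fun ε => eLpNorm (f ε) 4 μ) (𝓝[>] 0) (𝓝 0))
    (h' : Tendsto (fun ε => eLpNorm (g ε) 4 μ) (𝓝[>] 0) (𝓝 0)) :
    Tendsto (fun ε => eLpNorm (fun ω => f ε ω + g ε ω) 4 μ) (𝓝[>] 0) (𝓝 0) := by
  have h1 := h.add h'
  rw [add_zero] at h1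
  refine tendsto_of_tendsto_of_tendsto_of_le_of_le' tendsto_const_nhds h1
    (.of_forall fun _ => zero_le) ?_
  filter_upwards [hf, hg] with ε h2 h3
  exact eLpNorm_add_le h2 h3 (by norm_num)

lemma IsKernelFamily.sum {ι : Type*} [Fintype ι] {G : ι → ℝ → E d → ℝ} {H w : ι → E d → ℝ}
    {r : ι → ℝ} (h : ∀ k, IsKernelFamily (G k) (H k) (w k) (r k)) (c : ι → ℝ) :
    IsKernelFamily (fun ε y => ∑ k, c k * G k ε y) (fun y => ∑ k, c k * H k y)
      (fun y => ∑ k, |c k| * w k y) (∑ k, |r k|) := by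
  refine ⟨Finset.measurable_fun_sum _ fun k _ => (h k).measurable.const_mul _, ?_, ?_, ?_, ?_⟩
  · filter_upwards [eventually_all.2 fun k => (h k).continuous] with ε h1
    exact continuous_finsetSum _ fun k _ => continuous_const.mul (h1 k)
  · filter_upwards [eventually_all.2 fun k => (h k).abs_le] with ε h1 y
    refine (Finset.abs_sum_le_sum_abs _ _).trans (Finset.sum_le_sum fun k _ => ?_)
    rw [abs_mul]
    exact mul_le_mul_of_nonneg_left (h1 k y) (abs_nonneg _)
  · filter_upwards [eventually_all.2 fun k => (h k).eq_zero] with ε h1 y hy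
    refine Finset.sum_eq_zero fun k _ => ?_
    rw [h1 k y, mul_zero]
    exact (le_abs_self _).trans_lt
      ((Finset.single_le_sum (fun k _ => abs_nonneg (r k)) (Finset.mem_univ k)).trans_lt hy)
  · filter_upwards [eventually_all.2 fun k => (h k).tendsto] with y h1
    exact tendsto_finsetSum _ fun k _ => (h1 k).const_mul _

lemma BoundedPotential.sum {ι : Type*} {w : ι → E d → ENNReal} {p : ℝ} (s : Finset ι)
    (h : ∀ k, BoundedPotential (w k) p) : BoundedPotential (fun u => ∑ k ∈ s, w k u) p := by
  classical
  induction s using Finset.induction_on with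
  | empty => exact ⟨by simp, 0, by simp, by simp⟩
  | insert k s hk ih =>
    simp only [Finset.sum_insert hk]
    exact (h k).add ih

section Limit

variable [NeZero d] [IsProbabilityMeasure μ] {R γ₀ : ℝ} {θ : E d → ℝ} (hθ : IsMollifier θ) (hR : 0 < R)
  {W : Ω → Dist d} (hW : IsWhiteNoise W μ)
include hθ hW

lemma IsKernelFamily.eventually_memLp {G : ℝ → E d → ℝ} {H w : E d → ℝ} {r : ℝ}
    (hG : IsKernelFamily G H w r) :
    ∀ᶠ ε in 𝓝[>] (0 : ℝ), MemLp (fun ω => expIntegral R γ₀ θ ε (G ε) (W ω)) 4 μ := by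
  obtain ⟨δ, hδ, hδ0⟩ := ((hG.integral_prod hθ hW (R := R) (γ₀ := γ₀) (q := 4)).and
    self_mem_nhdsWithin).exists
  filter_upwards [hG.aemeasurable_expIntegral hθ hW, Ioo_mem_nhdsGT hδ0] with ε h1 h2
  refine memLp_four_of_integrable h1 ?_
  have := (hδ (fun _ => ε) fun _ => h2).1
  simpa using this

variable (hγ : 0 < γ₀) {α : ℝ} {φ : E d → ℝ} (hαd : α < d)
  (hs : 5 / 2 * (γ₀ ^ 2 * sphereArea d) < α) (hφ : IsCutoff φ)
include hγ hR hαd hs hφ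

lemma exists_tendsto_fieldEps (x : E d) (i : Fin d) : ∃ X : Ω → ℝ, MemLp X 4 μ ∧
    Tendsto (fun ε => eLpNorm (fun ω => fieldEps α R γ₀ φ θ ε (W ω) x i - X ω) 4 μ)
      (𝓝[>] 0) (𝓝 0) ∧ ∀ᶠ ε in 𝓝[>] (0 : ℝ), AEStronglyMeasurable
        (fun ω => fieldEps α R γ₀ φ θ ε (W ω) x i - X ω) μ := by
  have hs0 : 0 < γ₀ ^ 2 * sphereArea d := mul_pos (by positivity) sphereArea_pos
  obtain ⟨C, hC, hG⟩ := exists_isKernelFamily_fieldKernel hφ hθ hR hαd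
  have hfin : pairIntegral 4 (fun y => ENNReal.ofReal ((Metric.ball x (2 * R + 1)).indicator
      (fun y => C * ‖y - x‖ ^ (-((d : ℝ) - α))) y)) (γ₀ ^ 2 * sphereArea d) < ⊤ :=
    pairIntegral_add_two_lt_top (boundedPotential_fieldKernel (d := d) hC hαd
      (by linarith) hs (2 * R + 1) x) hs0 (n := 2) (by norm_num) (by norm_num)
  have hm := (hG i x).eventually_memLp hθ hW (R := R) (γ₀ := γ₀)
  have hcauchy := (hG i x).tendsto_integral_sub_pow_four hθ hW hR hfin
  obtain ⟨X, hX, hlim⟩ := exists_tendsto_eLpNorm_four (f := fun ε ω => expIntegral R γ₀ θ ε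
    (fun y => fieldKernel α R φ θ ε i (x - y)) (W ω)) hm hcauchy
  obtain ⟨h1, h2⟩ := tendsto_eLpNorm_fieldEps_sub hθ hR hγ hW hαd hs hφ x i
  have h1' := h1.mono fun ε hε => hε.aestronglyMeasurable
  have h3 : ∀ᶠ ε in 𝓝[>] (0 : ℝ), AEStronglyMeasurable (fun ω =>
      expIntegral R γ₀ θ ε (fun y => fieldKernel α R φ θ ε i (x - y)) (W ω) - X ω) μ :=
    hm.mono fun ε hε => hε.1.sub hX.1
  have h4 := tendsto_eLpNorm_of_add h1' h3 h2 hlim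
  simp only [sub_add_sub_cancel] at h4
  refine ⟨X, hX, h4, ?_⟩
  filter_upwards [h1', h3] with ε h5 h6
  exact (h5.add h6).congr (.of_forall fun ω => sub_add_sub_cancel _ _ _)

/-- Existence of the field. -/
lemma exists_isLimitField : ∃ X₀ : E d → Ω → E d, IsLimitField α R γ₀ φ θ μ W 4 X₀ := by
  choose X hX hlim hmeas using exists_tendsto_fieldEps hθ hR hW hγ hαd hs hφ
  refine ⟨fun x ω => WithLp.toLp 2 fun i => X x i ω, fun x => ⟨MemLp.of_eval_piLp fun i => hX x i, ?_⟩⟩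
  have h1 : Tendsto (fun ε => ∑ i, eLpNorm (fun ω => fieldEps α R γ₀ φ θ ε (W ω) x i - X x i ω) 4 μ)
      (𝓝[>] 0) (𝓝 0) := by
    simpa using tendsto_finsetSum Finset.univ fun i (_ : i ∈ Finset.univ) => hlim x i
  refine tendsto_of_tendsto_of_tendsto_of_le_of_le' tendsto_const_nhds h1
    (.of_forall fun _ => zero_le) ?_
  filter_upwards [eventually_all.2 fun i => hmeas x i] with ε hε
  calc _ ≤ eLpNorm (∑ i, fun ω => ‖fieldEps α R γ₀ φ θ ε (W ω) x i - X x i ω‖) 4 μ := by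
        refine eLpNorm_mono_real fun ω => ?_
        rw [Finset.sum_apply]
        refine (EuclideanSpace.norm_eq _).trans_le ((Real.sqrt_le_sqrt
          (Finset.sum_sq_le_sq_sum_of_nonneg fun i _ => norm_nonneg _)).trans
            (Real.sqrt_sq (Finset.sum_nonneg fun i _ => norm_nonneg _)).le)
    _ ≤ ∑ i, eLpNorm (fun ω => ‖fieldEps α R γ₀ φ θ ε (W ω) x i - X x i ω‖) 4 μ :=
        eLpNorm_sum_le (fun i _ => (hε i).norm) (by norm_num)
    _ = _ := by simp only [eLpNorm_norm]

/-- The third moments of linear combinations of components of the field. -/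
lemma integral_cube_isLimitField {X₀ : E d → Ω → E d} (hX : IsLimitField α R γ₀ φ θ μ W 4 X₀)
    {ι : Type*} [Fintype ι] (c : ι → ℝ) (i : ι → Fin d) (x : ι → E d) :
    ∫ ω, (∑ k, c k * X₀ (x k) ω (i k)) ^ 3 ∂μ =
      limitMoment R γ₀ 3 fun y => ∑ k, c k * limitKernel α R φ (i k) (x k - y) := by
  have hs0 : 0 < γ₀ ^ 2 * sphereArea d := mul_pos (by positivity) sphereArea_pos
  obtain ⟨C, hC, hG⟩ := exists_isKernelFamily_fieldKernel hφ hθ hR hαd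
  have hS := IsKernelFamily.sum (fun k => hG (i k) (x k)) c
  have hbp := BoundedPotential.sum Finset.univ fun k => (boundedPotential_fieldKernel (d := d) hC hαd
      (by linarith) hs (2 * R + 1) (x k)).const_mul (c := ENNReal.ofReal |c k|) ENNReal.ofReal_ne_top
  have hfin : pairIntegral 3 (fun y => ENNReal.ofReal (∑ k, |c k| *
      (Metric.ball (x k) (2 * R + 1)).indicator (fun y => C * ‖y - x k‖ ^ (-((d : ℝ) - α))) y))
      (γ₀ ^ 2 * sphereArea d) < ⊤ := by
    have := pairIntegral_add_two_lt_top hbp hs0 (n := 1) le_rfl (by norm_num; linarith)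
    refine lt_of_eq_of_lt ?_ this
    congr 1
    funext y
    rw [ENNReal.ofReal_sum_of_nonneg fun k _ => mul_nonneg (abs_nonneg _) ((hG (i k) (x k)).nonneg y)]
    exact Finset.sum_congr rfl fun k _ => ENNReal.ofReal_mul (abs_nonneg _)
  have hXi : ∀ x i, MemLp (fun ω => X₀ x ω i) 4 μ := fun x i => (hX x).1.eval_piLp i
  have hZ : MemLp (fun ω => ∑ k, c k * X₀ (x k) ω (i k)) 4 μ :=
    memLp_finsetSum _ fun k _ => (hXi (x k) (i k)).const_mul (c k)
  have hm := hS.eventually_memLp hθ hW (R := R) (γ₀ := γ₀)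
  have hlim : Tendsto (fun ε => eLpNorm (fun ω => expIntegral R γ₀ θ ε
      (fun y => ∑ k, c k * fieldKernel α R φ θ ε (i k) (x k - y)) (W ω) -
        ∑ k, c k * X₀ (x k) ω (i k)) 4 μ) (𝓝[>] 0) (𝓝 0) := by
    have hmk := fun k => (hG (i k) (x k)).eventually_memLp hθ hW (R := R) (γ₀ := γ₀)
    have h1 := tendsto_eLpNorm_sum c (f := fun k ε ω => expIntegral R γ₀ θ ε
      (fun y => fieldKernel α R φ θ ε (i k) (x k - y)) (W ω) - X₀ (x k) ω (i k))
      (fun k => (hmk k).mono fun ε hε => hε.1.sub (hXi _ _).1) fun k => ?_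
    · refine h1.congr' ?_
      filter_upwards [eventually_all.2 fun k => (hG (i k) (x k)).eventually] with ε hε
      congr 1
      funext ω
      have : expIntegral R γ₀ θ ε
          (fun y => ∑ k, c k * fieldKernel α R φ θ ε (i k) (x k - y)) (W ω) =
          ∑ k, c k * expIntegral R γ₀ θ ε (fun y => fieldKernel α R φ θ ε (i k) (x k - y)) (W ω) := by
        simp only [expIntegral, Finset.sum_mul]
        rw [integral_finsetSum]
        · simp only [mul_assoc, integral_const_mul]
        · intro k _
          have hk := (hε k)
          simp only [mul_assoc]
          refine Integrable.const_mul (Continuous.integrable_of_hasCompactSupport (hk.2.2.1.mul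
            ((isRandomField_expField hθ hW 1 hk.1).continuous ω)) ?_) _
          exact (hasCompactSupport_of_eq_zero hk.2.2.2.2).mul_right
      rw [this, ← Finset.sum_sub_distrib]
      exact Finset.sum_congr rfl fun k _ => mul_sub _ _ _
    · obtain ⟨h2, h3⟩ := tendsto_eLpNorm_fieldEps_sub hθ hR hγ hW hαd hs hφ (x k) (i k)
      have h4 : Tendsto (fun ε => eLpNorm (fun ω => fieldEps α R γ₀ φ θ ε (W ω) (x k) (i k) -
          X₀ (x k) ω (i k)) 4 μ) (𝓝[>] 0) (𝓝 0) := by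
        refine tendsto_of_tendsto_of_tendsto_of_le_of_le tendsto_const_nhds (hX (x k)).2
          (fun _ => zero_le) fun ε => eLpNorm_mono fun ω => ?_
        exact PiLp.norm_apply_le (fieldEps α R γ₀ φ θ ε (W ω) (x k) - X₀ (x k) ω) (i k)
      have h5 := h2.mono fun ε hε => (hε.aestronglyMeasurable.neg)
      have h6 : ∀ᶠ ε in 𝓝[>] (0 : ℝ), AEStronglyMeasurable (fun ω =>
          fieldEps α R γ₀ φ θ ε (W ω) (x k) (i k) - X₀ (x k) ω (i k)) μ := by
        filter_upwards [h2, hmk k] with ε h7 h8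
        refine ((h7.aestronglyMeasurable.add h8.1).sub (hXi (x k) (i k)).1).congr (.of_forall fun ω => ?_)
        simp
      have h9 := tendsto_eLpNorm_of_add h5 h6 (by simpa only [eLpNorm_neg] using h3) h4
      refine h9.congr fun ε => ?_
      congr 1
      funext ω
      simp
  refine tendsto_nhds_unique (tendsto_integral_cube hZ hm hlim) ?_
  have := hS.tendsto_moment hθ hW hR hfin (l := 𝓝[>] (0 : ℝ)) (ε := fun _ ε => ε) fun _ => tendsto_id
  simpa using this

end Limit

/-! ### Asymptotics of the third moment of increments -/

/-- The increment of a dipole, with a cutoff at scale `1 / t`. -/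
noncomputable def cutIncr (φ : E d → ℝ) (p t : ℝ) (e u : E d) : ℝ :=
  φ (t • u) * dipole p e u - φ (t • (u - e)) * dipole p e (u - e)

/-- The moments of increments after rescaling. -/
noncomputable def scaledMoment (q : ℕ) (φ : E d → ℝ) (p γ₀ t : ℝ) (e : E d) : ℝ :=
  ∫ v : Fin q → E d, (∏ i, cutIncr φ p t e (v i)) * ∏ i, ∏ k ∈ Finset.Ioi i,
    (t ^ (γ₀ ^ 2 * sphereArea d) * Real.exp (γ₀ ^ 2 * rho d (t • (v i - v k))))

@[fun_prop]
lemma measurable_rho (d : ℕ) : Measurable (rho d) := by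
  have h : StronglyMeasurable fun p : E d × E d => kernelK d 1 p.2 * kernelK d 1 (p.1 - p.2) :=
    (((measurable_kernelK 1).comp measurable_snd).mul
      ((measurable_kernelK 1).comp (measurable_fst.sub measurable_snd))).stronglyMeasurable
  exact h.integral_prod_right.measurable

lemma dipole_smul {r : ℝ} (hr : 0 < r) (p : ℝ) (e z : E d) :
    dipole p e (r • z) = r ^ (1 - p) * dipole p e z := by
  rw [dipole, dipole, inner_smul_right, norm_smul, Real.norm_of_nonneg hr.le,
    Real.mul_rpow hr.le (norm_nonneg _), sub_eq_add_neg, Real.rpow_add hr, Real.rpow_one]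
  ring

lemma scaledMoment_eq (q : ℕ) {α R r : ℝ} (hR : 0 < R) (hr : 0 < r) (φ : E d → ℝ) (γ₀ : ℝ)
    (x e : E d) : ∃ B, scaledMoment q φ ((d : ℝ) - α + 1) γ₀ (R⁻¹ * r) e = B * limitMoment R γ₀ q fun y =>
      cutoffR α R φ (x + r • e - y) * dipole ((d : ℝ) - α + 1) e (x + r • e - y) -
        cutoffR α R φ (x - y) * dipole ((d : ℝ) - α + 1) e (x - y) := by
  set p := (d : ℝ) - α + 1
  set f : (Fin q → E d) → ℝ := fun u => (∏ i, (cutoffR α R φ (x + r • e - u i) *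
    dipole p e (x + r • e - u i) - cutoffR α R φ (x - u i) * dipole p e (x - u i))) *
      Real.exp (γ₀ ^ 2 * ∑ i, ∑ k ∈ Finset.Ioi i, rho d (R⁻¹ • (u i - u k)))
  have h1 := Measure.integral_comp_smul volume (fun v => f ((fun _ => x + r • e) + v)) (-r)
  rw [integral_add_left_eq_self f, smul_eq_mul] at h1
  simp only [neg_smul, ← sub_eq_add_neg] at h1
  set A := |((-r) ^ Module.finrank ℝ (Fin q → E d))⁻¹|
  have hc : 0 < R ^ ((d : ℝ) / 2 - α) * r ^ (1 - p) := by positivity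
  set c := R ^ ((d : ℝ) / 2 - α) * r ^ (1 - p)
  refine ⟨(c ^ q)⁻¹ * (∏ i : Fin q, ∏ _k ∈ Finset.Ioi i, (R⁻¹ * r) ^ (γ₀ ^ 2 * sphereArea d)) * A, ?_⟩
  change scaledMoment q φ p γ₀ (R⁻¹ * r) e = _ * A * ∫ u, f u
  rw [mul_assoc, ← h1, ← integral_const_mul, scaledMoment]
  refine integral_congr_ae (.of_forall fun v => ?_)
  have hcut : ∀ z : E d, cutoffR α R φ (r • z) * dipole p e (r • z) =
      c * (φ ((R⁻¹ * r) • z) * dipole p e z) := fun z => by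
    rw [dipole_smul hr, cutoffR, smul_smul]
    ring
  have hH : ∀ i, cutIncr φ p (R⁻¹ * r) e (v i) = c⁻¹ * (cutoffR α R φ (x + r • e - (x + r • e - r • v i)) *
      dipole p e (x + r • e - (x + r • e - r • v i)) - cutoffR α R φ (x - (x + r • e - r • v i)) *
        dipole p e (x - (x + r • e - r • v i))) := fun i => by
    have e1 : x + r • e - (x + r • e - r • v i) = r • v i := by abel
    have e2 : x - (x + r • e - r • v i) = r • (v i - e) := by rw [smul_sub]; abel
    rw [e1, e2, hcut, hcut, ← mul_sub, inv_mul_cancel_left₀ hc.ne', cutIncr]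
  have hρ : ∀ i k, rho d (R⁻¹ • (x + r • e - r • v i - (x + r • e - r • v k))) =
      rho d ((R⁻¹ * r) • (v i - v k)) := fun i k => rho_eq_of_norm_eq <| by
    rw [sub_sub_sub_cancel_left, ← smul_sub, smul_smul, norm_smul, norm_smul, norm_sub_rev]
  simp only [f, Pi.sub_apply, Pi.smul_apply, hρ, hH, Finset.prod_mul_distrib, Finset.prod_const,
    Finset.mul_sum, Real.exp_sum, Finset.card_univ, Fintype.card_fin, inv_pow]
  ring

lemma rpow_mul_exp_rho {t γ₀ : ℝ} (ht : 0 < t) {z : E d} (hz : z ≠ 0) :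
    t ^ (γ₀ ^ 2 * sphereArea d) * Real.exp (γ₀ ^ 2 * rho d (t • z)) =
      Real.exp (γ₀ ^ 2 * (rho d (t • z) + sphereArea d * Real.log ‖t • z‖)) *
        ‖z‖ ^ (-(γ₀ ^ 2 * sphereArea d)) := by
  have hz0 : 0 < ‖z‖ := norm_pos_iff.2 hz
  rw [norm_smul, Real.norm_of_nonneg ht.le, Real.log_mul ht.ne' hz0.ne', Real.rpow_def_of_pos ht,
    Real.rpow_def_of_pos hz0, ← Real.exp_add, ← Real.exp_add]
  congr 1
  ring

lemma exists_rpow_mul_exp_rho_le [NeZero d] (γ₀ : ℝ) : ∃ C > 0, ∀ t > 0, ∀ z : E d, z ≠ 0 →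
    ‖t • z‖ ≤ 6 → t ^ (γ₀ ^ 2 * sphereArea d) * Real.exp (γ₀ ^ 2 * rho d (t • z)) ≤
      C * ‖z‖ ^ (-(γ₀ ^ 2 * sphereArea d)) := by
  obtain ⟨C, h⟩ := exists_rho_le (d := d)
  refine ⟨Real.exp (γ₀ ^ 2 * (sphereArea d * Real.log 6 + C)), Real.exp_pos _, fun t ht z hz h6 => ?_⟩
  rw [rpow_mul_exp_rho ht hz]
  have htz : t • z ≠ 0 := smul_ne_zero ht.ne' hz
  have h0 : 0 < ‖t • z‖ := norm_pos_iff.2 htz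
  have h1 : max 0 (-Real.log ‖t • z‖) + Real.log ‖t • z‖ ≤ Real.log 6 := by
    have := Real.log_le_log h0 h6
    rcases max_choice 0 (-Real.log ‖t • z‖) with h2 | h2 <;> rw [h2]
    · linarith
    · linarith [Real.log_nonneg (by norm_num : (1 : ℝ) ≤ 6)]
  have h2 := mul_le_mul_of_nonneg_left h1 (sphereArea_pos (d := d)).le
  refine mul_le_mul_of_nonneg_right (Real.exp_le_exp.2 (mul_le_mul_of_nonneg_left ?_ (sq_nonneg _)))
    (by positivity)
  linarith [h (t • z) htz]

section

variable [NeZero d] {φ : E d → ℝ} (hφ : IsCutoff φ)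
include hφ

omit [NeZero d] in
lemma exists_ofReal_abs_cutIncr_le {p : ℝ} (hp : 1 < p) : ∃ D, ∀ t, 0 < t → t ≤ 1 → ∀ e : E d, ‖e‖ = 1 →
    ∀ u, ENNReal.ofReal |cutIncr φ p t e u| ≤ incrMajorant p D 0 e u := by
  have hc : HasCompactSupport φ := hasCompactSupport_of_eq_zero hφ.eq_zero
  obtain ⟨L, hL⟩ := hφ.smooth.lipschitzWith_of_hasCompactSupport hc (by simp)
  refine ⟨L * 3, fun t ht ht1 e he u => ?_⟩
  have habs : ∀ z, |φ z| ≤ 1 := fun z => by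
    rw [abs_of_nonneg (hφ.mem_Icc z).1]; exact (hφ.mem_Icc z).2
  have := ofReal_abs_mul_rpow_le (η := 0) (D := L * 3) hp (by positivity) le_rfl u he he (habs (t • u))
    (habs (t • (u - e))) fun hu => ?_
  · simpa [cutIncr] using this
  · have hn : ‖t • u‖ = t * ‖u‖ := by rw [norm_smul, Real.norm_of_nonneg ht.le]
    have hn' : t * ‖u‖ - t ≤ ‖t • (u - e)‖ := by
      rw [norm_smul, Real.norm_of_nonneg ht.le]
      nlinarith [norm_sub_norm_le u e]
    rcases le_or_gt (t * ‖u‖) 3 with h3 | h3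
    · have h4 := hL.dist_le_mul (t • u) (t • (u - e))
      rw [Real.dist_eq, dist_eq_norm, ← smul_sub, sub_sub_cancel, norm_smul, he, mul_one,
        Real.norm_of_nonneg ht.le] at h4
      refine h4.trans ?_
      rw [mul_div_assoc]
      refine mul_le_mul_of_nonneg_left ?_ L.2
      rwa [le_div_iff₀ (by linarith)]
    · rw [hφ.eq_zero _ (by rw [hn]; linarith), hφ.eq_zero _ (by linarith), sub_zero, abs_zero]
      positivity

omit [NeZero d] in
lemma cutIncr_eq_zero {p t : ℝ} (ht : 0 < t) (ht1 : t ≤ 1) {e u : E d} (he : ‖e‖ = 1)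
    (hu : 3 < ‖t • u‖) : cutIncr φ p t e u = 0 := by
  have : ‖t • u‖ - t ≤ ‖t • (u - e)‖ := by
    rw [norm_smul, norm_smul, Real.norm_of_nonneg ht.le]
    nlinarith [norm_sub_norm_le u e]
  rw [cutIncr, hφ.eq_zero _ (by linarith), hφ.eq_zero (t • (u - e)) (by linarith), zero_mul, zero_mul,
    sub_zero]

/-- The rescaled moments converge to a multiple of the interaction integral. -/
lemma exists_tendsto_scaledMoment {p γ₀ : ℝ} {e : E d} (he : ‖e‖ = 1) (hp : (d : ℝ) < p) (hp' : p < d + 1)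
    (q : ℕ)
    (hfin : ∀ D, pairIntegral q (incrMajorant p D 0 e) (γ₀ ^ 2 * sphereArea d) < ⊤) :
    ∃ D ≠ 0, Tendsto (fun t => scaledMoment q φ p γ₀ t e) (𝓝[>] 0)
      (𝓝 (D * interactionIntegral q (dipoleIncr p e e) (γ₀ ^ 2 * sphereArea d))) := by
  have hp1 : 1 < p := lt_of_le_of_lt (by exact_mod_cast NeZero.one_le) hp
  obtain ⟨c, hc⟩ := exists_tendsto_rho (d := d)
  obtain ⟨C, hC, hρ⟩ := exists_rpow_mul_exp_rho_le (d := d) γ₀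
  obtain ⟨D, hD⟩ := exists_ofReal_abs_cutIncr_le hφ hp1
  set s := γ₀ ^ 2 * sphereArea d
  refine ⟨∏ i : Fin q, ∏ _k ∈ Finset.Ioi i, Real.exp (γ₀ ^ 2 * c),
    (Finset.prod_pos fun i _ => Finset.prod_pos fun k _ => Real.exp_pos _).ne', ?_⟩
  rw [interactionIntegral, ← integral_const_mul]
  set L := ∏ i : Fin q, ∏ _k ∈ Finset.Ioi i, C
  have hL : 0 ≤ L := Finset.prod_nonneg fun i _ => Finset.prod_nonneg fun k _ => hC.le
  set g : (Fin q → E d) → ENNReal := fun u => (∏ i, incrMajorant p D 0 e (u i)) *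
    ENNReal.ofReal (pairProd s u)
  have hgm : Measurable g := by
    have : Measurable (incrMajorant p D 0 e) := (boundedPotential_incrMajorant
      (p' := (d + 1 - p) / 2) hp1 (by linarith) (by linarith) (by linarith) e).measurable
    exact (Finset.measurable_fun_prod _ fun i _ => this.comp (measurable_pi_apply i)).mul
      (measurable_pairProd s).ennreal_ofReal
  have hrm := measurable_rho d
  have hφm : Measurable φ := hφ.smooth.continuous.measurable
  have hlt : ∀ᵐ u, g u < ⊤ := ae_lt_top hgm (hfin D).ne
  refine tendsto_integral_filter_of_dominated_convergence (fun u => L * (g u).toReal) ?_ ?_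
    ((integrable_toReal_of_lintegral_ne_top hgm.aemeasurable (hfin D).ne).const_mul L) ?_
  · refine .of_forall fun t => Measurable.aestronglyMeasurable ?_
    unfold cutIncr
    fun_prop
  · filter_upwards [Ioo_mem_nhdsGT one_pos] with t ht
    filter_upwards [hlt, ae_forall_ne] with u hu hne
    by_cases h3 : ∀ i, ‖t • u i‖ ≤ 3
    · have h1 : ∏ i, ∏ k ∈ Finset.Ioi i, (t ^ s * Real.exp (γ₀ ^ 2 * rho d (t • (u i - u k)))) ≤
          L * pairProd s u := by
        simp only [L, pairProd, ← Finset.prod_mul_distrib]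
        have h0 : ∀ i k, 0 ≤ t ^ s * Real.exp (γ₀ ^ 2 * rho d (t • (u i - u k))) := fun i k =>
          mul_nonneg (Real.rpow_nonneg ht.1.le _) (Real.exp_pos _).le
        refine Finset.prod_le_prod (fun i _ => Finset.prod_nonneg fun k _ => h0 i k) fun i _ =>
          Finset.prod_le_prod (fun k _ => h0 i k) fun k hk => hρ t ht.1 _
            (sub_ne_zero.2 (hne i k (Finset.mem_Ioi.1 hk).ne)) ?_
        rw [smul_sub]
        linarith [norm_sub_le (t • u i) (t • u k), h3 i, h3 k]
      have h2 : |∏ i, cutIncr φ p t e (u i)| * pairProd s u ≤ (g u).toReal := by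
        rw [← ENNReal.ofReal_le_iff_le_toReal hu.ne, ENNReal.ofReal_mul (abs_nonneg _), Finset.abs_prod,
          ENNReal.ofReal_prod_of_nonneg fun i _ => abs_nonneg _]
        exact mul_le_mul_left (Finset.prod_le_prod' fun i _ => hD t ht.1 ht.2.le e he (u i)) _
      have h4 : 0 ≤ ∏ i, ∏ k ∈ Finset.Ioi i, (t ^ s * Real.exp (γ₀ ^ 2 * rho d (t • (u i - u k)))) :=
        Finset.prod_nonneg fun i _ => Finset.prod_nonneg fun k _ =>
          mul_nonneg (Real.rpow_nonneg ht.1.le _) (Real.exp_pos _).le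
      rw [norm_mul, Real.norm_eq_abs, Real.norm_of_nonneg h4]
      calc _ ≤ |∏ i, cutIncr φ p t e (u i)| * (L * pairProd s u) :=
            mul_le_mul_of_nonneg_left h1 (abs_nonneg _)
        _ = L * (|∏ i, cutIncr φ p t e (u i)| * pairProd s u) := by ring
        _ ≤ _ := mul_le_mul_of_nonneg_left h2 hL
    · push Not at h3
      obtain ⟨i, hi⟩ := h3
      rw [Finset.prod_eq_zero (Finset.mem_univ i) (cutIncr_eq_zero hφ ht.1 ht.2.le he hi), zero_mul,
        norm_zero]
      positivity
  · filter_upwards [ae_forall_ne] with u hne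
    have hsm : ∀ z : E d, Tendsto (fun t : ℝ => t • z) (𝓝[>] 0) (𝓝 0) := fun z => by
      have : Continuous fun t : ℝ => t • z := by fun_prop
      simpa using tendsto_nhdsWithin_of_tendsto_nhds (this.tendsto 0)
    have hφ1 : ∀ z : E d, Tendsto (fun t : ℝ => φ (t • z)) (𝓝[>] 0) (𝓝 1) := fun z => by
      have := (hφ.smooth.continuous.tendsto 0).comp (hsm z)
      rwa [hφ.eq_one 0 (by simp)] at this
    have h1 : Tendsto (fun t => ∏ i, cutIncr φ p t e (u i)) (𝓝[>] 0) (𝓝 (∏ i, dipoleIncr p e e (u i))) := by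
      refine tendsto_finsetProd _ fun i _ => ?_
      have := ((hφ1 (u i)).mul_const (dipole p e (u i))).sub
        ((hφ1 (u i - e)).mul_const (dipole p e (u i - e)))
      simpa [dipoleIncr, cutIncr] using this
    have h2 : Tendsto (fun t => ∏ i, ∏ k ∈ Finset.Ioi i,
        (t ^ s * Real.exp (γ₀ ^ 2 * rho d (t • (u i - u k))))) (𝓝[>] 0)
        (𝓝 (∏ i, ∏ k ∈ Finset.Ioi i, (Real.exp (γ₀ ^ 2 * c) * ‖u i - u k‖ ^ (-s)))) := by
      refine tendsto_finsetProd _ fun i _ => tendsto_finsetProd _ fun k hk => ?_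
      have hz : u i - u k ≠ 0 := sub_ne_zero.2 (hne i k (Finset.mem_Ioi.1 hk).ne)
      have h3 : Tendsto (fun t : ℝ => t • (u i - u k)) (𝓝[>] 0) (𝓝[≠] 0) :=
        tendsto_nhdsWithin_iff.2 ⟨hsm _, by
          filter_upwards [self_mem_nhdsWithin] with t ht using smul_ne_zero (ne_of_gt ht) hz⟩
      have h4 := ((Real.continuous_exp.tendsto _).comp ((hc.comp h3).const_mul (γ₀ ^ 2))).mul_const
        (‖u i - u k‖ ^ (-s))
      refine h4.congr' ?_
      filter_upwards [self_mem_nhdsWithin] with t ht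
      exact (rpow_mul_exp_rho ht hz).symm
    have h3 := h1.mul h2
    convert h3 using 2
    simp only [pairProd, Finset.prod_mul_distrib]
    ring

end

lemma map_ne_map_neg_of_integral_cube_ne_zero {Z : Ω → ℝ} (hZ : AEMeasurable Z μ)
    (h : ∫ ω, Z ω ^ 3 ∂μ ≠ 0) : μ.map Z ≠ μ.map fun ω => -Z ω := fun heq => h <| by
  have h1 := integral_map (f := fun z : ℝ => z ^ 3) hZ (by fun_prop)
  have h2 := integral_map (f := fun z : ℝ => z ^ 3) hZ.neg (by fun_prop)
  have h3 : ∫ ω, (-Z ω) ^ 3 ∂μ = -∫ ω, Z ω ^ 3 ∂μ := by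
    rw [← integral_neg]
    exact integral_congr_ae (.of_forall fun ω => by ring)
  have h4 : ∫ z, z ^ 3 ∂μ.map Z = ∫ z, z ^ 3 ∂μ.map fun ω => -Z ω := by rw [heq]
  rw [h1, show (∫ z, z ^ 3 ∂μ.map fun ω => -Z ω) = ∫ ω, (-Z ω) ^ 3 ∂μ from h2, h3] at h4
  linarith

lemma sum_mul_limitKernel (α R : ℝ) (φ : E d → ℝ) (e z : E d) :
    ∑ i, e i * limitKernel α R φ i z = cutoffR α R φ z * dipole ((d : ℝ) - α + 1) e z := by
  rw [dipole, PiLp.inner_apply, Finset.sum_mul, Finset.mul_sum]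
  refine Finset.sum_congr rfl fun i _ => ?_
  rw [limitKernel, Real.rpow_neg (norm_nonneg z), div_eq_mul_inv]
  simp only [RCLike.inner_apply, conj_trivial]
  ring

/-- The third moment of longitudinal increments does not vanish at small scales. -/
lemma eventually_integral_cube_ne_zero [NeZero d] [IsProbabilityMeasure μ] {R γ₀ : ℝ} {θ : E d → ℝ}
    (hθ : IsMollifier θ) (hR : 0 < R) {W : Ω → Dist d} (hW : IsWhiteNoise W μ) (hγ : 0 < γ₀) {α : ℝ}
    {φ : E d → ℝ} (hα₁ : α < 1) (hs : 5 / 2 * (γ₀ ^ 2 * sphereArea d) < α) (hφ : IsCutoff φ)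
    {X₀ : E d → Ω → E d} (hX : IsLimitField α R γ₀ φ θ μ W 4 X₀) (x : E d) {e : E d} (he : ‖e‖ = 1)
    (hI : interactionIntegral 3 (dipoleIncr (d - α + 1) e e) (γ₀ ^ 2 * sphereArea d) ≠ 0) :
    ∀ᶠ r : ℝ in 𝓝[>] 0, ∫ ω, (inner ℝ (X₀ (x + r • e) ω - X₀ x ω) e) ^ 3 ∂μ ≠ 0 := by
  have hs0 : 0 < γ₀ ^ 2 * sphereArea d := mul_pos (by positivity) sphereArea_pos
  have hd : (1 : ℝ) ≤ d := by exact_mod_cast NeZero.one_le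
  obtain ⟨D, hD, hlim⟩ := exists_tendsto_scaledMoment hφ (p := (d : ℝ) - α + 1) (γ₀ := γ₀) he
    (by linarith) (by linarith) 3 fun D => pairIntegral_add_two_lt_top (boundedPotential_incrMajorant
      (p' := 5 / 2 * (γ₀ ^ 2 * sphereArea d)) (by linarith) (by linarith) (by linarith)
        (by linarith) e) hs0 (n := 1) le_rfl (by norm_num; linarith)
  have hr : Tendsto (fun r : ℝ => R⁻¹ * r) (𝓝[>] 0) (𝓝[>] 0) := by
    refine tendsto_nhdsWithin_iff.2 ⟨?_, ?_⟩
    · have : Continuous fun r : ℝ => R⁻¹ * r := by fun_prop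
      simpa using tendsto_nhdsWithin_of_tendsto_nhds (this.tendsto 0)
    · filter_upwards [self_mem_nhdsWithin] with r hr using mul_pos (inv_pos.2 hR) hr
  filter_upwards [(hlim.comp hr).eventually_ne (mul_ne_zero hD hI), self_mem_nhdsWithin] with r h1 hr0
  obtain ⟨B, hB⟩ := scaledMoment_eq 3 (α := α) hR hr0 φ γ₀ x e
  have h2 := integral_cube_isLimitField hθ hR hW hγ (by linarith) hs hφ hX
    (Sum.elim (fun i => e i) fun i => -e i) (Sum.elim id id)
    (Sum.elim (fun _ : Fin d => x + r • e) fun _ : Fin d => x)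
  simp only [Fintype.sum_sum_type, Sum.elim_inl, Sum.elim_inr, id_eq, neg_mul, Finset.sum_neg_distrib,
    sum_mul_limitKernel, ← sub_eq_add_neg] at h2
  have h3 : ∀ ω, inner ℝ (X₀ (x + r • e) ω - X₀ x ω) e =
      ∑ i, e i * X₀ (x + r • e) ω i - ∑ i, e i * X₀ x ω i := fun ω => by
    rw [inner_sub_left, PiLp.inner_apply, PiLp.inner_apply]
    simp only [RCLike.inner_apply, conj_trivial]
  simp only [h3]
  rw [h2]
  intro h0
  rw [h0, mul_zero] at hB
  exact h1 hB

end MultifractalField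

open MultifractalField in
theorem mainTheorem8 (d : ℕ) (hd : 1 ≤ d) (α : ℝ) (hα₀ : 0 < α) (hα₁ : α < 1) :
    -- even order `q = 2l`
    (∀ (l : ℕ), 1 ≤ l → ∀ (j : Fin d) (e : E d), ‖e‖ = 1 →
      ∃ N : Set ℝ, N.Countable ∧
        (∀ γ₀ : ℝ, 0 < γ₀ → Admissible d α l γ₀ → γ₀ ∉ N →
          ∀ R : ℝ, 0 < R → constC d α R γ₀ (2 * l) j e ≠ 0) ∧
        ∃ δ : ℝ, 0 < δ ∧ Disjoint N (Set.Ioo 0 δ) ∧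
          ∀ γ₀ ∈ Set.Ioo 0 δ, ∀ R : ℝ, 0 < R → 0 < constC d α R γ₀ (2 * l) j e) ∧
    -- order `3`
    ∃ N : Set ℝ, N.Countable ∧
      (∀ γ₀ : ℝ, 0 < γ₀ → Admissible d α 2 γ₀ → γ₀ ∉ N →
        (∀ (j : Fin d) (R : ℝ), 0 < R →
          constC d α R γ₀ 3 j (EuclideanSpace.single j 1) ≠ 0) ∧
        ∀ (R : ℝ), 0 < R → ∀ (φ θ : E d → ℝ), IsCutoff φ → IsMollifier θ →
          ∀ (Ω : Type*) [MeasurableSpace Ω] (μ : Measure Ω) [IsProbabilityMeasure μ]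
            (W : Ω → 𝓓'((⊤ : TopologicalSpace.Opens (E d)), ℝ)), IsWhiteNoise W μ →
            (∃ X₀ : E d → Ω → E d, IsLimitField α R γ₀ φ θ μ W 4 X₀) ∧
            ∀ X₀ : E d → Ω → E d, IsLimitField α R γ₀ φ θ μ W 4 X₀ →
              ∀ (x e : E d), ‖e‖ = 1 → ∀ᶠ r : ℝ in 𝓝[>] 0,
                ∫ ω, (inner ℝ (X₀ (x + r • e) ω - X₀ x ω) e) ^ 3 ∂μ ≠ 0 ∧
                μ.map (fun ω => inner ℝ (X₀ (x + r • e) ω - X₀ x ω) e) ≠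
                  μ.map (fun ω => -inner ℝ (X₀ (x + r • e) ω - X₀ x ω) e)) ∧
      ∃ δ : ℝ, 0 < δ ∧ Disjoint N (Set.Ioo 0 δ) ∧
        ∀ γ₀ ∈ Set.Ioo 0 δ, ∀ (j : Fin d) (R : ℝ), 0 < R →
          0 < constC d α R γ₀ 3 j (EuclideanSpace.single j 1) := by
  have : NeZero d := ⟨by omega⟩
  refine ⟨fun l hl j e he => exceptional_set_even hα₀ hα₁ hl j he, ?_⟩
  obtain ⟨N, hN, hN1, δ, hδ, hN2, hN3⟩ := exceptional_set_three (d := d) hα₀ hα₁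
  have hsingle : ∀ j : Fin d, ‖(EuclideanSpace.single j 1 : E d)‖ = 1 := fun j => by simp
  refine ⟨N, hN, fun γ₀ hγ hadm hγN => ⟨fun j R hR => ?_, ?_⟩, δ, hδ, hN2, fun γ₀ hγ j R hR => ?_⟩
  · rw [constC_eq]
    have := hN1 γ₀ hγ hadm hγN _ (hsingle j)
    positivity
  · intro R hR φ θ hφ hθ Ω _ μ _ W hW
    have hs : 5 / 2 * (γ₀ ^ 2 * sphereArea d) < α := by
      have h := (hadm.2 one_lt_two).trans_le (min_le_left _ _)
      norm_num at h
      exact h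
    have hd1 : (1 : ℝ) ≤ d := by exact_mod_cast hd
    refine ⟨exists_isLimitField hθ hR hW hγ (by linarith) hs hφ, fun X₀ hX x e he => ?_⟩
    filter_upwards [eventually_integral_cube_ne_zero hθ hR hW hγ hα₁ hs hφ hX x he
      (hN1 γ₀ hγ hadm hγN e he)] with r hr
    refine ⟨hr, map_ne_map_neg_of_integral_cube_ne_zero ?_ hr⟩
    exact (((hX _).1.sub (hX x).1).1.inner aestronglyMeasurable_const).aemeasurable
  · rw [constC_eq]
    have := hN3 γ₀ hγ _ (hsingle j)
    positivity
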